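/- **Conventions.** For $q\ge 0$ let $A=\Lambda\mathbb R^q=A_0\oplus A_1$ be the Grassmann algebra on $q$ generators. A (finite-dimensional, real) super vector space $W=W_0\oplus W_1$ has the $A$-points $W_A=(A_0\otimes W_0)\oplus(A_1\otimes W_1)$. A *supermanifold* is a functor from Grassmann algebras (with grading-preserving homomorphisms) to sets which is embedded in such a functor $A\mapsto W_A$ and is locally diffeomorphic to superdomains of a fixed super vector space; a *smooth map* is a natural transformation which is locally the restriction of a natural transformation between superdomains whose components are smooth with $A_0$-linear derivatives. A *Lie supergroup* is a group object in supermanifolds. A *normalized $p$-cocycle* on a supergroup $G$ with values in $\mathbb R=\mathbb R^{1|0}$ (trivial action) is a smooth map $f:G^p\to\mathbb R$ that is closed for the group cohomology differential on $A$-points and vanishes as soon as one of its arguments is $1$. A *2-supergroup* is a super bicategory (bicategory internal to supermanifolds) with one object, whose morphisms have smooth weak inverses and whose 2-morphisms have smooth strict inverses. For a normalized 3-cocycle $a$ on $G$, $\mathrm{String}_a(G)$ is the slim 2-supergroup with one object, morphisms $G$, 2-morphisms $G\times\mathbb R$ (where $(g,r)$ is a 2-morphism $g\Rightarrow g$), vertical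 composition by addition in $\mathbb R$, horizontal composition $(g,r)\cdot(g',r')=(gg',r+r')$, trivial unitors and the associator $(g_1,g_2,g_3)\mapsto(g_1g_2g_3,\,a(g_1,g_2,g_3))$. **The data.** Let $\mathbb K$ be a normed division algebra of dimension $n$: a real inner product space with a bilinear unital (not necessarily associative) product with $|ab|=|a||b|$. Let $V$ be the space of hermitian matrices $\begin{pmatrix}t+x&\bar y\\ y&t-x\end{pmatrix}$ with $t,x\in\mathbb R$, $y\in\mathbb K$, with the Minkowski inner product $g$ given by $g(A,A)=-\det A=-t^2+x^2+|y|^2$. Let $S_+=S_-=\mathbb K^2$, let $V$ act by $S_+\to S_-$, $\psi\mapsto A\psi$, and $S_-\to S_+$, $\phi\mapsto\tilde A\phi$, where $\tilde A=A-(\operatorname{tr}A)1$; this makes $S_+\oplus S_-$ a module over the Clifford algebra $\mathrm{Cl}(V)$ (with $v^2=g(v,v)$). For $\psi,\phi\in S_+$ let $\psi\cdot\phi\in V$ be the trace reversal of $\psi\phi^\dagger+\phi\psi^\dagger$. * The supertranslation algebra is $\mathcal T=V\oplus S_+$ ($V$ even, $S_+$ odd) with the bracket $[\psi,\phi]=\psi\cdot\phi$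 on spinors and zero otherwise. The form $\alpha$ is the graded-antisymmetric trilinear form on $\mathcal T$ with $\alpha(A,\psi,\phi)=g(A,\psi\cdot\phi)$ for $A\in V$, $\psi,\phi\in S_+$, and with no other components. * $T$ is the supergroup with underlying supermanifold $\mathcal T$ and, on $A$-points, the product $X\cdot Y=X+Y+\tfrac12[X,Y]_A$, where $[aX,bY]_A=ba[X,Y]$. * $\mathrm{Spin}(n+1,1)$ has as $A$-points the even elements $x\in A_0\otimes\mathrm{Cl}(V)$ with $x\bar x=\bar xx=1$ and $x(A_0\otimes V)\bar x\subseteq A_0\otimes V$, where $\bar x$ is the reversal. It acts on $T$ by $v\mapsto xv\bar x$ on vectors and by Clifford multiplication on $S_+$. * $\mathrm{SISO}(n+1,1)=\mathrm{Spin}(n+1,1)\ltimes T$, with the product $(x,h)(x',h')=(xx',h\,(x\cdot h'))$, is the Poincaré supergroup. * A smoothing factor is a smooth increasing function $\ell:[0,1]\to[0,1]$ that vanishes near $0$ with $\ell(1)=1$. The standard simplices $[h_0,\dots,h_p]:\Delta^p\to T_A$ in exponential coordinates are defined by $[h_0]=h_0$, $[h_0,\dots,h_p]=h_0[1,h_0^{-1}h_1,\dots,h_0^{-1}h_p]$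 and $[1,k_1,\dots,k_p](1-s,sy)=\ell(s)\,[k_1,\dots,k_p](y)$ for $s\in[0,1]$, $y\in\Delta^{p-1}$. Put $$\Big(\textstyle\int\alpha\Big)_A(h_1,h_2,h_3)=\int_{[1,h_1,h_1h_2,h_1h_2h_3]}\alpha_A\in A_0,$$ the integral of the left-invariant 3-form on $T_A$ given at the identity by $\alpha_A(aX,bY,cZ)=cba\,\alpha(X,Y,Z)$. The extension of $\int\alpha$ to $\mathrm{SISO}(n+1,1)$ is the cochain $$(\gamma_1,\gamma_2,\gamma_3)\mapsto\int_{[\pi(1),\pi(\gamma_1),\pi(\gamma_1\gamma_2),\pi(\gamma_1\gamma_2\gamma_3)]}\alpha_A,$$ where $\pi:\mathrm{SISO}(n+1,1)\to T$ is the projection $(x,h)\mapsto h$. **Theorem.** Let $n\in\{1,2,4,8\}$. There is a normed division algebra of dimension $n$, and smoothing factors exist. For every normed division algebra $\mathbb K$ of dimension $n$ and every smoothing factor $\ell$: 1. $\dim V=n+2$; $\mathcal T$ is a Lie superalgebra and $\alpha$ is an even 3-cocycle on it; 2. $T$, $\mathrm{Spin}(n+1,1)$ and $\mathrm{SISO}(n+1,1)$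 are Lie supergroups, and $\mathrm{Spin}(n+1,1)$ acts smoothly on $T$ by automorphisms; 3. $\int\alpha$ is a normalized 3-cocycle on $T$ and is invariant under $\mathrm{Spin}(n+1,1)$ on all $A$-points; 4. the extension of $\int\alpha$ to $\mathrm{SISO}(n+1,1)$ is a normalized 3-cocycle, and it restricts to $\int\alpha$ on $T$; 5. $\mathrm{Superstring}(n+1,1)=\mathrm{String}_{\int\alpha}(\mathrm{SISO}(n+1,1))$ is a (slim) Lie 2-supergroup. In particular there is a slim Lie 2-supergroup $\mathrm{Superstring}(n+1,1)$ extending $\mathrm{SISO}(n+1,1)$ by $\int\alpha$ in the spacetime dimensions $n+2=3,4,6$ and $10$. -/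

import Mathlib

open scoped TensorProduct ContDiff Topology

noncomputable section

namespace SuperString

/-! ### Normed division algebras -/

/-- A normed division algebra: a real inner product space with a bilinear, unital, not necessarily
associative multiplication satisfying `|ab| = |a||b|`. -/
class NormedDivAlg (K : Type) [NormedAddCommGroup K] [InnerProductSpace ℝ K] where
  mul : K →ₗ[ℝ] K →ₗ[ℝ] K
  one : K
  one_mul : ∀ a, mul one a = a
  mul_one : ∀ a, mul a one = a
  norm_mul : ∀ a b, ‖mul a b‖ = ‖a‖ * ‖b‖

section Algebra

variable (K : Type) [NormedAddCommGroup K] [InnerProductSpace ℝ K] [NormedDivAlg K]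

/-- Multiplication of the division algebra. -/
abbrev kmul : K →ₗ[ℝ] K →ₗ[ℝ] K := NormedDivAlg.mul

/-- Conjugation `a* = 2 Re(a) - a`, where `Re(a) = ⟨1, a⟩`. -/
def kconj : K →ₗ[ℝ] K :=
  (2 : ℝ) • (innerₗ K (NormedDivAlg.one : K)).smulRight (NormedDivAlg.one : K) - LinearMap.id

variable {K}

theorem kconj_apply (a : K) :
    kconj K a = (2 * inner ℝ (NormedDivAlg.one : K) a) • (NormedDivAlg.one : K) - a := by
  simp [kconj, mul_smul]

theorem kmul_kconj_left (a b : K) :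
    kmul K (kconj K a) b = (2 * inner ℝ (NormedDivAlg.one : K) a) • b - kmul K a b := by
  simp [kconj_apply, NormedDivAlg.one_mul]

theorem inner_kmul_kmul (a b c : K) :
    inner ℝ (kmul K a b) (kmul K a c) = ‖a‖ ^ 2 * inner ℝ b c := by
  have h := NormedDivAlg.norm_mul a (b + c)
  have h1 := norm_add_sq_real (kmul K a b) (kmul K a c)
  have h2 := norm_add_sq_real b c
  rw [← map_add, show ‖kmul K a (b + c)‖ = ‖a‖ * ‖b + c‖ from h,
    show ‖kmul K a b‖ = ‖a‖ * ‖b‖ from NormedDivAlg.norm_mul a b,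
    show ‖kmul K a c‖ = ‖a‖ * ‖c‖ from NormedDivAlg.norm_mul a c, mul_pow, h2] at h1
  linarith

theorem inner_kmul_left (a b c : K) :
    inner ℝ (kmul K a b) c = inner ℝ b (kmul K (kconj K a) c) := by
  have h := inner_kmul_kmul (a + NormedDivAlg.one) b c
  have h1 := inner_kmul_kmul a b c
  have h2 := inner_kmul_kmul (NormedDivAlg.one : K) b c
  have h3 := norm_add_sq_real a (NormedDivAlg.one : K)
  have e : ∀ x : K, kmul K NormedDivAlg.one x = x := NormedDivAlg.one_mul
  rw [h3] at h
  simp only [map_add, LinearMap.add_apply, inner_add_left, inner_add_right, e] at h h1 h2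
  rw [kmul_kconj_left, inner_sub_right, inner_smul_right, real_inner_comm a NormedDivAlg.one]
  linarith

theorem kconj_mul_self_mul (a b : K) : kmul K (kconj K a) (kmul K a b) = (‖a‖ ^ 2) • b := by
  refine ext_inner_left ℝ fun c => ?_
  rw [← inner_kmul_left, inner_kmul_kmul, inner_smul_right]

theorem self_mul_kconj_mul (a b : K) : kmul K a (kmul K (kconj K a) b) = (‖a‖ ^ 2) • b := by
  rw [← kconj_mul_self_mul, kmul_kconj_left, kmul_kconj_left]
  simp

/-! ### Vectors and spinors -/

variable (K)

/-- The vector representation `V`: the triple `(t, x, y)` stands for the hermitian matrix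
`((t + x, y*), (y, t - x))`. -/
abbrev Vec : Type := ℝ × ℝ × K

/-- The space `K²`, underlying both spinor representations `S₊` and `S₋`. -/
abbrev Spinor : Type := K × K

/-- The Minkowski inner product, with `g(A, A) = -det A = -t² + x² + |y|²`. -/
def minkowski : LinearMap.BilinForm ℝ (Vec K) :=
  LinearMap.mk₂ ℝ (fun A B => - (A.1 * B.1) + A.2.1 * B.2.1 + inner ℝ A.2.2 B.2.2)
    (by intro A A' B; simp [inner_add_left]; ring)
    (by intro c A B; simp [inner_smul_left]; ring)
    (by intro A B B'; simp [inner_add_right]; ring)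
    (by intro c A B; simp [inner_smul_right]; ring)

/-- The Minkowski quadratic form `-det`. -/
def minkowskiQ : QuadraticForm ℝ (Vec K) := LinearMap.BilinMap.toQuadraticMap (minkowski K)

/-- The action `S₊ → S₋` of a vector: the product `A ψ` of a hermitian matrix and a column. -/
def vecMul : Vec K →ₗ[ℝ] Spinor K →ₗ[ℝ] Spinor K :=
  LinearMap.mk₂ ℝ (fun A ψ =>
      ((A.1 + A.2.1) • ψ.1 + kmul K (kconj K A.2.2) ψ.2,
        kmul K A.2.2 ψ.1 + (A.1 - A.2.1) • ψ.2))
    (by intro A A' B; ext <;> simp [add_smul, sub_smul] <;> abel)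
    (by intro c A B; ext <;> simp [add_smul, sub_smul, mul_smul, smul_sub])
    (by intro A B B'; ext <;> simp <;> abel)
    (by intro c A B; ext <;> simp [smul_comm c])

/-- The trace reversal `Ã = A - tr A`. -/
def traceRev : Vec K →ₗ[ℝ] Vec K :=
  LinearMap.prodMap (-LinearMap.id) LinearMap.id

/-- The map `Γ(A)(ψ, φ) = (Ã φ, A ψ)` on `S₊ ⊕ S₋`. -/
def gammaMap : Vec K →ₗ[ℝ] Module.End ℝ (Spinor K × Spinor K) :=
  LinearMap.mk₂ ℝ (fun A s => (vecMul K (traceRev K A) s.2, vecMul K A s.1))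
    (by intro A A' B; simp)
    (by intro c A B; simp)
    (by intro A B B'; simp)
    (by intro c A B; simp)

theorem gammaMap_sq (A : Vec K) :
    gammaMap K A * gammaMap K A = algebraMap ℝ _ (minkowskiQ K A) := by
  refine LinearMap.ext fun s => ?_
  obtain ⟨⟨a, b⟩, ⟨c, d⟩⟩ := s
  obtain ⟨t, x, y⟩ := A
  have h1 := kconj_mul_self_mul y
  have h2 := self_mul_kconj_mul y
  have h3 : minkowskiQ K (t, x, y) = -(t * t) + x * x + ‖y‖ ^ 2 := by
    rw [← real_inner_self_eq_norm_sq y]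
    rfl
  rw [h3, Module.algebraMap_end_apply]
  ext <;> simp [gammaMap, vecMul, traceRev, h1, h2] <;> module

/-- The Clifford module `S₊ ⊕ S₋`. -/
def gamma : CliffordAlgebra (minkowskiQ K) →ₐ[ℝ] Module.End ℝ (Spinor K × Spinor K) :=
  CliffordAlgebra.lift (minkowskiQ K) ⟨gammaMap K, gammaMap_sq K⟩

/-- The action of the (even part of the) Clifford algebra on `S₊`. -/
def rhoPlus : CliffordAlgebra (minkowskiQ K) →ₗ[ℝ] Spinor K →ₗ[ℝ] Spinor K :=
  LinearMap.mk₂ ℝ (fun c ψ => (gamma K c (ψ, 0)).1)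
    (by intro A A' B; simp)
    (by intro c A B; simp)
    (by
      intro A B B'
      rw [show ((B + B', 0) : Spinor K × Spinor K) = (B, 0) + (B', 0) by simp, map_add]; rfl)
    (by
      intro c A B
      rw [show ((c • B, 0) : Spinor K × Spinor K) = c • (B, 0) by simp, map_smul]; rfl)

/-- The bracket of spinors on `S₊`: the trace reversal of the hermitian matrix `ψ φ† + φ ψ†`, which
has the entries `2⟨ψ₁, φ₁⟩`, `2⟨ψ₂, φ₂⟩` on the diagonal and `ψ₂ φ₁* + φ₂ ψ₁*` below it. -/
def spinorBracket : Spinor K →ₗ[ℝ] Spinor K →ₗ[ℝ] Vec K :=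
  LinearMap.mk₂ ℝ (fun ψ φ => traceRev K
      (inner ℝ ψ.1 φ.1 + inner ℝ ψ.2 φ.2, inner ℝ ψ.1 φ.1 - inner ℝ ψ.2 φ.2,
        kmul K ψ.2 (kconj K φ.1) + kmul K φ.2 (kconj K ψ.1)))
    (by intro A A' B; ext <;> simp [traceRev, inner_add_left] <;> first | ring | abel)
    (by intro c A B; ext <;> simp [traceRev, inner_smul_left] <;> ring)
    (by intro A B B'; ext <;> simp [traceRev, inner_add_right] <;> first | ring | abel)
    (by intro c A B; ext <;> simp [traceRev, inner_smul_right] <;> ring)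

end Algebra

/-! ### Grassmann algebras -/

/-- The Grassmann algebra `A = Λℝ^q`. -/
abbrev Gr (q : ℕ) : Type := ExteriorAlgebra ℝ (Fin q → ℝ)

/-- The even part `A₀`. -/
abbrev Ev (q : ℕ) : Subalgebra ℝ (Gr q) :=
  CliffordAlgebra.even (0 : QuadraticForm ℝ (Fin q → ℝ))

/-- The odd part `A₁`. -/
abbrev Od (q : ℕ) : Submodule ℝ (Gr q) :=
  CliffordAlgebra.evenOdd (0 : QuadraticForm ℝ (Fin q → ℝ)) 1

instance (q : ℕ) : Module.Finite ℝ (Gr q) :=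
  Module.Finite.of_basis (Pi.basisFun ℝ (Fin q)).ExteriorAlgebra

instance (q : ℕ) : Module.Finite ℝ (Ev q) :=
  inferInstanceAs (Module.Finite ℝ (Subalgebra.toSubmodule (Ev q)))

/-- Multiplication makes `A₁` a module over `A₀`. -/
instance (q : ℕ) : Module (Ev q) (Od q) where
  smul a b := ⟨(a : Gr q) * b, by
    have := CliffordAlgebra.evenOdd_mul_le (0 : QuadraticForm ℝ (Fin q → ℝ)) 0 1
      (Submodule.mul_mem_mul a.2 b.2)
    rwa [zero_add] at this⟩
  one_smul b := Subtype.ext (one_mul _)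
  mul_smul a a' b := Subtype.ext (mul_assoc _ _ _)
  smul_zero a := Subtype.ext (mul_zero _)
  smul_add a b b' := Subtype.ext (mul_add _ _ _)
  add_smul a a' b := Subtype.ext (add_mul _ _ _)
  zero_smul b := Subtype.ext (zero_mul _)

instance (q : ℕ) : SMulCommClass ℝ (Ev q) (Od q) where
  smul_comm r a b := Subtype.ext (mul_smul_comm r (a : Gr q) (b : Gr q)).symm

/-- The product of an even and an odd element, as a bilinear map. -/
def evOdMul (q : ℕ) : Ev q →ₗ[ℝ] Od q →ₗ[ℝ] Od q :=
  LinearMap.mk₂ ℝ (fun a b => a • b)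
    (fun _ _ _ => add_smul _ _ _)
    (fun r a b => Subtype.ext (smul_mul_assoc r (a : Gr q) (b : Gr q)))
    (fun _ _ _ => smul_add _ _ _)
    (fun r a b => (smul_comm r a b).symm)

/-- A homomorphism of Grassmann algebras: an algebra homomorphism that respects the grading. -/
structure GrHom (q r : ℕ) where
  hom : Gr q →ₐ[ℝ] Gr r
  even : ∀ a ∈ Ev q, hom a ∈ Ev r
  odd : ∀ a ∈ Od q, hom a ∈ Od r

/-- The restriction to even parts. -/
def GrHom.onEv {q r : ℕ} (f : GrHom q r) : Ev q →ₗ[ℝ] Ev r :=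
  (f.hom.toLinearMap.comp (Subalgebra.toSubmodule (Ev q)).subtype).codRestrict
    (Subalgebra.toSubmodule (Ev r)) fun a => f.even a a.2

/-- The restriction to odd parts. -/
def GrHom.onOd {q r : ℕ} (f : GrHom q r) : Od q →ₗ[ℝ] Od r :=
  f.hom.toLinearMap.restrict f.odd

/-- The projection `A → A₀` that kills `A₁`. -/
def evProj (q : ℕ) : Gr q →ₗ[ℝ] Ev q :=
  (DirectSum.component ℝ (ZMod 2)
      (fun i => CliffordAlgebra.evenOdd (0 : QuadraticForm ℝ (Fin q → ℝ)) i) 0).comp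
    (DirectSum.decomposeLinearEquiv
      (CliffordAlgebra.evenOdd (0 : QuadraticForm ℝ (Fin q → ℝ)))).toLinearMap

/-- The projection `A → A₁` that kills `A₀`. -/
def odProj (q : ℕ) : Gr q →ₗ[ℝ] Od q :=
  (DirectSum.component ℝ (ZMod 2)
      (fun i => CliffordAlgebra.evenOdd (0 : QuadraticForm ℝ (Fin q → ℝ)) i) 1).comp
    (DirectSum.decomposeLinearEquiv
      (CliffordAlgebra.evenOdd (0 : QuadraticForm ℝ (Fin q → ℝ)))).toLinearMap

/-- The augmentation `A₀ → ℝ` that kills all nilpotent elements. -/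
def aug (q : ℕ) : Ev q →ₗ[ℝ] ℝ :=
  (ExteriorAlgebra.algebraMapInv (R := ℝ) (M := Fin q → ℝ)).toLinearMap.comp
    (Subalgebra.toSubmodule (Ev q)).subtype

/-! ### Super vector spaces and their `A`-points -/

/-- A finite-dimensional real super vector space `V = V₀ ⊕ V₁`. -/
structure SVect where
  E : Type
  O : Type
  [acgE : AddCommGroup E]
  [acgO : AddCommGroup O]
  [modE : Module ℝ E]
  [modO : Module ℝ O]
  [finE : Module.Finite ℝ E]
  [finO : Module.Finite ℝ O]

attribute [instance] SVect.acgE SVect.acgO SVect.modE SVect.modO SVect.finE SVect.finO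

namespace SVect

/-- The `A`-points `V_A = A₀ ⊗ V₀ ⊕ A₁ ⊗ V₁`. -/
abbrev Pt (V : SVect) (q : ℕ) : Type := (Ev q ⊗[ℝ] V.E) × (Od q ⊗[ℝ] V.O)

/-- The map `V_f : V_A → V_B` induced by `f : A → B`. -/
def map (V : SVect) {q r : ℕ} (f : GrHom q r) : V.Pt q →ₗ[ℝ] V.Pt r :=
  LinearMap.prodMap (TensorProduct.map f.onEv LinearMap.id)
    (TensorProduct.map f.onOd LinearMap.id)

/-- The map `L_A` on `A`-points induced by an even linear map `L = L₀ ⊕ L₁`. -/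
def lin {V W : SVect} (L₀ : V.E →ₗ[ℝ] W.E) (L₁ : V.O →ₗ[ℝ] W.O) (q : ℕ) : V.Pt q →ₗ[ℝ] W.Pt q :=
  LinearMap.prodMap (TensorProduct.map LinearMap.id L₀) (TensorProduct.map LinearMap.id L₁)

/-- The projection of an `A`-point of `V` to the underlying point of `V₀`. -/
def body (V : SVect) {q : ℕ} (x : V.Pt q) : V.E :=
  TensorProduct.lid ℝ V.E (TensorProduct.map (aug q) LinearMap.id x.1)

/-- The zero super vector space, which as a supermanifold is the point. -/
def zero : SVect := ⟨PUnit, PUnit⟩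

/-- The super vector space `ℝ = ℝ^{1|0}`. -/
def line : SVect := ⟨ℝ, PUnit⟩

/-- The direct sum of two super vector spaces. -/
def prod (V W : SVect) : SVect := ⟨V.E × W.E, V.O × W.O⟩

/-- The direct sum of `p` copies of a super vector space. -/
def pow (V : SVect) (p : ℕ) : SVect := ⟨Fin p → V.E, Fin p → V.O⟩

/-- The first component of an `A`-point of `V ⊕ W`. -/
def pfst {V W : SVect} {q : ℕ} : (V.prod W).Pt q →ₗ[ℝ] V.Pt q :=
  lin (V := V.prod W) (W := V) (LinearMap.fst ℝ V.E W.E) (LinearMap.fst ℝ V.O W.O) q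

/-- The second component of an `A`-point of `V ⊕ W`. -/
def psnd {V W : SVect} {q : ℕ} : (V.prod W).Pt q →ₗ[ℝ] W.Pt q :=
  lin (V := V.prod W) (W := W) (LinearMap.snd ℝ V.E W.E) (LinearMap.snd ℝ V.O W.O) q

/-- The `A`-point of `V ⊕ W` with given components. -/
def pair {V W : SVect} {q : ℕ} (x : V.Pt q) (y : W.Pt q) : (V.prod W).Pt q :=
  lin (V := V) (W := V.prod W) (LinearMap.inl ℝ V.E W.E) (LinearMap.inl ℝ V.O W.O) q x +
    lin (V := W) (W := V.prod W) (LinearMap.inr ℝ V.E W.E) (LinearMap.inr ℝ V.O W.O) q y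

/-- The components of an `A`-point of `V^p`. -/
def coord {V : SVect} {p q : ℕ} (z : (V.pow p).Pt q) (i : Fin p) : V.Pt q :=
  lin (V := V.pow p) (W := V) (LinearMap.proj i) (LinearMap.proj i) q z

end SVect

/-! ### Smooth maps of superdomains -/

/-- Openness in the standard topology of a finite-dimensional real vector space. -/
def OpenSet {E : Type} [AddCommGroup E] [Module ℝ E] (U : Set E) : Prop :=
  ∀ (k : ℕ) (L : (Fin k → ℝ) →ₗ[ℝ] E), IsOpen (L ⁻¹' U)

/-- Smoothness of a map between finite-dimensional real vector spaces, on an open subset. -/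
def SmoothOn {E F : Type} [AddCommGroup E] [Module ℝ E] [AddCommGroup F] [Module ℝ F]
    (S : Set E) (f : E → F) : Prop :=
  ∀ (k : ℕ) (L : (Fin k → ℝ) →ₗ[ℝ] E) (l : F →ₗ[ℝ] ℝ),
    ContDiffOn ℝ ∞ (fun x => l (f (L x))) (L ⁻¹' S)

/-- The superdomain in `V` over `U ⊆ V₀`, on `A`-points. -/
def domain (V : SVect) (U : Set V.E) (q : ℕ) : Set (V.Pt q) := {x | V.body x ∈ U}

/-- `A₀`-smoothness: smooth, with an `A₀`-linear derivative at each point. -/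
def A0SmoothOn (V W : SVect) (q : ℕ) (S : Set (V.Pt q)) (f : V.Pt q → W.Pt q) : Prop :=
  SmoothOn S f ∧ ∀ x ∈ S, ∃ D : V.Pt q →ₗ[Ev q] W.Pt q, ∀ (v : V.Pt q) (l : W.Pt q →ₗ[ℝ] ℝ),
    HasDerivAt (fun t : ℝ => l (f (x + t • v))) (l (D v)) 0

/-- Smooth maps from the superdomain in `V` over `U` to `W`: natural, with `A₀`-smooth components.
Only the values on the superdomain matter. -/
structure IsSmoothOn (V W : SVect) (U : Set V.E) (F : ∀ q, V.Pt q → W.Pt q) : Prop where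
  natural : ∀ (q r : ℕ) (f : GrHom q r), ∀ x ∈ domain V U q, F r (V.map f x) = W.map f (F q x)
  smooth : ∀ q, A0SmoothOn V W q (domain V U q) (F q)

/-! ### Supermanifolds -/

/-- A family of sets of `A`-points of a super vector space. -/
structure SuperSpace where
  V : SVect
  pts : ∀ q, Set (V.Pt q)

namespace SuperSpace

/-- A family of functions on `A`-points; only its values on the `A`-points of `M` matter. -/
abbrev Fam (M N : SuperSpace) : Type := ∀ q, M.V.Pt q → N.V.Pt q

/-- `M` is a supermanifold (embedded in the super vector space `M.V`): it is a functor on Grassmann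
algebras which is locally diffeomorphic to superdomains in a fixed super vector space `W`, by a
chart `φ` whose inverse is the restriction of a smooth map `ρ` of superdomains. -/
structure IsSupermanifold (M : SuperSpace) : Prop where
  functorial : ∀ (q r : ℕ) (f : GrHom q r), ∀ x ∈ M.pts q, M.V.map f x ∈ M.pts r
  chart : ∃ W : SVect, ∀ q, ∀ x ∈ M.pts q, ∃ (U : Set M.V.E) (U' : Set W.E)
    (φ : ∀ r, W.Pt r → M.V.Pt r) (ρ : ∀ r, M.V.Pt r → W.Pt r),
    M.V.body x ∈ U ∧ OpenSet U ∧ OpenSet U' ∧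
    IsSmoothOn W M.V U' φ ∧ IsSmoothOn M.V W U ρ ∧
    (∀ r, ∀ w ∈ domain W U' r, φ r w ∈ M.pts r ∧ φ r w ∈ domain M.V U r ∧ ρ r (φ r w) = w) ∧
    (∀ r, ∀ y ∈ M.pts r, y ∈ domain M.V U r → ρ r y ∈ domain W U' r ∧ φ r (ρ r y) = y)

/-- Smooth maps of supermanifolds: natural transformations which are, locally on `M`, restrictions
of smooth maps of superdomains. -/
structure IsSMap (M N : SuperSpace) (f : Fam M N) : Prop where
  maps : ∀ q, ∀ x ∈ M.pts q, f q x ∈ N.pts q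
  natural : ∀ (q r : ℕ) (h : GrHom q r), ∀ x ∈ M.pts q, f r (M.V.map h x) = N.V.map h (f q x)
  smooth : ∀ q, ∀ x ∈ M.pts q, ∃ (U : Set M.V.E) (F : Fam M N),
    M.V.body x ∈ U ∧ OpenSet U ∧ IsSmoothOn M.V N.V U F ∧
    ∀ r, ∀ y ∈ M.pts r, y ∈ domain M.V U r → f r y = F r y

/-- A super vector space as a supermanifold. -/
abbrev affine (V : SVect) : SuperSpace := ⟨V, fun _ => Set.univ⟩

/-- The one-point supermanifold. -/
def point : SuperSpace := affine SVect.zero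

/-- The product. -/
def prod (M N : SuperSpace) : SuperSpace :=
  ⟨M.V.prod N.V, fun q => {z | SVect.pfst z ∈ M.pts q ∧ SVect.psnd z ∈ N.pts q}⟩

/-- The `p`-fold power. -/
def pow (M : SuperSpace) (p : ℕ) : SuperSpace :=
  ⟨M.V.pow p, fun q => {z | ∀ i, SVect.coord z i ∈ M.pts q}⟩

/-- The pullback `M ×_L N`. -/
def pullback {M N L : SuperSpace} (f : Fam M L) (g : Fam N L) : SuperSpace :=
  ⟨M.V.prod N.V, fun q => {z | SVect.pfst z ∈ M.pts q ∧ SVect.psnd z ∈ N.pts q ∧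
    f q (SVect.pfst z) = g q (SVect.psnd z)}⟩

/-- A family of functions of two variables, as a family on the product of the ambient spaces. -/
def uncurry {V W X : SVect} (f : ∀ q, V.Pt q → W.Pt q → X.Pt q) :
    ∀ q, (V.prod W).Pt q → X.Pt q :=
  fun q z => f q (SVect.pfst z) (SVect.psnd z)

end SuperSpace

open SuperSpace

/-! ### Supergroups -/

/-- The data of a supergroup: a space with multiplication, inversion and identity. -/
structure SGroup where
  space : SuperSpace
  mul : ∀ q, space.V.Pt q → space.V.Pt q → space.V.Pt q
  inv : ∀ q, space.V.Pt q → space.V.Pt q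
  one : ∀ q, space.V.Pt q

/-- A Lie supergroup: a group object in supermanifolds. -/
structure IsSupergroup (G : SGroup) : Prop where
  manifold : G.space.IsSupermanifold
  smooth_mul : IsSMap (G.space.prod G.space) G.space (uncurry G.mul)
  smooth_inv : IsSMap G.space G.space G.inv
  smooth_one : IsSMap point G.space (fun q _ => G.one q)
  mul_assoc : ∀ q, ∀ x ∈ G.space.pts q, ∀ y ∈ G.space.pts q, ∀ z ∈ G.space.pts q,
    G.mul q (G.mul q x y) z = G.mul q x (G.mul q y z)
  one_mul : ∀ q, ∀ x ∈ G.space.pts q, G.mul q (G.one q) x = x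
  mul_one : ∀ q, ∀ x ∈ G.space.pts q, G.mul q x (G.one q) = x
  inv_mul : ∀ q, ∀ x ∈ G.space.pts q, G.mul q (G.inv q x) x = G.one q
  mul_inv : ∀ q, ∀ x ∈ G.space.pts q, G.mul q x (G.inv q x) = G.one q

/-- A smooth action of the supergroup `G` on the supergroup `H` by automorphisms. -/
structure IsActionByAut (G H : SGroup)
    (act : ∀ q, G.space.V.Pt q → H.space.V.Pt q → H.space.V.Pt q) : Prop where
  smooth : IsSMap (G.space.prod H.space) H.space (uncurry act)
  one_act : ∀ q, ∀ h ∈ H.space.pts q, act q (G.one q) h = h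
  mul_act : ∀ q, ∀ g ∈ G.space.pts q, ∀ g' ∈ G.space.pts q, ∀ h ∈ H.space.pts q,
    act q (G.mul q g g') h = act q g (act q g' h)
  act_mul : ∀ q, ∀ g ∈ G.space.pts q, ∀ h ∈ H.space.pts q, ∀ h' ∈ H.space.pts q,
    act q g (H.mul q h h') = H.mul q (act q g h) (act q g h')

/-- The semidirect product `G ⋉ H`, with `(g, h)(g', h') = (g g', h (g · h'))`. -/
def semidirect (G H : SGroup)
    (act : ∀ q, G.space.V.Pt q → H.space.V.Pt q → H.space.V.Pt q) : SGroup where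
  space := G.space.prod H.space
  mul q z w := SVect.pair (G.mul q (SVect.pfst z) (SVect.pfst w))
    (H.mul q (SVect.psnd z) (act q (SVect.pfst z) (SVect.psnd w)))
  inv q z := SVect.pair (G.inv q (SVect.pfst z))
    (act q (G.inv q (SVect.pfst z)) (H.inv q (SVect.psnd z)))
  one q := SVect.pair (G.one q) (H.one q)

/-- A super vector space as an abelian supergroup under addition. -/
def addGroup (W : SVect) : SGroup where
  space := affine W
  mul _ x y := x + y
  inv _ x := -x
  one _ := 0

/-- The products `1, g₁, g₁g₂, …, g₁⋯g_p`. -/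
def SGroup.partialProd (G : SGroup) (q : ℕ) {p : ℕ} (g : Fin p → G.space.V.Pt q) :
    Fin (p + 1) → G.space.V.Pt q :=
  fun k => Fin.induction (G.one q) (fun i x => G.mul q x (g i)) k

/-! ### Supergroup cohomology -/

section Cohomology

variable (G : SGroup) (W : SVect) (act : ∀ q, G.space.V.Pt q → W.Pt q → W.Pt q)

/-- Families of `W`-valued functions of `p` variables on the `A`-points of `G`. -/
abbrev Cochain (p : ℕ) : Type := ∀ q, (Fin p → G.space.V.Pt q) → W.Pt q

variable {W} in
/-- The differential of supergroup cohomology: `df(g₁, …, g_{p+1})` is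
`g₁ f(g₂, …) + ∑ (-1)^i f(…, g_i g_{i+1}, …) + (-1)^{p+1} f(g₁, …, g_p)`. -/
def coboundary {p : ℕ} (f : Cochain G W p) : Cochain G W (p + 1) := fun q g =>
  act q (g 0) (f q fun i => g i.succ) +
    ∑ j : Fin (p + 1), (-1 : ℝ) ^ ((j : ℕ) + 1) • f q (Fin.contractNth j (G.mul q) g)

variable {W} in
/-- `f` is a smooth normalized `p`-cocycle on `G` with values in `W`. -/
structure IsNormalizedCocycle {p : ℕ} (f : Cochain G W p) : Prop where
  smooth : IsSMap (G.space.pow p) (affine W) (fun q z => f q (SVect.coord z))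
  closed : ∀ q (g : Fin (p + 1) → G.space.V.Pt q), (∀ i, g i ∈ G.space.pts q) →
    coboundary G act f q g = 0
  normalized : ∀ q (g : Fin p → G.space.V.Pt q), (∀ i, g i ∈ G.space.pts q) →
    (∃ i, g i = G.one q) → f q g = 0

end Cohomology

/-! ### Super bicategories and 2-supergroups -/

/-- The data of a super bicategory. Composites are written in the order of the arrows: `vcomp α β`
is first `α`, then `β`, and `hcomp f g` is first `f`, then `g`. -/
structure Bicat where
  B0 : SuperSpace
  B1 : SuperSpace
  B2 : SuperSpace
  src : Fam B1 B0
  tgt : Fam B1 B0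
  idt : Fam B0 B1
  src2 : Fam B2 B1
  tgt2 : Fam B2 B1
  idt2 : Fam B1 B2
  vcomp : ∀ q, B2.V.Pt q → B2.V.Pt q → B2.V.Pt q
  hcomp : ∀ q, B1.V.Pt q → B1.V.Pt q → B1.V.Pt q
  hcomp2 : ∀ q, B2.V.Pt q → B2.V.Pt q → B2.V.Pt q
  assoc : ∀ q, B1.V.Pt q → B1.V.Pt q → B1.V.Pt q → B2.V.Pt q
  lunit : Fam B1 B2
  runit : Fam B1 B2

namespace Bicat

variable (B : Bicat)

/-- Pairs of composable morphisms, `B₁ ×_{B₀} B₁`. -/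
def comp2 : SuperSpace := pullback B.tgt B.src

/-- Triples of composable morphisms, `B₁ ×_{B₀} (B₁ ×_{B₀} B₁)`. -/
def comp3 : SuperSpace :=
  pullback (N := B.comp2) B.tgt (fun q z => B.src q (SVect.pfst z))

/-- Vertically composable pairs of 2-morphisms, `B₂ ×_{B₁} B₂`. -/
def vpairs : SuperSpace := pullback B.tgt2 B.src2

/-- Horizontally composable pairs of 2-morphisms, `B₂ ×_{B₀} B₂`. -/
def hpairs : SuperSpace :=
  pullback (M := B.B2) (N := B.B2) (L := B.B0)
    (fun q α => B.tgt q (B.src2 q α)) (fun q α => B.src q (B.src2 q α))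

/-- `f` and `g` are composable morphisms. -/
def C1 (q : ℕ) (f g : B.B1.V.Pt q) : Prop :=
  f ∈ B.B1.pts q ∧ g ∈ B.B1.pts q ∧ B.tgt q f = B.src q g

/-- `α` and `β` are vertically composable 2-morphisms. -/
def CV (q : ℕ) (α β : B.B2.V.Pt q) : Prop :=
  α ∈ B.B2.pts q ∧ β ∈ B.B2.pts q ∧ B.tgt2 q α = B.src2 q β

/-- `α` and `β` are horizontally composable 2-morphisms. -/
def CH (q : ℕ) (α β : B.B2.V.Pt q) : Prop :=
  α ∈ B.B2.pts q ∧ β ∈ B.B2.pts q ∧ B.tgt q (B.src2 q α) = B.src q (B.src2 q β)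

/-- `α` is a 2-morphism from `f` to `g`. -/
def Hom2 (q : ℕ) (α : B.B2.V.Pt q) (f g : B.B1.V.Pt q) : Prop :=
  α ∈ B.B2.pts q ∧ B.src2 q α = f ∧ B.tgt2 q α = g

/-- The axioms of a super bicategory. -/
structure IsSuperBicategory : Prop where
  manifold0 : B.B0.IsSupermanifold
  manifold1 : B.B1.IsSupermanifold
  manifold2 : B.B2.IsSupermanifold
  manifold_comp2 : B.comp2.IsSupermanifold
  manifold_comp3 : B.comp3.IsSupermanifold
  manifold_vpairs : B.vpairs.IsSupermanifold
  manifold_hpairs : B.hpairs.IsSupermanifold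
  smooth_src : IsSMap B.B1 B.B0 B.src
  smooth_tgt : IsSMap B.B1 B.B0 B.tgt
  smooth_idt : IsSMap B.B0 B.B1 B.idt
  smooth_src2 : IsSMap B.B2 B.B1 B.src2
  smooth_tgt2 : IsSMap B.B2 B.B1 B.tgt2
  smooth_idt2 : IsSMap B.B1 B.B2 B.idt2
  smooth_vcomp : IsSMap B.vpairs B.B2 (uncurry B.vcomp)
  smooth_hcomp : IsSMap B.comp2 B.B1 (uncurry B.hcomp)
  smooth_hcomp2 : IsSMap B.hpairs B.B2 (uncurry B.hcomp2)
  smooth_assoc : IsSMap B.comp3 B.B2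
    (fun q z => B.assoc q (SVect.pfst z) (SVect.pfst (SVect.psnd z)) (SVect.psnd (SVect.psnd z)))
  smooth_lunit : IsSMap B.B1 B.B2 B.lunit
  smooth_runit : IsSMap B.B1 B.B2 B.runit
  /- The morphisms and 2-morphisms form a category under vertical composition. -/
  src2_idt2 : ∀ q, ∀ f ∈ B.B1.pts q, B.src2 q (B.idt2 q f) = f
  tgt2_idt2 : ∀ q, ∀ f ∈ B.B1.pts q, B.tgt2 q (B.idt2 q f) = f
  src2_vcomp : ∀ q α β, B.CV q α β → B.src2 q (B.vcomp q α β) = B.src2 q α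
  tgt2_vcomp : ∀ q α β, B.CV q α β → B.tgt2 q (B.vcomp q α β) = B.tgt2 q β
  vcomp_assoc : ∀ q α β γ, B.CV q α β → B.CV q β γ →
    B.vcomp q (B.vcomp q α β) γ = B.vcomp q α (B.vcomp q β γ)
  idt2_vcomp : ∀ q, ∀ α ∈ B.B2.pts q, B.vcomp q (B.idt2 q (B.src2 q α)) α = α
  vcomp_idt2 : ∀ q, ∀ α ∈ B.B2.pts q, B.vcomp q α (B.idt2 q (B.tgt2 q α)) = α
  /- Sources and targets of identities, of 2-morphisms and of composites. -/
  src_idt : ∀ q, ∀ x ∈ B.B0.pts q, B.src q (B.idt q x) = x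
  tgt_idt : ∀ q, ∀ x ∈ B.B0.pts q, B.tgt q (B.idt q x) = x
  src_hcomp : ∀ q f g, B.C1 q f g → B.src q (B.hcomp q f g) = B.src q f
  tgt_hcomp : ∀ q f g, B.C1 q f g → B.tgt q (B.hcomp q f g) = B.tgt q g
  src_src2 : ∀ q, ∀ α ∈ B.B2.pts q, B.src q (B.src2 q α) = B.src q (B.tgt2 q α)
  tgt_src2 : ∀ q, ∀ α ∈ B.B2.pts q, B.tgt q (B.src2 q α) = B.tgt q (B.tgt2 q α)
  /- Horizontal composition is a functor. -/
  src2_hcomp2 : ∀ q α β, B.CH q α β →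
    B.src2 q (B.hcomp2 q α β) = B.hcomp q (B.src2 q α) (B.src2 q β)
  tgt2_hcomp2 : ∀ q α β, B.CH q α β →
    B.tgt2 q (B.hcomp2 q α β) = B.hcomp q (B.tgt2 q α) (B.tgt2 q β)
  hcomp2_idt2 : ∀ q f g, B.C1 q f g →
    B.hcomp2 q (B.idt2 q f) (B.idt2 q g) = B.idt2 q (B.hcomp q f g)
  interchange : ∀ q α α' β β', B.CV q α α' → B.CV q β β' → B.CH q α β →
    B.hcomp2 q (B.vcomp q α α') (B.vcomp q β β') =
      B.vcomp q (B.hcomp2 q α β) (B.hcomp2 q α' β')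
  /- The associator is a natural isomorphism. -/
  assoc_hom : ∀ q f g h, B.C1 q f g → B.C1 q g h →
    B.Hom2 q (B.assoc q f g h) (B.hcomp q (B.hcomp q f g) h) (B.hcomp q f (B.hcomp q g h))
  assoc_natural : ∀ q α β γ, B.CH q α β → B.CH q β γ →
    B.vcomp q (B.hcomp2 q (B.hcomp2 q α β) γ)
        (B.assoc q (B.tgt2 q α) (B.tgt2 q β) (B.tgt2 q γ)) =
      B.vcomp q (B.assoc q (B.src2 q α) (B.src2 q β) (B.src2 q γ))
        (B.hcomp2 q α (B.hcomp2 q β γ))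
  assoc_iso : ∃ a' : ∀ q, B.B1.V.Pt q → B.B1.V.Pt q → B.B1.V.Pt q → B.B2.V.Pt q,
    IsSMap B.comp3 B.B2
      (fun q z => a' q (SVect.pfst z) (SVect.pfst (SVect.psnd z)) (SVect.psnd (SVect.psnd z))) ∧
    ∀ q f g h, B.C1 q f g → B.C1 q g h →
      B.Hom2 q (a' q f g h) (B.hcomp q f (B.hcomp q g h)) (B.hcomp q (B.hcomp q f g) h) ∧
      B.vcomp q (B.assoc q f g h) (a' q f g h) = B.idt2 q (B.hcomp q (B.hcomp q f g) h) ∧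
      B.vcomp q (a' q f g h) (B.assoc q f g h) = B.idt2 q (B.hcomp q f (B.hcomp q g h))
  /- The unitors are natural isomorphisms. -/
  lunit_hom : ∀ q, ∀ f ∈ B.B1.pts q,
    B.Hom2 q (B.lunit q f) (B.hcomp q (B.idt q (B.src q f)) f) f
  lunit_natural : ∀ q, ∀ α ∈ B.B2.pts q,
    B.vcomp q (B.hcomp2 q (B.idt2 q (B.idt q (B.src q (B.src2 q α)))) α)
        (B.lunit q (B.tgt2 q α)) =
      B.vcomp q (B.lunit q (B.src2 q α)) α
  lunit_iso : ∃ l' : Fam B.B1 B.B2, IsSMap B.B1 B.B2 l' ∧ ∀ q, ∀ f ∈ B.B1.pts q,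
    B.Hom2 q (l' q f) f (B.hcomp q (B.idt q (B.src q f)) f) ∧
    B.vcomp q (B.lunit q f) (l' q f) = B.idt2 q (B.hcomp q (B.idt q (B.src q f)) f) ∧
    B.vcomp q (l' q f) (B.lunit q f) = B.idt2 q f
  runit_hom : ∀ q, ∀ f ∈ B.B1.pts q,
    B.Hom2 q (B.runit q f) (B.hcomp q f (B.idt q (B.tgt q f))) f
  runit_natural : ∀ q, ∀ α ∈ B.B2.pts q,
    B.vcomp q (B.hcomp2 q α (B.idt2 q (B.idt q (B.tgt q (B.src2 q α)))))
        (B.runit q (B.tgt2 q α)) =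
      B.vcomp q (B.runit q (B.src2 q α)) α
  runit_iso : ∃ r' : Fam B.B1 B.B2, IsSMap B.B1 B.B2 r' ∧ ∀ q, ∀ f ∈ B.B1.pts q,
    B.Hom2 q (r' q f) f (B.hcomp q f (B.idt q (B.tgt q f))) ∧
    B.vcomp q (B.runit q f) (r' q f) = B.idt2 q (B.hcomp q f (B.idt q (B.tgt q f))) ∧
    B.vcomp q (r' q f) (B.runit q f) = B.idt2 q f
  /- The pentagon and triangle identities. -/
  pentagon : ∀ q f g h k, B.C1 q f g → B.C1 q g h → B.C1 q h k →
    B.vcomp q (B.assoc q (B.hcomp q f g) h k) (B.assoc q f g (B.hcomp q h k)) =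
      B.vcomp q (B.vcomp q (B.hcomp2 q (B.assoc q f g h) (B.idt2 q k))
          (B.assoc q f (B.hcomp q g h) k))
        (B.hcomp2 q (B.idt2 q f) (B.assoc q g h k))
  triangle : ∀ q f g, B.C1 q f g →
    B.vcomp q (B.assoc q f (B.idt q (B.tgt q f)) g) (B.hcomp2 q (B.idt2 q f) (B.lunit q g)) =
      B.hcomp2 q (B.runit q f) (B.idt2 q g)

/-- A 2-supergroup: a super bicategory with one object, whose morphisms have smooth weak inverses
and whose 2-morphisms have smooth strict inverses. -/
structure Is2Supergroup : Prop where
  bicategory : B.IsSuperBicategory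
  one_object : B.B0 = point
  weak_inverses : ∃ (inv1 : Fam B.B1 B.B1) (e u : Fam B.B1 B.B2),
    IsSMap B.B1 B.B1 inv1 ∧ IsSMap B.B1 B.B2 e ∧ IsSMap B.B1 B.B2 u ∧
    ∀ q, ∀ f ∈ B.B1.pts q,
      B.src q (inv1 q f) = B.tgt q f ∧ B.tgt q (inv1 q f) = B.src q f ∧
      B.Hom2 q (e q f) (B.hcomp q (inv1 q f) f) (B.idt q (B.tgt q f)) ∧
      B.Hom2 q (u q f) (B.hcomp q f (inv1 q f)) (B.idt q (B.src q f))
  strict_inverses : ∃ inv2 : Fam B.B2 B.B2, IsSMap B.B2 B.B2 inv2 ∧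
    ∀ q, ∀ α ∈ B.B2.pts q,
      B.Hom2 q (inv2 q α) (B.tgt2 q α) (B.src2 q α) ∧
      B.vcomp q (inv2 q α) α = B.idt2 q (B.tgt2 q α) ∧
      B.vcomp q α (inv2 q α) = B.idt2 q (B.src2 q α)

end Bicat

/-- The slim 2-supergroup data `String_a(G, W)`: one object, morphisms `G`, 2-morphisms `G ⋉ W`,
trivial unitors, and the associator `a`. -/
def stringBicat (G : SGroup) (W : SVect) (act : ∀ q, G.space.V.Pt q → W.Pt q → W.Pt q)
    (a : Cochain G W 3) : Bicat where
  B0 := point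
  B1 := G.space
  B2 := G.space.prod (affine W)
  src _ _ := 0
  tgt _ _ := 0
  idt q _ := G.one q
  src2 _ α := SVect.pfst α
  tgt2 _ α := SVect.pfst α
  idt2 _ g := SVect.pair g 0
  vcomp _ α β := SVect.pair (SVect.pfst α) (SVect.psnd α + SVect.psnd β)
  hcomp q g g' := G.mul q g g'
  hcomp2 q α β := SVect.pair (G.mul q (SVect.pfst α) (SVect.pfst β))
    (SVect.psnd α + act q (SVect.pfst α) (SVect.psnd β))
  assoc q g₁ g₂ g₃ := SVect.pair (G.mul q (G.mul q g₁ g₂) g₃) (a q ![g₁, g₂, g₃])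
  lunit _ g := SVect.pair g 0
  runit _ g := SVect.pair g 0

/-! ### Lie superalgebras and their cochains -/

namespace SVect

variable (V : SVect)

/-- The total space `V₀ ⊕ V₁`. -/
abbrev Tot : Type := V.E × V.O

/-- `X` is homogeneous of parity `i`. -/
def Homog (i : ZMod 2) (X : V.Tot) : Prop := if i = 0 then X.2 = 0 else X.1 = 0

/-- The axioms of a Lie superalgebra. -/
structure IsLieSuperalgebra (br : V.Tot →ₗ[ℝ] V.Tot →ₗ[ℝ] V.Tot) : Prop where
  parity : ∀ i j X Y, V.Homog i X → V.Homog j Y → V.Homog (i + j) (br X Y)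
  antisymm : ∀ i j X Y, V.Homog i X → V.Homog j Y → br X Y = -(-1 : ℝ) ^ (i.val * j.val) • br Y X
  jacobi : ∀ i j k X Y Z, V.Homog i X → V.Homog j Y → V.Homog k Z →
    br X (br Y Z) = br (br X Y) Z + (-1 : ℝ) ^ (i.val * j.val) • br Y (br X Z)

/-- The Chevalley–Eilenberg differential of a real-valued cochain (trivial coefficients) on
homogeneous elements `X i` of parity `s i`: the sum over `i < j` of
`(-1)^{i+j} (-1)^{|X_i||X_j|} ε(i) ε(j) η([X_i, X_j], …, X̂_i, …, X̂_j, …)`, where `ε(i)` is the sign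
of moving `X_i` to the front. -/
def superD (br : V.Tot →ₗ[ℝ] V.Tot →ₗ[ℝ] V.Tot) {m : ℕ} (η : (Fin (m + 1) → V.Tot) → ℝ)
    (s : Fin (m + 2) → ZMod 2) (X : Fin (m + 2) → V.Tot) : ℝ :=
  ∑ j : Fin (m + 2), ∑ i : Fin (m + 1), if i.castSucc < j then
    (-1 : ℝ) ^ ((i : ℕ) + (j : ℕ)) * (-1) ^ ((s i.castSucc).val * (s j).val) *
      (-1) ^ ((s i.castSucc).val * ∑ k ∈ Finset.Iio i.castSucc, (s k).val) *
      (-1) ^ ((s j).val * ∑ k ∈ Finset.Iio j, (s k).val) *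
      η (Fin.cons (br (X i.castSucc) (X j)) fun k : Fin m => X (j.succAbove (i.succAbove k)))
  else 0

/-- An even 3-cocycle: a graded-antisymmetric, parity-preserving trilinear form with vanishing
differential. -/
structure IsEven3Cocycle (br : V.Tot →ₗ[ℝ] V.Tot →ₗ[ℝ] V.Tot)
    (η : V.Tot →ₗ[ℝ] V.Tot →ₗ[ℝ] V.Tot →ₗ[ℝ] ℝ) : Prop where
  swap12 : ∀ i j k X Y Z, V.Homog i X → V.Homog j Y → V.Homog k Z →
    η X Y Z = -(-1 : ℝ) ^ (i.val * j.val) * η Y X Z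
  swap23 : ∀ i j k X Y Z, V.Homog i X → V.Homog j Y → V.Homog k Z →
    η X Y Z = -(-1 : ℝ) ^ (j.val * k.val) * η X Z Y
  even : ∀ i j k X Y Z, V.Homog i X → V.Homog j Y → V.Homog k Z → i + j + k ≠ 0 → η X Y Z = 0
  closed : ∀ (s : Fin 4 → ZMod 2) (X : Fin 4 → V.Tot), (∀ i, V.Homog (s i) (X i)) →
    V.superD br (m := 2) (fun Y => η (Y 0) (Y 1) (Y 2)) s X = 0

variable {V}

/-- The inclusion `V_A = (A ⊗ V)₀ ⊆ A ⊗ V`. -/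
def toTot (q : ℕ) : V.Pt q →ₗ[ℝ] Gr q ⊗[ℝ] V.Tot :=
  LinearMap.coprod
    (TensorProduct.map (Subalgebra.toSubmodule (Ev q)).subtype (LinearMap.inl ℝ V.E V.O))
    (TensorProduct.map (Od q).subtype (LinearMap.inr ℝ V.E V.O))

/-- The projection `A ⊗ V → (A ⊗ V)₀ = V_A`. -/
def ofTot (q : ℕ) : Gr q ⊗[ℝ] V.Tot →ₗ[ℝ] V.Pt q :=
  LinearMap.prod (TensorProduct.map (evProj q) (LinearMap.fst ℝ V.E V.O))
    (TensorProduct.map (odProj q) (LinearMap.snd ℝ V.E V.O))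

/-- The reversed product `(a, b) ↦ b a` of the Grassmann algebra. -/
def mulRev (q : ℕ) : Gr q →ₗ[ℝ] Gr q →ₗ[ℝ] Gr q := (LinearMap.mul ℝ (Gr q)).flip

/-- The bracket on `A`-points: `[a X, b Y]_A = b a [X, Y]`. -/
def brA (br : V.Tot →ₗ[ℝ] V.Tot →ₗ[ℝ] V.Tot) (q : ℕ) (x y : V.Pt q) : V.Pt q :=
  ofTot q (TensorProduct.map₂ (mulRev q) br (toTot q x) (toTot q y))

/-- The map `η_A : (V_A)³ → A₀` induced by an even trilinear form, with
`η_A(a X, b Y, c Z) = c b a η(X, Y, Z)`; here `A₀ = A₀ ⊗ ℝ`. -/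
def omegaA (η : V.Tot →ₗ[ℝ] V.Tot →ₗ[ℝ] V.Tot →ₗ[ℝ] ℝ) (q : ℕ) (x y z : V.Pt q) :
    Ev q ⊗[ℝ] ℝ :=
  TensorProduct.map (evProj q) LinearMap.id
    (TensorProduct.map₂ (mulRev q) (LinearMap.id : (V.Tot →ₗ[ℝ] ℝ) →ₗ[ℝ] V.Tot →ₗ[ℝ] ℝ)
      (TensorProduct.map₂ (mulRev q) η (toTot q x) (toTot q y)) (toTot q z))

end SVect

/-! ### Exponential supergroups and the integration of cochains -/

/-- The exponential supergroup of a 2-step nilpotent Lie superalgebra, in exponential coordinates.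
The Baker–Campbell–Hausdorff formula reads `exp X exp Y = exp (X + Y + ½[X, Y])`. -/
def expGroup (V : SVect) (br : V.Tot →ₗ[ℝ] V.Tot →ₗ[ℝ] V.Tot) : SGroup where
  space := affine V
  mul q x y := x + y + (1 / 2 : ℝ) • SVect.brA br q x y
  inv _ x := -x
  one _ := 0

/-- A smoothing factor: a smooth increasing function `[0,1] → [0,1]` which vanishes near `0` and
takes the value `1` at `1`. -/
structure IsSmoothingFactor (l : ℝ → ℝ) : Prop where
  smooth : ContDiffOn ℝ ∞ l (Set.Icc 0 1)
  mono : MonotoneOn l (Set.Icc 0 1)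
  zero : ∀ᶠ t in 𝓝[≥] (0 : ℝ), l t = 0
  one : l 1 = 1

section Integration

/-- The derivative at `0` of a curve in a finite-dimensional real vector space. -/
def curveDeriv {E : Type} [AddCommGroup E] [Module ℝ E] [Module.Finite ℝ E] (c : ℝ → E) : E :=
  (Module.finBasis ℝ E).equivFun.symm fun i =>
    deriv (fun t => (Module.finBasis ℝ E).equivFun (c t) i) 0

/-- The integral over `S ⊆ ℝ^p` of a function with values in a finite-dimensional real vector
space. -/
def vecIntegral {E : Type} [AddCommGroup E] [Module ℝ E] [Module.Finite ℝ E] {p : ℕ}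
    (S : Set (Fin p → ℝ)) (f : (Fin p → ℝ) → E) : E :=
  (Module.finBasis ℝ E).equivFun.symm fun i =>
    ∫ x in S, (Module.finBasis ℝ E).equivFun (f x) i

variable {V : SVect} (br : V.Tot →ₗ[ℝ] V.Tot →ₗ[ℝ] V.Tot) (l : ℝ → ℝ)

/-- The standard left-invariant simplices `[g₀, …, g_p] : Δ^p → N_A` with smoothing factor `l`, by
the apex-base construction: `[g₀, …, g_p] = g₀ [1, g₀⁻¹g₁, …, g₀⁻¹g_p]`, and
`[1, h₁, …, h_p](1 - t, t y) = exp (l(t) X)` where `exp X = [h₁, …, h_p](y)`. -/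
def simplex (q : ℕ) : ∀ p : ℕ, (Fin (p + 1) → ℝ) → (Fin (p + 1) → V.Pt q) → V.Pt q
  | 0, _, g => g 0
  | p + 1, x, g => (expGroup V br).mul q (g 0) (l (1 - x 0) •
      simplex q p (fun i => x i.succ / (1 - x 0))
        fun i => (expGroup V br).mul q ((expGroup V br).inv q (g 0)) (g i.succ))

/-- The parametrization `(x₁, …, x_p) ↦ (1 - ∑ x_i, x₁, …, x_p)` of the hyperplane of `Δ^p`. -/
def bary {p : ℕ} (x : Fin p → ℝ) : Fin (p + 1) → ℝ := Fin.cons (1 - ∑ i, x i) x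

/-- The standard simplex in the coordinates `x₁, …, x_p`. -/
def stdSimplexCoords (p : ℕ) : Set (Fin p → ℝ) := {x | (∀ i, 0 ≤ x i) ∧ ∑ i, x i ≤ 1}

/-- The left translate to the identity of the `i`-th partial derivative of a simplex `σ`. -/
def leftDeriv (q : ℕ) {p : ℕ} (g : Fin (p + 1) → V.Pt q) (x : Fin p → ℝ) (i : Fin p) : V.Pt q :=
  curveDeriv fun t : ℝ => (expGroup V br).mul q
    ((expGroup V br).inv q (simplex br l q p (bary x) g))
    (simplex br l q p (bary (x + t • Pi.single i 1)) g)

variable (η : V.Tot →ₗ[ℝ] V.Tot →ₗ[ℝ] V.Tot →ₗ[ℝ] ℝ)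

/-- The integral over the simplex `[g₀, g₁, g₂, g₃]` of the left-invariant 3-form defined by
`η_A`. -/
def integralSimplex (q : ℕ) (g : Fin 4 → V.Pt q) : SVect.line.Pt q :=
  (vecIntegral (E := Ev q ⊗[ℝ] ℝ) (stdSimplexCoords 3) fun x =>
    SVect.omegaA η q (leftDeriv br l q g x 0) (leftDeriv br l q g x 1) (leftDeriv br l q g x 2), 0)

/-- The supergroup 3-cochain
`(∫η)_A(n₁, n₂, n₃) = ∫ η_A` over `[1, n₁, n₁n₂, n₁n₂n₃]`. -/
def integralCochain : Cochain (expGroup V br) SVect.line 3 := fun q n =>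
  integralSimplex br l η q ((expGroup V br).partialProd q n)

end Integration

/-! ### The supertranslation, Lorentz and Poincaré supergroups -/

section Poincare

variable (K : Type) [NormedAddCommGroup K] [InnerProductSpace ℝ K] [FiniteDimensional ℝ K]
  [NormedDivAlg K]

/-- The super vector space `𝒯 = V ⊕ S₊`. -/
abbrev superTrans : SVect := ⟨Vec K, Spinor K⟩

/-- The bracket of the supertranslation algebra, nonzero only on two spinors. -/
def transBracket : (superTrans K).Tot →ₗ[ℝ] (superTrans K).Tot →ₗ[ℝ] (superTrans K).Tot :=
  ((spinorBracket K).compl₁₂ (LinearMap.snd ℝ (Vec K) (Spinor K))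
    (LinearMap.snd ℝ (Vec K) (Spinor K))).compr₂ (LinearMap.inl ℝ (Vec K) (Spinor K))

/-- The 3-cochain with `α(A, ψ, φ) = g(A, ψ · φ)`, extended by graded antisymmetry and by zero. -/
def alpha : (superTrans K).Tot →ₗ[ℝ] (superTrans K).Tot →ₗ[ℝ] (superTrans K).Tot →ₗ[ℝ] ℝ :=
  LinearMap.mk₂ ℝ (fun (X Y : Vec K × Spinor K) =>
      ((minkowski K X.1).comp (spinorBracket K Y.2)).comp (LinearMap.snd ℝ (Vec K) (Spinor K))
      - ((minkowski K Y.1).comp (spinorBracket K X.2)).comp (LinearMap.snd ℝ (Vec K) (Spinor K))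
      + ((minkowski K).flip (spinorBracket K X.2 Y.2)).comp (LinearMap.fst ℝ (Vec K) (Spinor K)))
    (by intro X X' Y; refine LinearMap.ext fun Z => ?_; simp; ring)
    (by intro c X Y; refine LinearMap.ext fun Z => ?_; simp; ring)
    (by intro X Y Y'; refine LinearMap.ext fun Z => ?_; simp; ring)
    (by intro c X Y; refine LinearMap.ext fun Z => ?_; simp; ring)

/-- The supertranslation group `T`, that is, Minkowski superspacetime. -/
def transGroup : SGroup := expGroup (superTrans K) (transBracket K)

/-- The Clifford algebra of the Minkowski form. -/
abbrev Cliff : Type := CliffordAlgebra (minkowskiQ K)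

instance : Module.Finite ℝ (Cliff K) :=
  haveI : Invertible (2 : ℝ) := invertibleOfNonzero two_ne_zero
  haveI : Module.Finite ℝ (ExteriorAlgebra ℝ (Vec K)) :=
    Module.Finite.of_basis (Module.finBasis ℝ (Vec K)).ExteriorAlgebra
  Module.Finite.equiv (CliffordAlgebra.equivExterior (minkowskiQ K)).symm

/-- The purely even super vector space of the Clifford algebra. -/
def cliffSV : SVect := ⟨Cliff K, PUnit⟩

/-- The vector part of an element of the Clifford algebra; a left inverse of `CliffordAlgebra.ι`. -/
def vecPart : Cliff K →ₗ[ℝ] Vec K :=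
  haveI : Invertible (2 : ℝ) := invertibleOfNonzero two_ne_zero
  (ExteriorAlgebra.ιInv (R := ℝ) (M := Vec K)).comp
    (CliffordAlgebra.equivExterior (minkowskiQ K)).toLinearMap

/-- The inclusion `A₀ ⊗ V → A₀ ⊗ Cl(V)`. -/
def iotaA (q : ℕ) : Ev q ⊗[ℝ] Vec K →ₗ[ℝ] Ev q ⊗[ℝ] Cliff K :=
  TensorProduct.map LinearMap.id (CliffordAlgebra.ι (minkowskiQ K))

/-- The reversal `v₁ ⋯ v_k ↦ v_k ⋯ v₁` on `A₀ ⊗ Cl(V)`. -/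
def revA (q : ℕ) : Ev q ⊗[ℝ] Cliff K →ₗ[ℝ] Ev q ⊗[ℝ] Cliff K :=
  TensorProduct.map LinearMap.id CliffordAlgebra.reverse

/-- The grade involution on `A₀ ⊗ Cl(V)`, which is the identity exactly on the even part. -/
def involA (q : ℕ) : Ev q ⊗[ℝ] Cliff K →ₗ[ℝ] Ev q ⊗[ℝ] Cliff K :=
  TensorProduct.map LinearMap.id (CliffordAlgebra.involute (Q := minkowskiQ K)).toLinearMap

/-- The Lorentz group `Spin(n+1,1)`, the double cover of `SO₀(n+1,1)`, as a supergroup. Its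
`A`-points are the even elements `x` of `A₀ ⊗ Cl(V)` such that `x x̄ = x̄ x = 1`, where `x̄` is the
reversal, and `x (A₀ ⊗ V) x̄ ⊆ A₀ ⊗ V`. -/
def spinGroup : SGroup where
  space := ⟨cliffSV K, fun q => {x : (Ev q ⊗[ℝ] Cliff K) × (Od q ⊗[ℝ] PUnit) |
    involA K q x.1 = x.1 ∧ x.1 * revA K q x.1 = 1 ∧ revA K q x.1 * x.1 = 1 ∧
    ∀ v : Ev q ⊗[ℝ] Vec K, ∃ w : Ev q ⊗[ℝ] Vec K,
      x.1 * iotaA K q v * revA K q x.1 = iotaA K q w}⟩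
  mul q := fun (x y : (Ev q ⊗[ℝ] Cliff K) × (Od q ⊗[ℝ] PUnit)) => (x.1 * y.1, 0)
  inv q := fun (x : (Ev q ⊗[ℝ] Cliff K) × (Od q ⊗[ℝ] PUnit)) => (revA K q x.1, 0)
  one q := ((1, 0) : (Ev q ⊗[ℝ] Cliff K) × (Od q ⊗[ℝ] PUnit))

/-- The action of `Spin(n+1,1)` on `T`: on vectors by `v ↦ x v x̄`, on spinors by the Clifford
action on `S₊`. -/
def spinAct (q : ℕ) : (cliffSV K).Pt q → (superTrans K).Pt q → (superTrans K).Pt q :=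
  fun (x : (Ev q ⊗[ℝ] Cliff K) × (Od q ⊗[ℝ] PUnit))
    (s : (Ev q ⊗[ℝ] Vec K) × (Od q ⊗[ℝ] Spinor K)) =>
    (TensorProduct.map LinearMap.id (vecPart K) (x.1 * iotaA K q s.1 * revA K q x.1),
      TensorProduct.map₂ (evOdMul q) (rhoPlus K) x.1 s.2)

/-- The Poincaré supergroup `SISO(n+1,1) = Spin(n+1,1) ⋉ T`. -/
def poincare : SGroup := semidirect (spinGroup K) (transGroup K) (spinAct K)

/-- The supergroup 3-cochain `∫α` on `T`. -/
def intAlpha (l : ℝ → ℝ) : Cochain (transGroup K) SVect.line 3 :=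
  integralCochain (transBracket K) l (alpha K)

/-- The extension of `∫α` to the Poincaré supergroup: as a homogeneous cochain it is the pullback
of the homogeneous cochain `(h₀, …, h₃) ↦ ∫ α_A` over `[h₀, …, h₃]` along the projection to `T`. -/
def intAlphaExt (l : ℝ → ℝ) : Cochain (poincare K) SVect.line 3 := fun q γ =>
  integralSimplex (transBracket K) l (alpha K) q fun k =>
    SVect.psnd ((poincare K).partialProd q γ k)

/-- The trivial action of a supergroup on the additive group of a super vector space. -/
def trivAct (G : SGroup) (W : SVect) : ∀ q, G.space.V.Pt q → W.Pt q → W.Pt q := fun _ _ w => w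

/-- The superstring 2-supergroup `Superstring(n+1,1) = String_{∫α}(SISO(n+1,1))`. -/
def superstring (l : ℝ → ℝ) : Bicat :=
  stringBicat (poincare K) SVect.line (trivAct (poincare K) SVect.line) (intAlphaExt K l)

end Poincare

end SuperString

end

/-! The source of everything is that the bracket of a spinor with itself is a null vector: since
|ψ₂ψ₁*| = |ψ₂||ψ₁|, its Minkowski square is -(p+r)² + (p-r)² + 4pr = 0 with p = |ψ₁|² and r = |ψ₂|².
Polarizing this quartic identity gives the 3-ψ rule `minkowski_spinorBracket_cyclic`: the products
g([ψ₁,ψ₂],[ψ₃,ψ₄]), summed over the three pairings, cancel. This is the closedness of α. Tensored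
with anticommuting coefficients it holds for the bracket and the form on A-points (`isStringPair`),
where no further signs are visible, so that even and odd elements can be treated alike.

The integral never has to be evaluated. As T is 2-step nilpotent, the simplex with successive edges
x, y, z is g₀ · a(x · b(y · cz)) for scalar functions a, b, c of the barycentric coordinates. Its
left-invariant derivatives are combinations of three vectors whose coefficients are the derivatives
of a, ab and abc. The pulled back form is therefore the Jacobian of (a, ab, abc) times the value of
α_A on these vectors, and in this value the dependence on the point cancels (`form_coneDeriv`). What
remains is the cubic cochain α_A(x,y,z) + ½ g([x,y],[y,z]), so ∫α is a real constant times this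
cochain (`integralSimplex_alpha`). The cochain is polynomial, hence smooth; it vanishes when an
argument is the identity; its coboundary is -½ times the 3-ψ sum (`cubicForm_cocycle`).

Invariance under Spin follows because conjugation preserves the Minkowski form, which is half an
anticommutator, and because the bracket is the transpose of the Clifford action: g(w, ψ·φ) = ⟨ψ,
wφ⟩, with reversal as the adjoint (`spinorBracketA_rhoPlusA`). An invariant cocycle on H then
extends to G ⋉ H by applying it to the successive edges of the projected simplex
(`IsTripleCocycle.semidirect`).

The analytic work is to show that Spin is a supermanifold. On the whole Clifford algebra the map X ↦
exp(PX)(1 + (1-P)X), with P a projection to the Lie algebra, has derivative the identity at 0 and is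
locally invertible. If its value lies in the group, then so does 1 + m with m = (1-P)X. The group
equations for 1 + m, sorted into linear and quadratic terms, make m a fixed point of a quadratic
map, whence m = 0 if the body of m is small (`eq_lieIncl_of_isSpin`). So the group is cut out by the
Lie algebra in these coordinates.

Statements about A-points are reduced to statements near their bodies by the rescalings θ ↦ tθ of
the Grassmann generators. For t ≠ 0 these are automorphisms commuting with every natural map, and as
t → 0 they move a point to its body (`SVect.exists_scale_mem`). This turns the ordinary inverse
function theorem into one for purely even superdomains (`IsSmoothOn.exists_inverse`).

Finally, in the slim bicategory with associator a, the pentagon is the cocycle condition and the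
triangle is normalization (`IsSupergroup.isSuperBicategory`). -/

noncomputable section

namespace SuperString

/-! ### Smoothness in finite-dimensional vector spaces without a chosen norm -/

section CoordNorm

variable (E : Type) [AddCommGroup E] [Module ℝ E] [Module.Finite ℝ E]

/-- The norm given by the coordinates in a basis. -/
abbrev coordNorm : NormedAddCommGroup E :=
  NormedAddCommGroup.induced E (Fin (Module.finrank ℝ E) → ℝ) (Module.finBasis ℝ E).equivFun
    (Module.finBasis ℝ E).equivFun.injective

/-- The normed space structure given by the coordinates in a basis. -/
abbrev coordSpace : @NormedSpace ℝ E _ (coordNorm E).toSeminormedAddCommGroup :=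
  let := coordNorm E
  NormedSpace.induced ℝ E (Fin (Module.finrank ℝ E) → ℝ) (Module.finBasis ℝ E).equivFun

end CoordNorm

/-- `D` is the derivative of `f` at `x`, tested on lines and linear functionals. -/
def HasLinDeriv {E F : Type} [AddCommGroup E] [Module ℝ E] [AddCommGroup F] [Module ℝ F]
    (f : E → F) (x : E) (D : E →ₗ[ℝ] F) : Prop :=
  ∀ (v : E) (l : F →ₗ[ℝ] ℝ), HasDerivAt (fun t : ℝ => l (f (x + t • v))) (l (D v)) 0

section Normed

variable {E F G : Type} [NormedAddCommGroup E] [NormedSpace ℝ E] [FiniteDimensional ℝ E]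
  [NormedAddCommGroup F] [NormedSpace ℝ F] [FiniteDimensional ℝ F]

/-- The definition tests every linear map from some ℝ^k. The coordinate isomorphism of a basis alone
decides openness, and all other linear maps are continuous. With its analogue for smoothness below,
this lets norm-free statements be proved by installing auxiliary coordinate norms. -/
theorem openSet_iff_isOpen (U : Set E) : OpenSet U ↔ IsOpen U := by
  constructor
  · intro h
    let e := (Module.finBasis ℝ E).equivFun.toContinuousLinearEquiv
    have h1 := h _ (Module.finBasis ℝ E).equivFun.symm.toLinearMap
    have h2 : U = e ⁻¹' ((Module.finBasis ℝ E).equivFun.symm.toLinearMap ⁻¹' U) := by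
      ext x; simp [e]
    rw [h2]
    exact h1.preimage e.continuous
  · intro h k L
    exact h.preimage (LinearMap.continuous_of_finiteDimensional L)

theorem smoothOn_iff_contDiffOn (S : Set E) (f : E → F) : SmoothOn S f ↔ ContDiffOn ℝ ∞ f S := by
  constructor
  · intro h
    let e := (Module.finBasis ℝ E).equivFun.toContinuousLinearEquiv
    let e' := (Module.finBasis ℝ F).equivFun.toContinuousLinearEquiv
    have h1 : ContDiffOn ℝ ∞ (fun x => e' (f (e.symm x))) (e.symm ⁻¹' S) := by
      rw [contDiffOn_pi]
      intro i
      exact h _ e.symm.toLinearEquiv.toLinearMap ((Module.finBasis ℝ F).coord i)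
    have h2 : f = fun x => e'.symm ((fun y => e' (f (e.symm y))) (e x)) := by
      funext x; simp
    rw [h2]
    refine e'.symm.contDiff.comp_contDiffOn (h1.comp e.contDiff.contDiffOn ?_)
    intro x hx; simpa using hx
  · intro h k L l
    have hL : ContDiff ℝ ∞ L := L.toContinuousLinearMap.contDiff
    have hl : ContDiff ℝ ∞ l := l.toContinuousLinearMap.contDiff
    exact hl.comp_contDiffOn (h.comp hL.contDiffOn fun _ hx => hx)

theorem HasFDerivAt.hasLinDeriv {f : E → F} {x : E} {D : E →L[ℝ] F} (h : HasFDerivAt f D x) :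
    HasLinDeriv f x (D : E →ₗ[ℝ] F) := by
  intro v l
  have h1 : HasDerivAt (fun t : ℝ => x + t • v) v 0 := by
    simpa using ((hasDerivAt_id (0 : ℝ)).smul_const v).const_add x
  have h2 : HasFDerivAt f D (x + (0 : ℝ) • v) := by simpa using h
  exact (l.toContinuousLinearMap.hasFDerivAt.comp_hasDerivAt (0 : ℝ) (h2.comp_hasDerivAt (0 : ℝ) h1))

/-- Directional derivatives alone would not give a Fréchet derivative. Smoothness provides one, and
its values on lines identify it with the given linear map. -/
theorem HasLinDeriv.hasFDerivAt {f : E → F} {x : E} {D : E →ₗ[ℝ] F} {S : Set E}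
    (hS : OpenSet S) (hx : x ∈ S) (hf : SmoothOn S f) (h : HasLinDeriv f x D) :
    HasFDerivAt f D.toContinuousLinearMap x := by
  rw [openSet_iff_isOpen] at hS
  rw [smoothOn_iff_contDiffOn] at hf
  have h1 : DifferentiableAt ℝ f x :=
    (hf.contDiffAt (hS.mem_nhds hx)).differentiableAt (by simp)
  have h2 := HasFDerivAt.hasLinDeriv h1.hasFDerivAt
  have h3 : fderiv ℝ f x = D.toContinuousLinearMap := by
    ext v
    rw [← sub_eq_zero]
    refine (Module.finBasis ℝ F).ext_elem fun i => ?_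
    have := (h2 v ((Module.finBasis ℝ F).coord i)).unique (h v ((Module.finBasis ℝ F).coord i))
    simpa [sub_eq_zero] using this
  rw [← h3]
  exact h1.hasFDerivAt

end Normed

section NormFree

variable {E F G : Type} [AddCommGroup E] [Module ℝ E] [Module.Finite ℝ E]
  [AddCommGroup F] [Module ℝ F] [Module.Finite ℝ F]
  [AddCommGroup G] [Module ℝ G] [Module.Finite ℝ G]

theorem HasLinDeriv.unique {f : E → F} {x : E} {D D' : E →ₗ[ℝ] F} (h : HasLinDeriv f x D)
    (h' : HasLinDeriv f x D') : D = D' := by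
  ext v
  refine (Module.finBasis ℝ F).ext_elem fun i => ?_
  exact (h v ((Module.finBasis ℝ F).coord i)).unique (h' v ((Module.finBasis ℝ F).coord i))

theorem HasLinDeriv.exists_of_smoothOn {f : E → F} {S : Set E} (hS : OpenSet S)
    (hf : SmoothOn S f) {x : E} (hx : x ∈ S) : ∃ D, HasLinDeriv f x D := by
  let := coordNorm E; let := coordSpace E; let := coordNorm F; let := coordSpace F
  rw [openSet_iff_isOpen] at hS
  rw [smoothOn_iff_contDiffOn] at hf
  have h1 : DifferentiableAt ℝ f x :=
    (hf.contDiffAt (hS.mem_nhds hx)).differentiableAt (by simp)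
  exact ⟨_, HasFDerivAt.hasLinDeriv h1.hasFDerivAt⟩

theorem openSet_univ : OpenSet (Set.univ : Set E) := fun _ _ => isOpen_univ

theorem OpenSet.inter {U U' : Set E} (h : OpenSet U) (h' : OpenSet U') : OpenSet (U ∩ U') :=
  fun k L => (h k L).inter (h' k L)

theorem OpenSet.preimage_linear {U : Set F} (h : OpenSet U) (L : E →ₗ[ℝ] F) :
    OpenSet (L ⁻¹' U) :=
  fun k L' => h k (L.comp L')

theorem SmoothOn.isOpen_inter_preimage {U : Set E} {f : E → F} {U' : Set F}
    (hf : SmoothOn U f) (h : OpenSet U) (h' : OpenSet U') : OpenSet (U ∩ f ⁻¹' U') := by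
  let := coordNorm E; let := coordSpace E; let := coordNorm F; let := coordSpace F
  rw [openSet_iff_isOpen] at h h' ⊢
  rw [smoothOn_iff_contDiffOn] at hf
  exact hf.continuousOn.isOpen_inter_preimage h h'

theorem SmoothOn.mono {S T : Set E} {f : E → F} (h : SmoothOn T f) (hST : S ⊆ T) : SmoothOn S f :=
  fun k L l => (h k L l).mono (Set.preimage_mono hST)

theorem SmoothOn.congr {S : Set E} {f g : E → F} (h : SmoothOn S f) (hfg : ∀ x ∈ S, g x = f x) :
    SmoothOn S g :=
  fun k L l => (h k L l).congr fun x hx => by rw [hfg _ hx]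

theorem SmoothOn.comp {S : Set E} {T : Set F} {f : E → F} {g : F → G} (hg : SmoothOn T g)
    (hf : SmoothOn S f) (h : ∀ x ∈ S, f x ∈ T) : SmoothOn S fun x => g (f x) := by
  let := coordNorm E; let := coordSpace E; let := coordNorm F; let := coordSpace F
  let := coordNorm G; let := coordSpace G
  rw [smoothOn_iff_contDiffOn] at hf hg ⊢
  exact hg.comp hf h

theorem SmoothOn.of_locally {S : Set E} {f : E → F}
    (h : ∀ x ∈ S, ∃ N : Set E, OpenSet N ∧ x ∈ N ∧ SmoothOn N f) : SmoothOn S f := by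
  let := coordNorm E; let := coordSpace E; let := coordNorm F; let := coordSpace F
  rw [smoothOn_iff_contDiffOn]
  intro x hx
  obtain ⟨N, hN, hxN, hf⟩ := h x hx
  rw [openSet_iff_isOpen] at hN
  rw [smoothOn_iff_contDiffOn] at hf
  exact (hf.contDiffAt (hN.mem_nhds hxN)).contDiffWithinAt

theorem smoothOn_linear (S : Set E) (L : E →ₗ[ℝ] F) : SmoothOn S L := by
  let := coordNorm E; let := coordSpace E; let := coordNorm F; let := coordSpace F
  rw [smoothOn_iff_contDiffOn]
  exact L.toContinuousLinearMap.contDiff.contDiffOn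

theorem smoothOn_const (S : Set E) (c : F) : SmoothOn S fun _ : E => c :=
  fun _ _ _ => contDiffOn_const

theorem SmoothOn.add {S : Set E} {f g : E → F} (hf : SmoothOn S f) (hg : SmoothOn S g) :
    SmoothOn S fun x => f x + g x :=
  fun k L l => by simpa using (hf k L l).add (hg k L l)

/-- Linear maps in two variables as continuous bilinear maps. -/
theorem SmoothOn.bilin {H : Type} [AddCommGroup H] [Module ℝ H] [Module.Finite ℝ H]
    {S : Set E} {f : E → F} {g : E → G} (hf : SmoothOn S f) (hg : SmoothOn S g)
    (b : F →ₗ[ℝ] G →ₗ[ℝ] H) : SmoothOn S fun x => b (f x) (g x) := by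
  let := coordNorm E; let := coordSpace E; let := coordNorm F; let := coordSpace F
  let := coordNorm G; let := coordSpace G; let := coordNorm H; let := coordSpace H
  rw [smoothOn_iff_contDiffOn] at hf hg ⊢
  exact (((LinearMap.toContinuousLinearMap.toLinearMap.comp b).toContinuousLinearMap).isBoundedBilinearMap).contDiff.comp_contDiffOn
    (hf.prodMk hg)

theorem hasLinDeriv_linear (L : E →ₗ[ℝ] F) (x : E) : HasLinDeriv L x L := by
  intro v l
  simp only [map_add, map_smul, smul_eq_mul]
  simpa using ((hasDerivAt_id (0 : ℝ)).mul_const (l (L v))).const_add (l (L x))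

theorem hasLinDeriv_const (c : F) (x : E) : HasLinDeriv (fun _ => c) x 0 := by
  intro v l
  simpa using hasDerivAt_const (0 : ℝ) (l c)

theorem HasLinDeriv.add {f g : E → F} {x : E} {D D' : E →ₗ[ℝ] F} (hf : HasLinDeriv f x D)
    (hg : HasLinDeriv g x D') : HasLinDeriv (fun y => f y + g y) x (D + D') := by
  intro v l
  simp only [LinearMap.add_apply, map_add]
  exact (hf v l).add (hg v l)

theorem HasLinDeriv.congr {f g : E → F} {x : E} {D : E →ₗ[ℝ] F} {S : Set E} (hS : OpenSet S)
    (hx : x ∈ S) (hf : HasLinDeriv f x D) (hfg : ∀ y ∈ S, g y = f y) : HasLinDeriv g x D := by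
  intro v l
  refine (hf v l).congr_of_eventuallyEq ?_
  let := coordNorm E; let := coordSpace E
  rw [openSet_iff_isOpen] at hS
  have h1 : Continuous fun t : ℝ => x + t • v := by fun_prop
  have h2 : ∀ᶠ t in 𝓝 (0 : ℝ), x + t • v ∈ S :=
    h1.continuousAt.eventually_mem (hS.mem_nhds (by simpa using hx))
  filter_upwards [h2] with t ht
  rw [hfg _ ht]

/-- The chain rule is false for merely directional derivatives; the smoothness of both maps makes it
available through Fréchet derivatives. -/
theorem HasLinDeriv.comp {S : Set E} {T : Set F} {f : E → F} {g : F → G} {x : E}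
    {D : E →ₗ[ℝ] F} {D' : F →ₗ[ℝ] G} (hS : OpenSet S) (hT : OpenSet T) (hx : x ∈ S)
    (hfx : f x ∈ T) (hfS : SmoothOn S f) (hgT : SmoothOn T g)
    (hf : HasLinDeriv f x D) (hg : HasLinDeriv g (f x) D') :
    HasLinDeriv (fun y => g (f y)) x (D'.comp D) := by
  let := coordNorm E; let := coordSpace E; let := coordNorm F; let := coordSpace F
  let := coordNorm G; let := coordSpace G
  exact HasFDerivAt.hasLinDeriv ((hg.hasFDerivAt hT hfx hgT).comp x (hf.hasFDerivAt hS hx hfS))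

theorem HasLinDeriv.bilin {H : Type} [AddCommGroup H] [Module ℝ H] [Module.Finite ℝ H]
    {S : Set E} {f : E → F} {g : E → G} {x : E} {D : E →ₗ[ℝ] F} {D' : E →ₗ[ℝ] G}
    (hS : OpenSet S) (hx : x ∈ S) (hfS : SmoothOn S f) (hgS : SmoothOn S g)
    (hf : HasLinDeriv f x D) (hg : HasLinDeriv g x D') (b : F →ₗ[ℝ] G →ₗ[ℝ] H) :
    HasLinDeriv (fun y => b (f y) (g y)) x ((b (f x)).comp D' + (b.flip (g x)).comp D) := by
  let := coordNorm E; let := coordSpace E; let := coordNorm F; let := coordSpace F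
  let := coordNorm G; let := coordSpace G; let := coordNorm H; let := coordSpace H
  exact HasFDerivAt.hasLinDeriv
    ((((LinearMap.toContinuousLinearMap.toLinearMap.comp b).toContinuousLinearMap).isBoundedBilinearMap).hasFDerivAt
      (f x, g x) |>.comp x ((hf.hasFDerivAt hS hx hfS).prodMk (hg.hasFDerivAt hS hx hgS)))

/-- The inverse function theorem. -/
theorem exists_local_inverse {S : Set E} {f : E → F} (hS : OpenSet S) (hf : SmoothOn S f)
    (hD : ∀ x ∈ S, ∃ D : E ≃ₗ[ℝ] F, HasLinDeriv f x (D : E →ₗ[ℝ] F)) {x : E} (hx : x ∈ S) :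
    ∃ (A : Set E) (B : Set F) (g : F → E), x ∈ A ∧ A ⊆ S ∧ OpenSet A ∧ OpenSet B ∧
      SmoothOn B g ∧ (∀ a ∈ A, f a ∈ B ∧ g (f a) = a) ∧ (∀ b ∈ B, g b ∈ A ∧ f (g b) = b) := by
  let := coordNorm E; let := coordSpace E; let := coordNorm F; let := coordSpace F
  have : CompleteSpace E := FiniteDimensional.complete ℝ E
  have hS' := (openSet_iff_isOpen S).1 hS
  have hf' := (smoothOn_iff_contDiffOn S f).1 hf
  have key : ∀ y ∈ S, ∃ D : E ≃L[ℝ] F, HasFDerivAt f (D : E →L[ℝ] F) y := fun y hy => by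
    obtain ⟨D, h⟩ := hD y hy
    exact ⟨D.toContinuousLinearEquiv, h.hasFDerivAt hS hy hf⟩
  obtain ⟨D, h⟩ := key x hx
  have hc := hf'.contDiffAt (hS'.mem_nhds hx)
  let e₀ := hc.toOpenPartialHomeomorph f h (by simp)
  have hxe₀ : x ∈ e₀.source := hc.mem_toOpenPartialHomeomorph_source h (by simp)
  -- Restricting the source to `S` ensures that the derivative is invertible at every point of the
  -- source, so that the inverse is smooth on the whole target and not only at the image of `x`.
  let e := e₀.restr S
  have hes : e.source = e₀.source ∩ S := by
    rw [OpenPartialHomeomorph.restr_source, hS'.interior_eq]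
  have hef : ∀ y, e y = f y := fun y => rfl
  refine ⟨e.source, e.target, e.symm, ?_, ?_, ?_, ?_, ?_, ?_, ?_⟩
  · rw [hes]; exact ⟨hxe₀, hx⟩
  · rw [hes]; exact Set.inter_subset_right
  · exact (openSet_iff_isOpen _).2 e.open_source
  · exact (openSet_iff_isOpen _).2 e.open_target
  · rw [smoothOn_iff_contDiffOn]
    intro y hy
    have h1 : e.symm y ∈ S := by
      have := e.map_target hy
      rw [hes] at this
      exact this.2
    obtain ⟨D', h'⟩ := key _ h1
    exact (e.contDiffAt_symm hy h' (hf'.contDiffAt (hS'.mem_nhds h1))).contDiffWithinAt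
  · intro a ha
    exact ⟨e.map_source ha, e.left_inv ha⟩
  · intro b hb
    exact ⟨e.map_target hb, e.right_inv hb⟩

/-- Bijectivity is an open condition on the derivative. -/
theorem exists_nhds_bijective_deriv {S : Set E} {f : E → F} (hS : OpenSet S) (hf : SmoothOn S f)
    {x : E} (hx : x ∈ S) (D : E ≃ₗ[ℝ] F) (hD : HasLinDeriv f x (D : E →ₗ[ℝ] F)) :
    ∃ A : Set E, x ∈ A ∧ A ⊆ S ∧ OpenSet A ∧
      ∀ y ∈ A, ∃ D : E ≃ₗ[ℝ] F, HasLinDeriv f y (D : E →ₗ[ℝ] F) := by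
  let := coordNorm E; let := coordSpace E; let := coordNorm F; let := coordSpace F
  have : CompleteSpace E := FiniteDimensional.complete ℝ E
  have hS' := (openSet_iff_isOpen S).1 hS
  have hf' := (smoothOn_iff_contDiffOn S f).1 hf
  have h1 : ContinuousOn (fderiv ℝ f) S := hf'.continuousOn_fderiv_of_isOpen hS' (by simp)
  have h2 : fderiv ℝ f x = (D.toContinuousLinearEquiv : E →L[ℝ] F) :=
    (hD.hasFDerivAt hS hx hf).fderiv
  have h3 : IsOpen (Set.range ((↑) : (E ≃L[ℝ] F) → E →L[ℝ] F)) := ContinuousLinearEquiv.isOpen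
  refine ⟨S ∩ fderiv ℝ f ⁻¹' Set.range ((↑) : (E ≃L[ℝ] F) → E →L[ℝ] F), ⟨hx, ?_⟩,
    Set.inter_subset_left, ?_, ?_⟩
  · exact ⟨_, h2.symm⟩
  · exact (openSet_iff_isOpen _).2 (h1.isOpen_inter_preimage hS' h3)
  · rintro y ⟨hy, e, he⟩
    have h4 : DifferentiableAt ℝ f y :=
      (hf'.contDiffAt (hS'.mem_nhds hy)).differentiableAt (by simp)
    have h5 := HasFDerivAt.hasLinDeriv h4.hasFDerivAt
    rw [← he] at h5
    exact ⟨e.toLinearEquiv, h5⟩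

end NormFree

/-! ### Grassmann algebras -/

section Grassmann

variable {q r s : ℕ}

theorem gr_ι_mul_ι (v w : Fin q → ℝ) :
    ExteriorAlgebra.ι ℝ v * ExteriorAlgebra.ι ℝ w =
      -(ExteriorAlgebra.ι ℝ w * ExteriorAlgebra.ι ℝ v) :=
  eq_neg_of_add_eq_zero_left (ExteriorAlgebra.ι_add_mul_swap v w)

/-- It suffices to commute with a generator, and moving it past a pair of generators produces two
signs, which cancel. -/
theorem ev_commute {a : Gr q} (ha : a ∈ Ev q) (b : Gr q) : a * b = b * a := by
  have h1 : ∀ v : Fin q → ℝ, a * ExteriorAlgebra.ι ℝ v = ExteriorAlgebra.ι ℝ v * a := by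
    intro v
    induction a, ha using CliffordAlgebra.even_induction with
    | algebraMap r => exact Algebra.commutes r _
    | add x y hx hy h1 h2 => rw [add_mul, mul_add, h1, h2]
    | ι_mul_ι_mul m₁ m₂ x hx h1 =>
      change ExteriorAlgebra.ι ℝ m₁ * ExteriorAlgebra.ι ℝ m₂ * x * _ =
        _ * (ExteriorAlgebra.ι ℝ m₁ * ExteriorAlgebra.ι ℝ m₂ * x)
      rw [mul_assoc, h1, ← mul_assoc, ← mul_assoc]
      congr 1
      rw [mul_assoc, gr_ι_mul_ι m₂ v, mul_neg, ← mul_assoc, gr_ι_mul_ι m₁ v, neg_mul, neg_neg,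
        mul_assoc]
  induction b using ExteriorAlgebra.induction with
  | algebraMap r => exact (Algebra.commutes r a).symm
  | ι v => exact h1 v
  | mul x y hx hy => rw [← mul_assoc, hx, mul_assoc, hy, mul_assoc]
  | add x y hx hy => rw [mul_add, add_mul, hx, hy]

theorem od_involute {a : Gr q} (ha : a ∈ Od q) : CliffordAlgebra.involute a = -a :=
  CliffordAlgebra.involute_eq_of_mem_odd ha

/-- The rule is first proved for arbitrary `b` with the grade involution of `b` in place of a sign.
In this form it is multiplicative in `b` and reduces to generators. -/
theorem od_anticommute {a b : Gr q} (ha : a ∈ Od q) (hb : b ∈ Od q) : a * b = -(b * a) := by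
  have h1 : ∀ v : Fin q → ℝ, a * ExteriorAlgebra.ι ℝ v = -(ExteriorAlgebra.ι ℝ v * a) := by
    intro v
    induction a, ha using CliffordAlgebra.odd_induction with
    | ι m => exact gr_ι_mul_ι m v
    | add x y hx hy h1 h2 => rw [add_mul, mul_add, h1, h2, neg_add]
    | ι_mul_ι_mul m₁ m₂ x hx h1 =>
      change ExteriorAlgebra.ι ℝ m₁ * ExteriorAlgebra.ι ℝ m₂ * x * _ =
        -(_ * (ExteriorAlgebra.ι ℝ m₁ * ExteriorAlgebra.ι ℝ m₂ * x))
      rw [mul_assoc, h1, ← mul_assoc, ← mul_assoc, mul_neg, ← mul_assoc]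
      congr 2
      rw [mul_assoc, gr_ι_mul_ι m₂ v, mul_neg, ← mul_assoc, gr_ι_mul_ι m₁ v, neg_mul, neg_neg,
        mul_assoc]
  have h2 : ∀ b : Gr q, a * b = CliffordAlgebra.involute b * a := by
    intro b
    induction b using ExteriorAlgebra.induction with
    | algebraMap r => rw [AlgHom.commutes]; exact (Algebra.commutes r a).symm
    | ι v => rw [h1 v, ← neg_mul]; congr 1; exact (CliffordAlgebra.involute_ι v).symm
    | mul x y hx hy => rw [← mul_assoc, hx, mul_assoc, hy, map_mul, mul_assoc]
    | add x y hx hy => rw [mul_add, map_add, add_mul, hx, hy]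
  rw [h2, od_involute hb, neg_mul]

theorem ev_mul_comm (a b : Ev q) : a * b = b * a := Subtype.ext (ev_commute a.2 b)

theorem od_mul_od_mem {a b : Gr q} (ha : a ∈ Od q) (hb : b ∈ Od q) : a * b ∈ Ev q := by
  have := CliffordAlgebra.evenOdd_mul_le (0 : QuadraticForm ℝ (Fin q → ℝ)) 1 1
    (Submodule.mul_mem_mul ha hb)
  exact this

/-- The reversed product `(a, b) ↦ b a` of odd elements. -/
def odMulRev (q : ℕ) : Od q →ₗ[ℝ] Od q →ₗ[ℝ] Ev q :=
  LinearMap.mk₂ ℝ (fun a b => ⟨b * a, od_mul_od_mem b.2 a.2⟩)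
    (fun _ _ _ => Subtype.ext (mul_add _ _ _))
    (fun _ _ _ => Subtype.ext (mul_smul_comm _ _ _))
    (fun _ _ _ => Subtype.ext (add_mul _ _ _))
    (fun _ _ _ => Subtype.ext (smul_mul_assoc _ _ _))

theorem odMulRev_swap (a b : Od q) : odMulRev q a b = - odMulRev q b a :=
  Subtype.ext (od_anticommute b.2 a.2)

@[simp] theorem GrHom.onEv_coe (f : GrHom q r) (a : Ev q) : (f.onEv a : Gr r) = f.hom a := rfl

@[simp] theorem GrHom.onOd_coe (f : GrHom q r) (a : Od q) : (f.onOd a : Gr r) = f.hom a := rfl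

@[simp] theorem GrHom.onEv_one (f : GrHom q r) : f.onEv 1 = 1 := Subtype.ext (map_one f.hom)

theorem GrHom.onEv_mul (f : GrHom q r) (a b : Ev q) : f.onEv (a * b) = f.onEv a * f.onEv b :=
  Subtype.ext (map_mul f.hom _ _)

theorem GrHom.onOd_smul (f : GrHom q r) (a : Ev q) (b : Od q) :
    f.onOd (a • b) = f.onEv a • f.onOd b :=
  Subtype.ext (map_mul f.hom _ _)

theorem GrHom.onEv_odMulRev (f : GrHom q r) (a b : Od q) :
    f.onEv (odMulRev q a b) = odMulRev r (f.onOd a) (f.onOd b) :=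
  Subtype.ext (map_mul f.hom _ _)

/-- The composite of homomorphisms of Grassmann algebras. -/
def GrHom.comp (g : GrHom r s) (f : GrHom q r) : GrHom q s where
  hom := g.hom.comp f.hom
  even a ha := g.even _ (f.even a ha)
  odd a ha := g.odd _ (f.odd a ha)

/-- An odd element anticommutes with itself, so its square is zero, and ℝ has no nilpotents. -/
theorem algebraMapInv_od {a : Gr q} (ha : a ∈ Od q) : ExteriorAlgebra.algebraMapInv a = (0 : ℝ) := by
  have h := od_anticommute ha ha
  have h1 : a * a = 0 := by
    have h2 : (2 : ℝ) • (a * a) = 0 := by rw [two_smul]; nth_rewrite 1 [h]; simp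
    exact (smul_eq_zero.1 h2).resolve_left two_ne_zero
  have h3 := congrArg (ExteriorAlgebra.algebraMapInv (R := ℝ) (M := Fin q → ℝ)) h1
  rw [map_mul, map_zero] at h3
  exact mul_self_eq_zero.1 h3

/-- Generators go to odd elements, on which the augmentation vanishes, so both sides are algebra
homomorphisms that kill the generators. This makes bodies natural. -/
theorem GrHom.algebraMapInv_hom (f : GrHom q r) (a : Gr q) :
    ExteriorAlgebra.algebraMapInv (f.hom a) = (ExteriorAlgebra.algebraMapInv a : ℝ) := by
  have : (ExteriorAlgebra.algebraMapInv (R := ℝ)).comp f.hom = ExteriorAlgebra.algebraMapInv := by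
    refine ExteriorAlgebra.hom_ext (LinearMap.ext fun v => ?_)
    have h1 : (ExteriorAlgebra.ι ℝ v : Gr q) ∈ Od q := CliffordAlgebra.ι_mem_evenOdd_one _ v
    change ExteriorAlgebra.algebraMapInv (f.hom (ExteriorAlgebra.ι ℝ v)) =
      ExteriorAlgebra.algebraMapInv (ExteriorAlgebra.ι ℝ v)
    rw [algebraMapInv_od (f.odd _ h1), algebraMapInv_od h1]
  exact congrArg (fun g => g a) this

@[simp] theorem aug_one : aug q 1 = 1 := map_one ExteriorAlgebra.algebraMapInv

@[simp] theorem aug_onEv (f : GrHom q r) (a : Ev q) : aug r (f.onEv a) = aug q a :=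
  f.algebraMapInv_hom a

/-- The homomorphism of Grassmann algebras induced by a linear map of generators. -/
def GrHom.ofLinear (L : (Fin q → ℝ) →ₗ[ℝ] (Fin r → ℝ)) : GrHom q r where
  hom := ExteriorAlgebra.map L
  even a ha := by
    induction a, ha using CliffordAlgebra.even_induction with
    | algebraMap r => rw [AlgHom.commutes]; exact Subalgebra.algebraMap_mem _ r
    | add x y hx hy h1 h2 => rw [map_add]; exact add_mem h1 h2
    | ι_mul_ι_mul m₁ m₂ x hx h1 =>
      rw [map_mul, map_mul]
      refine mul_mem ?_ h1
      exact od_mul_od_mem (by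
        rw [show (ExteriorAlgebra.map L) (CliffordAlgebra.ι 0 m₁) = ExteriorAlgebra.ι ℝ (L m₁) from
          ExteriorAlgebra.map_apply_ι L m₁]
        exact CliffordAlgebra.ι_mem_evenOdd_one _ _) (by
        rw [show (ExteriorAlgebra.map L) (CliffordAlgebra.ι 0 m₂) = ExteriorAlgebra.ι ℝ (L m₂) from
          ExteriorAlgebra.map_apply_ι L m₂]
        exact CliffordAlgebra.ι_mem_evenOdd_one _ _)
  odd a ha := by
    induction a, ha using CliffordAlgebra.odd_induction with
    | ι m =>
      rw [show (ExteriorAlgebra.map L) (CliffordAlgebra.ι 0 m) = ExteriorAlgebra.ι ℝ (L m) from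
          ExteriorAlgebra.map_apply_ι L m]
      exact CliffordAlgebra.ι_mem_evenOdd_one _ _
    | add x y hx hy h1 h2 => rw [map_add]; exact add_mem h1 h2
    | ι_mul_ι_mul m₁ m₂ x hx h1 =>
      rw [map_mul, map_mul]
      have h2 : (ExteriorAlgebra.map L) (CliffordAlgebra.ι 0 m₁) *
          (ExteriorAlgebra.map L) (CliffordAlgebra.ι 0 m₂) ∈ Ev r := od_mul_od_mem (by
        rw [show (ExteriorAlgebra.map L) (CliffordAlgebra.ι 0 m₁) = ExteriorAlgebra.ι ℝ (L m₁) from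
          ExteriorAlgebra.map_apply_ι L m₁]
        exact CliffordAlgebra.ι_mem_evenOdd_one _ _) (by
        rw [show (ExteriorAlgebra.map L) (CliffordAlgebra.ι 0 m₂) = ExteriorAlgebra.ι ℝ (L m₂) from
          ExteriorAlgebra.map_apply_ι L m₂]
        exact CliffordAlgebra.ι_mem_evenOdd_one _ _)
      exact ((⟨_, h2⟩ : Ev r) • (⟨_, h1⟩ : Od r)).2

/-- The rescaling `θ ↦ t θ` of the generators. -/
def GrHom.scale (q : ℕ) (t : ℝ) : GrHom q q := GrHom.ofLinear (t • LinearMap.id)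

theorem GrHom.scale_hom_hom (t u : ℝ) (a : Gr q) :
    (GrHom.scale q t).hom ((GrHom.scale q u).hom a) = (GrHom.scale q (t * u)).hom a := by
  change (ExteriorAlgebra.map _) ((ExteriorAlgebra.map _) a) = _
  rw [← AlgHom.comp_apply, ExteriorAlgebra.map_comp_map, LinearMap.smul_comp, LinearMap.id_comp,
    smul_smul]
  rfl

theorem GrHom.scale_one_hom (a : Gr q) : (GrHom.scale q 1).hom a = a := by
  change (ExteriorAlgebra.map _) a = _
  rw [one_smul, ExteriorAlgebra.map_id]; rfl

/-- At parameter zero the rescaling retracts the Grassmann algebra to the constants. The family of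
rescalings thus joins the identity to the projection to the body. -/
theorem GrHom.scale_zero_hom (a : Gr q) :
    (GrHom.scale q 0).hom a = algebraMap ℝ _ (ExteriorAlgebra.algebraMapInv a) := by
  have : (GrHom.scale q 0).hom =
      (Algebra.ofId ℝ (Gr q)).comp (ExteriorAlgebra.algebraMapInv (R := ℝ)) := by
    refine ExteriorAlgebra.hom_ext (LinearMap.ext fun v => ?_)
    have h1 : (ExteriorAlgebra.ι ℝ v : Gr q) ∈ Od q := CliffordAlgebra.ι_mem_evenOdd_one _ v
    change (ExteriorAlgebra.map _) (ExteriorAlgebra.ι ℝ v) =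
      algebraMap ℝ _ (ExteriorAlgebra.algebraMapInv (ExteriorAlgebra.ι ℝ v))
    rw [algebraMapInv_od h1, ExteriorAlgebra.map_apply_ι]
    simp
  exact congrArg (fun g => g a) this

end Grassmann

/-! ### Normed algebra structures on finite-dimensional algebras -/

section AlgNorm

variable (C : Type) [Ring C] [Algebra ℝ C] [Module.Finite ℝ C]

/-- Left multiplication as a ring homomorphism to continuous endomorphisms. -/
def lmulCoord : C →ₐ[ℝ] Matrix (Fin (Module.finrank ℝ C)) (Fin (Module.finrank ℝ C)) ℝ :=
  Algebra.leftMulMatrix (Module.finBasis ℝ C)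

/-- A submultiplicative norm on a finite-dimensional algebra. -/
abbrev algNorm : NormedRing C :=
  letI := Matrix.linftyOpNormedRing (n := Fin (Module.finrank ℝ C)) (α := ℝ)
  NormedRing.induced C (Matrix (Fin (Module.finrank ℝ C)) (Fin (Module.finrank ℝ C)) ℝ)
    (lmulCoord C) (Algebra.leftMulMatrix_injective _)

/-- The normed algebra structure for `algNorm`. -/
abbrev algNormAlgebra : @NormedAlgebra ℝ C _ (algNorm C).toSeminormedRing :=
  letI := Matrix.linftyOpNormedRing (n := Fin (Module.finrank ℝ C)) (α := ℝ)
  letI := Matrix.linftyOpNormedAlgebra (R := ℝ) (n := Fin (Module.finrank ℝ C)) (α := ℝ)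
  letI := algNorm C
  NormedAlgebra.induced ℝ C (Matrix (Fin (Module.finrank ℝ C)) (Fin (Module.finrank ℝ C)) ℝ)
    (lmulCoord C)

end AlgNorm

/-- Continuity in the parameter is inherited by sums and products, hence need only be seen on
generators. The limit is tested by linear functionals because no topology is fixed on the Grassmann
algebra. -/
theorem GrHom.tendsto_scale {q : ℕ} (a : Gr q) (l : Gr q →ₗ[ℝ] ℝ) :
    Filter.Tendsto (fun t => l ((GrHom.scale q t).hom a)) (𝓝 0)
      (𝓝 (l ((GrHom.scale q 0).hom a))) := by
  let := algNorm (Gr q); let := algNormAlgebra (Gr q)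
  have h : Continuous fun t => (GrHom.scale q t).hom a := by
    induction a using ExteriorAlgebra.induction with
    | algebraMap r => simp only [AlgHom.commutes]; exact continuous_const
    | ι v =>
      have : ∀ t, (GrHom.scale q t).hom (ExteriorAlgebra.ι ℝ v) = t • ExteriorAlgebra.ι ℝ v := by
        intro t
        change (ExteriorAlgebra.map _) _ = _
        rw [ExteriorAlgebra.map_apply_ι]; simp
      simp only [this]
      fun_prop
    | mul x y hx hy => simp only [map_mul]; exact hx.mul hy
    | add x y hx hy => simp only [map_add]; exact hx.add hy
  exact ((LinearMap.continuous_of_finiteDimensional l).comp h).continuousAt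

/-! ### Bodies and real points -/

namespace SVect

variable {V W X : SVect} {q r s : ℕ}

@[simp] theorem map_fst (f : GrHom q r) (x : V.Pt q) :
    (V.map f x).1 = TensorProduct.map f.onEv LinearMap.id x.1 := rfl

@[simp] theorem map_snd (f : GrHom q r) (x : V.Pt q) :
    (V.map f x).2 = TensorProduct.map f.onOd LinearMap.id x.2 := rfl

theorem map_map (g : GrHom r s) (f : GrHom q r) (x : V.Pt q) :
    V.map g (V.map f x) = V.map (g.comp f) x := by
  refine Prod.ext ?_ ?_
  · rw [map_fst, map_fst, map_fst, ← LinearMap.comp_apply, ← TensorProduct.map_comp]; rfl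
  · rw [map_snd, map_snd, map_snd, ← LinearMap.comp_apply, ← TensorProduct.map_comp]; rfl

instance (E : Type) [AddCommGroup E] [Module ℝ E] (q : ℕ) : SMul (Ev q) (Ev q ⊗[ℝ] E) :=
  TensorProduct.leftModule.toSMul

instance (E : Type) [AddCommGroup E] [Module ℝ E] (q : ℕ) : SMul (Ev q) (Od q ⊗[ℝ] E) :=
  TensorProduct.leftModule.toSMul

instance (V : SVect) (q : ℕ) : Module (Ev q) (V.Pt q) := Prod.instModule

instance (V : SVect) (q : ℕ) : SMul (Ev q) (V.Pt q) := Prod.instSMul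

/-- The real point `1 ⊗ u` over a point `u` of `V₀`. -/
def realPt (V : SVect) (q : ℕ) : V.E →ₗ[ℝ] V.Pt q :=
  (LinearMap.inl ℝ _ _).comp (TensorProduct.mk ℝ (Ev q) V.E 1)

theorem realPt_apply (u : V.E) : V.realPt q u = (1 ⊗ₜ u, 0) := rfl

/-- `body` as a linear map. -/
def bodyL (V : SVect) (q : ℕ) : V.Pt q →ₗ[ℝ] V.E :=
  ((TensorProduct.lid ℝ V.E).toLinearMap.comp (TensorProduct.map (aug q) LinearMap.id)).comp
    (LinearMap.fst ℝ _ _)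

@[simp] theorem body_realPt (u : V.E) : V.body (V.realPt q u) = u := by
  simp [body, realPt_apply]

@[simp] theorem body_map (f : GrHom q r) (x : V.Pt q) : V.body (V.map f x) = V.body x := by
  simp only [body, map_fst, ← LinearMap.comp_apply, ← TensorProduct.map_comp]
  congr 3
  exact LinearMap.ext fun a => aug_onEv f a

@[simp] theorem map_realPt (f : GrHom q r) (u : V.E) : V.map f (V.realPt q u) = V.realPt r u := by
  refine Prod.ext ?_ ?_ <;> simp [realPt_apply]

@[simp] theorem map_scale_zero (x : V.Pt q) :
    V.map (GrHom.scale q 0) x = V.realPt q (V.body x) := by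
  obtain ⟨x, y⟩ := x
  refine Prod.ext ?_ ?_
  · change TensorProduct.map (GrHom.scale q 0).onEv LinearMap.id x =
      1 ⊗ₜ TensorProduct.lid ℝ V.E (TensorProduct.map (aug q) LinearMap.id x)
    induction x with
    | zero => simp
    | add x y hx hy => simp [hx, hy, TensorProduct.tmul_add]
    | tmul a e =>
      simp only [TensorProduct.map_tmul, LinearMap.id_coe, id_eq, TensorProduct.lid_tmul]
      rw [← TensorProduct.smul_tmul]
      congr 1
      refine Subtype.ext ?_
      rw [GrHom.onEv_coe, GrHom.scale_zero_hom, Algebra.algebraMap_eq_smul_one]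
      rfl
  · change TensorProduct.map (GrHom.scale q 0).onOd LinearMap.id y = 0
    have : (GrHom.scale q 0).onOd = 0 := by
      refine LinearMap.ext fun a => Subtype.ext ?_
      rw [GrHom.onOd_coe, GrHom.scale_zero_hom, algebraMapInv_od a.2]
      simp
    rw [this, TensorProduct.map_zero_left]; rfl

/-- Rescalings by nonzero factors are invertible, so whatever is known at a point close to its body
can be carried back to the point itself. -/
theorem map_scale_scale {t u : ℝ} (h : t * u = 1) (x : V.Pt q) :
    V.map (GrHom.scale q t) (V.map (GrHom.scale q u) x) = x := by
  rw [map_map]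
  have h1 : ∀ a, ((GrHom.scale q t).comp (GrHom.scale q u)).hom a = a := fun a => by
    change (GrHom.scale q t).hom ((GrHom.scale q u).hom a) = a
    rw [GrHom.scale_hom_hom, h, GrHom.scale_one_hom]
  have h2 : ((GrHom.scale q t).comp (GrHom.scale q u)).onEv = LinearMap.id :=
    LinearMap.ext fun a => Subtype.ext (h1 a)
  have h3 : ((GrHom.scale q t).comp (GrHom.scale q u)).onOd = LinearMap.id :=
    LinearMap.ext fun a => Subtype.ext (h1 a)
  refine Prod.ext ?_ ?_ <;> simp [h2, h3]

theorem tendsto_map_scale (x : V.Pt q) (l : V.Pt q →ₗ[ℝ] ℝ) :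
    Filter.Tendsto (fun t => l (V.map (GrHom.scale q t) x)) (𝓝 0)
      (𝓝 (l (V.map (GrHom.scale q 0) x))) := by
  obtain ⟨x, y⟩ := x
  have hx : ∀ l : Ev q ⊗[ℝ] V.E →ₗ[ℝ] ℝ, Filter.Tendsto
      (fun t => l (TensorProduct.map (GrHom.scale q t).onEv LinearMap.id x)) (𝓝 0)
      (𝓝 (l (TensorProduct.map (GrHom.scale q 0).onEv LinearMap.id x))) := by
    intro l
    induction x with
    | zero => simp
    | add x y hx hy => simpa only [map_add] using hx.add hy
    | tmul a e =>
      -- On a pure tensor the functional only depends on the Grassmann factor; extended from `A₀` to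
      -- all of `A`, it falls under the continuity of the rescaling of `A`.
      obtain ⟨l', hl'⟩ := LinearMap.exists_extend (p := Subalgebra.toSubmodule (Ev q))
        (l.comp ((TensorProduct.mk ℝ (Ev q) V.E).flip e))
      have h := GrHom.tendsto_scale (a : Gr q) l'
      have e1 : ∀ t, l' ((GrHom.scale q t).hom a) =
          l (TensorProduct.map (GrHom.scale q t).onEv LinearMap.id (a ⊗ₜ e)) := fun t =>
        congrArg (fun m => m ((GrHom.scale q t).onEv a)) hl'
      simpa only [e1] using h
  have hy : ∀ l : Od q ⊗[ℝ] V.O →ₗ[ℝ] ℝ, Filter.Tendsto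
      (fun t => l (TensorProduct.map (GrHom.scale q t).onOd LinearMap.id y)) (𝓝 0)
      (𝓝 (l (TensorProduct.map (GrHom.scale q 0).onOd LinearMap.id y))) := by
    intro l
    induction y with
    | zero => simp
    | add x y hx hy => simpa only [map_add] using hx.add hy
    | tmul a e =>
      obtain ⟨l', hl'⟩ := LinearMap.exists_extend (p := Od q)
        (l.comp ((TensorProduct.mk ℝ (Od q) V.O).flip e))
      have h := GrHom.tendsto_scale (a : Gr q) l'
      have e1 : ∀ t, l' ((GrHom.scale q t).hom a) =
          l (TensorProduct.map (GrHom.scale q t).onOd LinearMap.id (a ⊗ₜ e)) := fun t =>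
        congrArg (fun m => m ((GrHom.scale q t).onOd a)) hl'
      simpa only [e1] using h
  have e2 : ∀ z : V.Pt q, l z = l.comp (LinearMap.inl ℝ _ _) z.1 + l.comp (LinearMap.inr ℝ _ _) z.2 :=
    fun z => by simp [← map_add]
  simp only [e2]
  exact (hx _).add (hy _)

/-- Small rescalings move a point into any neighbourhood of its body. -/
theorem exists_scale_mem (x : V.Pt q) {B : Set (V.Pt q)} (hB : OpenSet B)
    (hx : V.realPt q (V.body x) ∈ B) :
    ∃ δ > 0, ∀ t, |t| < δ → V.map (GrHom.scale q t) x ∈ B := by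
  let := coordNorm (V.Pt q); let := coordSpace (V.Pt q)
  rw [openSet_iff_isOpen] at hB
  let e := (Module.finBasis ℝ (V.Pt q)).equivFun.toContinuousLinearEquiv
  have h : Filter.Tendsto (fun t => V.map (GrHom.scale q t) x) (𝓝 0)
      (𝓝 (V.map (GrHom.scale q 0) x)) := by
    have h1 : Filter.Tendsto (fun t => e (V.map (GrHom.scale q t) x)) (𝓝 0)
        (𝓝 (e (V.map (GrHom.scale q 0) x))) := by
      rw [tendsto_pi_nhds]
      intro i
      exact tendsto_map_scale x ((Module.finBasis ℝ (V.Pt q)).coord i)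
    simpa [Function.comp_def] using (e.symm.continuous.tendsto _).comp h1
  rw [map_scale_zero] at h
  have h2 := h (hB.mem_nhds hx)
  obtain ⟨δ, hδ, h3⟩ := Metric.mem_nhds_iff.1 h2
  exact ⟨δ, hδ, fun t ht => h3 (by simpa using ht)⟩

end SVect

/-! ### Smooth maps of superdomains -/

section Smooth

variable {V W X Y : SVect} {q r : ℕ}

/-- The real and the `A₀`-module structures on points are given independently. Their compatibility
allows an `A₀`-linear derivative to be read as a real linear one. -/
theorem SVect.real_smul_one_smul (c : ℝ) (x : V.Pt q) : (c • (1 : Ev q)) • x = c • x := by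
  obtain ⟨x, y⟩ := x
  refine Prod.ext ?_ ?_
  · change (c • (1 : Ev q)) • x = c • x
    rw [smul_assoc, one_smul]
  · change (c • (1 : Ev q)) • y = c • y
    induction y with
    | zero => rw [smul_zero, smul_zero]
    | add x y hx hy => rw [smul_add, smul_add, hx, hy]
    | tmul a e =>
      change ((c • (1 : Ev q)) • a) ⊗ₜ e = (c • a) ⊗ₜ[ℝ] e
      congr 1
      refine Subtype.ext ?_
      change (c • (1 : Gr q)) * a = c • (a : Gr q)
      rw [smul_mul_assoc, one_mul]

/-- An additive map that commutes with even scalars is real linear. -/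
def SVect.realLinear (D : V.Pt q →ₗ[Ev q] W.Pt q) : V.Pt q →ₗ[ℝ] W.Pt q where
  toFun := D
  map_add' := D.map_add
  map_smul' c x := by
    rw [← SVect.real_smul_one_smul, D.map_smul, SVect.real_smul_one_smul]; rfl

/-- Separates the derivative into a real linear map, to which the norm-free calculus applies, and
its compatibility with even scalars. -/
theorem a0SmoothOn_iff {S : Set (V.Pt q)} {f : V.Pt q → W.Pt q} :
    A0SmoothOn V W q S f ↔ SmoothOn S f ∧ ∀ x ∈ S, ∃ D : V.Pt q →ₗ[ℝ] W.Pt q,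
      HasLinDeriv f x D ∧ ∀ (a : Ev q) v, D (a • v) = a • D v := by
  refine and_congr_right fun _ => forall₂_congr fun x _ => ⟨?_, ?_⟩
  · rintro ⟨D, hD⟩
    exact ⟨SVect.realLinear D, hD, fun a v => D.map_smul a v⟩
  · rintro ⟨D, hD, ha⟩
    exact ⟨{ toFun := D, map_add' := D.map_add, map_smul' := ha }, hD⟩

theorem openSet_domain {U : Set V.E} (hU : OpenSet U) : OpenSet (domain V U q) :=
  fun k L => hU k ((V.bodyL q).comp L)

theorem IsSmoothOn.mono {U U' : Set V.E} {F : ∀ q, V.Pt q → W.Pt q} (h : IsSmoothOn V W U' F)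
    (hU : U ⊆ U') : IsSmoothOn V W U F where
  natural q r f x hx := h.natural q r f x (hU hx)
  smooth q := ⟨(h.smooth q).1.mono fun _ hx => hU hx, fun x hx => (h.smooth q).2 x (hU hx)⟩

/-- Openness of `U` is needed because a derivative depends on a neighbourhood; naturality transfers
because homomorphisms of Grassmann algebras do not change the body and so preserve the superdomain.
-/
theorem IsSmoothOn.congr {U : Set V.E} (hU : OpenSet U) {F G : ∀ q, V.Pt q → W.Pt q}
    (h : IsSmoothOn V W U F) (hFG : ∀ q, ∀ x ∈ domain V U q, G q x = F q x) :
    IsSmoothOn V W U G where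
  natural q r f x hx := by
    rw [hFG q x hx, hFG r _ (by simpa [domain] using hx), h.natural q r f x hx]
  smooth q := by
    have h1 := a0SmoothOn_iff.1 (h.smooth q)
    refine a0SmoothOn_iff.2 ⟨h1.1.congr (hFG q), fun x hx => ?_⟩
    obtain ⟨D, hD, ha⟩ := h1.2 x hx
    exact ⟨D, hD.congr (openSet_domain hU) hx (hFG q), ha⟩

theorem IsSmoothOn.comp {U : Set V.E} {U' : Set W.E} (hU : OpenSet U) (hU' : OpenSet U')
    {F : ∀ q, V.Pt q → W.Pt q} {G : ∀ q, W.Pt q → X.Pt q} (hG : IsSmoothOn W X U' G)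
    (hF : IsSmoothOn V W U F) (h : ∀ q, ∀ x ∈ domain V U q, F q x ∈ domain W U' q) :
    IsSmoothOn V X U fun q x => G q (F q x) where
  natural q r f x hx := by rw [hF.natural q r f x hx, hG.natural q r f _ (h q x hx)]
  smooth q := by
    have h1 := a0SmoothOn_iff.1 (hF.smooth q)
    have h2 := a0SmoothOn_iff.1 (hG.smooth q)
    refine a0SmoothOn_iff.2 ⟨h2.1.comp h1.1 (h q), fun x hx => ?_⟩
    obtain ⟨D, hD, ha⟩ := h1.2 x hx
    obtain ⟨D', hD', ha'⟩ := h2.2 _ (h q x hx)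
    exact ⟨D'.comp D, hD.comp (openSet_domain hU) (openSet_domain hU') hx (h q x hx) h1.1 h2.1 hD',
      fun a v => by simp only [LinearMap.comp_apply, ha, ha']⟩

theorem IsSmoothOn.comp_univ {U : Set V.E} (hU : OpenSet U)
    {F : ∀ q, V.Pt q → W.Pt q} {G : ∀ q, W.Pt q → X.Pt q} (hG : IsSmoothOn W X Set.univ G)
    (hF : IsSmoothOn V W U F) : IsSmoothOn V X U fun q x => G q (F q x) :=
  hG.comp hU openSet_univ hF fun _ _ _ => Set.mem_univ _

theorem isSmoothOn_linear (U : Set V.E) (L : ∀ q, V.Pt q →ₗ[ℝ] W.Pt q)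
    (hn : ∀ q r (f : GrHom q r) x, L r (V.map f x) = W.map f (L q x))
    (ha : ∀ q (a : Ev q) x, L q (a • x) = a • L q x) : IsSmoothOn V W U fun q => L q where
  natural q r f x _ := hn q r f x
  smooth q := a0SmoothOn_iff.2 ⟨smoothOn_linear _ _, fun x _ =>
    ⟨L q, hasLinDeriv_linear _ _, ha q⟩⟩

theorem isSmoothOn_id (U : Set V.E) : IsSmoothOn V V U fun _ x => x :=
  isSmoothOn_linear U (fun _ => LinearMap.id) (fun _ _ _ _ => rfl) fun _ _ _ => rfl

theorem isSmoothOn_realPt (U : Set V.E) (c : W.E) : IsSmoothOn V W U fun q _ => W.realPt q c where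
  natural q r f x _ := by simp
  smooth q := a0SmoothOn_iff.2 ⟨smoothOn_const _ _, fun x _ =>
    ⟨0, hasLinDeriv_const _ _, fun a v => by simp⟩⟩

theorem IsSmoothOn.add {U : Set V.E} {F G : ∀ q, V.Pt q → W.Pt q}
    (hF : IsSmoothOn V W U F) (hG : IsSmoothOn V W U G) :
    IsSmoothOn V W U fun q x => F q x + G q x where
  natural q r f x hx := by rw [hF.natural q r f x hx, hG.natural q r f x hx, map_add]
  smooth q := by
    have h1 := a0SmoothOn_iff.1 (hF.smooth q)
    have h2 := a0SmoothOn_iff.1 (hG.smooth q)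
    refine a0SmoothOn_iff.2 ⟨h1.1.add h2.1, fun x hx => ?_⟩
    obtain ⟨D, hD, ha⟩ := h1.2 x hx
    obtain ⟨D', hD', ha'⟩ := h2.2 x hx
    exact ⟨D + D', hD.add hD', fun a v => by
      simp only [LinearMap.add_apply, ha, ha', smul_add]⟩

/-- The product rule. The group law of T, Clifford multiplication, the Spin action and the cubic
cochain are all assembled from natural `A₀`-bilinear maps, and their smoothness comes from here. -/
theorem IsSmoothOn.bilin {U : Set V.E} (hU : OpenSet U) {F : ∀ q, V.Pt q → W.Pt q}
    {G : ∀ q, V.Pt q → X.Pt q} (hF : IsSmoothOn V W U F) (hG : IsSmoothOn V X U G)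
    (b : ∀ q, W.Pt q →ₗ[ℝ] X.Pt q →ₗ[ℝ] Y.Pt q)
    (hn : ∀ q r (f : GrHom q r) x y, b r (W.map f x) (X.map f y) = Y.map f (b q x y))
    (ha : ∀ q (a : Ev q) x y, b q (a • x) y = a • b q x y)
    (ha' : ∀ q (a : Ev q) x y, b q x (a • y) = a • b q x y) :
    IsSmoothOn V Y U fun q x => b q (F q x) (G q x) where
  natural q r f x hx := by rw [hF.natural q r f x hx, hG.natural q r f x hx, hn]
  smooth q := by
    have h1 := a0SmoothOn_iff.1 (hF.smooth q)
    have h2 := a0SmoothOn_iff.1 (hG.smooth q)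
    refine a0SmoothOn_iff.2 ⟨h1.1.bilin h2.1 _, fun x hx => ?_⟩
    obtain ⟨D, hD, hc⟩ := h1.2 x hx
    obtain ⟨D', hD', hc'⟩ := h2.2 x hx
    refine ⟨(b q (F q x)).comp D' + ((b q).flip (G q x)).comp D,
      HasLinDeriv.bilin (E := V.Pt q) (F := W.Pt q) (G := X.Pt q) (H := Y.Pt q)
        (openSet_domain hU) hx h1.1 h2.1 hD hD' (b q), fun a v => ?_⟩
    simp only [LinearMap.add_apply, LinearMap.comp_apply, LinearMap.flip_apply, hc, hc', ha, ha',
      smul_add]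

theorem IsSmoothOn.const_smul {U : Set V.E} (hU : OpenSet U) {F : ∀ q, V.Pt q → W.Pt q}
    (hF : IsSmoothOn V W U F) (c : ℝ) : IsSmoothOn V W U fun q x => c • F q x :=
  IsSmoothOn.comp_univ hU (isSmoothOn_linear _ (fun q => c • LinearMap.id)
    (fun q r f x => (map_smul (W.map f) c x).symm)
    fun q a x => by
      simp only [LinearMap.smul_apply, LinearMap.id_apply]
      rw [← SVect.real_smul_one_smul, smul_smul, ev_mul_comm, ← smul_smul,
        SVect.real_smul_one_smul]) hF

theorem IsSmoothOn.neg {U : Set V.E} (hU : OpenSet U) {F : ∀ q, V.Pt q → W.Pt q}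
    (hF : IsSmoothOn V W U F) : IsSmoothOn V W U fun q x => -F q x := by
  have e : (fun q x => -F q x) = fun q x => (-1 : ℝ) • F q x := by
    funext q x; exact (neg_one_smul ℝ (F q x)).symm
  rw [e]
  exact hF.const_smul hU (-1)

/-! ### Linear and bilinear maps on `A`-points -/

namespace SVect

theorem lin_map (L₀ : V.E →ₗ[ℝ] W.E) (L₁ : V.O →ₗ[ℝ] W.O) (f : GrHom q r) (x : V.Pt q) :
    lin L₀ L₁ r (V.map f x) = W.map f (lin L₀ L₁ q x) := by
  refine Prod.ext ?_ ?_
  · change TensorProduct.map LinearMap.id L₀ (TensorProduct.map f.onEv LinearMap.id x.1) =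
      TensorProduct.map f.onEv LinearMap.id (TensorProduct.map LinearMap.id L₀ x.1)
    rw [← LinearMap.comp_apply, ← LinearMap.comp_apply, ← TensorProduct.map_comp,
      ← TensorProduct.map_comp]; rfl
  · change TensorProduct.map LinearMap.id L₁ (TensorProduct.map f.onOd LinearMap.id x.2) =
      TensorProduct.map f.onOd LinearMap.id (TensorProduct.map LinearMap.id L₁ x.2)
    rw [← LinearMap.comp_apply, ← LinearMap.comp_apply, ← TensorProduct.map_comp,
      ← TensorProduct.map_comp]; rfl

theorem map_id_smul_ev {E F : Type} [AddCommGroup E] [Module ℝ E] [AddCommGroup F] [Module ℝ F]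
    (L : E →ₗ[ℝ] F) (a : Ev q) (x : Ev q ⊗[ℝ] E) :
    TensorProduct.map LinearMap.id L (a • x) = a • TensorProduct.map LinearMap.id L x := by
  induction x with
  | zero => rw [smul_zero, map_zero, smul_zero]
  | add x y hx hy => rw [smul_add, map_add, map_add, hx, hy, smul_add]
  | tmul b e => rfl

theorem map_id_smul_od {E F : Type} [AddCommGroup E] [Module ℝ E] [AddCommGroup F] [Module ℝ F]
    (L : E →ₗ[ℝ] F) (a : Ev q) (x : Od q ⊗[ℝ] E) :
    TensorProduct.map LinearMap.id L (a • x) = a • TensorProduct.map LinearMap.id L x := by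
  induction x with
  | zero => rw [smul_zero, map_zero, smul_zero]
  | add x y hx hy => rw [smul_add, map_add, map_add, hx, hy, smul_add]
  | tmul b e => rfl

theorem lin_smul_ev (L₀ : V.E →ₗ[ℝ] W.E) (L₁ : V.O →ₗ[ℝ] W.O) (a : Ev q) (x : V.Pt q) :
    lin L₀ L₁ q (a • x) = a • lin L₀ L₁ q x :=
  Prod.ext (map_id_smul_ev L₀ a x.1) (map_id_smul_od L₁ a x.2)

theorem lin_lin (L₀ : V.E →ₗ[ℝ] W.E) (L₁ : V.O →ₗ[ℝ] W.O) (M₀ : W.E →ₗ[ℝ] X.E)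
    (M₁ : W.O →ₗ[ℝ] X.O) (x : V.Pt q) :
    lin M₀ M₁ q (lin L₀ L₁ q x) = lin (M₀.comp L₀) (M₁.comp L₁) q x := by
  refine Prod.ext ?_ ?_
  · change TensorProduct.map LinearMap.id M₀ (TensorProduct.map LinearMap.id L₀ x.1) =
      TensorProduct.map LinearMap.id (M₀.comp L₀) x.1
    rw [← LinearMap.comp_apply, ← TensorProduct.map_comp]; rfl
  · change TensorProduct.map LinearMap.id M₁ (TensorProduct.map LinearMap.id L₁ x.2) =
      TensorProduct.map LinearMap.id (M₁.comp L₁) x.2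
    rw [← LinearMap.comp_apply, ← TensorProduct.map_comp]; rfl

theorem lin_id (x : V.Pt q) : lin (V := V) LinearMap.id LinearMap.id q x = x := by
  refine Prod.ext ?_ ?_ <;> simp [lin]

theorem lin_zero (x : V.Pt q) : lin (V := V) (W := W) 0 0 q x = 0 := by
  refine Prod.ext ?_ ?_ <;> simp [lin]

theorem lin_add (L₀ M₀ : V.E →ₗ[ℝ] W.E) (L₁ M₁ : V.O →ₗ[ℝ] W.O) (x : V.Pt q) :
    lin (L₀ + M₀) (L₁ + M₁) q x = lin L₀ L₁ q x + lin M₀ M₁ q x := by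
  refine Prod.ext ?_ ?_ <;> simp [lin, TensorProduct.map_add_right]

theorem body_lin (L₀ : V.E →ₗ[ℝ] W.E) (L₁ : V.O →ₗ[ℝ] W.O) (x : V.Pt q) :
    W.body (lin L₀ L₁ q x) = L₀ (V.body x) := by
  obtain ⟨x, y⟩ := x
  change TensorProduct.lid ℝ W.E (TensorProduct.map (aug q) LinearMap.id
    (TensorProduct.map LinearMap.id L₀ x)) =
      L₀ (TensorProduct.lid ℝ V.E (TensorProduct.map (aug q) LinearMap.id x))
  induction x with
  | zero => simp
  | add x y hx hy => simp only [map_add, hx, hy]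
  | tmul a e => simp

/-- The even part of the first projection of a direct sum. -/
def fstE (V W : SVect) : (V.prod W).E →ₗ[ℝ] V.E := LinearMap.fst ℝ V.E W.E

/-- The odd part of the first projection of a direct sum. -/
def fstO (V W : SVect) : (V.prod W).O →ₗ[ℝ] V.O := LinearMap.fst ℝ V.O W.O

/-- The even part of the second projection of a direct sum. -/
def sndE (V W : SVect) : (V.prod W).E →ₗ[ℝ] W.E := LinearMap.snd ℝ V.E W.E

/-- The odd part of the second projection of a direct sum. -/
def sndO (V W : SVect) : (V.prod W).O →ₗ[ℝ] W.O := LinearMap.snd ℝ V.O W.O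

/-- The even part of the first inclusion in a direct sum. -/
def inlE (V W : SVect) : V.E →ₗ[ℝ] (V.prod W).E := LinearMap.inl ℝ V.E W.E

/-- The odd part of the first inclusion in a direct sum. -/
def inlO (V W : SVect) : V.O →ₗ[ℝ] (V.prod W).O := LinearMap.inl ℝ V.O W.O

/-- The even part of the second inclusion in a direct sum. -/
def inrE (V W : SVect) : W.E →ₗ[ℝ] (V.prod W).E := LinearMap.inr ℝ V.E W.E

/-- The odd part of the second inclusion in a direct sum. -/
def inrO (V W : SVect) : W.O →ₗ[ℝ] (V.prod W).O := LinearMap.inr ℝ V.O W.O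

theorem pfst_eq (z : (V.prod W).Pt q) : pfst z = lin (fstE V W) (fstO V W) q z := rfl

theorem psnd_eq (z : (V.prod W).Pt q) : psnd z = lin (sndE V W) (sndO V W) q z := rfl

theorem pair_eq (x : V.Pt q) (y : W.Pt q) :
    pair x y = lin (inlE V W) (inlO V W) q x + lin (inrE V W) (inrO V W) q y := rfl

@[simp] theorem pfst_pair (x : V.Pt q) (y : W.Pt q) : pfst (pair x y) = x := by
  rw [pfst_eq, pair_eq, map_add, lin_lin, lin_lin]
  rw [show (fstE V W).comp (inlE V W) = LinearMap.id from rfl,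
    show (fstO V W).comp (inlO V W) = LinearMap.id from rfl,
    show (fstE V W).comp (inrE V W) = 0 from rfl,
    show (fstO V W).comp (inrO V W) = 0 from rfl, lin_id, lin_zero, add_zero]

@[simp] theorem psnd_pair (x : V.Pt q) (y : W.Pt q) : psnd (pair x y) = y := by
  rw [psnd_eq, pair_eq, map_add, lin_lin, lin_lin]
  rw [show (sndE V W).comp (inlE V W) = 0 from rfl,
    show (sndO V W).comp (inlO V W) = 0 from rfl,
    show (sndE V W).comp (inrE V W) = LinearMap.id from rfl,
    show (sndO V W).comp (inrO V W) = LinearMap.id from rfl, lin_id, lin_zero, zero_add]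

@[simp] theorem pair_pfst_psnd (z : (V.prod W).Pt q) : pair (pfst z) (psnd z) = z := by
  rw [pfst_eq, psnd_eq, pair_eq, lin_lin, lin_lin, ← lin_add]
  have h1 : (inlE V W).comp (fstE V W) + (inrE V W).comp (sndE V W) = LinearMap.id :=
    LinearMap.ext fun x => Prod.ext (add_zero x.1) (zero_add x.2)
  have h2 : (inlO V W).comp (fstO V W) + (inrO V W).comp (sndO V W) = LinearMap.id :=
    LinearMap.ext fun x => Prod.ext (add_zero x.1) (zero_add x.2)
  rw [h1, h2, lin_id]

theorem pair_ext {z w : (V.prod W).Pt q} (h1 : pfst z = pfst w) (h2 : psnd z = psnd w) :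
    z = w := by
  rw [← pair_pfst_psnd z, ← pair_pfst_psnd w, h1, h2]

theorem pfst_map (f : GrHom q r) (z : (V.prod W).Pt q) :
    pfst ((V.prod W).map f z) = V.map f (pfst z) := lin_map _ _ f z

theorem psnd_map (f : GrHom q r) (z : (V.prod W).Pt q) :
    psnd ((V.prod W).map f z) = W.map f (psnd z) := lin_map _ _ f z

theorem pair_map (f : GrHom q r) (x : V.Pt q) (y : W.Pt q) :
    (V.prod W).map f (pair x y) = pair (V.map f x) (W.map f y) :=
  pair_ext (by rw [pfst_map, pfst_pair, pfst_pair]) (by rw [psnd_map, psnd_pair, psnd_pair])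

theorem body_pfst (z : (V.prod W).Pt q) : V.body (pfst z) = ((V.prod W).body z).1 :=
  body_lin _ _ z

theorem body_psnd (z : (V.prod W).Pt q) : W.body (psnd z) = ((V.prod W).body z).2 :=
  body_lin _ _ z

theorem coord_map {p : ℕ} (f : GrHom q r) (z : (V.pow p).Pt q) (i : Fin p) :
    coord ((V.pow p).map f z) i = V.map f (coord z i) := lin_map _ _ f z

/-- The bilinear map on `A`-points induced by bilinear maps of the homogeneous parts. -/
def bil (bEE : V.E →ₗ[ℝ] W.E →ₗ[ℝ] X.E) (bEO : V.E →ₗ[ℝ] W.O →ₗ[ℝ] X.O)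
    (bOO : V.O →ₗ[ℝ] W.O →ₗ[ℝ] X.E) (q : ℕ) : V.Pt q →ₗ[ℝ] W.Pt q →ₗ[ℝ] X.Pt q :=
  LinearMap.mk₂ ℝ (fun x y => (TensorProduct.map₂ (LinearMap.mul ℝ (Ev q)) bEE x.1 y.1 +
      TensorProduct.map₂ (odMulRev q) bOO x.2 y.2, TensorProduct.map₂ (evOdMul q) bEO x.1 y.2))
    (fun x y z => Prod.ext (by simp; abel) (by simp))
    (fun c x z => Prod.ext (by simp) (by simp))
    (fun x y z => Prod.ext (by simp; abel) (by simp))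
    (fun c x z => Prod.ext (by simp) (by simp))

theorem tensor_induction₂ {A B E F : Type}
    [AddCommGroup A] [Module ℝ A] [AddCommGroup B] [Module ℝ B]
    [AddCommGroup E] [Module ℝ E] [AddCommGroup F] [Module ℝ F]
    {P : A ⊗[ℝ] E → B ⊗[ℝ] F → Prop}
    (h0 : ∀ y, P 0 y) (h0' : ∀ x, P x 0) (ha : ∀ x x' y, P x y → P x' y → P (x + x') y)
    (ha' : ∀ x y y', P x y → P x y' → P x (y + y')) (ht : ∀ a e b f, P (a ⊗ₜ e) (b ⊗ₜ f))
    (x : A ⊗[ℝ] E) (y : B ⊗[ℝ] F) : P x y := by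
  induction x with
  | zero => exact h0 y
  | add x x' hx hx' => exact ha _ _ _ hx hx'
  | tmul a e =>
    induction y with
    | zero => exact h0' _
    | add y y' hy hy' => exact ha' _ _ _ hy hy'
    | tmul b f => exact ht a e b f

/-- A relation between bilinear maps on tensor products may be checked on pure tensors. -/
theorem map₂_map_of_pure {A B C A' B' C' E F G : Type}
    [AddCommGroup A] [Module ℝ A] [AddCommGroup B] [Module ℝ B] [AddCommGroup C] [Module ℝ C]
    [AddCommGroup A'] [Module ℝ A'] [AddCommGroup B'] [Module ℝ B'] [AddCommGroup C'] [Module ℝ C']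
    [AddCommGroup E] [Module ℝ E] [AddCommGroup F] [Module ℝ F] [AddCommGroup G] [Module ℝ G]
    (m : A →ₗ[ℝ] B →ₗ[ℝ] C) (m' : A' →ₗ[ℝ] B' →ₗ[ℝ] C') (f : A →ₗ[ℝ] A') (g : B →ₗ[ℝ] B')
    (h : C →ₗ[ℝ] C') (hm : ∀ a b, h (m a b) = m' (f a) (g b)) (b : E →ₗ[ℝ] F →ₗ[ℝ] G)
    (x : A ⊗[ℝ] E) (y : B ⊗[ℝ] F) :
    TensorProduct.map₂ m' b (TensorProduct.map f LinearMap.id x)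
      (TensorProduct.map g LinearMap.id y) =
      TensorProduct.map h LinearMap.id (TensorProduct.map₂ m b x y) := by
  refine tensor_induction₂ (P := fun x y => TensorProduct.map₂ m' b
    (TensorProduct.map f LinearMap.id x) (TensorProduct.map g LinearMap.id y) =
      TensorProduct.map h LinearMap.id (TensorProduct.map₂ m b x y)) ?_ ?_ ?_ ?_ ?_ x y
  · intro y; simp only [map_zero, LinearMap.zero_apply]
  · intro x; simp only [map_zero]
  · intro x x' y h1 h2; simp only [map_add, LinearMap.add_apply, h1, h2]
  · intro x y y' h1 h2; simp only [map_add, h1, h2]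
  · intro a e b f
    simp only [TensorProduct.map_tmul, TensorProduct.map₂_apply_tmul, LinearMap.id_coe, id_eq, hm]

section Bil

variable (bEE : V.E →ₗ[ℝ] W.E →ₗ[ℝ] X.E) (bEO : V.E →ₗ[ℝ] W.O →ₗ[ℝ] X.O)
    (bOO : V.O →ₗ[ℝ] W.O →ₗ[ℝ] X.E)

theorem bil_apply (x : V.Pt q) (y : W.Pt q) : bil bEE bEO bOO q x y =
    (TensorProduct.map₂ (LinearMap.mul ℝ (Ev q)) bEE x.1 y.1 +
      TensorProduct.map₂ (odMulRev q) bOO x.2 y.2,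
        TensorProduct.map₂ (evOdMul q) bEO x.1 y.2) := rfl

theorem bil_map (f : GrHom q r) (x : V.Pt q) (y : W.Pt q) :
    bil bEE bEO bOO r (V.map f x) (W.map f y) = X.map f (bil bEE bEO bOO q x y) := by
  rw [bil_apply, bil_apply]
  refine Prod.ext ?_ ?_
  · simp only [map_fst, map_snd, map_add]
    rw [map₂_map_of_pure (LinearMap.mul ℝ (Ev q)) (LinearMap.mul ℝ (Ev r)) f.onEv f.onEv f.onEv
      (fun a b => GrHom.onEv_mul f a b), map₂_map_of_pure (odMulRev q) (odMulRev r) f.onOd f.onOd f.onEv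
      (fun a b => GrHom.onEv_odMulRev f a b)]
  · simp only [map_fst, map_snd]
    rw [map₂_map_of_pure (evOdMul q) (evOdMul r) f.onEv f.onOd f.onOd
      (fun a b => GrHom.onOd_smul f a b)]

/-- Multiplication by an even scalar, as a map of the tensor factor. -/
theorem smul_eq_map_ev {E : Type} [AddCommGroup E] [Module ℝ E] (a : Ev q) (x : Ev q ⊗[ℝ] E) :
    a • x = TensorProduct.map (LinearMap.mul ℝ (Ev q) a) LinearMap.id x := by
  induction x with
  | zero => rw [smul_zero, map_zero]
  | add x y hx hy => rw [smul_add, map_add, hx, hy]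
  | tmul b e => rfl

theorem smul_eq_map_od {E : Type} [AddCommGroup E] [Module ℝ E] (a : Ev q) (x : Od q ⊗[ℝ] E) :
    a • x = TensorProduct.map (evOdMul q a) LinearMap.id x := by
  induction x with
  | zero => rw [smul_zero, map_zero]
  | add x y hx hy => rw [smul_add, map_add, hx, hy]
  | tmul b e => rfl

/-- An even scalar is central, so it can be moved past odd coefficients even in the reversed product
`odMulRev`. -/
theorem bil_smul_left (a : Ev q) (x : V.Pt q) (y : W.Pt q) :
    bil bEE bEO bOO q (a • x) y = a • bil bEE bEO bOO q x y := by
  obtain ⟨x, x'⟩ := x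
  obtain ⟨y, y'⟩ := y
  rw [bil_apply, bil_apply]
  refine Prod.ext ?_ ?_
  · change TensorProduct.map₂ _ bEE (a • x) y + TensorProduct.map₂ _ bOO (a • x') y' = a • (_ + _)
    rw [smul_add, smul_eq_map_ev, smul_eq_map_od, smul_eq_map_ev, smul_eq_map_ev]
    congr 1
    · refine Eq.trans ?_ (map₂_map_of_pure (LinearMap.mul ℝ (Ev q)) (LinearMap.mul ℝ (Ev q))
        (LinearMap.mul ℝ (Ev q) a) LinearMap.id (LinearMap.mul ℝ (Ev q) a) (fun b c => (mul_assoc a b c).symm) bEE x y)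
      rw [TensorProduct.map_id]; rfl
    · refine Eq.trans ?_ (map₂_map_of_pure (odMulRev q) (odMulRev q) (evOdMul q a)
        LinearMap.id (LinearMap.mul ℝ (Ev q) a) (fun b c => ?_) bOO x' y')
      · rw [TensorProduct.map_id]; rfl
      · refine Subtype.ext ?_
        change (a : Gr q) * (c * b) = c * (a * b)
        rw [← mul_assoc, ev_commute a.2, mul_assoc]
  · change TensorProduct.map₂ _ bEO (a • x) y' = a • _
    rw [smul_eq_map_ev, smul_eq_map_od]
    refine Eq.trans ?_ (map₂_map_of_pure (evOdMul q) (evOdMul q) (LinearMap.mul ℝ (Ev q) a) LinearMap.id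
        (evOdMul q a) (fun b c => (mul_smul a b c).symm) bEO x y')
    rw [TensorProduct.map_id]; rfl

theorem bil_smul_right (a : Ev q) (x : V.Pt q) (y : W.Pt q) :
    bil bEE bEO bOO q x (a • y) = a • bil bEE bEO bOO q x y := by
  obtain ⟨x, x'⟩ := x
  obtain ⟨y, y'⟩ := y
  rw [bil_apply, bil_apply]
  refine Prod.ext ?_ ?_
  · change TensorProduct.map₂ _ bEE x (a • y) + TensorProduct.map₂ _ bOO x' (a • y') = a • (_ + _)
    rw [smul_add, smul_eq_map_ev, smul_eq_map_od, smul_eq_map_ev, smul_eq_map_ev]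
    congr 1
    · refine Eq.trans ?_ (map₂_map_of_pure (LinearMap.mul ℝ (Ev q)) (LinearMap.mul ℝ (Ev q))
        LinearMap.id (LinearMap.mul ℝ (Ev q) a) (LinearMap.mul ℝ (Ev q) a) (fun b c => ?_) bEE x y)
      · rw [TensorProduct.map_id]; rfl
      · change a * (b * c) = b * (a * c)
        rw [← mul_assoc, ev_mul_comm a b, mul_assoc]
    · refine Eq.trans ?_ (map₂_map_of_pure (odMulRev q) (odMulRev q) LinearMap.id
        (evOdMul q a) (LinearMap.mul ℝ (Ev q) a) (fun b c => ?_) bOO x' y')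
      · rw [TensorProduct.map_id]; rfl
      · refine Subtype.ext ?_
        change (a : Gr q) * (c * b) = (a * c) * b
        rw [mul_assoc]
  · change TensorProduct.map₂ _ bEO x (a • y') = a • _
    rw [smul_eq_map_od, smul_eq_map_od]
    refine Eq.trans ?_ (map₂_map_of_pure (evOdMul q) (evOdMul q) LinearMap.id (evOdMul q a) (evOdMul q a)
        (fun b c => ?_) bEO x y')
    · rw [TensorProduct.map_id]; rfl
    · change a • (b • c) = b • (a • c)
      rw [← mul_smul, ev_mul_comm, mul_smul]

end Bil

end SVect

end Smooth

open SuperSpace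

/-! ### The calculus of smooth maps of supermanifolds -/

section Calculus

variable {V W X Y : SVect} {q r : ℕ}

theorem isSmoothOn_lin (U : Set V.E) (L₀ : V.E →ₗ[ℝ] W.E) (L₁ : V.O →ₗ[ℝ] W.O) :
    IsSmoothOn V W U fun q => SVect.lin L₀ L₁ q :=
  isSmoothOn_linear U _ (fun _ _ f x => SVect.lin_map L₀ L₁ f x)
    fun _ a x => SVect.lin_smul_ev L₀ L₁ a x

theorem isSmoothOn_pfst (U : Set (V.prod W).E) :
    IsSmoothOn (V.prod W) V U fun _ z => SVect.pfst z :=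
  isSmoothOn_lin U (SVect.fstE V W) (SVect.fstO V W)

theorem isSmoothOn_psnd (U : Set (V.prod W).E) :
    IsSmoothOn (V.prod W) W U fun _ z => SVect.psnd z :=
  isSmoothOn_lin U (SVect.sndE V W) (SVect.sndO V W)

theorem isSmoothOn_coord {p : ℕ} (U : Set (V.pow p).E) (i : Fin p) :
    IsSmoothOn (V.pow p) V U fun _ z => SVect.coord z i :=
  isSmoothOn_lin (V := V.pow p) (W := V) U (LinearMap.proj i : (Fin p → V.E) →ₗ[ℝ] V.E)
    (LinearMap.proj i : (Fin p → V.O) →ₗ[ℝ] V.O)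

theorem IsSmoothOn.pfst {U : Set X.E} (hU : OpenSet U) {F : ∀ q, X.Pt q → (V.prod W).Pt q}
    (hF : IsSmoothOn X (V.prod W) U F) : IsSmoothOn X V U fun q x => SVect.pfst (F q x) :=
  (isSmoothOn_pfst Set.univ).comp_univ hU hF

theorem IsSmoothOn.psnd {U : Set X.E} (hU : OpenSet U) {F : ∀ q, X.Pt q → (V.prod W).Pt q}
    (hF : IsSmoothOn X (V.prod W) U F) : IsSmoothOn X W U fun q x => SVect.psnd (F q x) :=
  (isSmoothOn_psnd Set.univ).comp_univ hU hF

theorem IsSmoothOn.lin {U : Set X.E} (hU : OpenSet U) {F : ∀ q, X.Pt q → V.Pt q}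
    (hF : IsSmoothOn X V U F) (L₀ : V.E →ₗ[ℝ] W.E) (L₁ : V.O →ₗ[ℝ] W.O) :
    IsSmoothOn X W U fun q x => SVect.lin L₀ L₁ q (F q x) :=
  (isSmoothOn_lin Set.univ L₀ L₁).comp_univ hU hF

theorem IsSmoothOn.pair {U : Set X.E} (hU : OpenSet U) {F : ∀ q, X.Pt q → V.Pt q}
    {G : ∀ q, X.Pt q → W.Pt q} (hF : IsSmoothOn X V U F) (hG : IsSmoothOn X W U G) :
    IsSmoothOn X (V.prod W) U fun q x => SVect.pair (F q x) (G q x) :=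
  (hF.lin hU (SVect.inlE V W) (SVect.inlO V W)).add (hG.lin hU (SVect.inrE V W) (SVect.inrO V W))

theorem IsSmoothOn.bil {U : Set X.E} (hU : OpenSet U) {F : ∀ q, X.Pt q → V.Pt q}
    {G : ∀ q, X.Pt q → W.Pt q} (hF : IsSmoothOn X V U F) (hG : IsSmoothOn X W U G)
    (bEE : V.E →ₗ[ℝ] W.E →ₗ[ℝ] Y.E) (bEO : V.E →ₗ[ℝ] W.O →ₗ[ℝ] Y.O)
    (bOO : V.O →ₗ[ℝ] W.O →ₗ[ℝ] Y.E) :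
    IsSmoothOn X Y U fun q x => SVect.bil bEE bEO bOO q (F q x) (G q x) :=
  hF.bilin hU hG _ (fun _ _ f x y => SVect.bil_map bEE bEO bOO f x y)
    (fun _ a x y => SVect.bil_smul_left bEE bEO bOO a x y)
    (fun _ a x y => SVect.bil_smul_right bEE bEO bOO a x y)

/-- The map of bodies induced by a map of superdomains. -/
def bodyMap (F : ∀ q, V.Pt q → W.Pt q) (u : V.E) : W.E := W.body (F 0 (V.realPt 0 u))

theorem realPt_mem_domain {U : Set V.E} {u : V.E} (hu : u ∈ U) : V.realPt q u ∈ domain V U q := by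
  simpa [domain] using hu

/-- A real point comes from the Grassmann algebra on no generators and is fixed by the rescaling
with factor zero. Naturality forces its image to have the same two properties. -/
theorem IsSmoothOn.realPt_eq {U : Set V.E} {F : ∀ q, V.Pt q → W.Pt q} (hF : IsSmoothOn V W U F)
    {u : V.E} (hu : u ∈ U) : F q (V.realPt q u) = W.realPt q (bodyMap F u) := by
  have h1 := hF.natural 0 q (GrHom.ofLinear 0) _ (realPt_mem_domain hu)
  have h2 := hF.natural 0 0 (GrHom.scale 0 0) _ (realPt_mem_domain hu)
  rw [SVect.map_realPt] at h1 h2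
  rw [h1, h2, SVect.map_scale_zero, SVect.map_realPt]
  rfl

/-- Naturality for the rescaling with factor zero, which replaces a point by its body. Hence
conditions on the body of a value are conditions on the body of the argument. -/
theorem IsSmoothOn.body_eq {U : Set V.E} {F : ∀ q, V.Pt q → W.Pt q} (hF : IsSmoothOn V W U F)
    {x : V.Pt q} (hx : x ∈ domain V U q) : W.body (F q x) = bodyMap F (V.body x) := by
  have h1 := hF.natural q q (GrHom.scale q 0) x hx
  rw [SVect.map_scale_zero, SVect.map_scale_zero, hF.realPt_eq hx] at h1
  simpa using (congrArg W.body h1).symm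

theorem IsSmoothOn.smoothOn_bodyMap {U : Set V.E} {F : ∀ q, V.Pt q → W.Pt q}
    (hF : IsSmoothOn V W U F) : SmoothOn U (bodyMap F) :=
  SmoothOn.comp (E := V.E) (F := W.Pt 0) (G := W.E)
    (smoothOn_linear (E := W.Pt 0) (F := W.E) Set.univ (W.bodyL 0))
    (SmoothOn.comp (E := V.E) (F := V.Pt 0) (G := W.Pt 0) (hF.smooth 0).1
      (smoothOn_linear (E := V.E) (F := V.Pt 0) U (V.realPt 0)) fun _ hx => realPt_mem_domain hx) fun _ _ => Set.mem_univ _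

theorem SuperSpace.IsSMap.of_smooth {M N : SuperSpace} {f : Fam M N} (h : IsSmoothOn M.V N.V Set.univ f)
    (hm : ∀ q, ∀ x ∈ M.pts q, f q x ∈ N.pts q) : IsSMap M N f where
  maps := hm
  natural q r g x _ := h.natural q r g x (Set.mem_univ _)
  smooth q x _ := ⟨Set.univ, f, Set.mem_univ _, openSet_univ, h, fun _ _ _ _ => rfl⟩

theorem SuperSpace.IsSMap.congr {M N : SuperSpace} {f g : Fam M N} (h : IsSMap M N f)
    (hM : ∀ q r (f : GrHom q r), ∀ x ∈ M.pts q, M.V.map f x ∈ M.pts r)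
    (hfg : ∀ q, ∀ x ∈ M.pts q, g q x = f q x) : IsSMap M N g where
  maps q x hx := by rw [hfg q x hx]; exact h.maps q x hx
  natural q r k x hx := by rw [hfg q x hx, hfg r _ (hM q r k x hx), h.natural q r k x hx]
  smooth q x hx := by
    obtain ⟨U, F, h1, h2, h3, h4⟩ := h.smooth q x hx
    exact ⟨U, F, h1, h2, h3, fun r y hy hyU => by rw [hfg r y hy, h4 r y hy hyU]⟩

theorem SuperSpace.IsSMap.comp {M N L : SuperSpace} {f : Fam M N} {g : Fam N L} (hg : IsSMap N L g)
    (hf : IsSMap M N f) : IsSMap M L fun q x => g q (f q x) where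
  maps q x hx := hg.maps q _ (hf.maps q x hx)
  natural q r k x hx := by rw [hf.natural q r k x hx, hg.natural q r k _ (hf.maps q x hx)]
  smooth q x hx := by
    obtain ⟨U, F, h1, h2, h3, h4⟩ := hf.smooth q x hx
    obtain ⟨U', G, h1', h2', h3', h4'⟩ := hg.smooth q _ (hf.maps q x hx)
    -- Whether a value of the first map lies in the second superdomain is decided by bodies, so the
    -- composite is represented over this open set for all Grassmann algebras at once.
    have hop : OpenSet (U ∩ bodyMap F ⁻¹' U') := h3.smoothOn_bodyMap.isOpen_inter_preimage h2 h2'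
    refine ⟨U ∩ bodyMap F ⁻¹' U', fun q x => G q (F q x), ⟨h1, ?_⟩, hop, ?_, ?_⟩
    · rw [Set.mem_preimage, ← h3.body_eq h1, ← h4 q x hx h1]; exact h1'
    · refine h3'.comp hop h2' (h3.mono Set.inter_subset_left) fun r y hy => ?_
      change _ ∈ U'
      rw [h3.body_eq hy.1]; exact hy.2
    · intro r y hy hyU
      have h5 := h4 r y hy hyU.1
      rw [h4' r _ (hf.maps r y hy), h5]
      change _ ∈ U'
      rw [h5, h3.body_eq hyU.1]; exact hyU.2

theorem SuperSpace.IsSMap.pair {M N L : SuperSpace} {f : Fam M N} {g : Fam M L} (hf : IsSMap M N f)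
    (hg : IsSMap M L g) : IsSMap M (N.prod L) fun q x => SVect.pair (f q x) (g q x) where
  maps q x hx := ⟨by rw [SVect.pfst_pair]; exact hf.maps q x hx,
    by rw [SVect.psnd_pair]; exact hg.maps q x hx⟩
  natural q r k x hx := by
    rw [hf.natural q r k x hx, hg.natural q r k x hx]
    exact (SVect.pair_map k _ _).symm
  smooth q x hx := by
    obtain ⟨U, F, h1, h2, h3, h4⟩ := hf.smooth q x hx
    obtain ⟨U', G, h1', h2', h3', h4'⟩ := hg.smooth q x hx
    have hop := h2.inter h2'
    exact ⟨U ∩ U', fun q x => SVect.pair (F q x) (G q x), ⟨h1, h1'⟩, hop,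
      (h3.mono Set.inter_subset_left).pair hop (h3'.mono Set.inter_subset_right),
      fun r y hy hyU => by rw [h4 r y hy hyU.1, h4' r y hy hyU.2]⟩

theorem SuperSpace.IsSMap.id {M : SuperSpace} : IsSMap M M fun _ x => x :=
  IsSMap.of_smooth (isSmoothOn_id _) fun _ _ hx => hx

theorem isSMap_pfst {M N : SuperSpace} : IsSMap (M.prod N) M fun _ z => SVect.pfst z :=
  IsSMap.of_smooth (isSmoothOn_pfst _) fun _ _ hx => hx.1

theorem isSMap_psnd {M N : SuperSpace} : IsSMap (M.prod N) N fun _ z => SVect.psnd z :=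
  IsSMap.of_smooth (isSmoothOn_psnd _) fun _ _ hx => hx.2

theorem SuperSpace.IsSMap.pfst {M N L : SuperSpace} {f : Fam L (M.prod N)} (hf : IsSMap L (M.prod N) f) :
    IsSMap L M fun q z => SVect.pfst (f q z) := isSMap_pfst.comp hf

theorem SuperSpace.IsSMap.psnd {M N L : SuperSpace} {f : Fam L (M.prod N)} (hf : IsSMap L (M.prod N) f) :
    IsSMap L N fun q z => SVect.psnd (f q z) := isSMap_psnd.comp hf

theorem isSMap_coord {M : SuperSpace} {p : ℕ} (i : Fin p) :
    IsSMap (M.pow p) M fun _ z => SVect.coord z i :=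
  IsSMap.of_smooth (isSmoothOn_coord _ i) fun _ _ hx => hx i

theorem isSMap_zero {M : SuperSpace} : IsSMap M (affine W) fun _ _ => 0 :=
  IsSMap.of_smooth (by simpa using isSmoothOn_realPt (V := M.V) (W := W) Set.univ 0)
    fun _ _ _ => Set.mem_univ _

theorem SuperSpace.IsSMap.add {M : SuperSpace} {f g : Fam M (affine W)} (hf : IsSMap M (affine W) f)
    (hg : IsSMap M (affine W) g) : IsSMap M (affine W) fun q x => f q x + g q x where
  maps _ _ _ := Set.mem_univ _
  natural q r k x hx := by
    rw [hf.natural q r k x hx, hg.natural q r k x hx, map_add]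
  smooth q x hx := by
    obtain ⟨U, F, h1, h2, h3, h4⟩ := hf.smooth q x hx
    obtain ⟨U', G, h1', h2', h3', h4'⟩ := hg.smooth q x hx
    exact ⟨U ∩ U', fun q x => F q x + G q x, ⟨h1, h1'⟩, h2.inter h2',
      (h3.mono Set.inter_subset_left).add (h3'.mono Set.inter_subset_right),
      fun r y hy hyU => by rw [h4 r y hy hyU.1, h4' r y hy hyU.2]⟩

theorem SuperSpace.IsSMap.neg {M : SuperSpace} {f : Fam M (affine W)} (hf : IsSMap M (affine W) f) :
    IsSMap M (affine W) fun q x => -f q x :=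
  IsSMap.comp (N := affine W) (L := affine W)
    (IsSMap.of_smooth ((isSmoothOn_id (V := W) Set.univ).neg openSet_univ) fun _ _ _ => Set.mem_univ _) hf

/-- Two-variable smooth maps, composed with smooth maps. -/
theorem SuperSpace.IsSMap.comp₂ {M N L K : SuperSpace} {m : ∀ q, N.V.Pt q → L.V.Pt q → K.V.Pt q}
    (hm : IsSMap (N.prod L) K (uncurry m)) {f : Fam M N} {g : Fam M L} (hf : IsSMap M N f)
    (hg : IsSMap M L g) : IsSMap M K fun q x => m q (f q x) (g q x) := by
  have h := hm.comp (hf.pair hg)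
  have e : (fun q x => uncurry m q (SVect.pair (f q x) (g q x))) =
      fun q x => m q (f q x) (g q x) := by
    funext q x
    simp only [uncurry, SVect.pfst_pair, SVect.psnd_pair]
  rw [e] at h
  exact h

end Calculus

/-! ### Supermanifolds -/

section Manifolds

variable {V W : SVect} {q r : ℕ}

theorem isSupermanifold_affine (W : SVect) : (affine W).IsSupermanifold where
  functorial _ _ _ _ _ := Set.mem_univ _
  chart := ⟨W, fun _ _ _ => ⟨Set.univ, Set.univ, fun _ x => x, fun _ x => x, Set.mem_univ _,
    openSet_univ, openSet_univ, isSmoothOn_id _, isSmoothOn_id _,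
    fun _ _ _ => ⟨Set.mem_univ _, Set.mem_univ _, rfl⟩, fun _ _ _ _ => ⟨Set.mem_univ _, rfl⟩⟩⟩

/-- The product of two sets of bodies. -/
def box (U : Set V.E) (U' : Set W.E) : Set (V.prod W).E :=
  {u | SVect.fstE V W u ∈ U ∧ SVect.sndE V W u ∈ U'}

theorem mem_domain_box {U : Set V.E} {U' : Set W.E} {z : (V.prod W).Pt q} :
    z ∈ domain (V.prod W) (box U U') q ↔
      SVect.pfst z ∈ domain V U q ∧ SVect.psnd z ∈ domain W U' q := by
  simp only [domain, Set.mem_setOf_eq, SVect.body_pfst, SVect.body_psnd]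
  rfl

theorem openSet_box {U : Set V.E} {U' : Set W.E} (hU : OpenSet U) (hU' : OpenSet U') :
    OpenSet (box U U') :=
  (hU.preimage_linear (SVect.fstE V W)).inter (hU'.preimage_linear (SVect.sndE V W))

theorem IsSmoothOn.prodMap {V' W' : SVect} {U : Set V.E} {U' : Set W.E} (hU : OpenSet U)
    (hU' : OpenSet U') {F : ∀ q, V.Pt q → V'.Pt q} {G : ∀ q, W.Pt q → W'.Pt q}
    (hF : IsSmoothOn V V' U F) (hG : IsSmoothOn W W' U' G) :
    IsSmoothOn (V.prod W) (V'.prod W') (box U U')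
      fun q z => SVect.pair (F q (SVect.pfst z)) (G q (SVect.psnd z)) :=
  IsSmoothOn.pair (openSet_box hU hU')
    (hF.comp (openSet_box hU hU') hU (isSmoothOn_pfst _) fun _ _ hz => (mem_domain_box.1 hz).1)
    (hG.comp (openSet_box hU hU') hU' (isSmoothOn_psnd _) fun _ _ hz => (mem_domain_box.1 hz).2)

theorem SuperSpace.IsSupermanifold.prod {M N : SuperSpace} (hM : M.IsSupermanifold)
    (hN : N.IsSupermanifold) : (M.prod N).IsSupermanifold where
  functorial q r f z hz := by
    refine ⟨?_, ?_⟩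
    · rw [show SVect.pfst ((M.prod N).V.map f z) = _ from SVect.pfst_map f z]
      exact hM.functorial q r f _ hz.1
    · rw [show SVect.psnd ((M.prod N).V.map f z) = _ from SVect.psnd_map f z]
      exact hN.functorial q r f _ hz.2
  chart := by
    obtain ⟨W, hW⟩ := hM.chart
    obtain ⟨X, hX⟩ := hN.chart
    refine ⟨W.prod X, fun q z hz => ?_⟩
    obtain ⟨U, U', φ, ρ, h1, h2, h3, h4, h5, h6, h7⟩ := hW q _ hz.1
    obtain ⟨T, T', φ', ρ', k1, k2, k3, k4, k5, k6, k7⟩ := hX q _ hz.2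
    refine ⟨box U T, box U' T', fun q w => SVect.pair (φ q (SVect.pfst w)) (φ' q (SVect.psnd w)),
      fun q w => SVect.pair (ρ q (SVect.pfst w)) (ρ' q (SVect.psnd w)), ?_, openSet_box h2 k2,
      openSet_box h3 k3, h4.prodMap h3 k3 k4, h5.prodMap h2 k2 k5, ?_, ?_⟩
    · exact mem_domain_box.2 ⟨h1, k1⟩
    · intro r w hw
      obtain ⟨hw1, hw2⟩ := mem_domain_box.1 hw
      obtain ⟨a1, a2, a3⟩ := h6 r _ hw1
      obtain ⟨b1, b2, b3⟩ := k6 r _ hw2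
      refine ⟨⟨?_, ?_⟩, mem_domain_box.2 ⟨?_, ?_⟩, ?_⟩
      · rw [SVect.pfst_pair]; exact a1
      · rw [SVect.psnd_pair]; exact b1
      · rw [SVect.pfst_pair]; exact a2
      · rw [SVect.psnd_pair]; exact b2
      · beta_reduce
        refine SVect.pair_ext ?_ ?_
        · rw [SVect.pfst_pair, SVect.pfst_pair, a3]
        · rw [SVect.psnd_pair, SVect.psnd_pair, b3]
    · intro r y hy hyU
      obtain ⟨hy1, hy2⟩ := mem_domain_box.1 hyU
      obtain ⟨a1, a2⟩ := h7 r _ hy.1 hy1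
      obtain ⟨b1, b2⟩ := k7 r _ hy.2 hy2
      refine ⟨mem_domain_box.2 ⟨?_, ?_⟩, ?_⟩
      · rw [SVect.pfst_pair]; exact a1
      · rw [SVect.psnd_pair]; exact b1
      · beta_reduce
        refine SVect.pair_ext (V := M.V) (W := N.V) ?_ ?_
        · rw [SVect.pfst_pair, SVect.pfst_pair, a2]
        · rw [SVect.psnd_pair, SVect.psnd_pair, b2]

/-- Supermanifolds may be transported along embeddings of the ambient space. -/
theorem SuperSpace.IsSupermanifold.of_embedding {M N : SuperSpace} (hN : N.IsSupermanifold)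
    {i : Fam N M} {j : Fam M N} (hi : IsSmoothOn N.V M.V Set.univ i)
    (hj : IsSmoothOn M.V N.V Set.univ j) (hiM : ∀ q, ∀ x ∈ N.pts q, i q x ∈ M.pts q)
    (hjN : ∀ q, ∀ y ∈ M.pts q, j q y ∈ N.pts q) (hij : ∀ q, ∀ y ∈ M.pts q, i q (j q y) = y)
    (hji : ∀ q x, j q (i q x) = x) : M.IsSupermanifold where
  functorial q r f y hy := by
    rw [← hij q y hy, ← hi.natural q r f _ (Set.mem_univ _)]
    exact hiM r _ (hN.functorial q r f _ (hjN q y hy))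
  chart := by
    obtain ⟨W, hW⟩ := hN.chart
    refine ⟨W, fun q y hy => ?_⟩
    obtain ⟨U, U', φ, ρ, h1, h2, h3, h4, h5, h6, h7⟩ := hW q _ (hjN q y hy)
    -- The new chart lives over the preimage of the old one under the map of bodies of the
    -- retraction `j`.
    have hdom : ∀ r (z : M.V.Pt r), z ∈ domain M.V (Set.univ ∩ bodyMap j ⁻¹' U) r ↔
        j r z ∈ domain N.V U r := fun r z => by
      simp only [domain, Set.mem_setOf_eq, Set.univ_inter, Set.mem_preimage]
      rw [hj.body_eq (Set.mem_univ _)]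
    have hop : OpenSet (Set.univ ∩ bodyMap j ⁻¹' U) :=
      hj.smoothOn_bodyMap.isOpen_inter_preimage openSet_univ h2
    refine ⟨Set.univ ∩ bodyMap j ⁻¹' U, U', fun q w => i q (φ q w), fun q z => ρ q (j q z),
      (hdom q y).2 h1, hop, h3, hi.comp_univ h3 h4,
      h5.comp hop h2 (hj.mono (Set.subset_univ _)) fun r z hz => (hdom r z).1 hz, ?_, ?_⟩
    · intro r w hw
      obtain ⟨a1, a2, a3⟩ := h6 r w hw
      exact ⟨hiM r _ a1, (hdom r _).2 (by rw [hji]; exact a2), by beta_reduce; rw [hji, a3]⟩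
    · intro r z hz hzU
      obtain ⟨a1, a2⟩ := h7 r _ (hjN r z hz) ((hdom r z).1 hzU)
      exact ⟨a1, by beta_reduce; rw [a2, hij r z hz]⟩

end Manifolds

instance (V : SVect) (q : ℕ) : AddCommGroup (V.Pt q) := inferInstance

/-! ### Semidirect products -/

section Semidirect

variable {G H : SGroup} {q : ℕ}

theorem IsSupergroup.mul_mem (hG : IsSupergroup G) {x y : G.space.V.Pt q} (hx : x ∈ G.space.pts q)
    (hy : y ∈ G.space.pts q) : G.mul q x y ∈ G.space.pts q := by
  have h := hG.smooth_mul.maps q (SVect.pair x y)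
    ⟨by rw [SVect.pfst_pair]; exact hx, by rw [SVect.psnd_pair]; exact hy⟩
  simpa only [uncurry, SVect.pfst_pair, SVect.psnd_pair] using h

theorem IsSupergroup.inv_mem (hG : IsSupergroup G) {x : G.space.V.Pt q} (hx : x ∈ G.space.pts q) :
    G.inv q x ∈ G.space.pts q := hG.smooth_inv.maps q x hx

theorem IsSupergroup.one_mem (hG : IsSupergroup G) (q : ℕ) : G.one q ∈ G.space.pts q :=
  hG.smooth_one.maps q 0 (Set.mem_univ _)

variable {act : ∀ q, G.space.V.Pt q → H.space.V.Pt q → H.space.V.Pt q}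

theorem IsActionByAut.act_mem (ha : IsActionByAut G H act) {g : G.space.V.Pt q}
    {h : H.space.V.Pt q} (hg : g ∈ G.space.pts q) (hh : h ∈ H.space.pts q) :
    act q g h ∈ H.space.pts q := by
  have h := ha.smooth.maps q (SVect.pair g h)
    ⟨by rw [SVect.pfst_pair]; exact hg, by rw [SVect.psnd_pair]; exact hh⟩
  simpa only [uncurry, SVect.pfst_pair, SVect.psnd_pair] using h

/-- An automorphism sends the identity to an idempotent, and the only idempotent of a group is its
identity. -/
theorem IsActionByAut.act_one (hH : IsSupergroup H) (ha : IsActionByAut G H act)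
    {g : G.space.V.Pt q} (hg : g ∈ G.space.pts q) : act q g (H.one q) = H.one q := by
  have h1 := hH.one_mem q
  have h2 := ha.act_mem hg h1
  have h3 := ha.act_mul q g hg _ h1 _ h1
  rw [hH.one_mul q _ h1] at h3
  have h4 := congrArg (H.mul q (H.inv q (act q g (H.one q)))) h3
  rw [← hH.mul_assoc q _ (hH.inv_mem h2) _ h2 _ h2, hH.inv_mul q _ h2, hH.one_mul q _ h2] at h4
  exact h4.symm

theorem IsSupergroup.semidirect (hG : IsSupergroup G) (hH : IsSupergroup H)
    (ha : IsActionByAut G H act) : IsSupergroup (semidirect G H act) where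
  manifold := hG.manifold.prod hH.manifold
  smooth_mul := by
    have p1 : IsSMap ((G.space.prod H.space).prod (G.space.prod H.space)) (G.space.prod H.space)
      fun _ z => SVect.pfst z := isSMap_pfst
    have p2 : IsSMap ((G.space.prod H.space).prod (G.space.prod H.space)) (G.space.prod H.space)
      fun _ z => SVect.psnd z := isSMap_psnd
    exact (hG.smooth_mul.comp₂ p1.pfst p2.pfst).pair
      (hH.smooth_mul.comp₂ p1.psnd (ha.smooth.comp₂ p1.pfst p2.psnd))
  smooth_inv := by
    have p1 : IsSMap (G.space.prod H.space) G.space fun _ z => SVect.pfst z := isSMap_pfst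
    have p2 : IsSMap (G.space.prod H.space) H.space fun _ z => SVect.psnd z := isSMap_psnd
    exact (hG.smooth_inv.comp p1).pair
      (ha.smooth.comp₂ (hG.smooth_inv.comp p1) (hH.smooth_inv.comp p2))
  smooth_one := hG.smooth_one.pair hH.smooth_one
  mul_assoc := by
    rintro q x ⟨hx1, hx2⟩ y ⟨hy1, hy2⟩ z ⟨hz1, hz2⟩
    refine SVect.pair_ext (V := G.space.V) (W := H.space.V) ?_ ?_
    · simp only [SuperString.semidirect, SVect.pfst_pair]
      exact hG.mul_assoc q _ hx1 _ hy1 _ hz1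
    · simp only [SuperString.semidirect, SVect.pfst_pair, SVect.psnd_pair]
      rw [ha.act_mul q _ hx1 _ hy2 _ (ha.act_mem hy1 hz2), ha.mul_act q _ hx1 _ hy1 _ hz2,
        hH.mul_assoc q _ hx2 _ (ha.act_mem hx1 hy2) _ (ha.act_mem hx1 (ha.act_mem hy1 hz2))]
  one_mul := by
    rintro q x ⟨hx1, hx2⟩
    refine SVect.pair_ext (V := G.space.V) (W := H.space.V) ?_ ?_
    · simp only [SuperString.semidirect, SVect.pfst_pair]
      exact hG.one_mul q _ hx1
    · simp only [SuperString.semidirect, SVect.pfst_pair, SVect.psnd_pair]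
      rw [ha.one_act q _ hx2, hH.one_mul q _ hx2]
  mul_one := by
    rintro q x ⟨hx1, hx2⟩
    refine SVect.pair_ext (V := G.space.V) (W := H.space.V) ?_ ?_
    · simp only [SuperString.semidirect, SVect.pfst_pair]
      exact hG.mul_one q _ hx1
    · simp only [SuperString.semidirect, SVect.psnd_pair]
      rw [IsActionByAut.act_one hH ha hx1, hH.mul_one q _ hx2]
  inv_mul := by
    rintro q x ⟨hx1, hx2⟩
    refine SVect.pair_ext (V := G.space.V) (W := H.space.V) ?_ ?_
    · simp only [SuperString.semidirect, SVect.pfst_pair]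
      exact hG.inv_mul q _ hx1
    · simp only [SuperString.semidirect, SVect.pfst_pair, SVect.psnd_pair]
      rw [← ha.act_mul q _ (hG.inv_mem hx1) _ (hH.inv_mem hx2) _ hx2, hH.inv_mul q _ hx2,
        IsActionByAut.act_one hH ha (hG.inv_mem hx1)]
  mul_inv := by
    rintro q x ⟨hx1, hx2⟩
    refine SVect.pair_ext (V := G.space.V) (W := H.space.V) ?_ ?_
    · simp only [SuperString.semidirect, SVect.pfst_pair]
      exact hG.mul_inv q _ hx1
    · simp only [SuperString.semidirect, SVect.pfst_pair, SVect.psnd_pair]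
      rw [← ha.mul_act q _ hx1 _ (hG.inv_mem hx1) _ (hH.inv_mem hx2), hG.mul_inv q _ hx1,
        ha.one_act q _ (hH.inv_mem hx2), hH.mul_inv q _ hx2]

end Semidirect

/-! ### Slim 2-supergroups -/

section Slim

/-- Used for the spaces of composable pairs and triples, which are subfunctors of products; over a
single object the condition for composing morphisms is vacuous. -/
theorem SuperSpace.IsSMap.restrict {M N : SuperSpace} {f : Fam M N} (h : IsSMap M N f)
    {S : ∀ q, Set (M.V.Pt q)} (hS : ∀ q, S q ⊆ M.pts q) : IsSMap ⟨M.V, S⟩ N f where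
  maps q x hx := h.maps q x (hS q hx)
  natural q r k x hx := h.natural q r k x (hS q hx)
  smooth q x hx := by
    obtain ⟨U, F, h1, h2, h3, h4⟩ := h.smooth q x (hS q hx)
    exact ⟨U, F, h1, h2, h3, fun r y hy hyU => h4 r y (hS r hy) hyU⟩

theorem SuperSpace.IsSupermanifold.congr_pts {M : SuperSpace} (h : M.IsSupermanifold)
    {S : ∀ q, Set (M.V.Pt q)} (hS : ∀ q, S q = M.pts q) : IsSupermanifold ⟨M.V, S⟩ := by
  have : (⟨M.V, S⟩ : SuperSpace) = M := by
    rw [show S = M.pts from funext hS]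
  rw [this]
  exact h

/-- The triple of components of a point of `V ⊕ (V ⊕ V)`, as a point of `V³`. -/
def SVect.triple (V : SVect) (q : ℕ) : (V.prod (V.prod V)).Pt q →ₗ[ℝ] (V.pow 3).Pt q :=
  SVect.lin (V := V.prod (V.prod V)) (W := V.pow 3)
    (LinearMap.pi (φ := fun _ => V.E) ![SVect.fstE V (V.prod V),
      (SVect.fstE V V).comp (SVect.sndE V (V.prod V)),
      (SVect.sndE V V).comp (SVect.sndE V (V.prod V))])
    (LinearMap.pi (φ := fun _ => V.O) ![SVect.fstO V (V.prod V),
      (SVect.fstO V V).comp (SVect.sndO V (V.prod V)),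
      (SVect.sndO V V).comp (SVect.sndO V (V.prod V))]) q

theorem SVect.coord_triple {V : SVect} {q : ℕ} (z : (V.prod (V.prod V)).Pt q) :
    SVect.coord (V.triple q z) =
      ![SVect.pfst z, SVect.pfst (SVect.psnd z), SVect.psnd (SVect.psnd z)] := by
  funext i
  have h := SVect.lin_lin (V := V.prod (V.prod V)) (W := V.pow 3) (X := V) (q := q)
    (LinearMap.pi (φ := fun _ => V.E) ![SVect.fstE V (V.prod V),
      (SVect.fstE V V).comp (SVect.sndE V (V.prod V)),
      (SVect.sndE V V).comp (SVect.sndE V (V.prod V))])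
    (LinearMap.pi (φ := fun _ => V.O) ![SVect.fstO V (V.prod V),
      (SVect.fstO V V).comp (SVect.sndO V (V.prod V)),
      (SVect.sndO V V).comp (SVect.sndO V (V.prod V))])
    (LinearMap.proj i : (Fin 3 → V.E) →ₗ[ℝ] V.E) (LinearMap.proj i : (Fin 3 → V.O) →ₗ[ℝ] V.O) z
  refine h.trans ?_
  fin_cases i
  · rfl
  · exact (SVect.lin_lin (SVect.sndE V (V.prod V)) (SVect.sndO V (V.prod V)) (SVect.fstE V V)
      (SVect.fstO V V) z).symm
  · exact (SVect.lin_lin (SVect.sndE V (V.prod V)) (SVect.sndO V (V.prod V)) (SVect.sndE V V)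
      (SVect.sndO V V) z).symm

theorem coboundary_three {G : SGroup} {W : SVect}
    (act : ∀ q, G.space.V.Pt q → W.Pt q → W.Pt q) (a : Cochain G W 3) (q : ℕ)
    (f g h k : G.space.V.Pt q) :
    coboundary G act a q ![f, g, h, k] = act q f (a q ![g, h, k]) - a q ![G.mul q f g, h, k] +
      a q ![f, G.mul q g h, k] - a q ![f, g, G.mul q h k] + a q ![f, g, h] := by
  have e0 : Fin.contractNth (0 : Fin 4) (G.mul q) ![f, g, h, k] = ![G.mul q f g, h, k] := by
    funext i; fin_cases i <;> rfl
  have e1 : Fin.contractNth (1 : Fin 4) (G.mul q) ![f, g, h, k] = ![f, G.mul q g h, k] := by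
    funext i; fin_cases i <;> rfl
  have e2 : Fin.contractNth (2 : Fin 4) (G.mul q) ![f, g, h, k] = ![f, g, G.mul q h k] := by
    funext i; fin_cases i <;> rfl
  have e3 : Fin.contractNth (3 : Fin 4) (G.mul q) ![f, g, h, k] = ![f, g, h] := by
    funext i; fin_cases i <;> rfl
  have e4 : (fun i : Fin 3 => ![f, g, h, k] i.succ) = ![g, h, k] := by
    funext i; fin_cases i <;> rfl
  unfold coboundary
  rw [Fin.sum_univ_four, e0, e1, e2, e3, e4]
  have s0 : (-1 : ℝ) ^ (((0 : Fin 4) : ℕ) + 1) = -1 := by norm_num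
  have s1 : (-1 : ℝ) ^ (((1 : Fin 4) : ℕ) + 1) = 1 := by norm_num
  have s2 : (-1 : ℝ) ^ (((2 : Fin 4) : ℕ) + 1) = -1 := by norm_num
  have s3 : (-1 : ℝ) ^ (((3 : Fin 4) : ℕ) + 1) = 1 := by norm_num
  rw [s0, s1, s2, s3]
  have e : ∀ x : W.Pt q, (-1 : ℝ) • x = -x := fun x => neg_one_smul ℝ x
  have e' : ∀ x : W.Pt q, (1 : ℝ) • x = x := fun x => one_smul ℝ x
  simp only [e, e', Matrix.cons_val_zero]
  abel

variable {G : SGroup} {W : SVect} {a : Cochain G W 3} {q : ℕ}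

/-- The closedness equation with its negative terms moved across. The left side belongs to the
two-step path of the pentagon and the right side to the three-step path. -/
theorem IsNormalizedCocycle.cocycle (ha : IsNormalizedCocycle G (trivAct G W) a)
    {f g h k : G.space.V.Pt q} (hf : f ∈ G.space.pts q) (hg : g ∈ G.space.pts q)
    (hh : h ∈ G.space.pts q) (hk : k ∈ G.space.pts q) :
    a q ![G.mul q f g, h, k] + a q ![f, g, G.mul q h k] =
      a q ![f, g, h] + a q ![f, G.mul q g h, k] + a q ![g, h, k] := by
  have h1 := ha.closed q ![f, g, h, k] (by intro i; fin_cases i <;> assumption)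
  rw [coboundary_three] at h1
  simp only [trivAct] at h1
  rw [← sub_eq_zero, ← neg_eq_zero, ← h1]
  abel

theorem IsNormalizedCocycle.isSMap_assoc (ha : IsNormalizedCocycle G (trivAct G W) a) :
    IsSMap (G.space.prod (G.space.prod G.space)) (affine W) fun q z =>
      a q ![SVect.pfst z, SVect.pfst (SVect.psnd z), SVect.psnd (SVect.psnd z)] := by
  have h1 : IsSMap (G.space.prod (G.space.prod G.space)) (G.space.pow 3)
      fun q z => G.space.V.triple q z := by
    refine IsSMap.of_smooth (isSmoothOn_lin (V := G.space.V.prod (G.space.V.prod G.space.V))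
      (W := G.space.V.pow 3) _ _ _) fun q z hz i => ?_
    have h2 := congrFun (SVect.coord_triple (V := G.space.V) z) i
    have h3 : SVect.coord (G.space.V.triple q z) i ∈ G.space.pts q := by
      rw [h2]
      fin_cases i
      exacts [hz.1, hz.2.1, hz.2.2]
    exact h3
  have h2 := ha.smooth.comp h1
  have e : (fun q z => a q (SVect.coord (G.space.V.triple q z))) = fun q z =>
      a q ![SVect.pfst z, SVect.pfst (SVect.psnd z), SVect.psnd (SVect.psnd z)] := by
    funext q z
    rw [SVect.coord_triple]
  exact e ▸ h2

/-- Vertically composable 2-morphisms lie over the same morphism, so a pair amounts to one morphism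
and two elements of `W`. The supermanifold `M × W × W` is embedded by duplicating the morphism. -/
theorem SuperSpace.IsSupermanifold.vpairs {M : SuperSpace} (hM : M.IsSupermanifold) (W : SVect) :
    IsSupermanifold ⟨(M.V.prod W).prod (M.V.prod W), fun q => {z |
      SVect.pfst (SVect.pfst z) ∈ M.pts q ∧
        SVect.pfst (SVect.pfst z) = SVect.pfst (SVect.psnd z)}⟩ := by
  have h : IsSupermanifold ⟨(M.V.prod W).prod W, fun q => {z |
      SVect.pfst (SVect.pfst z) ∈ M.pts q}⟩ :=
    ((hM.prod (isSupermanifold_affine W)).prod (isSupermanifold_affine W)).congr_pts fun q =>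
      Set.ext fun z => ⟨fun h => ⟨⟨h, Set.mem_univ _⟩, Set.mem_univ _⟩, fun h => h.1.1⟩
  refine h.of_embedding
    (i := fun q (z : ((M.V.prod W).prod W).Pt q) =>
      SVect.pair (SVect.pfst z) (SVect.pair (SVect.pfst (SVect.pfst z)) (SVect.psnd z)))
    (j := fun q (z : ((M.V.prod W).prod (M.V.prod W)).Pt q) =>
      SVect.pair (SVect.pfst z) (SVect.psnd (SVect.psnd z))) ?_ ?_ ?_ ?_ ?_ ?_
  · exact (isSmoothOn_pfst _).pair openSet_univ
      (((isSmoothOn_pfst _).pfst openSet_univ).pair openSet_univ (isSmoothOn_psnd _))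
  · exact (isSmoothOn_pfst _).pair openSet_univ ((isSmoothOn_psnd _).psnd openSet_univ)
  · intro q (x : ((M.V.prod W).prod W).Pt q) h1
    refine ⟨?_, ?_⟩
    · rw [SVect.pfst_pair]; exact h1
    · rw [SVect.psnd_pair, SVect.pfst_pair, SVect.pfst_pair]
  · intro q (y : ((M.V.prod W).prod (M.V.prod W)).Pt q) h1
    change SVect.pfst (SVect.pfst (SVect.pair (SVect.pfst y) _)) ∈ M.pts q
    rw [SVect.pfst_pair]; exact h1.1
  · intro q (y : ((M.V.prod W).prod (M.V.prod W)).Pt q) h1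
    refine SVect.pair_ext ?_ ?_
    · rw [SVect.pfst_pair, SVect.pfst_pair]
    · rw [SVect.psnd_pair, SVect.psnd_pair, SVect.pfst_pair]
      refine SVect.pair_ext ?_ ?_
      · rw [SVect.pfst_pair]; exact h1.2
      · rw [SVect.psnd_pair]
  · intro q (x : ((M.V.prod W).prod W).Pt q)
    refine SVect.pair_ext ?_ ?_
    · rw [SVect.pfst_pair, SVect.pfst_pair]
    · rw [SVect.psnd_pair, SVect.psnd_pair, SVect.psnd_pair]

/-- Vertical composition in a slim 2-supergroup. -/
def vertComp {V W : SVect} {q : ℕ} (α β : (V.prod W).Pt q) : (V.prod W).Pt q :=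
  SVect.pair (SVect.pfst α) (SVect.psnd α + SVect.psnd β)

/-- Horizontal composition in a slim 2-supergroup. -/
def horComp (G : SGroup) {W : SVect} {q : ℕ} (α β : (G.space.V.prod W).Pt q) :
    (G.space.V.prod W).Pt q :=
  SVect.pair (G.mul q (SVect.pfst α) (SVect.pfst β)) (SVect.psnd α + SVect.psnd β)

theorem vertComp_pair {V W : SVect} {q : ℕ} (x x' : V.Pt q) (y y' : W.Pt q) :
    vertComp (SVect.pair x y) (SVect.pair x' y') = SVect.pair x (y + y') := by
  simp only [vertComp, SVect.pfst_pair, SVect.psnd_pair]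

theorem horComp_pair {G : SGroup} {W : SVect} {q : ℕ} (x x' : G.space.V.Pt q) (y y' : W.Pt q) :
    horComp G (SVect.pair x y) (SVect.pair x' y') = SVect.pair (G.mul q x x') (y + y') := by
  simp only [horComp, SVect.pfst_pair, SVect.psnd_pair]

section Comp

variable {V : SVect} (α β γ δ : (V.prod W).Pt q) (f g h k : V.Pt q) (r r' : W.Pt q)

theorem vertComp_assoc : vertComp (vertComp α β) γ = vertComp α (vertComp β γ) := by
  simp only [vertComp, SVect.pfst_pair, SVect.psnd_pair, add_assoc]

theorem pair_zero_vertComp (h : f = SVect.pfst α) :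
    vertComp (SVect.pair f (0 : W.Pt q)) α = α := by
  simp only [vertComp, SVect.pfst_pair, SVect.psnd_pair, zero_add, h, SVect.pair_pfst_psnd]

theorem vertComp_pair_zero : vertComp α (SVect.pair f (0 : W.Pt q)) = α := by
  simp only [vertComp, SVect.psnd_pair, add_zero, SVect.pair_pfst_psnd]

theorem vertComp_pair_pair (h : r + r' = 0) :
    vertComp (SVect.pair f r) (SVect.pair g r') = SVect.pair f 0 := by
  rw [vertComp_pair, h]

theorem pair_neg_vertComp :
    vertComp (SVect.pair (SVect.pfst α) (-SVect.psnd α)) α = SVect.pair (SVect.pfst α) 0 := by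
  simp only [vertComp, SVect.pfst_pair, SVect.psnd_pair]
  exact congrArg (SVect.pair _) (neg_add_cancel (G := W.Pt q) _)

theorem vertComp_pair_neg :
    vertComp α (SVect.pair (SVect.pfst α) (-SVect.psnd α)) = SVect.pair (SVect.pfst α) 0 := by
  simp only [vertComp, SVect.psnd_pair]
  exact congrArg (SVect.pair _) (add_neg_cancel (G := W.Pt q) _)

end Comp

section HorComp

variable (α β γ δ : (G.space.V.prod W).Pt q) (f g h k : G.space.V.Pt q) (r r' : W.Pt q)

theorem horComp_pair_zero :
    horComp G (SVect.pair f 0) (SVect.pair g 0) = SVect.pair (G.mul q f g) (0 : W.Pt q) := by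
  rw [horComp_pair, add_zero]

/-- Because the action on `W` is trivial, both composites add up the same four elements of `W`, and
interchange is commutativity of addition. -/
theorem horComp_vertComp : horComp G (vertComp α β) (vertComp γ δ) =
    vertComp (horComp G α γ) (horComp G β δ) := by
  simp only [vertComp, horComp, SVect.pfst_pair, SVect.psnd_pair]
  congr 1
  exact add_add_add_comm _ _ _ _

theorem horComp_assoc_natural :
    vertComp (horComp G (horComp G α β) γ) (SVect.pair f r) = vertComp (SVect.pair
        (G.mul q (G.mul q (SVect.pfst α) (SVect.pfst β)) (SVect.pfst γ)) r)
      (horComp G α (horComp G β γ)) := by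
  simp only [vertComp, horComp, SVect.pfst_pair, SVect.psnd_pair]
  congr 1
  abel

theorem horComp_one_natural (h : G.mul q f (SVect.pfst α) = SVect.pfst α) :
    vertComp (horComp G (SVect.pair f 0) α) (SVect.pair g 0) =
      vertComp (SVect.pair (SVect.pfst α) 0) α := by
  simp only [vertComp, horComp, SVect.pfst_pair, SVect.psnd_pair, zero_add, add_zero, h]

theorem one_horComp_natural (h : G.mul q (SVect.pfst α) f = SVect.pfst α) :
    vertComp (horComp G α (SVect.pair f 0)) (SVect.pair g 0) =
      vertComp (SVect.pair (SVect.pfst α) 0) α := by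
  simp only [vertComp, horComp, SVect.pfst_pair, SVect.psnd_pair, zero_add, add_zero, h]

theorem horComp_pentagon {r₁ r₂ r₃ r₄ r₅ : W.Pt q} (hr : r₁ + r₂ = r₃ + r₄ + r₅)
    (f₁ f₂ f₃ f₄ f₅ : G.space.V.Pt q) (hf : f₁ = G.mul q f₂ k) :
    vertComp (SVect.pair f₁ r₁) (SVect.pair f₃ r₂) =
      vertComp (vertComp (horComp G (SVect.pair f₂ r₃) (SVect.pair k 0)) (SVect.pair f₄ r₄))
        (horComp G (SVect.pair f 0) (SVect.pair f₅ r₅)) := by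
  rw [horComp_pair, horComp_pair, vertComp_pair, vertComp_pair, vertComp_pair, zero_add,
    add_zero, hr, hf]

theorem horComp_triangle (hr : r = 0) (h : k = G.mul q f g) :
    vertComp (SVect.pair k r) (horComp G (SVect.pair f 0) (SVect.pair g 0)) =
      horComp G (SVect.pair f 0) (SVect.pair g 0) := by
  rw [horComp_pair, vertComp_pair, hr, h, zero_add]

end HorComp

theorem IsNormalizedCocycle.pentagon (ha : IsNormalizedCocycle G (trivAct G W) a)
    {f g h k : G.space.V.Pt q} (hf : f ∈ G.space.pts q) (hg : g ∈ G.space.pts q)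
    (hh : h ∈ G.space.pts q) (hk : k ∈ G.space.pts q) :
    vertComp (SVect.pair (G.mul q (G.mul q (G.mul q f g) h) k) (a q ![G.mul q f g, h, k]))
        (SVect.pair (G.mul q (G.mul q f g) (G.mul q h k)) (a q ![f, g, G.mul q h k])) =
      vertComp (vertComp (horComp G (SVect.pair (G.mul q (G.mul q f g) h) (a q ![f, g, h]))
        (SVect.pair k 0)) (SVect.pair (G.mul q (G.mul q f (G.mul q g h)) k)
          (a q ![f, G.mul q g h, k])))
        (horComp G (SVect.pair f 0) (SVect.pair (G.mul q (G.mul q g h) k) (a q ![g, h, k]))) :=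
  horComp_pentagon f k (ha.cocycle hf hg hh hk) _ _ _ _ _ rfl

end Slim

/-! ### The axioms of the 2-supergroup defined by a normalized 3-cocycle. -/

section Slim

variable {G : SGroup} {W : SVect} {a : Cochain G W 3} {q : ℕ}

instance (q : ℕ) : Subsingleton (SVect.zero.Pt q) :=
  have h1 : Subsingleton (Ev q ⊗[ℝ] PUnit) := inferInstance
  have h2 : Subsingleton (Od q ⊗[ℝ] PUnit) := inferInstance
  @instSubsingletonProd _ _ h1 h2

-- Every 2-morphism is an automorphism labelled by an element of `W`, and both compositions add
-- labels, so most axioms are group laws of `G` or of `W`. The cocycle itself matters in three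
-- places: its smoothness for the associator, its closedness for the pentagon, its normalization for
-- the triangle.
set_option maxHeartbeats 1000000 in
theorem IsSupergroup.isSuperBicategory (hG : IsSupergroup G)
    (ha : IsNormalizedCocycle G (trivAct G W) a) :
    (stringBicat G W (trivAct G W) a).IsSuperBicategory := by
  constructor
  case manifold0 =>
    exact isSupermanifold_affine _
  case manifold1 =>
    exact hG.manifold
  case manifold2 =>
    exact hG.manifold.prod (isSupermanifold_affine W)
  case manifold_comp2 =>
    exact (hG.manifold.prod hG.manifold).congr_pts fun q =>
    Set.ext fun z => ⟨fun h => ⟨h.1, h.2.1⟩, fun h => ⟨h.1, h.2, rfl⟩⟩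
  case manifold_comp3 =>
    exact (hG.manifold.prod (hG.manifold.prod hG.manifold)).congr_pts fun q =>
    Set.ext fun z => ⟨fun h => ⟨h.1, h.2.1.1, h.2.1.2.1⟩, fun h => ⟨h.1, ⟨h.2.1, h.2.2, rfl⟩, rfl⟩⟩
  case manifold_vpairs =>
    exact (hG.manifold.vpairs W).congr_pts fun q =>
    Set.ext fun z => ⟨fun h => ⟨h.1.1, h.2.2⟩, fun h => ⟨⟨h.1, Set.mem_univ _⟩,
      ⟨Set.mem_of_eq_of_mem (s := G.space.pts q) h.2.symm h.1, Set.mem_univ _⟩, h.2⟩⟩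
  case manifold_hpairs =>
    exact ((hG.manifold.prod (isSupermanifold_affine W)).prod
      (hG.manifold.prod (isSupermanifold_affine W))).congr_pts fun q =>
    Set.ext fun z => ⟨fun h => ⟨h.1, h.2.1⟩, fun h => ⟨h.1, h.2, rfl⟩⟩
  case smooth_src =>
    exact isSMap_zero
  case smooth_tgt =>
    exact isSMap_zero
  case smooth_idt =>
    exact hG.smooth_one
  case smooth_src2 =>
    exact isSMap_pfst
  case smooth_tgt2 =>
    exact isSMap_pfst
  case smooth_idt2 =>
    exact IsSMap.id.pair isSMap_zero
  case smooth_vcomp =>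
    have p1 : IsSMap ((G.space.prod (affine W)).prod (G.space.prod (affine W)))
      (G.space.prod (affine W)) fun _ z => SVect.pfst z := isSMap_pfst
    have p2 : IsSMap ((G.space.prod (affine W)).prod (G.space.prod (affine W)))
      (G.space.prod (affine W)) fun _ z => SVect.psnd z := isSMap_psnd
    exact (p1.pfst.pair (p1.psnd.add p2.psnd)).restrict fun q z hz => ⟨hz.1, hz.2.1⟩
  case smooth_hcomp =>
    exact hG.smooth_mul.restrict fun q z hz => ⟨hz.1, hz.2.1⟩
  case smooth_hcomp2 =>
    have p1 : IsSMap ((G.space.prod (affine W)).prod (G.space.prod (affine W)))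
      (G.space.prod (affine W)) fun _ z => SVect.pfst z := isSMap_pfst
    have p2 : IsSMap ((G.space.prod (affine W)).prod (G.space.prod (affine W)))
      (G.space.prod (affine W)) fun _ z => SVect.psnd z := isSMap_psnd
    exact ((hG.smooth_mul.comp₂ p1.pfst p2.pfst).pair (p1.psnd.add p2.psnd)).restrict
      fun q z hz => ⟨hz.1, hz.2.1⟩
  case smooth_assoc =>
    have p1 : IsSMap (G.space.prod (G.space.prod G.space)) G.space fun _ z => SVect.pfst z :=
      isSMap_pfst
    have p2 : IsSMap (G.space.prod (G.space.prod G.space)) (G.space.prod G.space)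
      fun _ z => SVect.psnd z := isSMap_psnd
    exact ((hG.smooth_mul.comp₂ (hG.smooth_mul.comp₂ p1 p2.pfst) p2.psnd).pair
      ha.isSMap_assoc).restrict fun q z hz => ⟨hz.1, hz.2.1.1, hz.2.1.2.1⟩
  case smooth_lunit =>
    exact IsSMap.id.pair isSMap_zero
  case smooth_runit =>
    exact IsSMap.id.pair isSMap_zero
  case src2_idt2 =>
    intro q f hf
    exact SVect.pfst_pair _ _
  case tgt2_idt2 =>
    intro q f hf
    exact SVect.pfst_pair _ _
  case src2_vcomp =>
    intro q α β h
    exact SVect.pfst_pair _ _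
  case tgt2_vcomp =>
    intro q α β h
    exact (SVect.pfst_pair _ _).trans h.2.2
  case vcomp_assoc =>
    intro q α β γ h h'
    exact vertComp_assoc (V := G.space.V) (W := W) α β γ
  case idt2_vcomp =>
    intro q α hα
    exact pair_zero_vertComp (V := G.space.V) (W := W) α _ rfl
  case vcomp_idt2 =>
    intro q α hα
    exact vertComp_pair_zero (V := G.space.V) (W := W) α _
  case src_idt =>
    intro q x hx
    exact Subsingleton.elim (α := SVect.zero.Pt q) _ _
  case tgt_idt =>
    intro q x hx
    exact Subsingleton.elim (α := SVect.zero.Pt q) _ _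
  case src_hcomp =>
    intro q f g h
    exact rfl
  case tgt_hcomp =>
    intro q f g h
    exact rfl
  case src_src2 =>
    intro q α hα
    exact rfl
  case tgt_src2 =>
    intro q α hα
    exact rfl
  case src2_hcomp2 =>
    intro q α β h
    exact SVect.pfst_pair _ _
  case tgt2_hcomp2 =>
    intro q α β h
    exact SVect.pfst_pair _ _
  case hcomp2_idt2 =>
    intro q f g h
    exact horComp_pair_zero (G := G) (W := W) f g
  case interchange =>
    intro q α α' β β' h h' h''
    exact horComp_vertComp (G := G) (W := W) α α' β β'
  case assoc_hom =>
    intro q f g h hfg hgh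
    refine ⟨⟨?_, Set.mem_univ _⟩, SVect.pfst_pair _ _,
      (SVect.pfst_pair _ _).trans (hG.mul_assoc q _ hfg.1 _ hfg.2.1 _ hgh.2.1)⟩
    exact Set.mem_of_eq_of_mem (SVect.pfst_pair (W := W) _ _)
      (hG.mul_mem (hG.mul_mem hfg.1 hfg.2.1) hgh.2.1)
  case assoc_natural =>
    intro q α β γ h h'
    exact horComp_assoc_natural (G := G) (W := W) α β γ _ _
  case assoc_iso =>
    have p1 : IsSMap (G.space.prod (G.space.prod G.space)) G.space fun _ z => SVect.pfst z :=
      isSMap_pfst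
    have p2 : IsSMap (G.space.prod (G.space.prod G.space)) (G.space.prod G.space)
      fun _ z => SVect.psnd z := isSMap_psnd
    -- The inverse associator has the opposite label over the same morphism; the two bracketings are
    -- equal by associativity in `G`.
    refine ⟨fun q f g h => SVect.pair (G.mul q (G.mul q f g) h) (-a q ![f, g, h]),
      ((hG.smooth_mul.comp₂ (hG.smooth_mul.comp₂ p1 p2.pfst) p2.psnd).pair
      ha.isSMap_assoc.neg).restrict fun q z hz => ⟨hz.1, hz.2.1.1, hz.2.1.2.1⟩,
      fun q f g h hfg hgh => ⟨⟨⟨?_, Set.mem_univ _⟩, ?_, SVect.pfst_pair _ _⟩, ?_, ?_⟩⟩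
    · exact Set.mem_of_eq_of_mem (SVect.pfst_pair (W := W) _ _)
        (hG.mul_mem (hG.mul_mem hfg.1 hfg.2.1) hgh.2.1)
    · exact (SVect.pfst_pair _ _).trans (hG.mul_assoc q _ hfg.1 _ hfg.2.1 _ hgh.2.1)
    · exact vertComp_pair_pair (V := G.space.V) (W := W) _ _ _ _
        (add_neg_cancel (G := W.Pt q) _)
    · refine (vertComp_pair_pair (V := G.space.V) (W := W) _ _ _ _
        (neg_add_cancel (G := W.Pt q) _)).trans ?_
      exact congrArg (fun x => SVect.pair x (0 : W.Pt q))
        (hG.mul_assoc q _ hfg.1 _ hfg.2.1 _ hgh.2.1)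
  case lunit_hom =>
    intro q f hf
    exact ⟨⟨Set.mem_of_eq_of_mem (SVect.pfst_pair (W := W) _ _) hf,
    Set.mem_univ _⟩, (SVect.pfst_pair _ _).trans (hG.one_mul q f hf).symm, SVect.pfst_pair _ _⟩
  case lunit_natural =>
    intro q α hα
    exact horComp_one_natural (G := G) (W := W) α _ _ (hG.one_mul q _ hα.1)
  case lunit_iso =>
    exact ⟨fun q f => SVect.pair f 0, IsSMap.id.pair isSMap_zero, fun q f hf => by
    refine ⟨⟨⟨Set.mem_of_eq_of_mem (SVect.pfst_pair (W := W) _ _) hf, Set.mem_univ _⟩,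
      SVect.pfst_pair _ _, (SVect.pfst_pair _ _).trans (hG.one_mul q f hf).symm⟩, ?_, ?_⟩
    · refine (vertComp_pair_pair (V := G.space.V) (W := W) _ _ _ _ (add_zero _)).trans ?_
      exact congrArg (fun x => SVect.pair x (0 : W.Pt q)) (hG.one_mul q f hf).symm
    · exact vertComp_pair_pair (V := G.space.V) (W := W) _ _ _ _ (add_zero _)⟩
  case runit_hom =>
    intro q f hf
    exact ⟨⟨Set.mem_of_eq_of_mem (SVect.pfst_pair (W := W) _ _) hf,
    Set.mem_univ _⟩, (SVect.pfst_pair _ _).trans (hG.mul_one q f hf).symm, SVect.pfst_pair _ _⟩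
  case runit_natural =>
    intro q α hα
    exact one_horComp_natural (G := G) (W := W) α _ _ (hG.mul_one q _ hα.1)
  case runit_iso =>
    exact ⟨fun q f => SVect.pair f 0, IsSMap.id.pair isSMap_zero, fun q f hf => by
    refine ⟨⟨⟨Set.mem_of_eq_of_mem (SVect.pfst_pair (W := W) _ _) hf, Set.mem_univ _⟩,
      SVect.pfst_pair _ _, (SVect.pfst_pair _ _).trans (hG.mul_one q f hf).symm⟩, ?_, ?_⟩
    · refine (vertComp_pair_pair (V := G.space.V) (W := W) _ _ _ _ (add_zero _)).trans ?_
      exact congrArg (fun x => SVect.pair x (0 : W.Pt q)) (hG.mul_one q f hf).symm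
    · exact vertComp_pair_pair (V := G.space.V) (W := W) _ _ _ _ (add_zero _)⟩
  case pentagon =>
    intro q f g h k hfg hgh hhk
    dsimp only [stringBicat, trivAct]
    exact ha.pentagon hfg.1 hfg.2.1 hgh.2.1 hhk.2.1
  case triangle =>
    intro q f g hfg
    refine horComp_triangle (G := G) (W := W) f g _ _ ?_ ?_
    -- With trivial unitors the triangle says exactly that the cocycle vanishes when its middle
    -- argument is the identity.
    · exact ha.normalized q ![f, G.one q, g] (by
        intro i; fin_cases i
        exacts [hfg.1, hG.one_mem q, hfg.2.1]) ⟨1, rfl⟩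
    · exact congrArg (fun x => G.mul q x g) (hG.mul_one q f hfg.1)

/-- Inverses in `G` are already strict, so identity 2-morphisms witness the weak inverses; the
strict inverse of a 2-morphism negates its label. -/
theorem IsSupergroup.is2Supergroup (hG : IsSupergroup G)
    (ha : IsNormalizedCocycle G (trivAct G W) a) :
    (stringBicat G W (trivAct G W) a).Is2Supergroup where
  bicategory := hG.isSuperBicategory ha
  one_object := rfl
  weak_inverses := by
    have h1 : IsSMap G.space (G.space.prod (affine W))
        fun q _ => SVect.pair (G.one q) 0 := by
      have h2 : IsSMap G.space point fun _ _ => 0 := isSMap_zero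
      exact (hG.smooth_one.comp h2).pair isSMap_zero
    have h3 : ∀ q, SVect.pair (G.one q) (0 : W.Pt q) ∈ (G.space.prod (affine W)).pts q :=
      fun q => ⟨by rw [SVect.pfst_pair]; exact hG.one_mem q, Set.mem_univ _⟩
    refine ⟨G.inv, fun q _ => SVect.pair (G.one q) 0, fun q _ => SVect.pair (G.one q) 0,
      hG.smooth_inv, h1, h1, fun q f hf => ⟨rfl, rfl, ⟨h3 q, ?_, SVect.pfst_pair _ _⟩,
        ⟨h3 q, ?_, SVect.pfst_pair _ _⟩⟩⟩
    · exact (SVect.pfst_pair _ _).trans (hG.inv_mul q f hf).symm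
    · exact (SVect.pfst_pair _ _).trans (hG.mul_inv q f hf).symm
  strict_inverses := by
    have p1 : IsSMap (G.space.prod (affine W)) G.space fun _ z => SVect.pfst z := isSMap_pfst
    have p2 : IsSMap (G.space.prod (affine W)) (affine W) fun _ z => SVect.psnd z := isSMap_psnd
    refine ⟨fun q α => SVect.pair (SVect.pfst α) (-SVect.psnd α), p1.pair p2.neg,
      fun q α hα => ⟨⟨⟨?_, Set.mem_univ _⟩, SVect.pfst_pair _ _, SVect.pfst_pair _ _⟩, ?_, ?_⟩⟩
    · exact Set.mem_of_eq_of_mem (SVect.pfst_pair (W := W) _ _) hα.1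
    · exact pair_neg_vertComp (V := G.space.V) (W := W) α
    · exact vertComp_pair_neg (V := G.space.V) (W := W) α

end Slim

/-! ### Existence of normed division algebras and smoothing factors -/

section Existence

open scoped Quaternion

instance : NormedDivAlg ℝ where
  mul := LinearMap.mul ℝ ℝ
  one := 1
  one_mul := _root_.one_mul
  mul_one := _root_.mul_one
  norm_mul := norm_mul

instance : NormedDivAlg ℂ where
  mul := LinearMap.mul ℝ ℂ
  one := 1
  one_mul := _root_.one_mul
  mul_one := _root_.mul_one
  norm_mul := norm_mul

instance : NormedDivAlg ℍ[ℝ] where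
  mul := LinearMap.mul ℝ ℍ[ℝ]
  one := 1
  one_mul := _root_.one_mul
  mul_one := _root_.mul_one
  norm_mul := norm_mul

/-- The octonions, as pairs of quaternions. -/
abbrev Octonion : Type := WithLp 2 (ℍ[ℝ] × ℍ[ℝ])

/-- The Cayley–Dickson product `(a, b)(c, d) = (a c - d* b, d a + b c*)`. -/
def Octonion.mul : Octonion →ₗ[ℝ] Octonion →ₗ[ℝ] Octonion :=
  LinearMap.mk₂ ℝ (fun x y => WithLp.toLp 2
      (x.fst * y.fst - star y.snd * x.snd, y.snd * x.fst + x.snd * star y.fst))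
    (by intro x x' y; refine WithLp.ofLp_injective 2 (Prod.ext ?_ ?_) <;> simp <;> noncomm_ring)
    (by intro c x y; refine WithLp.ofLp_injective 2 (Prod.ext ?_ ?_) <;> simp [smul_sub])
    (by intro x y y'; refine WithLp.ofLp_injective 2 (Prod.ext ?_ ?_) <;> simp <;> noncomm_ring)
    (by intro c x y; refine WithLp.ofLp_injective 2 (Prod.ext ?_ ?_) <;> simp [smul_sub])

/-- In the squared norm of (ac - d*b, da + bc*) the squares add up to (|a|²+|b|²)(|c|²+|d|²). The
cross terms cancel because the real parts of acb*d and dacb* agree by cyclicity. -/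
theorem Octonion.norm_mul (x y : Octonion) : ‖Octonion.mul x y‖ = ‖x‖ * ‖y‖ := by
  have h : ‖Octonion.mul x y‖ ^ 2 = (‖x‖ * ‖y‖) ^ 2 := by
    rw [mul_pow, WithLp.prod_norm_sq_eq_of_L2, WithLp.prod_norm_sq_eq_of_L2,
      WithLp.prod_norm_sq_eq_of_L2]
    change ‖x.fst * y.fst - star y.snd * x.snd‖ ^ 2 + ‖y.snd * x.fst + x.snd * star y.fst‖ ^ 2 = _
    have h : inner ℝ (x.fst * y.fst) (star y.snd * x.snd) =
        inner ℝ (y.snd * x.fst) (x.snd * star y.fst) := by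
      rw [Quaternion.inner_def, Quaternion.inner_def]
      simp
      ring
    rw [norm_sub_sq_real, norm_add_sq_real, h]
    simp only [_root_.norm_mul, Quaternion.norm_star]
    ring
  exact (pow_left_inj₀ (norm_nonneg _) (by positivity) two_ne_zero).1 h

instance : NormedDivAlg Octonion where
  mul := Octonion.mul
  one := WithLp.toLp 2 (1, 0)
  one_mul x := by refine WithLp.ofLp_injective 2 (Prod.ext ?_ ?_) <;> simp [Octonion.mul]
  mul_one x := by refine WithLp.ofLp_injective 2 (Prod.ext ?_ ?_) <;> simp [Octonion.mul]
  norm_mul := Octonion.norm_mul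

theorem finrank_octonion : Module.finrank ℝ Octonion = 8 := by
  rw [(WithLp.linearEquiv 2 ℝ (ℍ[ℝ] × ℍ[ℝ])).finrank_eq, Module.finrank_prod,
    Quaternion.finrank_eq_four]

theorem exists_normedDivAlg {n : ℕ} (hn : n = 1 ∨ n = 2 ∨ n = 4 ∨ n = 8) :
    ∃ (K : Type) (_ : NormedAddCommGroup K) (_ : InnerProductSpace ℝ K) (_ : NormedDivAlg K),
      FiniteDimensional ℝ K ∧ Module.finrank ℝ K = n := by
  rcases hn with rfl | rfl | rfl | rfl
  · exact ⟨ℝ, inferInstance, inferInstance, inferInstance, inferInstance, Module.finrank_self ℝ⟩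
  · exact ⟨ℂ, inferInstance, inferInstance, inferInstance, inferInstance,
      Complex.finrank_real_complex⟩
  · exact ⟨ℍ[ℝ], inferInstance, inferInstance, inferInstance, inferInstance,
      Quaternion.finrank_eq_four⟩
  · exact ⟨Octonion, inferInstance, inferInstance, inferInstance,
      FiniteDimensional.of_finrank_pos (by rw [finrank_octonion]; norm_num), finrank_octonion⟩

theorem exists_isSmoothingFactor : ∃ l : ℝ → ℝ, IsSmoothingFactor l := by
  -- The smooth step on [0,1] is compressed to [1/2,1], so that it vanishes on a whole neighbourhood
  -- of 0.
  refine ⟨fun t => Real.smoothTransition (2 * t - 1), ?_, ?_, ?_, ?_⟩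
  · exact (Real.smoothTransition.contDiff.comp (by fun_prop : ContDiff ℝ ∞ fun t : ℝ =>
      2 * t - 1)).contDiffOn
  · intro a _ b _ h
    exact Real.smoothTransition.monotone (by linarith)
  · refine Filter.Eventually.filter_mono nhdsWithin_le_nhds ?_
    filter_upwards [Iio_mem_nhds (show (0 : ℝ) < 1 / 2 by norm_num)] with t ht
    exact Real.smoothTransition.zero_of_nonpos (by linarith [Set.mem_Iio.1 ht])
  · exact Real.smoothTransition.one_of_one_le (by norm_num)

end Existence

/-! ### Vectors, spinors and the supertranslation algebra -/

section Algebra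

variable (K : Type) [NormedAddCommGroup K] [InnerProductSpace ℝ K] [NormedDivAlg K]

theorem finrank_vec [FiniteDimensional ℝ K] :
    Module.finrank ℝ (Vec K) = Module.finrank ℝ K + 2 := by
  rw [Module.finrank_prod, Module.finrank_prod, Module.finrank_self]
  ring

variable {K}

theorem norm_one_normedDivAlg [Nontrivial K] : ‖(NormedDivAlg.one : K)‖ = 1 := by
  obtain ⟨a, ha⟩ := exists_ne (0 : K)
  have h := NormedDivAlg.norm_mul (NormedDivAlg.one : K) a
  rw [NormedDivAlg.one_mul] at h
  have h' := norm_ne_zero_iff.2 ha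
  exact (mul_right_cancel₀ h' (by rw [_root_.one_mul]; exact h)).symm

theorem norm_kconj (a : K) : ‖kconj K a‖ = ‖a‖ := by
  -- In the zero algebra the unit does not have norm 1, so this case is split off.
  rcases subsingleton_or_nontrivial K with h | h
  · rw [Subsingleton.elim (kconj K a) a]
  have h : ‖kconj K a‖ ^ 2 = ‖a‖ ^ 2 := by
    rw [kconj_apply, norm_sub_sq_real, norm_smul, norm_one_normedDivAlg, inner_smul_left]
    simp only [RCLike.conj_to_real, Real.norm_eq_abs, mul_one, sq_abs]
    ring
  exact (pow_left_inj₀ (norm_nonneg _) (norm_nonneg _) two_ne_zero).1 h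

/-- Right multiplication by `b` scales inner products by |b|². Comparing this for `b`, `b + 1` and
`1` isolates the terms linear in `b`, which express the adjoint; associativity is not needed. -/
theorem inner_kmul_right (a b c : K) :
    inner ℝ (kmul K a b) c = inner ℝ a (kmul K c (kconj K b)) := by
  have key : ∀ a b c d : K, inner ℝ (kmul K a b) (kmul K c b) = ‖b‖ ^ 2 * inner ℝ a c := by
    intro a b c _
    have h := NormedDivAlg.norm_mul (a + c) b
    have h1 := norm_add_sq_real (kmul K a b) (kmul K c b)
    have h2 := norm_add_sq_real a c
    rw [← LinearMap.add_apply, ← map_add,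
      show ‖kmul K (a + c) b‖ = ‖a + c‖ * ‖b‖ from h,
      show ‖kmul K a b‖ = ‖a‖ * ‖b‖ from NormedDivAlg.norm_mul a b,
      show ‖kmul K c b‖ = ‖c‖ * ‖b‖ from NormedDivAlg.norm_mul c b, mul_pow, h2] at h1
    linarith
  have h := key a (b + NormedDivAlg.one) c 0
  have h1 := key a b c 0
  have h2 := key a (NormedDivAlg.one : K) c 0
  have h3 := norm_add_sq_real b (NormedDivAlg.one : K)
  have e : ∀ x : K, kmul K x NormedDivAlg.one = x := NormedDivAlg.mul_one
  rw [h3] at h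
  simp only [map_add, inner_add_left, inner_add_right, e] at h h1 h2
  rw [kconj_apply, map_sub, map_smul, e, inner_sub_right, inner_smul_right,
    real_inner_comm b NormedDivAlg.one]
  linarith

theorem minkowski_apply (A B : Vec K) :
    minkowski K A B = -(A.1 * B.1) + A.2.1 * B.2.1 + inner ℝ A.2.2 B.2.2 := rfl

theorem minkowski_comm (A B : Vec K) : minkowski K A B = minkowski K B A := by
  rw [minkowski_apply, minkowski_apply, real_inner_comm, mul_comm A.1, mul_comm A.2.1]

theorem spinorBracket_apply (ψ φ : Spinor K) : spinorBracket K ψ φ =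
    (-(inner ℝ ψ.1 φ.1 + inner ℝ ψ.2 φ.2), inner ℝ ψ.1 φ.1 - inner ℝ ψ.2 φ.2,
        kmul K ψ.2 (kconj K φ.1) + kmul K φ.2 (kconj K ψ.1)) := rfl

theorem spinorBracket_comm (ψ φ : Spinor K) : spinorBracket K ψ φ = spinorBracket K φ ψ := by
  rw [spinorBracket_apply, spinorBracket_apply, real_inner_comm, real_inner_comm ψ.2, add_comm (kmul K ψ.2 _)]

/-- The inner product of spinors. -/
def spinorInner (ψ φ : Spinor K) : ℝ := inner ℝ ψ.1 φ.1 + inner ℝ ψ.2 φ.2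

/-- The lower entry of `A` is moved across inner products by the two adjunctions for multiplication
in `K`, without any associativity. The bracket is thereby the transpose of the Clifford action,
which is how its equivariance under Spin is proved later. -/
theorem minkowski_spinorBracket (A : Vec K) (ψ φ : Spinor K) :
    minkowski K A (spinorBracket K ψ φ) = spinorInner ψ (vecMul K A φ) := by
  have h1 := inner_kmul_right A.2.2 φ.1 ψ.2
  have h2 := inner_kmul_right A.2.2 ψ.1 φ.2
  have h3 := inner_kmul_left A.2.2 ψ.1 φ.2
  simp only [minkowski_apply, spinorBracket_apply, spinorInner, vecMul, LinearMap.mk₂_apply,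
    inner_add_right, inner_smul_right]
  rw [real_inner_comm] at h1
  linarith

/-- Multiplicativity of the norm turns the square of the off-diagonal entry into 4|ψ₁|²|ψ₂|²,
exactly the difference of the squares of |ψ₁|²+|ψ₂|² and |ψ₁|²-|ψ₂|². The cocycle property of α
comes from this. -/
theorem minkowski_spinorBracket_self (ψ : Spinor K) :
    minkowski K (spinorBracket K ψ ψ) (spinorBracket K ψ ψ) = 0 := by
  simp only [minkowski_apply, spinorBracket_apply, ← two_smul ℝ (kmul K ψ.2 _), inner_smul_left,
    inner_smul_right, real_inner_self_eq_norm_sq]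
  rw [show ‖kmul K ψ.2 (kconj K ψ.1)‖ = ‖ψ.2‖ * ‖kconj K ψ.1‖ from NormedDivAlg.norm_mul _ _,
    norm_kconj]
  simp only [RCLike.conj_to_real]
  ring

/-- The 3-ψ rule, in its polarized form. -/
theorem minkowski_spinorBracket_cyclic (ψ₁ ψ₂ ψ₃ ψ₄ : Spinor K) :
    minkowski K (spinorBracket K ψ₁ ψ₂) (spinorBracket K ψ₃ ψ₄) +
    minkowski K (spinorBracket K ψ₁ ψ₃) (spinorBracket K ψ₂ ψ₄) +
    minkowski K (spinorBracket K ψ₁ ψ₄) (spinorBracket K ψ₂ ψ₃) = 0 := by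
  set P := spinorBracket K
  set B := minkowski K
  have cP : ∀ x y, P x y = P y x := spinorBracket_comm
  have cB : ∀ x y, B x y = B y x := minkowski_comm
  have s0 : ∀ x, B (P x x) (P x x) = 0 := minkowski_spinorBracket_self
  -- The quartic in s given by x + sy has no constant and no top coefficient; its vanishing at s =
  -- 1, -1, 2 forces the remaining three coefficients to be zero, and the linear one is 4 times this
  -- expression.
  have s1 : ∀ x y, B (P x x) (P x y) = 0 := by
    intro x y
    have h1 := s0 (x + y)
    have h2 := s0 (x - y)
    have h3 := s0 (x + (2 : ℝ) • y)
    have h4 := s0 x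
    have h5 := s0 y
    simp only [map_add, map_sub, map_smul, LinearMap.add_apply, LinearMap.sub_apply,
      LinearMap.smul_apply, smul_eq_mul, cP y x, cB (P x y) (P x x), cB (P y y) (P x x),
      cB (P y y) (P x y)] at h1 h2 h3
    linarith
  -- Second polarization: the part of `s1` at x ± z that is of first order in z. The cubic part in z
  -- vanishes by `s1` again.
  have s2 : ∀ x y z, B (P x x) (P z y) + 2 * B (P x z) (P x y) = 0 := by
    intro x y z
    have h1 := s1 (x + z) y
    have h2 := s1 (x - z) y
    have h3 := s1 x y
    have h4 := s1 z y
    simp only [map_add, map_sub, LinearMap.add_apply, LinearMap.sub_apply, cP z x] at h1 h2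
    linarith
  -- Third polarization, of the quadratic dependence on the first argument; it produces twice the
  -- cyclic sum.
  have h1 := s2 (ψ₁ + ψ₂) ψ₄ ψ₃
  have h2 := s2 ψ₁ ψ₄ ψ₃
  have h3 := s2 ψ₂ ψ₄ ψ₃
  simp only [map_add, LinearMap.add_apply, cP ψ₂ ψ₁] at h1
  rw [cB (P ψ₁ ψ₄)]
  linarith

variable (K) [FiniteDimensional ℝ K]

theorem transBracket_apply (X Y : (superTrans K).Tot) :
    transBracket K X Y = (spinorBracket K X.2 Y.2, 0) := rfl

theorem alpha_apply (X Y Z : (superTrans K).Tot) : alpha K X Y Z =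
    minkowski K X.1 (spinorBracket K Y.2 Z.2) - minkowski K Y.1 (spinorBracket K X.2 Z.2) +
      minkowski K Z.1 (spinorBracket K X.2 Y.2) := rfl

theorem homog_zero {V : SVect} {X : V.Tot} (h : V.Homog 0 X) : X.2 = 0 := by
  simpa [SVect.Homog] using h

theorem homog_one {V : SVect} {X : V.Tot} (h : V.Homog 1 X) : X.1 = 0 := by
  simpa [SVect.Homog] using h

theorem zmod_two_cases (i : ZMod 2) : i = 0 ∨ i = 1 := by
  revert i; decide

theorem transBracket_isLieSuperalgebra :
    (superTrans K).IsLieSuperalgebra (transBracket K) where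
  parity i j X Y hX hY := by
    rcases zmod_two_cases i with rfl | rfl <;> rcases zmod_two_cases j with rfl | rfl
    · rfl
    · simp [SVect.Homog, transBracket_apply, homog_zero hX]
    · simp [SVect.Homog, transBracket_apply, homog_zero hY]
    · rfl
  antisymm i j X Y hX hY := by
    rw [transBracket_apply, transBracket_apply, spinorBracket_comm]
    rcases zmod_two_cases i with rfl | rfl <;> rcases zmod_two_cases j with rfl | rfl
    · simp [homog_zero hX]
    · simp [homog_zero hX]
    · simp [homog_zero hY]
    · simp [ZMod.val_one]
  jacobi i j k X Y Z _ _ _ := by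
    simp [transBracket_apply]

theorem alpha_isEven3Cocycle :
    (superTrans K).IsEven3Cocycle (transBracket K) (alpha K) where
  swap12 i j k X Y Z hX hY hZ := by
    rw [alpha_apply, alpha_apply, spinorBracket_comm Y.2 X.2]
    rcases zmod_two_cases i with rfl | rfl <;> rcases zmod_two_cases j with rfl | rfl
    · simp [homog_zero hX, homog_zero hY]
    · simp [homog_zero hX, homog_one hY]
    · simp [homog_zero hY, homog_one hX]
    · simp [homog_one hX, homog_one hY, ZMod.val_one]
  swap23 i j k X Y Z hX hY hZ := by
    rw [alpha_apply, alpha_apply, spinorBracket_comm Y.2 Z.2]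
    rcases zmod_two_cases j with rfl | rfl <;> rcases zmod_two_cases k with rfl | rfl
    · simp [homog_zero hY, homog_zero hZ]
    · simp [homog_zero hY, homog_one hZ]
    · simp [homog_zero hZ, homog_one hY]
    · simp [homog_one hY, homog_one hZ, ZMod.val_one]
  even i j k X Y Z hX hY hZ h := by
    rw [alpha_apply]
    rcases zmod_two_cases i with rfl | rfl <;> rcases zmod_two_cases j with rfl | rfl <;>
      rcases zmod_two_cases k with rfl | rfl
    · exact absurd rfl h
    · simp [homog_zero hX, homog_zero hY]
    · simp [homog_zero hX, homog_zero hZ]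
    · exact absurd rfl h
    · simp [homog_zero hY, homog_zero hZ]
    · exact absurd rfl h
    · exact absurd rfl h
    · simp [homog_one hX, homog_one hY, homog_one hZ]
  closed s X hX := by
    have key : ∀ a b c d : (superTrans K).Tot, alpha K (transBracket K a b) c d =
        minkowski K (spinorBracket K a.2 b.2) (spinorBracket K c.2 d.2) := by
      intro a b c d
      simp [alpha_apply, transBracket_apply]
    have h := minkowski_spinorBracket_cyclic (X 0).2 (X 1).2 (X 2).2 (X 3).2
    have c2 : ∀ (a : (superTrans K).Tot) (f : Fin 2 → (superTrans K).Tot),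
        (Fin.cons a f : Fin 3 → (superTrans K).Tot) 2 = f 1 := fun _ _ => rfl
    simp only [SVect.superD, key, Fin.cons_zero, Fin.cons_one, c2]
    -- The differential only involves products of two brackets, and a bracket sees only spinor
    -- parts. An even argument has no spinor part and occurs in every term, so every term vanishes.
    by_cases h0 : ∃ i, s i = 0
    · obtain ⟨i, hi⟩ := h0
      have h2 : (X i).2 = 0 := homog_zero (hi ▸ hX i)
      refine Finset.sum_eq_zero fun j _ => Finset.sum_eq_zero fun k _ => ?_
      split_ifs with hk
      · have : i = k.castSucc ∨ i = j ∨ i = j.succAbove (k.succAbove 0) ∨ i = j.succAbove (k.succAbove 1) := by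
          revert hk
          clear * -
          revert i j k
          decide
        rcases this with rfl | rfl | rfl | rfl <;> simp [h2]
      · rfl
    -- With four odd arguments all six terms carry the sign -1, and complementary pairs of indices
    -- give equal terms. The sum is -2 times the 3-ψ sum.
    · push Not at h0
      have h1 : ∀ i, s i = 1 := fun i => (zmod_two_cases (s i)).resolve_left (h0 i)
      simp only [h1, ZMod.val_one]
      have hB := minkowski_comm (K := K)
      simp [Fin.sum_univ_succ, Fin.succAbove]
      rw [hB (spinorBracket K (X 2).2 (X 3).2), hB (spinorBracket K (X 1).2 (X 3).2),
        hB (spinorBracket K (X 1).2 (X 2).2)]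
      linarith

end Algebra

/-! ### The bracket and the form on `A`-points -/

theorem evProj_coe {q : ℕ} (a : Ev q) : evProj q (a : Gr q) = a := by
  change (DirectSum.decompose (CliffordAlgebra.evenOdd (0 : QuadraticForm ℝ (Fin q → ℝ)))
    (a : Gr q)) 0 = a
  exact Subtype.ext (DirectSum.decompose_of_mem_same
    (CliffordAlgebra.evenOdd (0 : QuadraticForm ℝ (Fin q → ℝ))) a.2)

theorem SVect.pt_induction {V : SVect} {q : ℕ} {P : V.Pt q → Prop}
    (ha : ∀ x y, P x → P y → P (x + y)) (he : ∀ (a : Ev q) (v : V.E), P (a ⊗ₜ v, 0))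
    (ho : ∀ (b : Od q) (s : V.O), P (0, b ⊗ₜ s)) (x : V.Pt q) : P x := by
  obtain ⟨x, y⟩ := x
  have h1 : P (x, 0) := by
    induction x with
    | zero => simpa using he 0 0
    | tmul a v => exact he a v
    | add x x' h h' =>
      have := ha _ _ h h'
      rwa [Prod.mk_add_mk, add_zero] at this
  have h2 : P (0, y) := by
    induction y with
    | zero => simpa using ho 0 0
    | tmul a v => exact ho a v
    | add x x' h h' =>
      have := ha _ _ h h'
      rwa [Prod.mk_add_mk, add_zero] at this
  have := ha _ _ h1 h2
  rwa [Prod.mk_add_mk, add_zero, zero_add] at this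

section

variable {q : ℕ} {V : SVect}

theorem toTot_ev (a : Ev q) (v : V.E) :
    SVect.toTot q ((a ⊗ₜ v, 0) : V.Pt q) = (a : Gr q) ⊗ₜ ((v, 0) : V.Tot) := by
  rw [SVect.toTot, LinearMap.coprod_apply, map_zero, add_zero]
  rfl

theorem toTot_od (b : Od q) (s : V.O) :
    SVect.toTot q ((0, b ⊗ₜ s) : V.Pt q) = (b : Gr q) ⊗ₜ ((0, s) : V.Tot) := by
  rw [SVect.toTot, LinearMap.coprod_apply, map_zero, zero_add]
  rfl

theorem ofTot_tmul (a : Gr q) (X : V.Tot) :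
    SVect.ofTot q (a ⊗ₜ X) = (evProj q a ⊗ₜ X.1, odProj q a ⊗ₜ X.2) := by
  simp [SVect.ofTot]

variable (br : V.Tot →ₗ[ℝ] V.Tot →ₗ[ℝ] V.Tot) (η : V.Tot →ₗ[ℝ] V.Tot →ₗ[ℝ] V.Tot →ₗ[ℝ] ℝ)

theorem brA_of_toTot {x y : V.Pt q} {a b : Gr q} {X Y : V.Tot} (hx : SVect.toTot q x = a ⊗ₜ X)
    (hy : SVect.toTot q y = b ⊗ₜ Y) : SVect.brA br q x y =
      (evProj q (b * a) ⊗ₜ (br X Y).1, odProj q (b * a) ⊗ₜ (br X Y).2) := by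
  rw [SVect.brA, hx, hy, TensorProduct.map₂_apply_tmul, TensorProduct.map_tmul]
  exact ofTot_tmul _ _

theorem omegaA_of_toTot {x y z : V.Pt q} {a b c : Gr q} {X Y Z : V.Tot}
    (hx : SVect.toTot q x = a ⊗ₜ X) (hy : SVect.toTot q y = b ⊗ₜ Y)
    (hz : SVect.toTot q z = c ⊗ₜ Z) :
    SVect.omegaA η q x y z = evProj q (c * (b * a)) ⊗ₜ η X Y Z := by
  rw [SVect.omegaA, hx, hy, hz, TensorProduct.map₂_apply_tmul, TensorProduct.map_tmul,
    TensorProduct.map₂_apply_tmul, TensorProduct.map_tmul, TensorProduct.map_tmul]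
  rfl

theorem brA_add_left (x x' y : V.Pt q) :
    SVect.brA br q (x + x') y = SVect.brA br q x y + SVect.brA br q x' y := by
  simp only [SVect.brA, map_add, LinearMap.add_apply]

theorem brA_add_right (x y y' : V.Pt q) :
    SVect.brA br q x (y + y') = SVect.brA br q x y + SVect.brA br q x y' := by
  simp only [SVect.brA, map_add]

theorem omegaA_add₁ (x x' y z : V.Pt q) : SVect.omegaA η q (x + x') y z =
    SVect.omegaA η q x y z + SVect.omegaA η q x' y z := by
  simp only [SVect.omegaA, map_add, LinearMap.add_apply]

theorem omegaA_add₂ (x y y' z : V.Pt q) : SVect.omegaA η q x (y + y') z =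
    SVect.omegaA η q x y z + SVect.omegaA η q x y' z := by
  simp only [SVect.omegaA, map_add, LinearMap.add_apply]

theorem omegaA_add₃ (x y z z' : V.Pt q) : SVect.omegaA η q x y (z + z') =
    SVect.omegaA η q x y z + SVect.omegaA η q x y z' := by
  simp only [SVect.omegaA, map_add]

end

variable {K : Type} [NormedAddCommGroup K] [InnerProductSpace ℝ K] [FiniteDimensional ℝ K]
  [NormedDivAlg K] {q : ℕ}

variable (K q) in
/-- The bracket of the supertranslation algebra on `A`-points. -/
def brT : (superTrans K).Pt q →ₗ[ℝ] (superTrans K).Pt q →ₗ[ℝ] (superTrans K).Pt q :=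
  SVect.bil (V := superTrans K) (W := superTrans K) (X := superTrans K) 0 0 (spinorBracket K) q

variable (K q) in
/-- The Minkowski form of the vector parts of `A`-points. -/
def minkT : (superTrans K).Pt q →ₗ[ℝ] (superTrans K).Pt q →ₗ[ℝ] SVect.line.Pt q :=
  SVect.bil (V := superTrans K) (W := superTrans K) (X := SVect.line) (minkowski K) 0 0 q

theorem map₂_zero' {A B C E F G : Type}
    [AddCommGroup A] [Module ℝ A] [AddCommGroup B] [Module ℝ B] [AddCommGroup C] [Module ℝ C]
    [AddCommGroup E] [Module ℝ E] [AddCommGroup F] [Module ℝ F] [AddCommGroup G] [Module ℝ G]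
    (m : A →ₗ[ℝ] B →ₗ[ℝ] C) (x : A ⊗[ℝ] E) (y : B ⊗[ℝ] F) :
    TensorProduct.map₂ m (0 : E →ₗ[ℝ] F →ₗ[ℝ] G) x y = 0 := by
  refine SVect.tensor_induction₂ (P := fun x y =>
    TensorProduct.map₂ m (0 : E →ₗ[ℝ] F →ₗ[ℝ] G) x y = 0) ?_ ?_ ?_ ?_ ?_ x y
  · intro y; simp only [map_zero, LinearMap.zero_apply]
  · intro x; simp only [map_zero]
  · intro x x' y h1 h2; simp only [map_add, LinearMap.add_apply, h1, h2, add_zero]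
  · intro x y y' h1 h2; simp only [map_add, h1, h2, add_zero]
  · intro a e b f; simp

theorem brT_apply (x y : (superTrans K).Pt q) :
    brT K q x y = (TensorProduct.map₂ (odMulRev q) (spinorBracket K) x.2 y.2, 0) := by
  rw [brT, SVect.bil_apply, map₂_zero', map₂_zero', zero_add]

theorem minkT_apply (x y : (superTrans K).Pt q) :
    minkT K q x y = (TensorProduct.map₂ (LinearMap.mul ℝ (Ev q)) (minkowski K) x.1 y.1, 0) := by
  refine (SVect.bil_apply (V := superTrans K) (W := superTrans K) (X := SVect.line)
    (minkowski K) 0 0 x y).trans ?_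
  rw [map₂_zero', map₂_zero', add_zero]
  rfl

theorem brT_ev_left (a : Ev q) (v : Vec K) (y : (superTrans K).Pt q) :
    brT K q (a ⊗ₜ v, 0) y = 0 := by
  rw [brT_apply, map_zero, LinearMap.zero_apply]; rfl

theorem brT_ev_right (a : Ev q) (v : Vec K) (y : (superTrans K).Pt q) :
    brT K q y (a ⊗ₜ v, 0) = 0 := by
  rw [brT_apply, map_zero]; rfl

theorem brT_od (a b : Od q) (s t : Spinor K) :
    brT K q (0, a ⊗ₜ s) (0, b ⊗ₜ t) = (odMulRev q a b ⊗ₜ spinorBracket K s t, 0) := by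
  rw [brT_apply]; rfl

theorem minkT_ev (a b : Ev q) (v w : Vec K) :
    minkT K q (a ⊗ₜ v, 0) (b ⊗ₜ w, 0) = ((a * b) ⊗ₜ minkowski K v w, 0) := by
  rw [minkT_apply]; rfl

theorem minkT_od_left (b : Od q) (s : Spinor K) (y : (superTrans K).Pt q) :
    minkT K q (0, b ⊗ₜ s) y = 0 := by
  rw [minkT_apply, map_zero, LinearMap.zero_apply]; rfl

/-- Passes from the general definition through A ⊗ 𝒯 to the bilinear form on homogeneous parts, to
which the lemmas on smoothness apply. Both sides are additive, so pure tensors of given parity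
suffice. -/
theorem brA_transBracket (x y : (superTrans K).Pt q) :
    SVect.brA (transBracket K) q x y = brT K q x y := by
  revert y
  refine SVect.pt_induction (V := superTrans K) (P := fun x => ∀ y : (superTrans K).Pt q,
    SVect.brA (transBracket K) q x y = brT K q x y) ?_ ?_ ?_ x
  · intro x x' h h' y
    rw [brA_add_left, h, h', map_add, LinearMap.add_apply]
  · intro a v y
    rw [brT_ev_left]
    refine SVect.pt_induction (V := superTrans K)
      (P := fun y => SVect.brA (transBracket K) q (a ⊗ₜ v, 0) y = 0) ?_ ?_ ?_ y
    · intro y y' h1 h2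
      rw [brA_add_right, h1, h2, add_zero]
    · intro b w
      rw [brA_of_toTot _ (toTot_ev a v) (toTot_ev b w), transBracket_apply]
      simp
    · intro b w
      rw [brA_of_toTot _ (toTot_ev a v) (toTot_od b w), transBracket_apply]
      simp
  · intro a v y
    refine SVect.pt_induction (V := superTrans K)
      (P := fun y => SVect.brA (transBracket K) q (0, a ⊗ₜ v) y = brT K q (0, a ⊗ₜ v) y) ?_ ?_ ?_ y
    · intro y y' h1 h2
      rw [brA_add_right, h1, h2, map_add]
    · intro b w
      rw [brA_of_toTot _ (toTot_od a v) (toTot_ev b w), transBracket_apply, brT_ev_right]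
      simp
    · intro b w
      rw [brA_of_toTot _ (toTot_od a v) (toTot_od b w), transBracket_apply, brT_od]
      exact Prod.ext (congrArg (fun t => t ⊗ₜ[ℝ] (spinorBracket K v w))
        (evProj_coe (odMulRev q a b))) (TensorProduct.tmul_zero _ _)

variable (K q) in
/-- The form `α_A`, with values in the even part of the line. -/
def omegaT (x y z : (superTrans K).Pt q) : SVect.line.Pt q :=
  minkT K q x (brT K q y z) - minkT K q y (brT K q x z) + minkT K q z (brT K q x y)

theorem omegaT_add₁ (x x' y z : (superTrans K).Pt q) :
    omegaT K q (x + x') y z = omegaT K q x y z + omegaT K q x' y z := by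
  simp only [omegaT, map_add, LinearMap.add_apply]; abel

theorem omegaT_add₂ (x y y' z : (superTrans K).Pt q) :
    omegaT K q x (y + y') z = omegaT K q x y z + omegaT K q x y' z := by
  simp only [omegaT, map_add, LinearMap.add_apply]; abel

theorem omegaT_add₃ (x y z z' : (superTrans K).Pt q) :
    omegaT K q x y (z + z') = omegaT K q x y z + omegaT K q x y z' := by
  simp only [omegaT, map_add, LinearMap.add_apply]; abel

section

variable (a b c : Ev q) (u v w : Vec K) (a' b' c' : Od q) (r s t : Spinor K)

theorem omegaT_ev_ev (z : (superTrans K).Pt q) : omegaT K q (a ⊗ₜ v, 0) (b ⊗ₜ w, 0) z = 0 := by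
  rw [omegaT, brT_ev_left, brT_ev_left, brT_ev_left, map_zero, map_zero, map_zero, sub_zero, add_zero]

theorem omegaT_ev_left_right (y : (superTrans K).Pt q) :
    omegaT K q (a ⊗ₜ v, 0) y (b ⊗ₜ w, 0) = 0 := by
  rw [omegaT, brT_ev_left, brT_ev_left, brT_ev_right, map_zero, map_zero, map_zero, sub_zero, add_zero]

theorem omegaT_ev_ev_right (x : (superTrans K).Pt q) :
    omegaT K q x (a ⊗ₜ v, 0) (b ⊗ₜ w, 0) = 0 := by
  rw [omegaT, brT_ev_right, brT_ev_right, brT_ev_right, map_zero, map_zero, map_zero, sub_zero, add_zero]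

theorem omegaT_od_od_od : omegaT K q (0, a' ⊗ₜ r) (0, b' ⊗ₜ s) (0, c' ⊗ₜ t) = 0 := by
  rw [omegaT, minkT_od_left, minkT_od_left, minkT_od_left, sub_zero, add_zero]

theorem omegaT_ev_od_od : omegaT K q (a ⊗ₜ v, 0) (0, b' ⊗ₜ s) (0, c' ⊗ₜ t) =
    ((a * odMulRev q b' c') ⊗ₜ minkowski K v (spinorBracket K s t), 0) := by
  rw [omegaT, brT_ev_left, brT_ev_left, map_zero, map_zero, sub_zero, add_zero, brT_od, minkT_ev]

theorem omegaT_od_ev_od : omegaT K q (0, b' ⊗ₜ s) (a ⊗ₜ v, 0) (0, c' ⊗ₜ t) =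
    ((a * odMulRev q b' c') ⊗ₜ (-minkowski K v (spinorBracket K s t)), 0) := by
  rw [omegaT, brT_ev_left, brT_ev_right, map_zero, map_zero, zero_sub, add_zero, brT_od, minkT_ev]
  exact Prod.ext (TensorProduct.tmul_neg _ _).symm (neg_zero (G := Od q ⊗[ℝ] PUnit))

theorem omegaT_od_od_ev : omegaT K q (0, b' ⊗ₜ s) (0, c' ⊗ₜ t) (a ⊗ₜ v, 0) =
    ((a * odMulRev q b' c') ⊗ₜ minkowski K v (spinorBracket K s t), 0) := by
  rw [omegaT, brT_ev_right, brT_ev_right, map_zero, map_zero, sub_zero, zero_add, brT_od, minkT_ev]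

end

theorem omegaA_alpha_tmul {x y z : (superTrans K).Pt q} {d : Ev q} {X Y Z : (superTrans K).Tot}
    {a' b' c' : Gr q} {t : SVect.line.Pt q}
    (hx : SVect.toTot q x = a' ⊗ₜ X) (hy : SVect.toTot q y = b' ⊗ₜ Y)
    (hz : SVect.toTot q z = c' ⊗ₜ Z) {r : ℝ} (hr : alpha K X Y Z = r)
    (h : (c' * (b' * a') : Gr q) = d) (ht : t = (d ⊗ₜ r, 0)) :
    SVect.omegaA (alpha K) q x y z = t.1 := by
  rw [omegaA_of_toTot _ hx hy hz, hr, h, evProj_coe, ht]; rfl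

theorem omegaA_alpha_zero {x y z : (superTrans K).Pt q} {X Y Z : (superTrans K).Tot}
    {a' b' c' : Gr q} {t : SVect.line.Pt q}
    (hx : SVect.toTot q x = a' ⊗ₜ X) (hy : SVect.toTot q y = b' ⊗ₜ Y)
    (hz : SVect.toTot q z = c' ⊗ₜ Z) (hr : alpha K X Y Z = 0) (ht : t = 0) :
    SVect.omegaA (alpha K) q x y z = t.1 := by
  rw [omegaA_of_toTot _ hx hy hz, hr, ht, TensorProduct.tmul_zero]; rfl

/-- Checked on the eight parity patterns of pure tensors. Only those with exactly one vector and two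
spinors contribute; there the reversed product of coefficients agrees with the one in `omegaT`
because the even coefficient is central. -/
theorem omegaA_alpha (x y z : (superTrans K).Pt q) :
    SVect.omegaA (alpha K) q x y z = (omegaT K q x y z).1 := by
  revert y z
  refine SVect.pt_induction (V := superTrans K) (P := fun x => ∀ y z : (superTrans K).Pt q,
    SVect.omegaA (alpha K) q x y z = (omegaT K q x y z).1) ?_ ?_ ?_ x
  · intro x x' h h' y z
    rw [omegaA_add₁, h, h', omegaT_add₁]; rfl
  all_goals
    intro a v y
    refine SVect.pt_induction (V := superTrans K)
      (P := fun y => ∀ z : (superTrans K).Pt q, SVect.omegaA (alpha K) q _ y z =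
        (omegaT K q _ y z).1) ?_ ?_ ?_ y
    · intro y y' h h' z
      rw [omegaA_add₂, h, h', omegaT_add₂]; rfl
    all_goals
      intro b w z
      refine SVect.pt_induction (V := superTrans K)
        (P := fun z => SVect.omegaA (alpha K) q _ _ z =
          (omegaT K q _ _ z).1) ?_ ?_ ?_ z
      · intro z z' h1 h2
        rw [omegaA_add₃, h1, h2, omegaT_add₃]; rfl
      all_goals
        intro c u
  · refine omegaA_alpha_zero (toTot_ev a v) (toTot_ev b w) (toTot_ev c u) ?_
      (omegaT_ev_ev _ _ _ _ _)
    simp [alpha_apply]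
  · refine omegaA_alpha_zero (toTot_ev a v) (toTot_ev b w) (toTot_od c u) ?_
      (omegaT_ev_ev _ _ _ _ _)
    simp [alpha_apply]
  · refine omegaA_alpha_zero (toTot_ev a v) (toTot_od b w) (toTot_ev c u) ?_
      (omegaT_ev_left_right _ _ _ _ _)
    simp [alpha_apply]
  · refine omegaA_alpha_tmul (d := a * odMulRev q b c) (toTot_ev a v) (toTot_od b w)
      (toTot_od c u) ?_ ?_ (omegaT_ev_od_od _ _ _ _ _ _)
    · simp [alpha_apply]
    · change (c : Gr q) * (b * a) = a * (c * b)
      rw [ev_commute a.2, mul_assoc]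
  · refine omegaA_alpha_zero (toTot_od a v) (toTot_ev b w) (toTot_ev c u) ?_
      (omegaT_ev_ev_right _ _ _ _ _)
    simp [alpha_apply]
  · refine omegaA_alpha_tmul (d := b * odMulRev q a c) (toTot_od a v) (toTot_ev b w)
      (toTot_od c u) ?_ ?_ (omegaT_od_ev_od _ _ _ _ _ _)
    · simp [alpha_apply]
    · change (c : Gr q) * (b * a) = b * (c * a)
      rw [← mul_assoc, ← ev_commute b.2, mul_assoc]
  · refine omegaA_alpha_tmul (d := c * odMulRev q a b) (toTot_od a v) (toTot_od b w)
      (toTot_ev c u) ?_ ?_ (omegaT_od_od_ev _ _ _ _ _ _)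
    · simp [alpha_apply]
    · rfl
  · refine omegaA_alpha_zero (toTot_od a v) (toTot_od b w) (toTot_od c u) ?_
      (omegaT_od_od_od _ _ _ _ _ _)
    simp [alpha_apply]

/-! ### The supertranslation group and its cubic cochain -/

/-- A bracket and a form of the kind that the supertranslation algebra has on `A`-points: the
bracket is antisymmetric and 2-step nilpotent, the form is symmetric, and brackets satisfy the
3-ψ rule. -/
structure IsStringPair {P L : Type} [AddCommGroup P] [Module ℝ P] [AddCommGroup L] [Module ℝ L]
    (br : P →ₗ[ℝ] P →ₗ[ℝ] P) (g : P →ₗ[ℝ] P →ₗ[ℝ] L) : Prop where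
  swap : ∀ x y, br x y = -br y x
  nil : ∀ x y z, br (br x y) z = 0
  comm : ∀ x y, g x y = g y x
  cyclic : ∀ x y z w, g (br x y) (br z w) + g (br x z) (br w y) + g (br x w) (br y z) = 0

namespace IsStringPair

variable {P L : Type} [AddCommGroup P] [Module ℝ P] [AddCommGroup L] [Module ℝ L]

/-- The product `x + y + ½ [x, y]`. -/
def bch (br : P →ₗ[ℝ] P →ₗ[ℝ] P) (x y : P) : P := x + y + (1 / 2 : ℝ) • br x y

/-- The form `g(x, [y, z]) - g(y, [x, z]) + g(z, [x, y])`. -/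
def form (br : P →ₗ[ℝ] P →ₗ[ℝ] P) (g : P →ₗ[ℝ] P →ₗ[ℝ] L) (x y z : P) : L :=
  g x (br y z) - g y (br x z) + g z (br x y)

/-- The cubic cochain. -/
def cubicForm (br : P →ₗ[ℝ] P →ₗ[ℝ] P) (g : P →ₗ[ℝ] P →ₗ[ℝ] L) (x y z : P) : L :=
  form br g x y z + (1 / 2 : ℝ) • g (br x y) (br y z)

variable {br : P →ₗ[ℝ] P →ₗ[ℝ] P} {g : P →ₗ[ℝ] P →ₗ[ℝ] L}

/-- On A-points the symmetric bracket of spinors becomes antisymmetric, since the odd coefficients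
anticommute. Hence squares vanish as in an ordinary Lie algebra. -/
theorem self (h : IsStringPair br g) (x : P) : br x x = 0 := by
  have h2 : (2 : ℝ) • br x x = 0 := by
    rw [two_smul]
    nth_rw 1 [h.swap x x]
    exact neg_add_cancel _
  exact (smul_eq_zero.1 h2).resolve_left two_ne_zero

theorem nil_right (h : IsStringPair br g) (x y z : P) : br z (br x y) = 0 := by
  rw [h.swap, h.nil, neg_zero]

theorem bch_assoc (h : IsStringPair br g) (x y z : P) : bch br (bch br x y) z = bch br x (bch br y z) := by
  simp only [bch, map_add, map_smul, LinearMap.add_apply, LinearMap.smul_apply, h.nil,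
    h.nil_right, smul_zero, smul_add, add_zero]
  abel

theorem bch_neg (h : IsStringPair br g) (x : P) : bch br x (-x) = 0 := by
  rw [bch, map_neg, h.self, neg_zero, smul_zero, add_zero, add_neg_cancel]

theorem neg_bch (h : IsStringPair br g) (x : P) : bch br (-x) x = 0 := by
  rw [bch, map_neg, LinearMap.neg_apply, h.self, neg_zero, smul_zero, add_zero, neg_add_cancel]

theorem zero_bch (x : P) : bch br 0 x = x := by
  rw [bch, map_zero, LinearMap.zero_apply, smul_zero, add_zero, zero_add]

theorem bch_zero (x : P) : bch br x 0 = x := by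
  rw [bch, map_zero, smul_zero, add_zero, add_zero]

/-- The terms of degree three cancel because the form is trilinear. The group law and the correction
½ g([x,y],[y,z]) contribute terms of degree four that pair two brackets, and by antisymmetry and
symmetry these assemble into a multiple of the 3-ψ sum. -/
theorem cubicForm_cocycle (h : IsStringPair br g) (x y z w : P) :
    cubicForm br g y z w - cubicForm br g (bch br x y) z w + cubicForm br g x (bch br y z) w -
      cubicForm br g x y (bch br z w) + cubicForm br g x y z = 0 := by
  have h1 := h.cyclic x y z w
  rw [h.swap w y, map_neg] at h1
  simp only [cubicForm, form, bch, map_add, map_smul, LinearMap.add_apply,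
    LinearMap.smul_apply, h.nil, h.nil_right, smul_zero, smul_add, add_zero, map_zero,
    LinearMap.zero_apply]
  rw [h.comm (br y z) (br x w), h.comm (br z w) (br x y)]
  -- The coboundary equals -1/2 times the cyclic sum; the zero on the right is written in that form
  -- to compare coefficients.
  rw [← smul_zero (-(1 / 2) : ℝ), ← h1]
  module

end IsStringPair

/-- Tensoring the 3-ψ rule with coefficients: the hypotheses on `n` and `m` say that the coefficient
products of the three pairings coincide, so they can be factored out. -/
theorem map₂_cyclic {A C E F : Type} [AddCommGroup A] [Module ℝ A] [AddCommGroup C] [Module ℝ C]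
    [AddCommGroup E] [Module ℝ E] [AddCommGroup F] [Module ℝ F] (n : A →ₗ[ℝ] A →ₗ[ℝ] C)
    (m : C →ₗ[ℝ] C →ₗ[ℝ] C) (b : E →ₗ[ℝ] E →ₗ[ℝ] F) (g : F →ₗ[ℝ] F →ₗ[ℝ] ℝ)
    (h : ∀ x y z w, g (b x y) (b z w) + g (b x z) (b w y) + g (b x w) (b y z) = 0)
    (h1 : ∀ x y z w, m (n x z) (n w y) = m (n x y) (n z w))
    (h2 : ∀ x y z w, m (n x w) (n y z) = m (n x y) (n z w)) (x y z w : A ⊗[ℝ] E) :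
    TensorProduct.map₂ m g (TensorProduct.map₂ n b x y) (TensorProduct.map₂ n b z w) +
      TensorProduct.map₂ m g (TensorProduct.map₂ n b x z) (TensorProduct.map₂ n b w y) +
      TensorProduct.map₂ m g (TensorProduct.map₂ n b x w) (TensorProduct.map₂ n b y z) = 0 := by
  induction x with
  | zero => simp only [map_zero, LinearMap.zero_apply, add_zero]
  | add s s' h h' =>
    have := congrArg₂ (· + ·) h h'
    simp only [map_add, LinearMap.add_apply]
    rw [add_zero] at this
    rw [← this]; abel
  | tmul a0 e0 =>
  induction y with
  | zero => simp only [map_zero, LinearMap.zero_apply, add_zero]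
  | add s s' h h' =>
    have := congrArg₂ (· + ·) h h'
    simp only [map_add, LinearMap.add_apply]
    rw [add_zero] at this
    rw [← this]; abel
  | tmul a1 e1 =>
  induction z with
  | zero => simp only [map_zero, LinearMap.zero_apply, add_zero]
  | add s s' h h' =>
    have := congrArg₂ (· + ·) h h'
    simp only [map_add, LinearMap.add_apply]
    rw [add_zero] at this
    rw [← this]; abel
  | tmul a2 e2 =>
  induction w with
  | zero => simp only [map_zero, LinearMap.zero_apply, add_zero]
  | add s s' h h' =>
    have := congrArg₂ (· + ·) h h'
    simp only [map_add, LinearMap.add_apply]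
    rw [add_zero] at this
    rw [← this]; abel
  | tmul a3 e3 =>
  simp only [TensorProduct.map₂_apply_tmul, TensorProduct.map_tmul]
  rw [h1 a0 a1 a2 a3, h2 a0 a1 a2 a3, ← TensorProduct.tmul_add, ← TensorProduct.tmul_add, h,
    TensorProduct.tmul_zero]

variable {K : Type} [NormedAddCommGroup K] [InnerProductSpace ℝ K] [FiniteDimensional ℝ K]
  [NormedDivAlg K] {q r : ℕ}

theorem map₂_swap {A B E F : Type} [AddCommGroup A] [Module ℝ A] [AddCommGroup B] [Module ℝ B]
    [AddCommGroup E] [Module ℝ E] [AddCommGroup F] [Module ℝ F] (m : A →ₗ[ℝ] A →ₗ[ℝ] B)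
    (b : E →ₗ[ℝ] E →ₗ[ℝ] F) (ε : ℝ) (h : ∀ a a' e e', m a a' ⊗ₜ[ℝ] b e e' = ε • m a' a ⊗ₜ[ℝ] b e' e)
    (x y : A ⊗[ℝ] E) : TensorProduct.map₂ m b x y = ε • TensorProduct.map₂ m b y x := by
  refine SVect.tensor_induction₂ (P := fun x y => TensorProduct.map₂ m b x y =
    ε • TensorProduct.map₂ m b y x) ?_ ?_ ?_ ?_ ?_ x y
  · intro y; simp only [map_zero, LinearMap.zero_apply, smul_zero]
  · intro y; simp only [map_zero, LinearMap.zero_apply, smul_zero]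
  · intro x x' y h1 h2; simp only [map_add, LinearMap.add_apply, h1, h2, smul_add]
  · intro x y y' h1 h2; simp only [map_add, LinearMap.add_apply, h1, h2, smul_add]
  · intro a e b f
    exact h _ _ _ _

theorem brT_swap (x y : (superTrans K).Pt q) : brT K q x y = -brT K q y x := by
  rw [brT_apply, brT_apply]
  refine Prod.ext ((map₂_swap _ _ (-1 : ℝ) ?_ x.2 y.2).trans
    (neg_one_smul ℝ (_ : Ev q ⊗[ℝ] Vec K)))
    (neg_zero (G := Od q ⊗[ℝ] Spinor K)).symm
  intro a a' (e : Spinor K) (e' : Spinor K)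
  rw [odMulRev_swap, spinorBracket_comm]
  exact (TensorProduct.neg_tmul _ _).trans (neg_one_smul ℝ _).symm

theorem minkT_swap (x y : (superTrans K).Pt q) : minkT K q x y = minkT K q y x := by
  rw [minkT_apply, minkT_apply]
  refine Prod.ext ((map₂_swap _ _ (1 : ℝ) ?_ x.1 y.1).trans (one_smul _ _)) rfl
  intro a a' e e'
  rw [minkowski_comm, one_smul, LinearMap.mul_apply', ev_mul_comm]
  rfl

theorem brT_brT_left (x y z : (superTrans K).Pt q) : brT K q (brT K q x y) z = 0 := by
  rw [brT_apply x y, brT_apply, map_zero]; rfl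

/-- A cyclic permutation of three odd factors is even and costs no sign. This is why the cyclic
identity of `IsStringPair` pairs the arguments in the order y, z, w up to rotation and needs no
signs. -/
theorem odMulRev_mul_cyclic (x y z w : Od q) :
    LinearMap.mul ℝ (Ev q) (odMulRev q x z) (odMulRev q w y) =
      LinearMap.mul ℝ (Ev q) (odMulRev q x y) (odMulRev q z w) := by
  refine Subtype.ext ?_
  change (z : Gr q) * x * (y * w) = y * x * (w * z)
  rw [od_anticommute w.2 z.2, mul_neg, ev_commute (od_mul_od_mem y.2 x.2) ((z : Gr q) * w),
    od_anticommute y.2 x.2, mul_neg, neg_neg, mul_assoc, mul_assoc (z : Gr q) w,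
    ← ev_commute (od_mul_od_mem x.2 y.2) (w : Gr q), mul_assoc]

theorem odMulRev_mul_cyclic' (x y z w : Od q) :
    LinearMap.mul ℝ (Ev q) (odMulRev q x w) (odMulRev q y z) =
      LinearMap.mul ℝ (Ev q) (odMulRev q x y) (odMulRev q z w) := by
  rw [odMulRev_swap y z, odMulRev_swap z w, map_neg, map_neg]
  exact congrArg _ (odMulRev_mul_cyclic x y w z)

/-- Collects all that the group law and the cochain use. Nilpotency is immediate, as brackets are
vectors and brackets of vectors vanish; the cyclic identity is the 3-ψ rule with odd coefficients.
-/
theorem isStringPair (K : Type) [NormedAddCommGroup K] [InnerProductSpace ℝ K]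
    [FiniteDimensional ℝ K] [NormedDivAlg K] (q : ℕ) : 
    IsStringPair (P := (superTrans K).Pt q) (L := SVect.line.Pt q) (brT K q) (minkT K q) where
  swap := brT_swap
  nil := brT_brT_left
  comm := minkT_swap
  cyclic x y z w := by
    simp only [brT_apply, minkT_apply]
    refine Prod.ext (map₂_cyclic (odMulRev q) (LinearMap.mul ℝ (Ev q)) (spinorBracket K)
      (minkowski K) (fun x y z w => ?_) odMulRev_mul_cyclic odMulRev_mul_cyclic' x.2 y.2 z.2 w.2)
      ((add_zero _).trans (add_zero _))
    rw [spinorBracket_comm w y]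
    exact minkowski_spinorBracket_cyclic x y z w

theorem transGroup_mul (x y : (superTrans K).Pt q) :
    (transGroup K).mul q x y = IsStringPair.bch (brT K q) x y := by
  rw [IsStringPair.bch, ← brA_transBracket]; rfl

theorem transGroup_mul_assoc (x y z : (superTrans K).Pt q) :
    (transGroup K).mul q ((transGroup K).mul q x y) z =
      (transGroup K).mul q x ((transGroup K).mul q y z) := by
  rw [transGroup_mul, transGroup_mul, transGroup_mul, transGroup_mul]
  exact (isStringPair K q).bch_assoc x y z

theorem isSupergroup_transGroup : IsSupergroup (transGroup K) where
  manifold := isSupermanifold_affine _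
  smooth_mul := by
    have p1 := isSmoothOn_pfst (V := superTrans K) (W := superTrans K) Set.univ
    have p2 := isSmoothOn_psnd (V := superTrans K) (W := superTrans K) Set.univ
    have h := (p1.add p2).add ((p1.bil openSet_univ p2 (Y := superTrans K) 0 0
      (spinorBracket K)).const_smul openSet_univ (1 / 2))
    refine IsSMap.of_smooth ?_ fun _ _ _ => Set.mem_univ _
    refine h.congr (openSet_univ (E := ((superTrans K).prod (superTrans K)).E)) fun q x _ => ?_
    exact transGroup_mul _ _
  smooth_inv := by
    have h := IsSMap.neg (IsSMap.id (M := affine (superTrans K)))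
    exact h
  smooth_one := isSMap_zero
  mul_assoc q x _ y _ z _ := transGroup_mul_assoc x y z
  one_mul q x _ := (transGroup_mul 0 x).trans (IsStringPair.zero_bch (P := (superTrans K).Pt q) x)
  mul_one q x _ := (transGroup_mul x 0).trans (IsStringPair.bch_zero (P := (superTrans K).Pt q) x)
  inv_mul q x _ := (transGroup_mul (-x) x).trans ((isStringPair K q).neg_bch x)
  mul_inv q x _ := (transGroup_mul x (-x)).trans ((isStringPair K q).bch_neg x)

variable (K q) in
/-- The cubic cochain `α_A(x, y, z) + ½ g([x, y], [y, z])` on the supertranslation group. -/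
def cubic (x y z : (superTrans K).Pt q) : SVect.line.Pt q :=
  omegaT K q x y z + (1 / 2 : ℝ) • minkT K q (brT K q x y) (brT K q y z)

theorem cubic_cocycle (x y z w : (superTrans K).Pt q) :
    cubic K q y z w - cubic K q ((transGroup K).mul q x y) z w +
      cubic K q x ((transGroup K).mul q y z) w - cubic K q x y ((transGroup K).mul q z w) +
      cubic K q x y z = 0 := by
  rw [transGroup_mul, transGroup_mul, transGroup_mul]
  exact (isStringPair K q).cubicForm_cocycle x y z w

theorem cubic_zero_left (y z : (superTrans K).Pt q) : cubic K q 0 y z = 0 := by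
  rw [cubic, omegaT]
  simp only [map_zero, LinearMap.zero_apply, sub_zero, zero_add, smul_zero]

theorem cubic_zero_mid (y z : (superTrans K).Pt q) : cubic K q y 0 z = 0 := by
  rw [cubic, omegaT]
  simp only [map_zero, LinearMap.zero_apply, sub_zero, zero_add, smul_zero]

theorem cubic_zero_right (y z : (superTrans K).Pt q) : cubic K q y z 0 = 0 := by
  rw [cubic, omegaT]
  simp only [map_zero, LinearMap.zero_apply, sub_zero, zero_add, smul_zero]

section Smooth

variable {X : SVect} {U : Set X.E} {f g h : ∀ q, X.Pt q → (superTrans K).Pt q}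

theorem IsSmoothOn.brT (hU : OpenSet U) (hf : IsSmoothOn X (superTrans K) U f)
    (hg : IsSmoothOn X (superTrans K) U g) :
    IsSmoothOn X (superTrans K) U fun q z => SuperString.brT K q (f q z) (g q z) :=
  hf.bil hU hg (Y := superTrans K) 0 0 (spinorBracket K)

theorem IsSmoothOn.minkT (hU : OpenSet U) (hf : IsSmoothOn X (superTrans K) U f)
    (hg : IsSmoothOn X (superTrans K) U g) :
    IsSmoothOn X SVect.line U fun q z => SuperString.minkT K q (f q z) (g q z) :=
  hf.bil hU hg (Y := SVect.line) (minkowski K) 0 0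

theorem IsSmoothOn.cubic (hU : OpenSet U) (hf : IsSmoothOn X (superTrans K) U f)
    (hg : IsSmoothOn X (superTrans K) U g) (hh : IsSmoothOn X (superTrans K) U h) :
    IsSmoothOn X SVect.line U fun q z => SuperString.cubic K q (f q z) (g q z) (h q z) := by
  have h1 := (hf.minkT hU (hg.brT hU hh)).add ((hg.minkT hU (hf.brT hU hh)).neg hU)
  have h2 := (h1.add (hh.minkT hU (hf.brT hU hg))).add
    (((hf.brT hU hg).minkT hU (hg.brT hU hh)).const_smul hU (1 / 2))
  refine h2.congr hU fun q z _ => ?_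
  rw [SuperString.cubic, omegaT, sub_eq_add_neg]

theorem isSmoothOn_cubic :
    IsSmoothOn ((superTrans K).prod ((superTrans K).prod (superTrans K))) SVect.line Set.univ
      fun q z => cubic K q (SVect.pfst z) (SVect.pfst (SVect.psnd z))
        (SVect.psnd (SVect.psnd z)) := by
  have p := isSmoothOn_psnd (V := superTrans K) (W := (superTrans K).prod (superTrans K)) Set.univ
  exact (isSmoothOn_pfst Set.univ).cubic openSet_univ (p.pfst openSet_univ) (p.psnd openSet_univ)

end Smooth

/-! ### Integration over simplices -/

namespace IsStringPair

variable {P L : Type} [AddCommGroup P] [Module ℝ P] [AddCommGroup L] [Module ℝ L]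
  {br : P →ₗ[ℝ] P →ₗ[ℝ] P} {g : P →ₗ[ℝ] P →ₗ[ℝ] L}

theorem neg_bch_eq (h : IsStringPair br g) (x y : P) : -bch br x y = bch br (-y) (-x) := by
  simp only [bch, map_neg, LinearMap.neg_apply, neg_neg]
  rw [h.swap x y]
  module

/-- Left invariance: a common left factor drops out of the quotient of two points. It removes base
vertices from simplices. -/
theorem bch_neg_bch (h : IsStringPair br g) (x y z : P) :
    bch br (-bch br x y) (bch br x z) = bch br (-y) z := by
  rw [h.neg_bch_eq, h.bch_assoc, ← h.bch_assoc (-x), h.neg_bch, zero_bch]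

variable (br) in
/-- The simplex `a (x · b (y · c z))`. -/
def cone (x y z : P) (a b c : ℝ) : P := a • bch br x (b • bch br y (c • z))

/-- 2-step nilpotency makes the group difference of two points of the cone polynomial. Expressed in
a, ab, abc it is of degree two, and every coefficient vanishes when the two points coincide, so that
the left-invariant derivative can be read off term by term. -/
theorem neg_cone_bch_cone (h : IsStringPair br g) (x y z : P) (a b c a' b' c' : ℝ) :
    bch br (-cone br x y z a b c) (cone br x y z a' b' c') =
      (a' - a) • x + (a' * b' - a * b) • y + (a' * b' * c' - a * b * c) • z +
      ((1 / 2) * (a' * b' - a * b) - (1 / 2) * (a * (a' * b') - a * b * a')) • br x y +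
      ((1 / 2) * (a' * b' * c' - a * b * c) -
        (1 / 2) * (a * (a' * b' * c') - a * b * c * a')) • br x z +
      ((1 / 2) * (a' * b' * c' - a * b * c) -
        (1 / 2) * (a * b * (a' * b' * c') - a * b * c * (a' * b'))) • br y z := by
  simp only [cone, bch, map_add, map_smul, map_neg, LinearMap.add_apply, LinearMap.smul_apply,
    LinearMap.neg_apply, h.nil, h.nil_right, smul_zero, smul_add, add_zero, h.self, zero_add,
    neg_zero]
  rw [h.swap y x, h.swap z x, h.swap z y]
  module

variable (br) in
/-- The left-invariant derivative of `cone` in the direction in which the functions `a`, `a b` and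
`a b c` have the derivatives `u'`, `w'` and `z'`. -/
def coneDeriv (x y z : P) (u w t u' w' t' : ℝ) : P :=
  u' • (x + (w / 2) • br x y + (t / 2) • br x z) +
    w' • (y + ((1 - u) / 2) • br x y + (t / 2) • br y z) +
    t' • (z + ((1 - u) / 2) • br x z + ((1 - w) / 2) • br y z)

/-- The form is alternating on A-points, so on three combinations of the same three elements it is
multiplied by the determinant of the coefficients. -/
theorem form_det (h : IsStringPair br g) (A B C : P) (u₁ u₂ u₃ w₁ w₂ w₃ t₁ t₂ t₃ : ℝ) :
    form br g (u₁ • A + w₁ • B + t₁ • C) (u₂ • A + w₂ • B + t₂ • C)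
      (u₃ • A + w₃ • B + t₃ • C) =
    (u₁ * (w₂ * t₃ - w₃ * t₂) - u₂ * (w₁ * t₃ - w₃ * t₁) + u₃ * (w₁ * t₂ - w₂ * t₁)) •
      form br g A B C := by
  simp only [form, map_add, map_smul, LinearMap.add_apply, LinearMap.smul_apply, h.self,
    smul_zero, add_zero, zero_add]
  rw [h.swap B A, h.swap C A, h.swap C B]
  simp only [map_neg]
  module

/-- Brackets of the three direction vectors only see x, y, z, so their bracket corrections enter
linearly. By symmetry of `g` the contributions of u and t cancel, while w/2 and (1-w)/2 add up to
the constant 1/2 in front of g([x,y],[y,z]). The integrand is thus a scalar function times a fixed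
element. -/
theorem form_coneDeriv (h : IsStringPair br g) (x y z : P)
    (u w t u₁ u₂ u₃ w₁ w₂ w₃ t₁ t₂ t₃ : ℝ) :
    form br g (coneDeriv br x y z u w t u₁ w₁ t₁) (coneDeriv br x y z u w t u₂ w₂ t₂)
      (coneDeriv br x y z u w t u₃ w₃ t₃) =
    (u₁ * (w₂ * t₃ - w₃ * t₂) - u₂ * (w₁ * t₃ - w₃ * t₁) + u₃ * (w₁ * t₂ - w₂ * t₁)) •
      cubicForm br g x y z := by
  rw [coneDeriv, coneDeriv, coneDeriv, h.form_det]
  congr 1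
  simp only [cubicForm, form, map_add, map_smul, LinearMap.add_apply, LinearMap.smul_apply,
    h.nil, h.nil_right, smul_zero, add_zero]
  rw [h.comm (br y z) (br x y), h.comm (br x z) (br x y), h.comm (br y z) (br x z)]
  module

end IsStringPair

/-! ### Derivatives of curves and integrals over the standard simplex. -/

section CurveDeriv

variable {E : Type} [AddCommGroup E] [Module ℝ E] [Module.Finite ℝ E]

theorem curveDeriv_eq {c : ℝ → E} {D : E} (h : ∀ l : E →ₗ[ℝ] ℝ, HasDerivAt (fun t => l (c t)) (l D) 0) :
    curveDeriv c = D := by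
  rw [curveDeriv, LinearEquiv.symm_apply_eq]
  funext i
  exact (h ((LinearMap.proj i).comp (Module.finBasis ℝ E).equivFun.toLinearMap)).deriv

/-- A constant factor can be taken out of the integral of a real function without any integrability
assumption, so nothing has to be known about `J`. -/
theorem vecIntegral_smul {p : ℕ} (S : Set (Fin p → ℝ)) (hS : MeasurableSet S) (f : (Fin p → ℝ) → E) (J : (Fin p → ℝ) → ℝ)
    (v : E) (h : ∀ᵐ x, x ∈ S → f x = J x • v) :
    vecIntegral S f = (∫ x in S, J x) • v := by
  rw [vecIntegral, LinearEquiv.symm_apply_eq]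
  funext i
  rw [map_smul, Pi.smul_apply, smul_eq_mul, ← MeasureTheory.integral_mul_const]
  refine MeasureTheory.setIntegral_congr_ae hS ?_
  filter_upwards [h] with x hx hxS
  rw [hx hxS, map_smul]
  rfl

/-- From an interior point one can move a little way along any direction inside the simplex; the
directions that decrease one coordinate or increase the sum make the inequalities strict. -/
theorem stdSimplexCoords_pos_of_mem_interior {p : ℕ} {x : Fin p → ℝ}
    (hx : x ∈ interior (stdSimplexCoords p)) (hp : 0 < p) : (∀ i, 0 < x i) ∧ ∑ i, x i < 1 := by
  have key : ∀ v : Fin p → ℝ, ∃ t : ℝ, 0 < t ∧ x + t • v ∈ stdSimplexCoords p := by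
    intro v
    have h1 : Filter.Tendsto (fun t : ℝ => x + t • v) (𝓝[>] 0) (𝓝 x) := by
      have : Continuous fun t : ℝ => x + t • v := by fun_prop
      have h2 := this.tendsto 0
      simp only [zero_smul, add_zero] at h2
      exact h2.mono_left nhdsWithin_le_nhds
    have h3 := (h1.eventually (mem_interior_iff_mem_nhds.1 hx)).and self_mem_nhdsWithin
    obtain ⟨t, ht, ht0⟩ := h3.exists
    exact ⟨t, ht0, ht⟩
  constructor
  · intro i
    obtain ⟨t, ht, h⟩ := key (-Pi.single i 1)
    have := h.1 i
    simp at this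
    linarith
  · obtain ⟨t, ht, h⟩ := key (Pi.single ⟨0, hp⟩ 1)
    have := h.2
    simp [Finset.sum_add_distrib, ← Finset.mul_sum, Pi.single_apply] at this
    linarith

theorem convex_stdSimplexCoords (p : ℕ) : Convex ℝ (stdSimplexCoords p) := by
  intro x hx y hy a b ha hb hab
  refine ⟨fun i => ?_, ?_⟩
  · have := hx.1 i
    have := hy.1 i
    simp only [Pi.add_apply, Pi.smul_apply, smul_eq_mul]
    positivity
  · simp only [Pi.add_apply, Pi.smul_apply, smul_eq_mul, Finset.sum_add_distrib, ← Finset.mul_sum]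
    nlinarith [hx.2, hy.2]

theorem isClosed_stdSimplexCoords (p : ℕ) : IsClosed (stdSimplexCoords p) := by
  refine IsClosed.inter (s₁ := {x | ∀ i, 0 ≤ x i}) (s₂ := {x : Fin p → ℝ | ∑ i, x i ≤ 1}) ?_ ?_
  · rw [Set.setOf_forall]
    exact isClosed_iInter fun i => isClosed_le continuous_const (continuous_apply i)
  · exact isClosed_le (by fun_prop) continuous_const

/-- The boundary of a convex set is a null set. Only the open simplex has to be considered, where
the denominators in the apex-base construction are positive and the smoothing factor is
differentiable. -/
theorem ae_stdSimplexCoords {p : ℕ} (hp : 0 < p) {Q : (Fin p → ℝ) → Prop}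
    (h : ∀ x : Fin p → ℝ, (∀ i, 0 < x i) → ∑ i, x i < 1 → Q x) :
    ∀ᵐ x, x ∈ stdSimplexCoords p → Q x := by
  have h0 := (convex_stdSimplexCoords p).addHaar_frontier MeasureTheory.volume
  filter_upwards [MeasureTheory.measure_eq_zero_iff_ae_notMem.1 h0] with x hx hxS
  have h1 : x ∈ interior (stdSimplexCoords p) := by
    by_contra h2
    exact hx ⟨subset_closure hxS, h2⟩
  have h3 := stdSimplexCoords_pos_of_mem_interior h1 hp
  exact h x h3.1 h3.2

end CurveDeriv

/-! ### The standard 3-simplices of the supertranslation group and the integral of α over them. -/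

section Simplex

variable {K : Type} [NormedAddCommGroup K] [InnerProductSpace ℝ K] [FiniteDimensional ℝ K]
  [NormedDivAlg K] {q : ℕ}

open IsStringPair

/-- Unrolling the apex-base recursion, the successive left translations telescope, and only the
quotients of consecutive vertices remain inside the nested cone. -/
theorem simplex_three (l : ℝ → ℝ) (x : Fin 4 → ℝ) (g : Fin 4 → (superTrans K).Pt q) :
    simplex (transBracket K) l q 3 x g = bch (brT K q) (g 0) (cone (brT K q)
      (bch (brT K q) (-g 0) (g 1)) (bch (brT K q) (-g 1) (g 2)) (bch (brT K q) (-g 2) (g 3))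
      (l (1 - x 0)) (l (1 - x 1 / (1 - x 0)))
      (l (1 - x 2 / (1 - x 0) / (1 - x 1 / (1 - x 0))))) := by
  have hm : ∀ x y : (superTrans K).Pt q, (expGroup (superTrans K) (transBracket K)).mul q x y =
    bch (brT K q) x y := transGroup_mul
  have hi : ∀ x : (superTrans K).Pt q, (expGroup (superTrans K) (transBracket K)).inv q x = -x :=
    fun _ => rfl
  have h := (isStringPair K q).bch_neg_bch
  simp only [simplex, hm, hi, cone]
  rw [h, h, h]
  rfl

/-- The scalar functions `a`, `a b` and `a b c` of the barycentric coordinates, for which a simplex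
is `g₀ · a (n₁ · b (n₂ · c n₃))`. -/
def simplexFun (l : ℝ → ℝ) (y : Fin 3 → ℝ) : Fin 3 → ℝ :=
  ![l (1 - bary y 0), l (1 - bary y 0) * l (1 - bary y 1 / (1 - bary y 0)),
    l (1 - bary y 0) * l (1 - bary y 1 / (1 - bary y 0)) *
      l (1 - bary y 2 / (1 - bary y 0) / (1 - bary y 1 / (1 - bary y 0)))]

/-- The endpoints are excluded because nothing is assumed about the function outside [0,1]. -/
theorem IsSmoothingFactor.differentiableAt {l : ℝ → ℝ} (hl : IsSmoothingFactor l) {t : ℝ}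
    (h0 : 0 < t) (h1 : t < 1) : DifferentiableAt ℝ l t :=
  (hl.smooth.differentiableOn (by simp)).differentiableAt (Icc_mem_nhds h0 h1)

/-- The three arguments of the smoothing factor are y₀+y₁+y₂, (y₁+y₂)/(y₀+y₁+y₂) and y₂/(y₁+y₂). In
the open simplex they lie strictly between 0 and 1 and the denominators are positive. -/
theorem differentiableAt_simplexFun {l : ℝ → ℝ} (hl : IsSmoothingFactor l) {y : Fin 3 → ℝ}
    (hy : ∀ i, 0 < y i) (hy1 : ∑ i, y i < 1) (j : Fin 3) :
    DifferentiableAt ℝ (fun y => simplexFun l y j) y := by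
  have h0 := hy 0
  have h1 := hy 1
  have h2 := hy 2
  rw [Fin.sum_univ_three] at hy1
  have b0 : ∀ z : Fin 3 → ℝ, bary z 0 = 1 - (z 0 + z 1 + z 2) := fun z => by
    rw [← Fin.sum_univ_three]; rfl
  have b1 : ∀ z : Fin 3 → ℝ, bary z 1 = z 0 := fun z => rfl
  have b2 : ∀ z : Fin 3 → ℝ, bary z 2 = z 1 := fun z => rfl
  have p : ∀ i : Fin 3, DifferentiableAt ℝ (fun z : Fin 3 → ℝ => z i) y := fun i => by fun_prop
  have pb1 : DifferentiableAt ℝ (fun z => bary z 1) y := p 0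
  have pb2 : DifferentiableAt ℝ (fun z => bary z 2) y := p 1
  have d0 : DifferentiableAt ℝ (fun z => 1 - bary z 0) y := by
    simp only [b0]; fun_prop
  have d1 : DifferentiableAt ℝ (fun z => 1 - bary z 1 / (1 - bary z 0)) y := by
    have hne : 1 - bary y 0 ≠ 0 := by rw [b0]; linarith
    simp only [div_eq_mul_inv]
    exact (pb1.mul (d0.inv hne)).const_sub 1
  have e1 : 1 - bary y 1 / (1 - bary y 0) = (y 1 + y 2) / (y 0 + y 1 + y 2) := by
    rw [b0, b1, sub_sub_cancel]; field_simp; ring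
  have d2 : DifferentiableAt ℝ
      (fun z => 1 - bary z 2 / (1 - bary z 0) / (1 - bary z 1 / (1 - bary z 0))) y := by
    have hne : 1 - bary y 0 ≠ 0 := by rw [b0]; linarith
    have hne1 : 1 - bary y 1 / (1 - bary y 0) ≠ 0 := by rw [e1]; positivity
    simp only [div_eq_mul_inv] at d1 hne1 ⊢
    exact ((pb2.mul (d0.inv hne)).mul (d1.inv hne1)).const_sub 1
  have e2 : 1 - bary y 2 / (1 - bary y 0) / (1 - bary y 1 / (1 - bary y 0)) =
      y 2 / (y 1 + y 2) := by
    rw [e1, b0, b2, sub_sub_cancel]; field_simp; ring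
  have l0 : DifferentiableAt ℝ (fun z => l (1 - bary z 0)) y :=
    DifferentiableAt.comp (g := l) y (hl.differentiableAt (by rw [b0]; linarith)
      (by rw [b0]; linarith)) d0
  have l1 : DifferentiableAt ℝ (fun z => l (1 - bary z 1 / (1 - bary z 0))) y :=
    DifferentiableAt.comp (g := l) y (hl.differentiableAt (by rw [e1]; positivity)
      (by rw [e1, div_lt_one (by positivity)]; linarith)) d1
  have l2 : DifferentiableAt ℝ
      (fun z => l (1 - bary z 2 / (1 - bary z 0) / (1 - bary z 1 / (1 - bary z 0)))) y :=
    DifferentiableAt.comp (g := l) y (hl.differentiableAt (by rw [e2]; positivity)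
      (by rw [e2, div_lt_one (by positivity)]; linarith)) d2
  fin_cases j
  · exact l0
  · exact l0.mul l1
  · exact (l0.mul l1).mul l2

/-- The derivatives of `simplexFun`. -/
def simplexFunDeriv (l : ℝ → ℝ) (y : Fin 3 → ℝ) (i j : Fin 3) : ℝ :=
  deriv (fun t : ℝ => simplexFun l (y + t • Pi.single i 1) j) 0

/-- The base vertex drops out by left invariance, and the explicit difference of cone points is
differentiated after applying a linear functional, which leaves a scalar computation in the three
functions a, ab, abc. -/
theorem leftDeriv_eq {l : ℝ → ℝ} (hl : IsSmoothingFactor l) {y : Fin 3 → ℝ}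
    (hy : ∀ i, 0 < y i) (hy1 : ∑ i, y i < 1) (g : Fin 4 → (superTrans K).Pt q) (i : Fin 3) :
    leftDeriv (transBracket K) l q g y i = coneDeriv (brT K q)
      (bch (brT K q) (-g 0) (g 1)) (bch (brT K q) (-g 1) (g 2)) (bch (brT K q) (-g 2) (g 3))
      (simplexFun l y 0) (simplexFun l y 1) (simplexFun l y 2) (simplexFunDeriv l y i 0)
      (simplexFunDeriv l y i 1) (simplexFunDeriv l y i 2) := by
  have hd : ∀ j, HasDerivAt (fun t : ℝ => simplexFun l (y + t • Pi.single i 1) j)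
      (simplexFunDeriv l y i j) 0 := by
    intro j
    refine DifferentiableAt.hasDerivAt ?_
    refine DifferentiableAt.comp (g := fun y => simplexFun l y j) (0 : ℝ) ?_ (by fun_prop)
    rw [zero_smul, add_zero]
    exact differentiableAt_simplexFun hl hy hy1 j
  refine curveDeriv_eq fun L => ?_
  set x := bch (brT K q) (-g 0) (g 1)
  set z := bch (brT K q) (-g 1) (g 2)
  set w := bch (brT K q) (-g 2) (g 3)
  have e : ∀ t : ℝ, L ((expGroup (superTrans K) (transBracket K)).mul q
      ((expGroup (superTrans K) (transBracket K)).inv q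
        (simplex (transBracket K) l q 3 (bary y) g))
      (simplex (transBracket K) l q 3 (bary (y + t • Pi.single i 1)) g)) =
      (simplexFun l (y + t • Pi.single i 1) 0 - simplexFun l y 0) * L x +
      (simplexFun l (y + t • Pi.single i 1) 1 - simplexFun l y 1) * L z +
      (simplexFun l (y + t • Pi.single i 1) 2 - simplexFun l y 2) * L w +
      ((1 / 2) * (simplexFun l (y + t • Pi.single i 1) 1 - simplexFun l y 1) -
        (1 / 2) * (simplexFun l y 0 * simplexFun l (y + t • Pi.single i 1) 1 -
          simplexFun l y 1 * simplexFun l (y + t • Pi.single i 1) 0)) * L (brT K q x z) +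
      ((1 / 2) * (simplexFun l (y + t • Pi.single i 1) 2 - simplexFun l y 2) -
        (1 / 2) * (simplexFun l y 0 * simplexFun l (y + t • Pi.single i 1) 2 -
          simplexFun l y 2 * simplexFun l (y + t • Pi.single i 1) 0)) * L (brT K q x w) +
      ((1 / 2) * (simplexFun l (y + t • Pi.single i 1) 2 - simplexFun l y 2) -
        (1 / 2) * (simplexFun l y 1 * simplexFun l (y + t • Pi.single i 1) 2 -
          simplexFun l y 2 * simplexFun l (y + t • Pi.single i 1) 1)) * L (brT K q z w) := by
    intro t
    rw [simplex_three, simplex_three]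
    refine (congrArg L (transGroup_mul _ _)).trans ?_
    refine (congrArg L (((isStringPair K q).bch_neg_bch _ _ _).trans
      ((isStringPair K q).neg_cone_bch_cone _ _ _ _ _ _ _ _ _))).trans ?_
    simp only [map_add, map_smul, smul_eq_mul]
    rfl
  have h0 := hd 0
  have h1 := hd 1
  have h2 := hd 2
  have main := ((((((h0.sub_const (simplexFun l y 0)).mul_const (L x)).add
    ((h1.sub_const (simplexFun l y 1)).mul_const (L z))).add
    ((h2.sub_const (simplexFun l y 2)).mul_const (L w))).add
    ((((h1.sub_const (simplexFun l y 1)).const_mul (1 / 2)).sub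
      (((h1.const_mul (simplexFun l y 0)).sub
        (h0.const_mul (simplexFun l y 1))).const_mul (1 / 2))).mul_const (L (brT K q x z)))).add
    ((((h2.sub_const (simplexFun l y 2)).const_mul (1 / 2)).sub
      (((h2.const_mul (simplexFun l y 0)).sub
        (h0.const_mul (simplexFun l y 2))).const_mul (1 / 2))).mul_const (L (brT K q x w)))).add
    ((((h2.sub_const (simplexFun l y 2)).const_mul (1 / 2)).sub
      (((h2.const_mul (simplexFun l y 1)).sub
        (h1.const_mul (simplexFun l y 2))).const_mul (1 / 2))).mul_const (L (brT K q z w)))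
  rw [show (fun t : ℝ => L ((expGroup (superTrans K) (transBracket K)).mul q
      ((expGroup (superTrans K) (transBracket K)).inv q
        (simplex (transBracket K) l q 3 (bary y) g))
      (simplex (transBracket K) l q 3 (bary (y + t • Pi.single i 1)) g))) = _ from funext e]
  refine HasDerivAt.congr_deriv main ?_
  simp only [coneDeriv, map_add, map_smul, smul_eq_mul]
  ring

/-- The Jacobian determinant of `simplexFun`. -/
def simplexJac (l : ℝ → ℝ) (y : Fin 3 → ℝ) : ℝ :=
  simplexFunDeriv l y 0 0 * (simplexFunDeriv l y 1 1 * simplexFunDeriv l y 2 2 -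
      simplexFunDeriv l y 2 1 * simplexFunDeriv l y 1 2) -
    simplexFunDeriv l y 1 0 * (simplexFunDeriv l y 0 1 * simplexFunDeriv l y 2 2 -
      simplexFunDeriv l y 2 1 * simplexFunDeriv l y 0 2) +
    simplexFunDeriv l y 2 0 * (simplexFunDeriv l y 0 1 * simplexFunDeriv l y 1 2 -
      simplexFunDeriv l y 1 1 * simplexFunDeriv l y 0 2)

/-- The integral of the left-invariant form over a simplex is a multiple of the cubic cochain. -/
theorem integralSimplex_alpha {l : ℝ → ℝ} (hl : IsSmoothingFactor l)
    (g : Fin 4 → (superTrans K).Pt q) :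
    integralSimplex (transBracket K) l (alpha K) q g =
      (∫ y in stdSimplexCoords 3, simplexJac l y) • cubic K q
        (bch (brT K q) (-g 0) (g 1)) (bch (brT K q) (-g 1) (g 2)) (bch (brT K q) (-g 2) (g 3)) := by
  have h2 : Subsingleton (Od q ⊗[ℝ] PUnit) := inferInstance
  refine Prod.ext ?_ (@Subsingleton.elim _ h2 _ _)
  refine vecIntegral_smul (E := Ev q ⊗[ℝ] ℝ) _ (isClosed_stdSimplexCoords 3).measurableSet _ _ _
    (ae_stdSimplexCoords (by norm_num) fun y hy hy1 => ?_)
  rw [omegaA_alpha, leftDeriv_eq hl hy hy1, leftDeriv_eq hl hy hy1, leftDeriv_eq hl hy hy1]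
  exact congrArg Prod.fst ((isStringPair K q).form_coneDeriv _ _ _ _ _ _ _ _ _ _ _ _ _ _ _)

end Simplex

/-! ### The Lorentz group and its action on superspacetime -/

section Multilinear

variable {A B C D E F : Type} [AddCommGroup A] [Module ℝ A] [AddCommGroup B] [Module ℝ B]
  [AddCommGroup C] [Module ℝ C] [AddCommGroup D] [Module ℝ D] [AddCommGroup E] [Module ℝ E]
  [AddCommGroup F] [Module ℝ F]
  {A' B' C' D' E' F' : Type} [AddCommGroup A'] [Module ℝ A'] [AddCommGroup B'] [Module ℝ B']
  [AddCommGroup C'] [Module ℝ C'] [AddCommGroup D'] [Module ℝ D'] [AddCommGroup E'] [Module ℝ E']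
  [AddCommGroup F'] [Module ℝ F']
  {A'' B'' : Type} [AddCommGroup A''] [Module ℝ A''] [AddCommGroup B''] [Module ℝ B'']

/-- An associativity law between bilinear maps of tensor products follows from such laws for
the factors. -/
theorem map₂_assoc {m₁ : A →ₗ[ℝ] B →ₗ[ℝ] D} {m₂ : D →ₗ[ℝ] C →ₗ[ℝ] F} {m₃ : B →ₗ[ℝ] C →ₗ[ℝ] E}
    {m₄ : A →ₗ[ℝ] E →ₗ[ℝ] F} {b₁ : A' →ₗ[ℝ] B' →ₗ[ℝ] D'} {b₂ : D' →ₗ[ℝ] C' →ₗ[ℝ] F'}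
    {b₃ : B' →ₗ[ℝ] C' →ₗ[ℝ] E'} {b₄ : A' →ₗ[ℝ] E' →ₗ[ℝ] F'} (L : A'' →ₗ[ℝ] A')
    (M : B'' →ₗ[ℝ] B') (hm : ∀ x y z, m₂ (m₁ x y) z = m₄ x (m₃ y z))
    (hb : ∀ x y z, b₂ (b₁ (L x) (M y)) z = b₄ (L x) (b₃ (M y) z))
    (x : A ⊗[ℝ] A'') (y : B ⊗[ℝ] B'') (z : C ⊗[ℝ] C') :
    TensorProduct.map₂ m₂ b₂ (TensorProduct.map₂ m₁ b₁ (TensorProduct.map LinearMap.id L x)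
        (TensorProduct.map LinearMap.id M y)) z =
      TensorProduct.map₂ m₄ b₄ (TensorProduct.map LinearMap.id L x)
        (TensorProduct.map₂ m₃ b₃ (TensorProduct.map LinearMap.id M y) z) := by
  induction x with
  | zero => simp only [map_zero, LinearMap.zero_apply]
  | add s s' h h' => simp only [map_add, LinearMap.add_apply, h, h']
  | tmul a0 e0 =>
  induction y with
  | zero => simp only [map_zero, LinearMap.zero_apply]
  | add s s' h h' => simp only [map_add, LinearMap.add_apply, h, h']
  | tmul a1 e1 =>
  induction z with
  | zero => simp only [map_zero]
  | add s s' h h' => simp only [map_add, h, h']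
  | tmul a2 e2 =>
    exact congrArg₂ (· ⊗ₜ[ℝ] ·) (hm _ _ _) (hb _ _ _)

/-- A commutation law between bilinear maps of tensor products follows from such laws for
the factors. -/
theorem map₂_left_comm {m₁ : B →ₗ[ℝ] C →ₗ[ℝ] D} {m₂ : A →ₗ[ℝ] D →ₗ[ℝ] F} {m₃ : A →ₗ[ℝ] C →ₗ[ℝ] E}
    {m₄ : B →ₗ[ℝ] E →ₗ[ℝ] F} {b₁ : B' →ₗ[ℝ] C' →ₗ[ℝ] D'} {b₂ : A' →ₗ[ℝ] D' →ₗ[ℝ] F'}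
    {b₃ : A' →ₗ[ℝ] C' →ₗ[ℝ] E'} {b₄ : B' →ₗ[ℝ] E' →ₗ[ℝ] F'}
    (hm : ∀ x y z, m₂ x (m₁ y z) = m₄ y (m₃ x z)) (hb : ∀ x y z, b₂ x (b₁ y z) = b₄ y (b₃ x z))
    (x : A ⊗[ℝ] A') (y : B ⊗[ℝ] B') (z : C ⊗[ℝ] C') :
    TensorProduct.map₂ m₂ b₂ x (TensorProduct.map₂ m₁ b₁ y z) =
      TensorProduct.map₂ m₄ b₄ y (TensorProduct.map₂ m₃ b₃ x z) := by
  induction x with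
  | zero => simp only [map_zero, LinearMap.zero_apply]
  | add s s' h h' => simp only [map_add, LinearMap.add_apply, h, h']
  | tmul a0 e0 =>
  induction y with
  | zero => simp only [map_zero, LinearMap.zero_apply]
  | add s s' h h' => simp only [map_add, LinearMap.add_apply, h, h']
  | tmul a1 e1 =>
  induction z with
  | zero => simp only [map_zero]
  | add s s' h h' => simp only [map_add, h, h']
  | tmul a2 e2 =>
    exact congrArg₂ (· ⊗ₜ[ℝ] ·) (hm _ _ _) (hb _ _ _)

/-- An adjunction between bilinear maps of tensor products follows from such laws for
the factors. -/
theorem map₂_adjoint {m₁ : A →ₗ[ℝ] B →ₗ[ℝ] D} {m₂ : D →ₗ[ℝ] C →ₗ[ℝ] F} {m₃ : A →ₗ[ℝ] C →ₗ[ℝ] E}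
    {m₄ : B →ₗ[ℝ] E →ₗ[ℝ] F} {b₁ : A' →ₗ[ℝ] B' →ₗ[ℝ] D'} {b₂ : D' →ₗ[ℝ] C' →ₗ[ℝ] F'}
    {b₃ : A'' →ₗ[ℝ] C' →ₗ[ℝ] E'} {b₄ : B' →ₗ[ℝ] E' →ₗ[ℝ] F'} (L : A' →ₗ[ℝ] A'')
    (hm : ∀ x y z, m₂ (m₁ x y) z = m₄ y (m₃ x z))
    (hb : ∀ x y z, b₂ (b₁ x y) z = b₄ y (b₃ (L x) z))
    (x : A ⊗[ℝ] A') (y : B ⊗[ℝ] B') (z : C ⊗[ℝ] C') :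
    TensorProduct.map₂ m₂ b₂ (TensorProduct.map₂ m₁ b₁ x y) z =
      TensorProduct.map₂ m₄ b₄ y (TensorProduct.map₂ m₃ b₃ (TensorProduct.map LinearMap.id L x) z) := by
  induction x with
  | zero => simp only [map_zero, LinearMap.zero_apply]
  | add s s' h h' => simp only [map_add, LinearMap.add_apply, h, h']
  | tmul a0 e0 =>
  induction y with
  | zero => simp only [map_zero, LinearMap.zero_apply]
  | add s s' h h' => simp only [map_add, LinearMap.add_apply, h, h']
  | tmul a1 e1 =>
  induction z with
  | zero => simp only [map_zero]
  | add s s' h h' => simp only [map_add, h, h']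
  | tmul a2 e2 =>
    exact congrArg₂ (· ⊗ₜ[ℝ] ·) (hm _ _ _) (hb _ _ _)

end Multilinear

theorem tensor_mul_eq_map₂ {q : ℕ} {C : Type} [Ring C] [Algebra ℝ C] (x y : Ev q ⊗[ℝ] C) :
    x * y = TensorProduct.map₂ (LinearMap.mul ℝ (Ev q)) (LinearMap.mul ℝ C) x y := by
  refine SVect.tensor_induction₂ (P := fun x y => x * y =
    TensorProduct.map₂ (LinearMap.mul ℝ (Ev q)) (LinearMap.mul ℝ C) x y) ?_ ?_ ?_ ?_ ?_ x y
  · intro y; simp only [map_zero, LinearMap.zero_apply, zero_mul]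
  · intro y; simp only [map_zero, mul_zero]
  · intro x x' y h1 h2; simp only [map_add, LinearMap.add_apply, h1, h2, add_mul]
  · intro x y y' h1 h2; simp only [map_add, h1, h2, mul_add]
  · intro a e b f
    simp [Algebra.TensorProduct.tmul_mul_tmul]

section Lorentz

variable {K : Type} [NormedAddCommGroup K] [InnerProductSpace ℝ K] [FiniteDimensional ℝ K]
  [NormedDivAlg K] {q r : ℕ}

theorem vecPart_ι (v : Vec K) : vecPart K (CliffordAlgebra.ι (minkowskiQ K) v) = v := by
  letI : Invertible (2 : ℝ) := invertibleOfNonzero two_ne_zero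
  refine (congrArg ExteriorAlgebra.ιInv (CliffordAlgebra.changeForm_ι
    CliffordAlgebra.changeForm.associated_neg_proof v)).trans ?_
  exact ExteriorAlgebra.ι_leftInverse v

variable (K) in
/-- The scalar part of an element of the Clifford algebra. -/
def scalPart : Cliff K →ₗ[ℝ] ℝ :=
  haveI : Invertible (2 : ℝ) := invertibleOfNonzero two_ne_zero
  (ExteriorAlgebra.algebraMapInv (R := ℝ) (M := Vec K)).toLinearMap.comp
    (CliffordAlgebra.equivExterior (minkowskiQ K)).toLinearMap

theorem scalPart_one : scalPart K 1 = 1 := by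
  simp [scalPart, CliffordAlgebra.equivExterior, CliffordAlgebra.changeFormEquiv]

theorem revA_mul (x y : Ev q ⊗[ℝ] Cliff K) : revA K q (x * y) = revA K q y * revA K q x := by
  refine SVect.tensor_induction₂ (P := fun x y => revA K q (x * y) = revA K q y * revA K q x)
    ?_ ?_ ?_ ?_ ?_ x y
  · intro y; simp only [map_zero, zero_mul, mul_zero]
  · intro y; simp only [map_zero, zero_mul, mul_zero]
  · intro x x' y h1 h2; simp only [map_add, h1, h2, add_mul, mul_add]
  · intro x y y' h1 h2; simp only [map_add, h1, h2, add_mul, mul_add]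
  · intro a e b f
    simp only [revA, TensorProduct.map_tmul, Algebra.TensorProduct.tmul_mul_tmul,
      LinearMap.id_apply, CliffordAlgebra.reverse.map_mul]
    rw [ev_mul_comm a b]

theorem revA_revA (x : Ev q ⊗[ℝ] Cliff K) : revA K q (revA K q x) = x := by
  rw [revA, ← LinearMap.comp_apply, ← TensorProduct.map_comp,
    show (CliffordAlgebra.reverse (Q := minkowskiQ K)).comp CliffordAlgebra.reverse =
      LinearMap.id from LinearMap.ext CliffordAlgebra.reverse_reverse, LinearMap.id_comp,
    TensorProduct.map_id]; rfl

theorem revA_one : revA K q 1 = 1 := by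
  rw [Algebra.TensorProduct.one_def, revA, TensorProduct.map_tmul, CliffordAlgebra.reverse.map_one]
  rfl

theorem involA_mul (x y : Ev q ⊗[ℝ] Cliff K) : involA K q (x * y) = involA K q x * involA K q y := by
  have h := map_mul (Algebra.TensorProduct.map (AlgHom.id ℝ (Ev q))
    (CliffordAlgebra.involute (Q := minkowskiQ K))) x y
  exact h

theorem involA_one : involA K q 1 = 1 :=
  map_one (Algebra.TensorProduct.map (AlgHom.id ℝ (Ev q))
    (CliffordAlgebra.involute (Q := minkowskiQ K)))

theorem involA_revA (x : Ev q ⊗[ℝ] Cliff K) : involA K q (revA K q x) = revA K q (involA K q x) := by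
  rw [revA, involA, ← LinearMap.comp_apply, ← TensorProduct.map_comp, ← LinearMap.comp_apply,
    ← TensorProduct.map_comp]
  congr 2
  exact LinearMap.ext fun c => (CliffordAlgebra.reverse_involute c).symm

variable (K q) in
/-- The vector part of elements of `A₀ ⊗ Cl(V)`. -/
def vecPartA : Ev q ⊗[ℝ] Cliff K →ₗ[ℝ] Ev q ⊗[ℝ] Vec K := TensorProduct.map LinearMap.id (vecPart K)

theorem vecPartA_iotaA (v : Ev q ⊗[ℝ] Vec K) : vecPartA K q (iotaA K q v) = v := by
  rw [vecPartA, iotaA, ← LinearMap.comp_apply, ← TensorProduct.map_comp,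
    show (vecPart K).comp (CliffordAlgebra.ι (minkowskiQ K)) = LinearMap.id from LinearMap.ext vecPart_ι, LinearMap.id_comp,
    TensorProduct.map_id]; rfl

theorem iotaA_injective : Function.Injective (iotaA K q) :=
  Function.LeftInverse.injective vecPartA_iotaA

variable (K q) in
/-- The inclusion of scalars. -/
def scalA : Ev q ⊗[ℝ] ℝ →ₗ[ℝ] Ev q ⊗[ℝ] Cliff K :=
  TensorProduct.map LinearMap.id (Algebra.linearMap ℝ (Cliff K))

theorem scalA_injective : Function.Injective (scalA K q) := by
  refine Function.LeftInverse.injective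
    (g := TensorProduct.map LinearMap.id (scalPart K)) fun v => ?_
  rw [scalA, ← LinearMap.comp_apply, ← TensorProduct.map_comp,
    show (scalPart K).comp (Algebra.linearMap ℝ (Cliff K)) = LinearMap.id from
      LinearMap.ext_ring (by simp [scalPart_one]), LinearMap.id_comp, TensorProduct.map_id]; rfl

theorem scalA_comm (s : Ev q ⊗[ℝ] ℝ) (x : Ev q ⊗[ℝ] Cliff K) : scalA K q s * x = x * scalA K q s := by
  refine SVect.tensor_induction₂ (P := fun s x => scalA K q s * x = x * scalA K q s)
    ?_ ?_ ?_ ?_ ?_ s x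
  · intro y; simp only [map_zero, zero_mul, mul_zero]
  · intro y; simp only [zero_mul, mul_zero]
  · intro x x' y h1 h2; simp only [map_add, h1, h2, add_mul, mul_add]
  · intro x y y' h1 h2; simp only [h1, h2, add_mul, mul_add]
  · intro a e b f
    simp only [scalA, TensorProduct.map_tmul, Algebra.TensorProduct.tmul_mul_tmul,
      Algebra.linearMap_apply, LinearMap.id_apply]
    rw [ev_mul_comm a b, Algebra.commutes]

variable (K q) in
/-- The Minkowski form on `A₀ ⊗ V`. -/
def minkA : Ev q ⊗[ℝ] Vec K →ₗ[ℝ] Ev q ⊗[ℝ] Vec K →ₗ[ℝ] Ev q ⊗[ℝ] ℝ :=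
  TensorProduct.map₂ (LinearMap.mul ℝ (Ev q)) (minkowski K)

theorem minkowskiQ_polar (v w : Vec K) :
    QuadraticMap.polar (minkowskiQ K) v w = 2 * minkowski K v w := by
  rw [minkowskiQ, LinearMap.BilinMap.polar_toQuadraticMap, minkowski_comm w v, two_mul]

theorem iotaA_mul_add (v w : Ev q ⊗[ℝ] Vec K) :
    iotaA K q v * iotaA K q w + iotaA K q w * iotaA K q v = (2 : ℝ) • scalA K q (minkA K q v w) := by
  refine SVect.tensor_induction₂ (P := fun v w => iotaA K q v * iotaA K q w +
    iotaA K q w * iotaA K q v = (2 : ℝ) • scalA K q (minkA K q v w)) ?_ ?_ ?_ ?_ ?_ v w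
  · intro y; simp only [map_zero, zero_mul, mul_zero, LinearMap.zero_apply, add_zero, smul_zero]
  · intro y; simp only [map_zero, zero_mul, mul_zero, add_zero, smul_zero]
  · intro x x' y h1 h2
    simp only [map_add, LinearMap.add_apply, smul_add, add_mul, mul_add, ← h1, ← h2]; abel
  · intro x y y' h1 h2
    simp only [map_add, smul_add, add_mul, mul_add, ← h1, ← h2]; abel
  · intro a e b f
    simp only [scalA, iotaA, minkA, TensorProduct.map_tmul, Algebra.TensorProduct.tmul_mul_tmul,
      Algebra.linearMap_apply, LinearMap.id_apply, TensorProduct.map₂_apply_tmul,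
      LinearMap.mul_apply']
    rw [ev_mul_comm b a, ← TensorProduct.tmul_add, CliffordAlgebra.ι_mul_ι_add_swap,
      minkowskiQ_polar, ← TensorProduct.tmul_smul, map_mul, ← Algebra.smul_def,
      show (2 : ℝ) • (algebraMap ℝ (Cliff K)) (minkowski K e f) =
        (algebraMap ℝ (Cliff K)) 2 * (algebraMap ℝ (Cliff K)) (minkowski K e f) from Algebra.smul_def _ _]

theorem minkowski_nondegenerate {d : Vec K} (h : ∀ w, minkowski K w d = 0) : d = 0 := by
  obtain ⟨t, x, y⟩ := d
  -- Reversing the time component of the test vector turns the Lorentzian form into the positive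
  -- definite t² + x² + |y|².
  have h1 := h (-t, x, y)
  rw [minkowski_apply] at h1
  simp only [real_inner_self_eq_norm_sq] at h1
  have h2 : t = 0 := by nlinarith [sq_nonneg ‖y‖, sq_nonneg x, sq_nonneg t]
  have h3 : x = 0 := by nlinarith [sq_nonneg ‖y‖, sq_nonneg x, sq_nonneg t]
  have h4 : ‖y‖ = 0 := by nlinarith [sq_nonneg ‖y‖, sq_nonneg x, sq_nonneg t]
  rw [h2, h3, norm_eq_zero.1 h4]; rfl

/-- The Minkowski form identifies V with its dual, so pairings with the constant vectors 1 ⊗ w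
realize all coordinate functionals. An element of A₀ ⊗ V whose coordinates vanish is zero. -/
theorem minkA_nondegenerate {d : Ev q ⊗[ℝ] Vec K} (h : ∀ w, minkA K q w d = 0) : d = 0 := by
  have hker : Function.Injective (minkowski K).flip := by
    rw [← LinearMap.ker_eq_bot, LinearMap.ker_eq_bot']
    intro m hm
    exact minkowski_nondegenerate fun w => LinearMap.congr_fun hm w
  have hinj : Function.Injective (minkowski K) := by
    rw [← LinearMap.ker_eq_bot, LinearMap.ker_eq_bot']
    intro m hm
    exact minkowski_nondegenerate fun w => by
      rw [minkowski_comm]; exact LinearMap.congr_fun hm w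
  have hsurj : Function.Surjective (minkowski K) :=
    (LinearMap.injective_iff_surjective_of_finrank_eq_finrank
      (Subspace.dual_finrank_eq (K := ℝ) (V := Vec K)).symm).1 hinj
  have h1 : ∀ f : Vec K →ₗ[ℝ] ℝ, TensorProduct.map (LinearMap.id : Ev q →ₗ[ℝ] Ev q) f d = 0 := by
    intro f
    obtain ⟨w, rfl⟩ := hsurj f
    rw [← h (1 ⊗ₜ w)]
    clear h
    induction d with
    | zero => simp only [map_zero]
    | add x y hx hy => simp only [map_add, hx, hy]
    | tmul a v => simp [minkA]
  let b := Module.finBasis ℝ (Vec K)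
  have h2 : (LinearMap.id : Vec K →ₗ[ℝ] Vec K) =
      ∑ i, (LinearMap.toSpanSingleton ℝ (Vec K) (b i)).comp (b.coord i) := by
    refine LinearMap.ext fun v => ?_
    conv_lhs => rw [← b.sum_repr v]
    simp [LinearMap.sum_apply]
  have h3 : d = TensorProduct.map LinearMap.id LinearMap.id d := by rw [TensorProduct.map_id]; rfl
  rw [h3]
  conv_lhs => rw [h2]
  rw [show TensorProduct.map (LinearMap.id : Ev q →ₗ[ℝ] Ev q)
    (∑ i, (LinearMap.toSpanSingleton ℝ (Vec K) (b i)).comp (b.coord i)) =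
    ∑ i, TensorProduct.map LinearMap.id ((LinearMap.toSpanSingleton ℝ (Vec K) (b i)).comp
      (b.coord i)) from map_sum (TensorProduct.mapBilinear (RingHom.id ℝ) _ _ _ _ LinearMap.id) _ _, LinearMap.sum_apply]
  refine Finset.sum_eq_zero fun i _ => ?_
  rw [← LinearMap.id_comp (LinearMap.id : Ev q →ₗ[ℝ] Ev q), TensorProduct.map_comp,
    LinearMap.comp_apply, h1, map_zero]

/-- The conditions on the `A`-points of `Spin(n+1,1)`. -/
structure IsSpin (x : Ev q ⊗[ℝ] Cliff K) : Prop where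
  even : involA K q x = x
  mul_rev : x * revA K q x = 1
  rev_mul : revA K q x * x = 1
  conj : ∀ v, ∃ w, x * iotaA K q v * revA K q x = iotaA K q w

theorem mem_spinGroup {x : (cliffSV K).Pt q} : x ∈ (spinGroup K).space.pts q ↔ IsSpin x.1 :=
  ⟨fun h => ⟨h.1, h.2.1, h.2.2.1, h.2.2.2⟩, fun h => ⟨h.1, h.2, h.3, h.4⟩⟩

variable (K) in
/-- The action of elements of the Clifford algebra on vectors. -/
def conjV (x : Ev q ⊗[ℝ] Cliff K) : Ev q ⊗[ℝ] Vec K →ₗ[ℝ] Ev q ⊗[ℝ] Vec K :=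
  (vecPartA K q).comp (((LinearMap.mulLeft ℝ x).comp (LinearMap.mulRight ℝ (revA K q x))).comp
    (iotaA K q))

theorem conjV_apply (x : Ev q ⊗[ℝ] Cliff K) (v : Ev q ⊗[ℝ] Vec K) :
    conjV K x v = vecPartA K q (x * iotaA K q v * revA K q x) := by
  rw [mul_assoc]; rfl

namespace IsSpin

variable {x y : Ev q ⊗[ℝ] Cliff K}

theorem iotaA_conjV (hx : IsSpin x) (v : Ev q ⊗[ℝ] Vec K) :
    iotaA K q (conjV K x v) = x * iotaA K q v * revA K q x := by
  obtain ⟨w, hw⟩ := hx.conj v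
  rw [conjV_apply, hw, vecPartA_iotaA]

theorem one : IsSpin (1 : Ev q ⊗[ℝ] Cliff K) where
  even := involA_one
  mul_rev := by rw [revA_one, one_mul]
  rev_mul := by rw [revA_one, one_mul]
  conj v := ⟨v, by rw [revA_one, one_mul, mul_one]⟩

theorem mul (hx : IsSpin x) (hy : IsSpin y) : IsSpin (x * y) where
  even := by rw [involA_mul, hx.even, hy.even]
  mul_rev := by
    rw [revA_mul, mul_assoc, ← mul_assoc y, hy.mul_rev, one_mul, hx.mul_rev]
  rev_mul := by
    rw [revA_mul, mul_assoc, ← mul_assoc (revA K q x), hx.rev_mul, one_mul, hy.rev_mul]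
  conj v := ⟨conjV K x (conjV K y v), by
    rw [hx.iotaA_conjV, hy.iotaA_conjV, revA_mul]; simp only [mul_assoc]⟩

theorem conjV_injective (hx : IsSpin x) : Function.Injective (conjV K x) := by
  intro v w h
  have h1 := congrArg (fun z => revA K q x * iotaA K q z * x) h
  simp only [hx.iotaA_conjV] at h1
  have e : ∀ v, revA K q x * (x * v * revA K q x) * x = v := fun v => by
    rw [mul_assoc, mul_assoc, hx.rev_mul, mul_one, ← mul_assoc, hx.rev_mul, one_mul]
  rw [e, e] at h1
  exact iotaA_injective h1

theorem rev (hx : IsSpin x) : IsSpin (revA K q x) where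
  even := by rw [involA_revA, hx.even]
  mul_rev := by rw [revA_revA, hx.rev_mul]
  rev_mul := by rw [revA_revA, hx.mul_rev]
  conj v := by
    -- That the inverse also preserves vectors is not part of the definition. Conjugation by `x` is
    -- an injective endomorphism of a finite-dimensional space, hence surjective.
    obtain ⟨w, hw⟩ := (LinearMap.injective_iff_surjective.1 hx.conjV_injective) v
    refine ⟨w, ?_⟩
    rw [← hw, hx.iotaA_conjV, revA_revA, mul_assoc, mul_assoc, hx.rev_mul, mul_one, ← mul_assoc,
      hx.rev_mul, one_mul]

/-- Twice the form is the anticommutator of vectors; conjugation by `x` respects products because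
x̄x = 1, and fixes the anticommutator because it is a central scalar. -/
theorem minkA_conjV (hx : IsSpin x) (v w : Ev q ⊗[ℝ] Vec K) :
    minkA K q (conjV K x v) (conjV K x w) = minkA K q v w := by
  refine scalA_injective (K := K) (smul_right_injective _ (two_ne_zero (α := ℝ)) ?_)
  have e : ∀ a b, x * a * revA K q x * (x * b * revA K q x) = x * (a * b) * revA K q x := by
    intro a b
    rw [← mul_assoc, ← mul_assoc, mul_assoc (x * a), hx.rev_mul, mul_one, mul_assoc x]
  change (2 : ℝ) • scalA K q _ = (2 : ℝ) • scalA K q _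
  rw [← iotaA_mul_add, hx.iotaA_conjV, hx.iotaA_conjV, e, e, ← add_mul, ← mul_add, iotaA_mul_add,
    mul_smul_comm, smul_mul_assoc, ← scalA_comm, mul_assoc, hx.mul_rev, mul_one]

end IsSpin

/-! ### The spinor representation -/

variable (K) in
/-- The components of the Clifford module: the map `S₊ → S₋`, for odd elements. -/
def rhoMix : Cliff K →ₗ[ℝ] Spinor K →ₗ[ℝ] Spinor K :=
  ((LinearMap.llcomp ℝ (Spinor K) (Spinor K × Spinor K) (Spinor K)
    (LinearMap.snd ℝ (Spinor K) (Spinor K))).comp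
    (LinearMap.lcomp ℝ (Spinor K × Spinor K) (LinearMap.inl ℝ (Spinor K) (Spinor K)))).comp
    (gamma K).toLinearMap

variable (K) in
/-- The components of the Clifford module: the map `S₋ → S₋`, for even elements. -/
def rhoMinus : Cliff K →ₗ[ℝ] Spinor K →ₗ[ℝ] Spinor K :=
  ((LinearMap.llcomp ℝ (Spinor K) (Spinor K × Spinor K) (Spinor K)
    (LinearMap.snd ℝ (Spinor K) (Spinor K))).comp
    (LinearMap.lcomp ℝ (Spinor K × Spinor K) (LinearMap.inr ℝ (Spinor K) (Spinor K)))).comp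
    (gamma K).toLinearMap

theorem rhoPlus_apply (c : Cliff K) (ψ : Spinor K) : rhoPlus K c ψ = (gamma K c (ψ, 0)).1 := rfl
theorem rhoMix_apply (c : Cliff K) (ψ : Spinor K) : rhoMix K c ψ = (gamma K c (ψ, 0)).2 := rfl
theorem rhoMinus_apply (c : Cliff K) (ψ : Spinor K) : rhoMinus K c ψ = (gamma K c (0, ψ)).2 := rfl

theorem gamma_ι (v : Vec K) (s : Spinor K × Spinor K) :
    gamma K (CliffordAlgebra.ι (minkowskiQ K) v) s =
      (vecMul K (traceRev K v) s.2, vecMul K v s.1) := by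
  rw [gamma, CliffordAlgebra.lift_ι_apply]; rfl

/-- The grade involution is conjugation by the parity operator (ψ, φ) ↦ (ψ, -φ), as is seen on
vectors, which exchange the summands. Hence even elements preserve S₊ and S₋. -/
theorem gamma_involute (c : Cliff K) (s : Spinor K × Spinor K) :
    gamma K (CliffordAlgebra.involute c) s =
      ((gamma K c (s.1, -s.2)).1, -(gamma K c (s.1, -s.2)).2) := by
  induction c using CliffordAlgebra.induction generalizing s with
  | algebraMap r =>
    rw [AlgHom.commutes, AlgHom.commutes]
    simp only [Module.algebraMap_end_apply, Prod.smul_mk, smul_neg, neg_neg]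
    rfl
  | ι v =>
    rw [CliffordAlgebra.involute_ι, map_neg, LinearMap.neg_apply, gamma_ι, gamma_ι]
    simp
  | mul a b ha hb =>
    rw [map_mul, map_mul, map_mul, Module.End.mul_apply, Module.End.mul_apply, ha, hb]
    simp
  | add a b ha hb =>
    simp only [map_add, LinearMap.add_apply, ha, hb, Prod.fst_add, Prod.snd_add, neg_add]
    rfl

variable (K) in
/-- The projection to the even part of the Clifford algebra. -/
def evenPart : Cliff K →ₗ[ℝ] Cliff K :=
  (1 / 2 : ℝ) • (LinearMap.id + (CliffordAlgebra.involute (Q := minkowskiQ K)).toLinearMap)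

theorem gamma_evenPart_inl (c : Cliff K) (ψ : Spinor K) :
    gamma K (evenPart K c) (ψ, 0) = (rhoPlus K (evenPart K c) ψ, 0) := by
  refine Prod.ext rfl ?_
  have h := gamma_involute c (ψ, 0)
  simp only [evenPart, LinearMap.smul_apply, LinearMap.add_apply, LinearMap.id_apply, map_smul,
    map_add, AlgHom.toLinearMap_apply, h, neg_zero, Prod.smul_snd, Prod.snd_add, add_neg_cancel,
    smul_zero]

theorem gamma_evenPart_inr (c : Cliff K) (ψ : Spinor K) :
    gamma K (evenPart K c) (0, ψ) = (0, rhoMinus K (evenPart K c) ψ) := by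
  refine Prod.ext ?_ rfl
  have h := gamma_involute c (0, ψ)
  have h2 : gamma K c (0, -ψ) = - gamma K c (0, ψ) := by rw [← map_neg]; simp
  simp only [evenPart, LinearMap.smul_apply, LinearMap.add_apply, LinearMap.id_apply, map_smul,
    map_add, AlgHom.toLinearMap_apply, h, h2, Prod.smul_fst, Prod.fst_add, Prod.fst_neg,
    add_neg_cancel, smul_zero]

/-- Since `rhoPlus` is only a compression of the Clifford module to S₊, it is multiplicative once
the right factor is even and does not leave S₊. -/
theorem rhoPlus_mul_even (c d : Cliff K) (ψ : Spinor K) :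
    rhoPlus K (c * evenPart K d) ψ = rhoPlus K c (rhoPlus K (evenPart K d) ψ) := by
  rw [rhoPlus_apply, map_mul, Module.End.mul_apply, gamma_evenPart_inl]; rfl

theorem rhoMix_mul_even (c d : Cliff K) (ψ : Spinor K) :
    rhoMix K (c * evenPart K d) ψ = rhoMix K c (rhoPlus K (evenPart K d) ψ) := by
  rw [rhoMix_apply, map_mul, Module.End.mul_apply, gamma_evenPart_inl]; rfl

theorem rhoMix_even_mul (c d : Cliff K) (ψ : Spinor K) :
    rhoMix K (evenPart K c * d) ψ = rhoMinus K (evenPart K c) (rhoMix K d ψ) := by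
  rw [rhoMix_apply, map_mul, Module.End.mul_apply,
    show gamma K d (ψ, 0) = ((rhoPlus K d ψ, 0) : Spinor K × Spinor K) + (0, rhoMix K d ψ) from
      Prod.ext (add_zero _).symm (zero_add _).symm, map_add, gamma_evenPart_inl,
    gamma_evenPart_inr]
  exact zero_add _

theorem rhoMix_ι (v : Vec K) (ψ : Spinor K) :
    rhoMix K (CliffordAlgebra.ι (minkowskiQ K) v) ψ = vecMul K v ψ := by
  rw [rhoMix_apply, gamma_ι]

theorem rhoPlus_one (ψ : Spinor K) : rhoPlus K 1 ψ = ψ := by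
  rw [rhoPlus_apply, map_one]; rfl

variable (K) in
/-- The real inner product of spinors as a bilinear map. -/
def spinorInnerL : Spinor K →ₗ[ℝ] Spinor K →ₗ[ℝ] ℝ :=
  (innerₗ K).compl₁₂ (LinearMap.fst ℝ K K) (LinearMap.fst ℝ K K) +
    (innerₗ K).compl₁₂ (LinearMap.snd ℝ K K) (LinearMap.snd ℝ K K)

theorem spinorInnerL_apply (ψ φ : Spinor K) : spinorInnerL K ψ φ = spinorInner ψ φ := rfl

/-- Hermitian matrices act self-adjointly. Through the adjunction with the Minkowski form this is
the symmetry of the spinor bracket. -/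
theorem spinorInner_vecMul (v : Vec K) (ψ φ : Spinor K) :
    spinorInnerL K (vecMul K v ψ) φ = spinorInnerL K ψ (vecMul K v φ) := by
  rw [spinorInnerL_apply, spinorInnerL_apply, ← minkowski_spinorBracket, spinorBracket_comm,
    minkowski_spinorBracket]
  simp only [spinorInner]
  rw [real_inner_comm, real_inner_comm (vecMul K v ψ).2]

/-- For the pairing of S₊ with S₋ vectors are self-adjoint, and taking adjoints reverses products,
so the adjoint of any Clifford element is its reversal. -/
theorem spinorInner_gamma (c : Cliff K) (s t : Spinor K × Spinor K) :
    spinorInnerL K (gamma K c s).1 t.2 + spinorInnerL K (gamma K c s).2 t.1 =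
      spinorInnerL K s.1 (gamma K (CliffordAlgebra.reverse c) t).2 +
        spinorInnerL K s.2 (gamma K (CliffordAlgebra.reverse c) t).1 := by
  induction c using CliffordAlgebra.induction generalizing s t with
  | algebraMap r =>
    rw [CliffordAlgebra.reverse.commutes, AlgHom.commutes]
    simp
  | ι v =>
    rw [CliffordAlgebra.reverse_ι, gamma_ι, gamma_ι]
    simp only [spinorInner_vecMul]
    rw [add_comm]
  | mul a b ha hb =>
    rw [CliffordAlgebra.reverse.map_mul, map_mul, map_mul, Module.End.mul_apply,
      Module.End.mul_apply, ha, hb]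
  | add a b ha hb =>
    simp only [map_add, LinearMap.add_apply, Prod.fst_add, Prod.snd_add]
    linarith [ha s t, hb s t]

theorem spinorInner_rhoPlus (c : Cliff K) (ψ φ : Spinor K) :
    spinorInnerL K (rhoPlus K c ψ) φ =
      spinorInnerL K ψ (rhoMinus K (CliffordAlgebra.reverse c) φ) := by
  have h := spinorInner_gamma c (ψ, 0) (0, φ)
  simpa [rhoPlus_apply, rhoMinus_apply] using h

variable (K q) in
/-- The projection to the even part of `A₀ ⊗ Cl(V)`. -/
def evenPartA : Ev q ⊗[ℝ] Cliff K →ₗ[ℝ] Ev q ⊗[ℝ] Cliff K :=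
  TensorProduct.map LinearMap.id (evenPart K)

theorem evenPartA_of_even {x : Ev q ⊗[ℝ] Cliff K} (hx : involA K q x = x) :
    evenPartA K q x = x := by
  rw [evenPartA, evenPart, TensorProduct.map_smul_right, TensorProduct.map_add_right,
    TensorProduct.map_id, LinearMap.smul_apply, LinearMap.add_apply,
    show TensorProduct.map LinearMap.id (CliffordAlgebra.involute (Q := minkowskiQ K)).toLinearMap
      x = x from hx, LinearMap.id_apply, ← two_smul ℝ x, smul_smul]
  norm_num

variable (K q) in
/-- The Clifford action of `A₀ ⊗ Cl(V)` on `A₁ ⊗ S₊`. -/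
def rhoPlusA : Ev q ⊗[ℝ] Cliff K →ₗ[ℝ] Od q ⊗[ℝ] Spinor K →ₗ[ℝ] Od q ⊗[ℝ] Spinor K :=
  TensorProduct.map₂ (evOdMul q) (rhoPlus K)

theorem ev_smul_smul_od (a b : Ev q) (c : Od q) :
    evOdMul q (LinearMap.mul ℝ (Ev q) a b) c = evOdMul q a (evOdMul q b c) :=
  Subtype.ext (mul_assoc _ _ _)

theorem odMulRev_evOdMul (a : Ev q) (b c : Od q) :
    odMulRev q (evOdMul q a b) c = odMulRev q b (evOdMul q a c) := by
  refine Subtype.ext ?_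
  change (c : Gr q) * ((a : Gr q) * (b : Gr q)) = ((a : Gr q) * (c : Gr q)) * (b : Gr q)
  rw [← mul_assoc, ev_commute a.2]

theorem mul_odMulRev (a : Ev q) (b c : Od q) :
    LinearMap.mul ℝ (Ev q) a (odMulRev q b c) = odMulRev q b (evOdMul q a c) :=
  Subtype.ext (mul_assoc _ _ _).symm

variable (K q) in
/-- The components `A₁ ⊗ S₊ → A₁ ⊗ S₋` of the Clifford action. -/
def rhoMixA : Ev q ⊗[ℝ] Cliff K →ₗ[ℝ] Od q ⊗[ℝ] Spinor K →ₗ[ℝ] Od q ⊗[ℝ] Spinor K :=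
  TensorProduct.map₂ (evOdMul q) (rhoMix K)

variable (K q) in
/-- The Clifford action of `A₀ ⊗ Cl(V)` on `A₁ ⊗ S₋`. -/
def rhoMinusA : Ev q ⊗[ℝ] Cliff K →ₗ[ℝ] Od q ⊗[ℝ] Spinor K →ₗ[ℝ] Od q ⊗[ℝ] Spinor K :=
  TensorProduct.map₂ (evOdMul q) (rhoMinus K)

theorem rhoPlusA_mul {x y : Ev q ⊗[ℝ] Cliff K} (hy : involA K q y = y)
    (s : Od q ⊗[ℝ] Spinor K) :
    rhoPlusA K q (x * y) s = rhoPlusA K q x (rhoPlusA K q y s) := by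
  have h := map₂_assoc (m₁ := LinearMap.mul ℝ (Ev q)) (m₂ := evOdMul q) (m₃ := evOdMul q)
    (m₄ := evOdMul q) (b₁ := LinearMap.mul ℝ (Cliff K)) (b₂ := rhoPlus K)
    (b₃ := rhoPlus K) (b₄ := rhoPlus K) LinearMap.id (evenPart K) ev_smul_smul_od
    rhoPlus_mul_even x y s
  rwa [← tensor_mul_eq_map₂, TensorProduct.map_id, LinearMap.id_apply,
    show TensorProduct.map LinearMap.id (evenPart K) y = y from evenPartA_of_even hy] at h

theorem rhoMixA_mul {x y : Ev q ⊗[ℝ] Cliff K} (hy : involA K q y = y)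
    (s : Od q ⊗[ℝ] Spinor K) :
    rhoMixA K q (x * y) s = rhoMixA K q x (rhoPlusA K q y s) := by
  have h := map₂_assoc (m₁ := LinearMap.mul ℝ (Ev q)) (m₂ := evOdMul q) (m₃ := evOdMul q)
    (m₄ := evOdMul q) (b₁ := LinearMap.mul ℝ (Cliff K)) (b₂ := rhoMix K)
    (b₃ := rhoPlus K) (b₄ := rhoMix K) LinearMap.id (evenPart K) ev_smul_smul_od
    rhoMix_mul_even x y s
  rwa [← tensor_mul_eq_map₂, TensorProduct.map_id, LinearMap.id_apply,
    show TensorProduct.map LinearMap.id (evenPart K) y = y from evenPartA_of_even hy] at h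

theorem rhoMixA_mul' {x y : Ev q ⊗[ℝ] Cliff K} (hx : involA K q x = x)
    (s : Od q ⊗[ℝ] Spinor K) :
    rhoMixA K q (x * y) s = rhoMinusA K q x (rhoMixA K q y s) := by
  have h := map₂_assoc (m₁ := LinearMap.mul ℝ (Ev q)) (m₂ := evOdMul q) (m₃ := evOdMul q)
    (m₄ := evOdMul q) (b₁ := LinearMap.mul ℝ (Cliff K)) (b₂ := rhoMix K)
    (b₃ := rhoMix K) (b₄ := rhoMinus K) (evenPart K) LinearMap.id ev_smul_smul_od
    rhoMix_even_mul x y s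
  rwa [← tensor_mul_eq_map₂, TensorProduct.map_id, LinearMap.id_apply,
    show TensorProduct.map LinearMap.id (evenPart K) x = x from evenPartA_of_even hx] at h

theorem rhoMixA_iotaA (v : Ev q ⊗[ℝ] Vec K) (s : Od q ⊗[ℝ] Spinor K) :
    rhoMixA K q (iotaA K q v) s = TensorProduct.map₂ (evOdMul q) (vecMul K) v s := by
  refine SVect.tensor_induction₂ (P := fun v s => rhoMixA K q (iotaA K q v) s =
    TensorProduct.map₂ (evOdMul q) (vecMul K) v s) ?_ ?_ ?_ ?_ ?_ v s
  · intro y; simp only [map_zero, LinearMap.zero_apply]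
  · intro y; simp only [map_zero]
  · intro x x' y h1 h2; simp only [map_add, LinearMap.add_apply, h1, h2]
  · intro x y y' h1 h2; simp only [map_add, h1, h2]
  · intro a e b f
    exact congrArg₂ (· ⊗ₜ[ℝ] ·) rfl (rhoMix_ι _ _)

theorem rhoPlusA_one (s : Od q ⊗[ℝ] Spinor K) : rhoPlusA K q 1 s = s := by
  induction s with
  | zero => rw [map_zero]
  | add x y hx hy => rw [map_add, hx, hy]
  | tmul a ψ =>
    rw [Algebra.TensorProduct.one_def]
    exact congrArg₂ (· ⊗ₜ[ℝ] ·) (one_smul (Ev q) a) (rhoPlus_one ψ)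

variable (K q) in
/-- The bracket of spinors on `A`-points. -/
def spinorBracketA : Od q ⊗[ℝ] Spinor K →ₗ[ℝ] Od q ⊗[ℝ] Spinor K →ₗ[ℝ] Ev q ⊗[ℝ] Vec K :=
  TensorProduct.map₂ (odMulRev q) (spinorBracket K)

variable (K q) in
/-- The pairing of `S₊` and `S₋` on `A`-points. -/
def spinorInnerA : Od q ⊗[ℝ] Spinor K →ₗ[ℝ] Od q ⊗[ℝ] Spinor K →ₗ[ℝ] Ev q ⊗[ℝ] ℝ :=
  TensorProduct.map₂ (odMulRev q) (spinorInnerL K)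

theorem minkA_spinorBracketA (w : Ev q ⊗[ℝ] Vec K) (s t : Od q ⊗[ℝ] Spinor K) :
    minkA K q w (spinorBracketA K q s t) = spinorInnerA K q s (rhoMixA K q (iotaA K q w) t) := by
  rw [rhoMixA_iotaA]
  exact map₂_left_comm mul_odMulRev minkowski_spinorBracket w s t

theorem spinorInnerA_rhoPlusA (x : Ev q ⊗[ℝ] Cliff K) (s t : Od q ⊗[ℝ] Spinor K) :
    spinorInnerA K q (rhoPlusA K q x s) t = spinorInnerA K q s (rhoMinusA K q (revA K q x) t) :=
  map₂_adjoint CliffordAlgebra.reverse odMulRev_evOdMul spinorInner_rhoPlus x s t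

namespace IsSpin

variable {x y : Ev q ⊗[ℝ] Cliff K}

theorem conjV_mul (hy : IsSpin y) (v : Ev q ⊗[ℝ] Vec K) :
    conjV K (x * y) v = conjV K x (conjV K y v) := by
  rw [conjV_apply, conjV_apply, hy.iotaA_conjV, revA_mul]
  simp only [mul_assoc]

theorem conjV_rev_conjV (hx : IsSpin x) (v : Ev q ⊗[ℝ] Vec K) :
    conjV K x (conjV K (revA K q x) v) = v := by
  rw [← hx.rev.conjV_mul, hx.mul_rev, conjV_apply, revA_one, one_mul, mul_one, vecPartA_iotaA]

/-- Tested against a vector w: g(w, xs·xt) = ⟨xs, wxt⟩ = ⟨s, x̄wxt⟩ = g(x̄wx, s·t) = g(w, x(s·t)x̄).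
Nondegeneracy of the form then gives the equality. -/
theorem spinorBracketA_rhoPlusA (hx : IsSpin x) (s t : Od q ⊗[ℝ] Spinor K) :
    spinorBracketA K q (rhoPlusA K q x s) (rhoPlusA K q x t) =
      conjV K x (spinorBracketA K q s t) := by
  rw [← sub_eq_zero]
  refine minkA_nondegenerate fun w => ?_
  rw [map_sub, sub_eq_zero, minkA_spinorBracketA, spinorInnerA_rhoPlusA, ← rhoMixA_mul hx.even,
    ← rhoMixA_mul' hx.rev.even, ← mul_assoc]
  have h := hx.rev.iotaA_conjV w
  rw [revA_revA] at h
  rw [← h, ← minkA_spinorBracketA, ← hx.minkA_conjV, hx.conjV_rev_conjV]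

end IsSpin

end Lorentz

/-! ### The smooth action of the Lorentz supergroup on the supertranslation group. -/

section SpinAction

variable {K : Type} [NormedAddCommGroup K] [InnerProductSpace ℝ K] [FiniteDimensional ℝ K]
  [NormedDivAlg K] {q r : ℕ}

theorem cliffSV_ext {x y : (cliffSV K).Pt q} (h : x.1 = y.1) : x = y :=
  Prod.ext h (@Subsingleton.elim _ (inferInstanceAs (Subsingleton (Od q ⊗[ℝ] PUnit))) _ _)

variable (K) in
/-- The action of a point of `Spin(n+1,1)` as a linear map. -/
def spinActL (x : (cliffSV K).Pt q) : (superTrans K).Pt q →ₗ[ℝ] (superTrans K).Pt q :=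
  LinearMap.prodMap (conjV K x.1) (rhoPlusA K q x.1)

theorem spinAct_eq (x : (cliffSV K).Pt q) (s : (superTrans K).Pt q) :
    spinAct K q x s = spinActL K x s :=
  Prod.ext (conjV_apply _ _).symm rfl

theorem brT_spinActL {x : (cliffSV K).Pt q} (hx : IsSpin x.1) (s t : (superTrans K).Pt q) :
    brT K q (spinActL K x s) (spinActL K x t) = spinActL K x (brT K q s t) := by
  rw [brT_apply, brT_apply]
  refine Prod.ext (hx.spinorBracketA_rhoPlusA s.2 t.2) ?_
  exact (map_zero (rhoPlusA K q x.1)).symm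

theorem minkT_spinActL {x : (cliffSV K).Pt q} (hx : IsSpin x.1) (s t : (superTrans K).Pt q) :
    minkT K q (spinActL K x s) (spinActL K x t) = minkT K q s t := by
  rw [minkT_apply, minkT_apply]
  exact Prod.ext (hx.minkA_conjV s.1 t.1) rfl

/-- The cubic cochain is built from the bracket, which is equivariant, and the Minkowski form, which
is invariant. -/
theorem cubic_spinActL {x : (cliffSV K).Pt q} (hx : IsSpin x.1) (s t u : (superTrans K).Pt q) :
    cubic K q (spinActL K x s) (spinActL K x t) (spinActL K x u) = cubic K q s t u := by
  simp only [cubic, omegaT, brT_spinActL hx, minkT_spinActL hx]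

theorem cubic_spinAct {x : (cliffSV K).Pt q} (hx : x ∈ (spinGroup K).space.pts q)
    (s t u : (superTrans K).Pt q) :
    cubic K q (spinAct K q x s) (spinAct K q x t) (spinAct K q x u) = cubic K q s t u := by
  rw [spinAct_eq, spinAct_eq, spinAct_eq, cubic_spinActL (mem_spinGroup.1 hx)]

/-- The map of `A₀ ⊗ Cl(V)` induced by a homomorphism of Grassmann algebras. -/
def mapEv (f : GrHom q r) (E : Type) [AddCommGroup E] [Module ℝ E] :
    Ev q ⊗[ℝ] E →ₗ[ℝ] Ev r ⊗[ℝ] E := TensorProduct.map f.onEv LinearMap.id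

theorem mapEv_mul {C : Type} [Ring C] [Algebra ℝ C] (f : GrHom q r) (x y : Ev q ⊗[ℝ] C) :
    mapEv f C (x * y) = mapEv f C x * mapEv f C y := by
  refine SVect.tensor_induction₂ (P := fun x y => mapEv f C (x * y) = mapEv f C x * mapEv f C y)
    ?_ ?_ ?_ ?_ ?_ x y
  · intro y; simp only [map_zero, zero_mul]
  · intro y; simp only [map_zero, mul_zero]
  · intro x x' y h1 h2; simp only [map_add, h1, h2, add_mul]
  · intro x y y' h1 h2; simp only [map_add, h1, h2, mul_add]
  · intro a e b g
    simp only [mapEv, TensorProduct.map_tmul, Algebra.TensorProduct.tmul_mul_tmul, f.onEv_mul,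
      LinearMap.id_apply]

theorem mapEv_one {C : Type} [Ring C] [Algebra ℝ C] (f : GrHom q r) :
    mapEv f C (1 : Ev q ⊗[ℝ] C) = 1 := by
  rw [Algebra.TensorProduct.one_def, mapEv, TensorProduct.map_tmul]
  exact congrArg₂ (· ⊗ₜ[ℝ] ·) (Subtype.ext (map_one f.hom)) rfl

theorem mapEv_comm {E F : Type} [AddCommGroup E] [Module ℝ E] [AddCommGroup F] [Module ℝ F]
    (f : GrHom q r) (L : E →ₗ[ℝ] F) (x : Ev q ⊗[ℝ] E) :
    mapEv f F (TensorProduct.map LinearMap.id L x) =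
      TensorProduct.map LinearMap.id L (mapEv f E x) := by
  rw [mapEv, mapEv, ← LinearMap.comp_apply, ← LinearMap.comp_apply, ← TensorProduct.map_comp,
    ← TensorProduct.map_comp]
  rfl

theorem ev_smul_eq_mul {C : Type} [Ring C] [Algebra ℝ C] (a : Ev q) (x : Ev q ⊗[ℝ] C) :
    a • x = (a ⊗ₜ 1) * x := by
  induction x with
  | zero => rw [smul_zero, mul_zero]
  | add x y hx hy => rw [smul_add, mul_add, hx, hy]
  | tmul b c => rw [Algebra.TensorProduct.tmul_mul_tmul, one_mul]; rfl

theorem ev_tmul_one_comm {C : Type} [Ring C] [Algebra ℝ C] (a : Ev q) (x : Ev q ⊗[ℝ] C) :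
    (a ⊗ₜ 1) * x = x * (a ⊗ₜ 1) := by
  induction x with
  | zero => rw [mul_zero, zero_mul]
  | add x y hx hy => rw [mul_add, add_mul, hx, hy]
  | tmul b c =>
    rw [Algebra.TensorProduct.tmul_mul_tmul, Algebra.TensorProduct.tmul_mul_tmul, one_mul, mul_one,
      ev_mul_comm]

theorem conjV_smul (x y : Ev q ⊗[ℝ] Cliff K) (a : Ev q) (v : Ev q ⊗[ℝ] Vec K) :
    x * iotaA K q (a • v) * y = a • (x * iotaA K q v * y) := by
  rw [show iotaA K q (a • v) = a • iotaA K q v from SVect.map_id_smul_ev _ _ _, ev_smul_eq_mul,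
    ev_smul_eq_mul, ← mul_assoc, ← ev_tmul_one_comm, mul_assoc, mul_assoc, mul_assoc]

theorem IsSpin.map {x : Ev q ⊗[ℝ] Cliff K} (hx : IsSpin x) (f : GrHom q r) :
    IsSpin (mapEv f (Cliff K) x) where
  even := (mapEv_comm f _ x).symm.trans (congrArg (mapEv f (Cliff K)) hx.even)
  mul_rev := by
    rw [show revA K r (mapEv f (Cliff K) x) = mapEv f (Cliff K) (revA K q x) from
      (mapEv_comm f _ x).symm, ← mapEv_mul, hx.mul_rev, mapEv_one]
  rev_mul := by
    rw [show revA K r (mapEv f (Cliff K) x) = mapEv f (Cliff K) (revA K q x) from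
      (mapEv_comm f _ x).symm, ← mapEv_mul, hx.rev_mul, mapEv_one]
  conj v := by
    induction v with
    | zero => exact ⟨0, by simp only [map_zero, mul_zero, zero_mul]⟩
    | add v w h1 h2 =>
      obtain ⟨v', h1⟩ := h1
      obtain ⟨w', h2⟩ := h2
      exact ⟨v' + w', by simp only [map_add, mul_add, add_mul, h1, h2]⟩
    | tmul a e =>
      -- A vector over the new Grassmann algebra need not come from the old one. By linearity over
      -- even scalars it suffices to treat the constant vectors 1 ⊗ e, which do.
      obtain ⟨w, hw⟩ := hx.conj (1 ⊗ₜ e)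
      refine ⟨a • mapEv f (Vec K) w, ?_⟩
      rw [show a ⊗ₜ[ℝ] e = a • mapEv f (Vec K) (1 ⊗ₜ[ℝ] e) by
          rw [mapEv, TensorProduct.map_tmul, show f.onEv 1 = 1 from Subtype.ext (map_one f.hom)]
          exact (congrArg (· ⊗ₜ[ℝ] e) (mul_one a)).symm, conjV_smul,
        show revA K r (mapEv f (Cliff K) x) = mapEv f (Cliff K) (revA K q x) from
          (mapEv_comm f _ x).symm,
        show iotaA K r (mapEv f (Vec K) (1 ⊗ₜ[ℝ] e)) = mapEv f (Cliff K) (iotaA K q (1 ⊗ₜ[ℝ] e)) from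
          (mapEv_comm f _ _).symm, ← mapEv_mul, ← mapEv_mul, hw,
        show mapEv f (Cliff K) (iotaA K q w) = iotaA K r (mapEv f (Vec K) w) from mapEv_comm f _ w]
      exact (SVect.map_id_smul_ev _ _ _).symm

theorem spinGroup_functorial (f : GrHom q r) {x : (cliffSV K).Pt q}
    (hx : x ∈ (spinGroup K).space.pts q) : (cliffSV K).map f x ∈ (spinGroup K).space.pts r :=
  mem_spinGroup.2 ((mem_spinGroup.1 hx).map f)

variable (K q) in
/-- Multiplication of `A`-points of the Clifford algebra. -/
def cliffMul : (cliffSV K).Pt q →ₗ[ℝ] (cliffSV K).Pt q →ₗ[ℝ] (cliffSV K).Pt q :=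
  SVect.bil (V := cliffSV K) (W := cliffSV K) (X := cliffSV K) (LinearMap.mul ℝ (Cliff K)) 0 0 q

theorem bil_zero_fst {V W X : SVect}
    (b : V.E →ₗ[ℝ] W.E →ₗ[ℝ] X.E) (c : V.E →ₗ[ℝ] W.O →ₗ[ℝ] X.O) (x : V.Pt q) (y : W.Pt q) :
    (SVect.bil b c 0 q x y).1 =
      TensorProduct.map₂ (LinearMap.mul ℝ (Ev q)) b x.1 y.1 := by
  rw [SVect.bil_apply, map₂_zero', add_zero]

theorem cliffMul_fst (x y : Ev q ⊗[ℝ] Cliff K) (x' y' : Od q ⊗[ℝ] PUnit) :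
    (cliffMul K q (x, x') (y, y')).1 = x * y := by
  rw [tensor_mul_eq_map₂]
  exact bil_zero_fst (V := cliffSV K) (W := cliffSV K) (X := cliffSV K) _ _ _ _

theorem spinGroup_mul (x y : (cliffSV K).Pt q) : (spinGroup K).mul q x y = cliffMul K q x y :=
  cliffSV_ext (cliffMul_fst x.1 y.1 x.2 y.2).symm

variable (K q) in
/-- Reversal of `A`-points of the Clifford algebra. -/
def cliffRev : (cliffSV K).Pt q →ₗ[ℝ] (cliffSV K).Pt q :=
  SVect.lin (V := cliffSV K) (W := cliffSV K) CliffordAlgebra.reverse 0 q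

theorem spinGroup_inv (x : (cliffSV K).Pt q) : (spinGroup K).inv q x = cliffRev K q x :=
  cliffSV_ext rfl

theorem spinGroup_smooth_mul : IsSMap ((spinGroup K).space.prod (spinGroup K).space)
    (spinGroup K).space (uncurry (spinGroup K).mul) := by
  refine IsSMap.of_smooth ?_ fun q z hz => ?_
  · refine ((isSmoothOn_pfst _).bil openSet_univ (isSmoothOn_psnd _)
      (Y := cliffSV K) (LinearMap.mul ℝ (Cliff K)) 0 0).congr openSet_univ fun q z _ => ?_
    exact spinGroup_mul _ _
  · exact mem_spinGroup.2 ((mem_spinGroup.1 hz.1).mul (mem_spinGroup.1 hz.2))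

theorem spinGroup_smooth_inv :
    IsSMap (spinGroup K).space (spinGroup K).space (spinGroup K).inv := by
  refine IsSMap.of_smooth ?_ fun q z hz => ?_
  · refine (isSmoothOn_lin (V := cliffSV K) (W := cliffSV K) Set.univ
      CliffordAlgebra.reverse 0).congr openSet_univ fun q z _ => ?_
    exact spinGroup_inv _
  · exact mem_spinGroup.2 (mem_spinGroup.1 hz).rev

theorem spinGroup_smooth_one :
    IsSMap point (spinGroup K).space (fun q _ => (spinGroup K).one q) :=
  IsSMap.of_smooth (isSmoothOn_realPt (V := SVect.zero) (W := cliffSV K) Set.univ (1 : Cliff K))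
    fun _ _ _ => mem_spinGroup.2 IsSpin.one

/-- The spin group is a supergroup as soon as it is a supermanifold. -/
theorem isSupergroup_spinGroup_of_manifold (h : (spinGroup K).space.IsSupermanifold) :
    IsSupergroup (spinGroup K) where
  manifold := h
  smooth_mul := spinGroup_smooth_mul
  smooth_inv := spinGroup_smooth_inv
  smooth_one := spinGroup_smooth_one
  mul_assoc q x _ y _ z _ := cliffSV_ext (mul_assoc (G := Ev q ⊗[ℝ] Cliff K) x.1 y.1 z.1)
  one_mul q x _ := cliffSV_ext (one_mul (M := Ev q ⊗[ℝ] Cliff K) x.1)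
  mul_one q x _ := cliffSV_ext (mul_one (M := Ev q ⊗[ℝ] Cliff K) x.1)
  inv_mul q x hx := cliffSV_ext (mem_spinGroup.1 hx).rev_mul
  mul_inv q x hx := cliffSV_ext (mem_spinGroup.1 hx).mul_rev

theorem map₂_compl₂_map {E F G H : Type} [AddCommGroup E] [Module ℝ E] [AddCommGroup F]
    [Module ℝ F] [AddCommGroup G] [Module ℝ G] [AddCommGroup H] [Module ℝ H]
    (b : E →ₗ[ℝ] H →ₗ[ℝ] G) (L : F →ₗ[ℝ] H) (x : Ev q ⊗[ℝ] E) (y : Ev q ⊗[ℝ] F) :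
    TensorProduct.map₂ (LinearMap.mul ℝ (Ev q)) (b.compl₂ L) x y =
      TensorProduct.map₂ (LinearMap.mul ℝ (Ev q)) b x (TensorProduct.map LinearMap.id L y) := by
  refine SVect.tensor_induction₂ (P := fun x y =>
    TensorProduct.map₂ (LinearMap.mul ℝ (Ev q)) (b.compl₂ L) x y =
      TensorProduct.map₂ (LinearMap.mul ℝ (Ev q)) b x (TensorProduct.map LinearMap.id L y))
    ?_ ?_ ?_ ?_ ?_ x y
  · intro y; simp only [map_zero, LinearMap.zero_apply]
  · intro y; simp only [map_zero]
  · intro x x' y h1 h2; simp only [map_add, LinearMap.add_apply, h1, h2]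
  · intro x y y' h1 h2; simp only [map_add, h1, h2]
  · intro a e b f
    rfl

/-- Writes the action as a composite of natural `A₀`-bilinear and linear maps; this is what makes it
smooth. -/
theorem spinAct_eq_bil (x : (cliffSV K).Pt q) (s : (superTrans K).Pt q) :
    spinAct K q x s = SVect.lin (V := cliffSV K) (W := superTrans K) (vecPart K) 0 q
      (cliffMul K q (SVect.bil (V := cliffSV K) (W := superTrans K) (X := cliffSV K)
        ((LinearMap.mul ℝ (Cliff K)).compl₂ (CliffordAlgebra.ι (minkowskiQ K))) 0 0 q x s)
        (cliffRev K q x)) +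
      SVect.bil (V := cliffSV K) (W := superTrans K) (X := superTrans K) 0 (rhoPlus K) 0 q x s := by
  have h1 := bil_zero_fst (V := cliffSV K) (W := superTrans K) (X := cliffSV K)
    ((LinearMap.mul ℝ (Cliff K)).compl₂ (CliffordAlgebra.ι (minkowskiQ K))) 0 x s
  have h2 := (bil_zero_fst (V := cliffSV K) (W := superTrans K) (X := superTrans K)
    0 (rhoPlus K) x s).trans (map₂_zero' _ _ _)
  have h3 := (congrArg (· * revA K q x.1) (h1.trans ((map₂_compl₂_map _ _ _ _).trans
    (tensor_mul_eq_map₂ x.1 (iotaA K q s.1)).symm)))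
  refine Prod.ext ?_ ?_
  · refine Eq.trans ?_ (congrArg₂ (· + ·) rfl h2).symm
    refine Eq.trans ?_ (add_zero _).symm
    refine congrArg (vecPartA K q) ?_
    exact h3.symm.trans (cliffMul_fst _ _ _ _).symm
  · have h4 : ∀ z : (cliffSV K).Pt q,
        (SVect.lin (V := cliffSV K) (W := superTrans K) (vecPart K) 0 q z).2 = 0 := fun z =>
      LinearMap.congr_fun (TensorProduct.map_zero_right LinearMap.id) z.2
    exact ((congrArg₂ (· + ·) (h4 _) rfl).trans (zero_add _)).symm

theorem isSmoothOn_spinAct :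
    IsSmoothOn ((cliffSV K).prod (superTrans K)) (superTrans K) Set.univ
      (uncurry (spinAct K)) := by
  have h1 := isSmoothOn_pfst (V := cliffSV K) (W := superTrans K) Set.univ
  have h2 := isSmoothOn_psnd (V := cliffSV K) (W := superTrans K) Set.univ
  have h3 := h1.bil openSet_univ h2 (Y := cliffSV K)
    ((LinearMap.mul ℝ (Cliff K)).compl₂ (CliffordAlgebra.ι (minkowskiQ K))) 0 0
  have h4 := h1.lin (W := cliffSV K) openSet_univ CliffordAlgebra.reverse 0
  have h5 := (h3.bil openSet_univ h4 (Y := cliffSV K) (LinearMap.mul ℝ (Cliff K)) 0 0).lin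
    (W := superTrans K) openSet_univ (vecPart K) 0
  have h6 := h1.bil openSet_univ h2 (Y := superTrans K) 0 (rhoPlus K) 0
  refine (h5.add h6).congr openSet_univ fun q z _ => spinAct_eq_bil _ _

theorem spinAct_transGroup_mul {x : (cliffSV K).Pt q} (hx : x ∈ (spinGroup K).space.pts q)
    (s t : (superTrans K).Pt q) : spinAct K q x (IsStringPair.bch (brT K q) s t) =
      IsStringPair.bch (brT K q) (spinAct K q x s) (spinAct K q x t) := by
  rw [spinAct_eq, spinAct_eq, spinAct_eq, IsStringPair.bch, IsStringPair.bch,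
      brT_spinActL (mem_spinGroup.1 hx), map_add, map_add, map_smul]

theorem isActionByAut_spinAct : IsActionByAut (spinGroup K) (transGroup K) (spinAct K) where
  smooth := IsSMap.of_smooth isSmoothOn_spinAct fun _ _ _ => Set.mem_univ _
  one_act q h _ := by
    refine (spinAct_eq _ _).trans (Prod.ext ?_ (rhoPlusA_one _))
    refine (conjV_apply (K := K) 1 h.1).trans ?_
    rw [revA_one, one_mul, mul_one]
    exact vecPartA_iotaA h.1
  mul_act q x hx y hy h _ := by
    have hy' := mem_spinGroup.1 hy
    refine (spinAct_eq _ _).trans (Eq.trans ?_ (spinAct_eq _ _).symm)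
    refine Eq.trans ?_ (congrArg (spinActL K x) (spinAct_eq _ _).symm)
    exact Prod.ext (hy'.conjV_mul h.1) (rhoPlusA_mul hy'.even h.2)
  act_mul q x hx s _ t _ :=
    (congrArg (spinAct K q x) (transGroup_mul s t)).trans
      ((spinAct_transGroup_mul hx s t).trans (transGroup_mul _ _).symm)

end SpinAction

/-! ### The exponential map of a finite-dimensional algebra -/

section NormedExp

variable {C : Type} [NormedRing C] [NormedAlgebra ℝ C]

/-- The derivative of the `n`-th power at `x` in the direction `v`. -/
def powDeriv (x v : C) : ℕ → C
  | 0 => 0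
  | n + 1 => powDeriv x v n * x + x ^ n * v

theorem hasDerivAt_pow_line (x v : C) (n : ℕ) (t : ℝ) :
    HasDerivAt (fun t : ℝ => (x + t • v) ^ n) (powDeriv (x + t • v) v n) t := by
  have h : HasDerivAt (fun t : ℝ => x + t • v) v t := by
    simpa using ((hasDerivAt_id t).smul_const v).const_add x
  induction n with
  | zero => simpa [powDeriv] using hasDerivAt_const t (1 : C)
  | succ n ih =>
    simp only [pow_succ]
    exact ih.mul h

theorem norm_pow_le_of_norm_le {x : C} {R : ℝ} (hx : ‖x‖ ≤ R) (n : ℕ) :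
    ‖x ^ n‖ ≤ ‖(1 : C)‖ * R ^ n := by
  have hR : 0 ≤ R := (norm_nonneg x).trans hx
  induction n with
  | zero => simp
  | succ n ih =>
    rw [pow_succ, pow_succ, ← mul_assoc]
    refine (norm_mul_le _ _).trans ?_
    exact mul_le_mul ih hx (norm_nonneg _) (by positivity)

theorem norm_powDeriv_le {x v : C} {R : ℝ} (hx : ‖x‖ ≤ R) (hv : ‖v‖ ≤ R) (n : ℕ) :
    ‖powDeriv x v n‖ ≤ ‖(1 : C)‖ * (n * R ^ n) := by
  have hR : 0 ≤ R := (norm_nonneg x).trans hx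
  induction n with
  | zero => simp [powDeriv]
  | succ n ih =>
    have h1 : ‖powDeriv x v n * x‖ ≤ ‖(1 : C)‖ * (n * R ^ n) * R :=
      (norm_mul_le _ _).trans (by gcongr)
    have h2 : ‖x ^ n * v‖ ≤ ‖(1 : C)‖ * R ^ n * R :=
      (norm_mul_le _ _).trans (by gcongr; exact norm_pow_le_of_norm_le hx n)
    refine (norm_add_le _ _).trans ((add_le_add h1 h2).trans (le_of_eq ?_))
    push_cast
    ring

/-- The derivative of a power is a sum of terms xⁱvxʲ, and `T` moves through the multiplications on
both sides. The case of interest is multiplication by an even scalar, which is central. -/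
theorem map_powDeriv (T : C →ₗ[ℝ] C) (hl : ∀ x y, T (x * y) = T x * y)
    (hr : ∀ x y, T (x * y) = x * T y) (x v : C) (n : ℕ) :
    T (powDeriv x v n) = powDeriv x (T v) n := by
  induction n with
  | zero => simp [powDeriv]
  | succ n ih => rw [powDeriv, powDeriv, map_add, hl, hr, ih]

theorem norm_exp_term_le {x v : C} {R : ℝ} (hx : ‖x‖ ≤ R) (hv : ‖v‖ ≤ R) (n : ℕ) :
    ‖((n.factorial : ℝ)⁻¹) • powDeriv x v n‖ ≤ ‖(1 : C)‖ * ((2 * R) ^ n / n.factorial) := by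
  have hR : 0 ≤ R := (norm_nonneg x).trans hx
  -- This crude bound absorbs the factor n from differentiation and leaves the exponential series of
  -- 2R as a majorant.
  have hn : (n : ℝ) ≤ 2 ^ n := by exact_mod_cast (Nat.lt_two_pow_self).le
  rw [norm_smul, norm_inv, RCLike.norm_natCast, mul_pow]
  calc ((n.factorial : ℝ)⁻¹) * ‖powDeriv x v n‖
      ≤ (n.factorial : ℝ)⁻¹ * (‖(1 : C)‖ * (2 ^ n * R ^ n)) := by
        gcongr
        refine (norm_powDeriv_le hx hv n).trans ?_
        gcongr
    _ = _ := by ring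

variable [CompleteSpace C]

/-- Termwise differentiation with a uniform summable bound for |t| < 1. The series for the
derivative is needed explicitly, to see that it commutes with central multiplications. -/
theorem hasDerivAt_exp_line (x v : C) :
    HasDerivAt (fun t : ℝ => NormedSpace.exp (x + t • v))
      (∑' n : ℕ, ((n.factorial : ℝ)⁻¹) • powDeriv x v n) 0 := by
  have e : (fun t : ℝ => NormedSpace.exp (x + t • v)) =
      fun t : ℝ => ∑' n : ℕ, ((n.factorial : ℝ)⁻¹) • (x + t • v) ^ n := by
    rw [NormedSpace.exp_eq_tsum ℝ]
  have hR : ∀ t ∈ Metric.ball (0 : ℝ) 1, ‖x + t • v‖ ≤ ‖x‖ + ‖v‖ := by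
    intro t ht
    rw [mem_ball_zero_iff] at ht
    refine (norm_add_le _ _).trans (add_le_add le_rfl ?_)
    rw [norm_smul]
    exact mul_le_of_le_one_left (norm_nonneg v) ht.le
  have h := hasDerivAt_tsum_of_isPreconnected (𝕜 := ℝ)
    (g := fun (n : ℕ) (t : ℝ) => ((n.factorial : ℝ)⁻¹) • (x + t • v) ^ n)
    (g' := fun (n : ℕ) (t : ℝ) => ((n.factorial : ℝ)⁻¹) • powDeriv (x + t • v) v n)
    (u := fun n => ‖(1 : C)‖ * ((2 * (‖x‖ + ‖v‖)) ^ n / n.factorial)) (t := Metric.ball 0 1)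
    (y₀ := 0) (y := 0)
    ((Real.summable_pow_div_factorial _).mul_left _) Metric.isOpen_ball
    (convex_ball 0 1).isPreconnected
    (fun n t _ => (hasDerivAt_pow_line x v n t).fun_const_smul _)
    (fun n t ht => norm_exp_term_le (hR t ht) (le_add_of_nonneg_left (norm_nonneg x)) n)
    (Metric.mem_ball_self one_pos) (by
      simpa using NormedSpace.expSeries_summable' (𝕂 := ℝ) (x + (0 : ℝ) • v))
    (Metric.mem_ball_self one_pos)
  rw [e]
  simpa using h

end NormedExp

section AlgExp

variable {C C' : Type} [Ring C] [Algebra ℝ C] [Module.Finite ℝ C]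
  [Ring C'] [Algebra ℝ C'] [Module.Finite ℝ C']

theorem algNorm_completeSpace : @CompleteSpace C (algNorm C).toMetricSpace.toUniformSpace := by
  let := algNorm C; let := algNormAlgebra C
  exact FiniteDimensional.complete ℝ C

/-- The exponential map of a finite-dimensional algebra. -/
def aexp (x : C) : C :=
  letI := algNorm C
  NormedSpace.exp x

theorem aexp_hasSum (x : C) (l : C →ₗ[ℝ] ℝ) :
    HasSum (fun n : ℕ => ((n.factorial : ℝ)⁻¹) * l (x ^ n)) (l (aexp x)) := by
  let := algNorm C; let := algNormAlgebra C; have := algNorm_completeSpace (C := C)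
  have h := NormedSpace.exp_series_hasSum_exp' (𝕂 := ℝ) x
  have h2 := h.mapL (LinearMap.toContinuousLinearMap l)
  simp only [map_smul, smul_eq_mul, LinearMap.coe_toContinuousLinearMap'] at h2
  exact h2

/-- Only the powers of a single element enter the exponential series, so `f` need not be
multiplicative. This covers reversal, which is an antiautomorphism, and left and right
multiplication operators. -/
theorem map_aexp (f : C →ₗ[ℝ] C') {x : C} {y : C'} (hf : ∀ n, f (x ^ n) = y ^ n) :
    f (aexp x) = aexp y := by
  refine (Module.finBasis ℝ C').ext_elem fun i => ?_
  set l := (Module.finBasis ℝ C').coord i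
  have h1 := aexp_hasSum x (l.comp f)
  simp only [LinearMap.comp_apply, hf] at h1
  exact h1.unique (aexp_hasSum y l)

theorem aexp_zero : aexp (0 : C) = 1 := by
  let := algNorm C; let := algNormAlgebra C; have := algNorm_completeSpace (C := C)
  exact NormedSpace.exp_zero

theorem aexp_add {x y : C} (h : Commute x y) : aexp (x + y) = aexp x * aexp y := by
  let := algNorm C; let := algNormAlgebra C; have := algNorm_completeSpace (C := C)
  let := NormedAlgebra.restrictScalars ℚ ℝ C
  exact NormedSpace.exp_add_of_commute h

theorem aexp_mul_neg (x : C) : aexp x * aexp (-x) = 1 := by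
  rw [← aexp_add (Commute.neg_right rfl), add_neg_cancel, aexp_zero]

theorem aexp_neg_mul (x : C) : aexp (-x) * aexp x = 1 := by
  rw [← aexp_add (Commute.neg_left rfl), neg_add_cancel, aexp_zero]

theorem smoothOn_aexp : SmoothOn Set.univ (aexp : C → C) := by
  let := algNorm C; let := algNormAlgebra C; have := algNorm_completeSpace (C := C)
  rw [smoothOn_iff_contDiffOn]
  refine ContDiff.contDiffOn ?_
  rw [contDiff_iff_contDiffAt]
  exact fun x => (NormedSpace.exp_analytic (𝕂 := ℝ) x).contDiffAt

/-- The derivative of the exponential map commutes with multiplications by central elements. -/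
theorem exists_hasLinDeriv_aexp (x : C) : ∃ D : C →ₗ[ℝ] C, HasLinDeriv aexp x D ∧
    ∀ T : C →ₗ[ℝ] C, (∀ x y, T (x * y) = T x * y) → (∀ x y, T (x * y) = x * T y) →
      ∀ v, D (T v) = T (D v) := by
  obtain ⟨D, hD⟩ := HasLinDeriv.exists_of_smoothOn openSet_univ (smoothOn_aexp (C := C))
    (Set.mem_univ x)
  refine ⟨D, hD, fun T hl hr v => ?_⟩
  let := algNorm C; let := algNormAlgebra C; have := algNorm_completeSpace (C := C)
  have key : ∀ v, D v = ∑' n : ℕ, ((n.factorial : ℝ)⁻¹) • powDeriv x v n := by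
    intro v
    refine (Module.finBasis ℝ C).ext_elem fun i => ?_
    refine (hD v ((Module.finBasis ℝ C).coord i)).unique ?_
    exact (LinearMap.toContinuousLinearMap
      ((Module.finBasis ℝ C).coord i)).hasFDerivAt.comp_hasDerivAt (0 : ℝ) (hasDerivAt_exp_line x v)
  have hs : Summable fun n : ℕ => ((n.factorial : ℝ)⁻¹) • powDeriv x v n :=
    .of_norm_bounded ((Real.summable_pow_div_factorial _).mul_left _) fun n =>
      norm_exp_term_le (R := max ‖x‖ ‖v‖) (le_max_left _ _) (le_max_right _ _) n
  rw [key, key, show T (∑' n : ℕ, ((n.factorial : ℝ)⁻¹) • powDeriv x v n) = _ from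
    (LinearMap.toContinuousLinearMap T).map_tsum hs]
  refine tsum_congr fun n => ?_
  rw [LinearMap.coe_toContinuousLinearMap', map_smul, map_powDeriv T hl hr]

theorem hasLinDeriv_aexp_zero : HasLinDeriv (aexp : C → C) 0 LinearMap.id := by
  let := algNorm C; let := algNormAlgebra C; have := algNorm_completeSpace (C := C)
  exact HasFDerivAt.hasLinDeriv (D := ContinuousLinearMap.id ℝ C)
    (hasFDerivAt_exp_zero (𝕂 := ℝ))

/-- The exponential computed inside the subalgebra is carried to the outer one by the inclusion,
independently of the norms chosen on the two algebras. -/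
theorem aexp_mem (S : Subalgebra ℝ C) {x : C} (hx : x ∈ S) : aexp x ∈ S := by
  have h := map_aexp S.val.toLinearMap (x := ⟨x, hx⟩) (y := x) fun n => rfl
  rw [← h]
  exact Subtype.property _

/-- Conjugation by `exp x` preserves the subspaces that are preserved by `[x, ·]`. -/
theorem aexp_conj_mem (M : Submodule ℝ C) {x : C} (hx : ∀ m ∈ M, x * m - m * x ∈ M) {m : C}
    (hm : m ∈ M) : aexp x * m * aexp (-x) ∈ M := by
  let S : Subalgebra ℝ (Module.End ℝ C) :=
    { carrier := {T | ∀ m ∈ M, T m ∈ M}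
      mul_mem' := fun ha hb m hm => ha _ (hb m hm)
      add_mem' := fun ha hb m hm => M.add_mem (ha m hm) (hb m hm)
      algebraMap_mem' := fun r m hm => M.smul_mem r hm }
  have h1 : LinearMap.mulLeft ℝ x + LinearMap.mulRight ℝ (-x) ∈ S := fun m hm => by
    have := hx m hm
    rwa [sub_eq_add_neg, ← mul_neg] at this
  -- The commutator with `x` is the sum of the commuting operators of left multiplication by x and
  -- right multiplication by -x, so its exponential is conjugation by exp x. It lies in the algebra
  -- of operators preserving `M` because the commutator does.
  have hc : Commute (LinearMap.mulLeft ℝ x) (LinearMap.mulRight ℝ (-x)) :=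
    LinearMap.commute_mulLeft_right x (-x)
  have h2 := aexp_mem S h1 m hm
  rw [aexp_add hc,
    ← map_aexp (LinearMap.mul ℝ C) (fun n => (LinearMap.pow_mulLeft ..).symm),
    ← map_aexp (LinearMap.mul ℝ C).flip (fun n => (LinearMap.pow_mulRight ..).symm)] at h2
  rw [mul_assoc]
  exact h2

end AlgExp

/-! ### The inverse function theorem for superdomains -/

section InverseFunction

variable {V W : SVect} {q r : ℕ}

/-- The derivatives of the components of a smooth map of superdomains. -/
theorem IsSmoothOn.exists_deriv {U : Set V.E} {F : ∀ q, V.Pt q → W.Pt q}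
    (hF : IsSmoothOn V W U F) {x : V.Pt q} (hx : x ∈ domain V U q) :
    ∃ D : V.Pt q →ₗ[ℝ] W.Pt q, HasLinDeriv (F q) x D ∧ ∀ (a : Ev q) v, D (a • v) = a • D v :=
  (a0SmoothOn_iff.1 (hF.smooth q)).2 x hx

theorem ev_tmul_eq_smul [Subsingleton V.O] (a : Ev q) (e : V.E) :
    ((a ⊗ₜ e, 0) : V.Pt q) = a • V.realPt q e := by
  rw [SVect.realPt_apply]
  refine Prod.ext ?_ (smul_zero a).symm
  exact congrArg (· ⊗ₜ[ℝ] e) (mul_one a).symm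

/-- For purely even superdomains, the derivative at a real point is the extension of the derivative
of the underlying map. -/
theorem IsSmoothOn.bijective_deriv_realPt [Subsingleton V.O] [Subsingleton W.O] {U : Set V.E}
    {F : ∀ q, V.Pt q → W.Pt q} (hU : OpenSet U) (hF : IsSmoothOn V W U F) {u : V.E} (hu : u ∈ U)
    (d : V.E ≃ₗ[ℝ] W.E) (hd : HasLinDeriv (bodyMap F) u (d : V.E →ₗ[ℝ] W.E)) (q : ℕ) :
    ∃ D : V.Pt q ≃ₗ[ℝ] W.Pt q, HasLinDeriv (F q) (V.realPt q u) (D : V.Pt q →ₗ[ℝ] W.Pt q) := by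
  have hx : V.realPt q u ∈ domain V U q := realPt_mem_domain hu
  obtain ⟨D, hD, hDa⟩ := hF.exists_deriv hx
  have h1 : HasLinDeriv (fun u => F q (V.realPt q u)) u (D.comp (V.realPt q)) :=
    HasLinDeriv.comp (E := V.E) (F := V.Pt q) (G := W.Pt q) (g := F q) hU (openSet_domain hU) hu hx
      (smoothOn_linear (E := V.E) (F := V.Pt q) U (V.realPt q)) (hF.smooth q).1
      (hasLinDeriv_linear (E := V.E) (F := V.Pt q) (V.realPt q) u) hD
  have h2 : HasLinDeriv (fun u => F q (V.realPt q u)) u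
      ((W.realPt q).comp (d : V.E →ₗ[ℝ] W.E)) := by
    have h3 : HasLinDeriv (fun u => W.realPt q (bodyMap F u)) u
        ((W.realPt q).comp (d : V.E →ₗ[ℝ] W.E)) :=
      HasLinDeriv.comp (E := V.E) (F := W.E) (G := W.Pt q) (g := W.realPt q) hU openSet_univ hu
        (Set.mem_univ _) hF.smoothOn_bodyMap (smoothOn_linear (E := W.E) (F := W.Pt q) _ _) hd
        (hasLinDeriv_linear (E := W.E) (F := W.Pt q) _ _)
    exact h3.congr hU hu fun v hv => hF.realPt_eq hv
  -- Along real points the map is its body map, so on real directions `D` agrees with `d`. Real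
  -- directions span the tangent space over `A₀` when there are no odd coordinates, and `D` is
  -- `A₀`-linear, hence `D` is the extension of `d`.
  have h4 : ∀ e, D (V.realPt q e) = W.realPt q (d e) := fun e =>
    LinearMap.congr_fun (h1.unique (E := V.E) (F := W.Pt q) h2) e
  have sV : Subsingleton (Od q ⊗[ℝ] V.O) := inferInstance
  have sW : Subsingleton (Od q ⊗[ℝ] W.O) := inferInstance
  let D' : V.Pt q ≃ₗ[ℝ] W.Pt q := LinearEquiv.prodCongr
    (TensorProduct.congr (LinearEquiv.refl ℝ (Ev q)) d)
    { toFun := 0, invFun := 0, map_add' := fun _ _ => Subsingleton.elim _ _,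
      map_smul' := fun _ _ => Subsingleton.elim _ _, left_inv := fun _ => Subsingleton.elim _ _,
      right_inv := fun _ => Subsingleton.elim _ _ }
  have e : (D' : V.Pt q →ₗ[ℝ] W.Pt q) = D := by
    refine LinearMap.ext fun x => ?_
    obtain ⟨x, y⟩ := x
    obtain rfl : y = 0 := Subsingleton.elim _ _
    induction x with
    | zero => exact (map_zero _).trans (map_zero D).symm
    | add x y hx hy =>
      rw [show ((x + y, 0) : V.Pt q) = (x, 0) + (y, 0) from Prod.ext rfl (add_zero _).symm,
        map_add, map_add, hx, hy]
    | tmul a e =>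
      rw [ev_tmul_eq_smul, hDa, h4, ← ev_tmul_eq_smul, ← ev_tmul_eq_smul]
      exact Prod.ext rfl (Subsingleton.elim _ _)
  exact ⟨D', e ▸ hD⟩

theorem scale_mem_domain {U : Set V.E} (t : ℝ) {x : V.Pt q} (hx : x ∈ domain V U q) :
    V.map (GrHom.scale q t) x ∈ domain V U q := by
  simpa [domain] using hx

theorem map_scale_injective {t : ℝ} (ht : t ≠ 0) {x y : V.Pt q}
    (h : V.map (GrHom.scale q t) x = V.map (GrHom.scale q t) y) : x = y := by
  rw [← SVect.map_scale_scale (inv_mul_cancel₀ ht) x, h, SVect.map_scale_scale (inv_mul_cancel₀ ht)]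

/-- If the derivatives are bijective at real points, they are so everywhere. -/
theorem IsSmoothOn.bijective_deriv {U : Set V.E} {F : ∀ q, V.Pt q → W.Pt q} (hU : OpenSet U)
    (hF : IsSmoothOn V W U F) (h : ∀ u ∈ U, ∃ D : V.Pt q ≃ₗ[ℝ] W.Pt q,
      HasLinDeriv (F q) (V.realPt q u) (D : V.Pt q →ₗ[ℝ] W.Pt q))
    {x : V.Pt q} (hx : x ∈ domain V U q) :
    ∃ D : V.Pt q ≃ₗ[ℝ] W.Pt q, HasLinDeriv (F q) x (D : V.Pt q →ₗ[ℝ] W.Pt q) := by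
  obtain ⟨D, hD⟩ := h _ hx
  obtain ⟨A, hxA, hAS, hA, hA'⟩ := exists_nhds_bijective_deriv (E := V.Pt q) (F := W.Pt q)
    (openSet_domain hU) (hF.smooth q).1 (realPt_mem_domain hx) D hD
  -- Invertibility is open, so it holds at the rescaled point for a small factor. By naturality the
  -- map is conjugate to itself under rescaling, which brings invertibility back to `x`.
  obtain ⟨δ, hδ, hs⟩ := SVect.exists_scale_mem x hA hxA
  have ht0 : δ / 2 ≠ 0 := by positivity
  obtain ⟨D₁, hD₁⟩ := hA' _ (hs (δ / 2) (by rw [abs_of_pos (by positivity)]; linarith))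
  set t := δ / 2
  let eV : V.Pt q ≃ₗ[ℝ] V.Pt q := LinearEquiv.ofLinear (V.map (GrHom.scale q t))
    (V.map (GrHom.scale q t⁻¹))
    (LinearMap.ext (SVect.map_scale_scale (mul_inv_cancel₀ ht0)))
    (LinearMap.ext (SVect.map_scale_scale (inv_mul_cancel₀ ht0)))
  let eW : W.Pt q ≃ₗ[ℝ] W.Pt q := LinearEquiv.ofLinear (W.map (GrHom.scale q t⁻¹))
    (W.map (GrHom.scale q t))
    (LinearMap.ext (SVect.map_scale_scale (inv_mul_cancel₀ ht0)))
    (LinearMap.ext (SVect.map_scale_scale (mul_inv_cancel₀ ht0)))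
  refine ⟨(eV.trans D₁).trans eW, ?_⟩
  have h1 : HasLinDeriv (fun y => F q (V.map (GrHom.scale q t) y)) x
      ((D₁ : V.Pt q →ₗ[ℝ] W.Pt q).comp (V.map (GrHom.scale q t))) :=
    HasLinDeriv.comp (E := V.Pt q) (F := V.Pt q) (G := W.Pt q) (g := F q) (openSet_domain hU)
      (openSet_domain hU) hx (scale_mem_domain t hx) (smoothOn_linear (E := V.Pt q) _ _)
      (hF.smooth q).1 (hasLinDeriv_linear (E := V.Pt q) _ _) hD₁
  have h2 : SmoothOn (domain V U q) fun y => F q (V.map (GrHom.scale q t) y) :=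
    SmoothOn.comp (E := V.Pt q) (F := V.Pt q) (G := W.Pt q) (hF.smooth q).1
      (smoothOn_linear (E := V.Pt q) _ _) fun y hy => scale_mem_domain t hy
  have h3 := HasLinDeriv.comp (E := V.Pt q) (F := W.Pt q) (G := W.Pt q)
    (g := W.map (GrHom.scale q t⁻¹)) (openSet_domain hU) openSet_univ hx (Set.mem_univ _) h2
    (smoothOn_linear (E := W.Pt q) _ _) h1 (hasLinDeriv_linear (E := W.Pt q) _ _)
  refine HasLinDeriv.congr (E := V.Pt q) (F := W.Pt q) (openSet_domain hU) hx h3 fun y hy => ?_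
  rw [hF.natural q q _ y hy, SVect.map_scale_scale (inv_mul_cancel₀ ht0)]

/-- The inverse function theorem for purely even superdomains. -/
theorem IsSmoothOn.exists_inverse [Subsingleton V.O] [Subsingleton W.O] {U : Set V.E}
    {F : ∀ q, V.Pt q → W.Pt q} (hU : OpenSet U) (hF : IsSmoothOn V W U F) {u : V.E} (hu : u ∈ U)
    (d : V.E ≃ₗ[ℝ] W.E) (hd : HasLinDeriv (bodyMap F) u (d : V.E →ₗ[ℝ] W.E)) :
    ∃ (A : Set V.E) (B : Set W.E) (G : ∀ q, W.Pt q → V.Pt q), u ∈ A ∧ A ⊆ U ∧ OpenSet A ∧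
      OpenSet B ∧ IsSmoothOn W V B G ∧
      (∀ q, ∀ x ∈ domain V A q, F q x ∈ domain W B q ∧ G q (F q x) = x) ∧
      (∀ q, ∀ y ∈ domain W B q, G q y ∈ domain V A q ∧ F q (G q y) = y) := by
  -- The sets `A` and `B` are chosen from the body map alone and serve all Grassmann algebras
  -- simultaneously; the components of the map are shown to be bijections over them.
  obtain ⟨S, huS, hSU, hS, hSd⟩ := exists_nhds_bijective_deriv (E := V.E) (F := W.E) hU
    hF.smoothOn_bodyMap hu d hd
  obtain ⟨A, B, g, huA, hAS, hA, hB, hg, hfg, hgf⟩ := exists_local_inverse (E := V.E) (F := W.E)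
    hS (hF.smoothOn_bodyMap.mono hSU) hSd huS
  have hAU := hAS.trans hSU
  have hFA := hF.mono hAU
  have hD : ∀ q, ∀ x ∈ domain V A q, ∃ D : V.Pt q ≃ₗ[ℝ] W.Pt q,
      HasLinDeriv (F q) x (D : V.Pt q →ₗ[ℝ] W.Pt q) := by
    intro q x hx
    refine hFA.bijective_deriv hA (fun u hu => ?_) hx
    obtain ⟨d, hd⟩ := hSd u (hAS hu)
    exact hFA.bijective_deriv_realPt hA hu d hd q
  have hloc : ∀ q, ∀ x ∈ domain V A q, ∃ (A' : Set (V.Pt q)) (B' : Set (W.Pt q))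
      (g' : W.Pt q → V.Pt q), x ∈ A' ∧ A' ⊆ domain V A q ∧ OpenSet A' ∧ OpenSet B' ∧
      SmoothOn B' g' ∧ (∀ a ∈ A', F q a ∈ B' ∧ g' (F q a) = a) ∧
      (∀ b ∈ B', g' b ∈ A' ∧ F q (g' b) = b) := fun q x hx =>
    exists_local_inverse (E := V.Pt q) (F := W.Pt q) (openSet_domain hA) (hFA.smooth q).1 (hD q) hx
  -- Points with the same value have the same body, as the body map is injective on `A`. A common
  -- small rescaling moves both into a neighbourhood of that body where the component is injective.
  have hinj : ∀ q, ∀ x ∈ domain V A q, ∀ y ∈ domain V A q, F q x = F q y → x = y := by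
    intro q x hx y hy hxy
    have hb : V.body x = V.body y := by
      have h := congrArg W.body hxy
      rw [hFA.body_eq hx, hFA.body_eq hy] at h
      rw [← (hfg _ hx).2, h, (hfg _ hy).2]
    obtain ⟨A', B', g', hxA', -, hA', -, -, h1, -⟩ := hloc q _ (realPt_mem_domain hx)
    obtain ⟨δ, hδ, hs⟩ := SVect.exists_scale_mem x hA' hxA'
    obtain ⟨δ', hδ', hs'⟩ := SVect.exists_scale_mem y hA' (hb ▸ hxA')
    have hm : 0 < min δ δ' := lt_min hδ hδ'
    have habs : |min δ δ' / 2| < min δ δ' := by rw [abs_of_pos (by positivity)]; linarith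
    have h2 := hs _ (habs.trans_le (min_le_left _ _))
    have h3 := hs' _ (habs.trans_le (min_le_right _ _))
    refine map_scale_injective (t := min δ δ' / 2) (by positivity) ?_
    rw [← (h1 _ h2).2, ← (h1 _ h3).2, hFA.natural q q _ x hx, hFA.natural q q _ y hy, hxy]
  -- A small rescaling of `y` lies in the image of a neighbourhood of the real point over the
  -- preimage of its body; scaling the solution back solves the equation for `y`.
  have hsurj : ∀ q, ∀ y ∈ domain W B q, ∃ x ∈ domain V A q, F q x = y := by
    intro q y hy
    have hx := (hgf _ hy).1
    obtain ⟨A', B', g', hxA', hA'A, -, hB', -, h1, h2⟩ := hloc q _ (realPt_mem_domain (q := q) hx)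
    have h3 := (h1 _ hxA').1
    rw [hFA.realPt_eq hx, (hgf _ hy).2] at h3
    obtain ⟨δ, hδ, hs⟩ := SVect.exists_scale_mem y hB' h3
    have ht0 : δ / 2 ≠ 0 := by positivity
    have h4 := h2 _ (hs (δ / 2) (by rw [abs_of_pos (by positivity)]; linarith))
    have h5 := hA'A h4.1
    refine ⟨V.map (GrHom.scale q (δ / 2)⁻¹) (g' (W.map (GrHom.scale q (δ / 2)) y)),
      scale_mem_domain _ h5, ?_⟩
    rw [hFA.natural q q _ _ h5, h4.2, SVect.map_scale_scale (inv_mul_cancel₀ ht0)]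
  choose G hGA hG using hsurj
  classical
  let G' : ∀ q, W.Pt q → V.Pt q := fun q y => if h : y ∈ domain W B q then G q y h else 0
  have hG' : ∀ q, ∀ y ∈ domain W B q, G' q y ∈ domain V A q ∧ F q (G' q y) = y := by
    intro q y hy
    simp only [G', dif_pos hy]
    exact ⟨hGA q y hy, hG q y hy⟩
  have hFB : ∀ q, ∀ x ∈ domain V A q, F q x ∈ domain W B q := by
    intro q x hx
    have := (hfg _ hx).1
    rwa [← hFA.body_eq hx] at this
  have hGF : ∀ q, ∀ x ∈ domain V A q, G' q (F q x) = x := fun q x hx =>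
    hinj q _ (hG' q _ (hFB q x hx)).1 x hx (hG' q _ (hFB q x hx)).2
  -- By injectivity the global inverse agrees with the local smooth inverses near each point.
  have hsm : ∀ q, SmoothOn (domain W B q) (G' q) := by
    intro q
    refine SmoothOn.of_locally (E := W.Pt q) (F := V.Pt q) fun y hy => ?_
    obtain ⟨A', B', g', hxA', hA'A, -, hB', hg', h1, h2⟩ := hloc q _ (hG' q y hy).1
    refine ⟨B', hB', ?_, hg'.congr fun b hb => ?_⟩
    · have := (h1 _ hxA').1
      rwa [(hG' q y hy).2] at this
    · have h3 := h2 b hb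
      conv_lhs => rw [← h3.2]
      exact hGF q _ (hA'A h3.1)
  refine ⟨A, B, G', huA, hAU, hA, hB, ⟨?_, ?_⟩, fun q x hx => ⟨hFB q x hx, hGF q x hx⟩, hG'⟩
  · intro q r f y hy
    have h1 := hG' q y hy
    have h2 : V.map f (G' q y) ∈ domain V A r := by
      have := h1.1
      simpa [domain] using this
    have h3 := hGF r _ h2
    rwa [hFA.natural q r f _ h1.1, h1.2] at h3
  · intro q
    refine a0SmoothOn_iff.2 ⟨hsm q, fun y hy => ?_⟩
    obtain ⟨hx, hxy⟩ := hG' q y hy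
    obtain ⟨D, hDF, hDa⟩ := hFA.exists_deriv hx
    obtain ⟨D₁, hD₁⟩ := hD q _ hx
    -- The derivative is unique, so the bijective one is also the `A₀`-linear one. The derivative of
    -- the inverse is its inverse and inherits linearity.
    obtain rfl : D₁.toLinearMap = D := hD₁.unique (E := V.Pt q) (F := W.Pt q) hDF
    obtain ⟨D', hD'⟩ := HasLinDeriv.exists_of_smoothOn (E := W.Pt q) (F := V.Pt q)
      (openSet_domain hB) (hsm q) hy
    have h1 : HasLinDeriv (fun y => F q (G' q y)) y (D₁.toLinearMap.comp D') :=
      HasLinDeriv.comp (E := W.Pt q) (F := V.Pt q) (G := W.Pt q) (g := F q) (openSet_domain hB)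
        (openSet_domain hA) hy hx (hsm q) (hFA.smooth q).1 hD' hDF
    have h2 : HasLinDeriv (fun y => F q (G' q y)) y LinearMap.id :=
      HasLinDeriv.congr (E := W.Pt q) (F := W.Pt q) (openSet_domain hB) hy
        (hasLinDeriv_linear (E := W.Pt q) LinearMap.id y) fun z hz => (hG' q z hz).2
    have h3 : ∀ v, D₁ (D' v) = v := fun v =>
      LinearMap.congr_fun (h1.unique (E := W.Pt q) (F := W.Pt q) h2) v
    refine ⟨D', hD', fun a v => D₁.injective ?_⟩
    rw [h3]
    refine Eq.trans ?_ (hDa a (D' v)).symm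
    exact congrArg (a • ·) (h3 v).symm

end InverseFunction

/-! ### The Lorentz group is a supermanifold -/

section Small

variable {E : Type} [AddCommGroup E] [Module ℝ E] [Module.Finite ℝ E]

/-- Near zero, a quadratic map has no fixed points but zero. -/
theorem exists_nhds_quadratic (Q : E →ₗ[ℝ] E →ₗ[ℝ] E) :
    ∃ N : Set E, OpenSet N ∧ 0 ∈ N ∧ ∀ m ∈ N, Q m m = m → m = 0 := by
  let := coordNorm E; let := coordSpace E
  let Qc : E →L[ℝ] E →L[ℝ] E := LinearMap.toContinuousLinearMap
    ((LinearMap.toContinuousLinearMap : (E →ₗ[ℝ] E) ≃ₗ[ℝ] (E →L[ℝ] E)).toLinearMap.comp Q)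
  have hQ : ∀ m, Qc m m = Q m m := fun m => rfl
  -- A fixed point satisfies |m| ≤ |Q||m|², which for m ≠ 0 forces |Q||m| ≥ 1. The summand 1 keeps
  -- the radius meaningful when Q = 0.
  refine ⟨Metric.ball 0 (1 / (‖Qc‖ + 1)), (openSet_iff_isOpen _).2 Metric.isOpen_ball,
    Metric.mem_ball_self (by positivity), fun m hm h => ?_⟩
  by_contra hne
  have h1 : 0 < ‖m‖ := norm_pos_iff.2 hne
  have h2 := Qc.le_opNorm₂ m m
  rw [hQ, h] at h2
  rw [mem_ball_zero_iff, lt_div_iff₀ (by positivity)] at hm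
  have h3 : 1 ≤ ‖Qc‖ * ‖m‖ := by
    by_contra h4
    push Not at h4
    nlinarith
  nlinarith

theorem exists_comp_eq_of_ker_le {F G : Type} [AddCommGroup F] [Module ℝ F] [AddCommGroup G]
    [Module ℝ G] (f : E →ₗ[ℝ] F) (g : E →ₗ[ℝ] G) (h : LinearMap.ker f ≤ LinearMap.ker g) :
    ∃ k : F →ₗ[ℝ] G, k.comp f = g := by
  obtain ⟨s, hs⟩ := f.rangeRestrict.exists_rightInverse_of_surjective f.range_rangeRestrict
  obtain ⟨k, hk⟩ := LinearMap.exists_extend (g.comp s)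
  refine ⟨k, LinearMap.ext fun x => ?_⟩
  have h1 : k (f x) = g (s (f.rangeRestrict x)) :=
    LinearMap.congr_fun hk (f.rangeRestrict x)
  have h2 : f.rangeRestrict (s (f.rangeRestrict x)) = f.rangeRestrict x :=
    LinearMap.congr_fun hs _
  have h3 : x - s (f.rangeRestrict x) ∈ LinearMap.ker f := by
    rw [LinearMap.mem_ker, map_sub, sub_eq_zero]
    exact (congrArg Subtype.val h2).symm
  have h4 := h h3
  rw [LinearMap.mem_ker, map_sub, sub_eq_zero] at h4
  rw [LinearMap.comp_apply, h1, h4]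

end Small

section SpinManifold

variable {K : Type} [NormedAddCommGroup K] [InnerProductSpace ℝ K] [FiniteDimensional ℝ K]
  [NormedDivAlg K] {q r : ℕ}

variable (K) in
/-- The projection of the Clifford algebra along the vectors. -/
def nonVec : Cliff K →ₗ[ℝ] Cliff K :=
  LinearMap.id - (CliffordAlgebra.ι (minkowskiQ K)).comp (vecPart K)

theorem nonVec_ι (v : Vec K) : nonVec K (CliffordAlgebra.ι (minkowskiQ K) v) = 0 := by
  simp [nonVec, vecPart_ι]

theorem eq_ι_of_nonVec {c : Cliff K} (h : nonVec K c = 0) :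
    c = CliffordAlgebra.ι (minkowskiQ K) (vecPart K c) := sub_eq_zero.1 h

variable (K) in
/-- Indices for the equations that define the Lie algebra of the Lorentz group. -/
abbrev LieIndex : Type := Option (Option (Fin (Module.finrank ℝ (Vec K))))

variable (K) in
/-- The vectors of a basis, as elements of the Clifford algebra. -/
def cliffVec (j : Fin (Module.finrank ℝ (Vec K))) : Cliff K :=
  CliffordAlgebra.ι (minkowskiQ K) (Module.finBasis ℝ (Vec K) j)

variable (K) in
/-- The linear equations that define the Lie algebra of the Lorentz group. -/
def lieEq : LieIndex K → Cliff K →ₗ[ℝ] Cliff K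
  | none => (CliffordAlgebra.involute (Q := minkowskiQ K)).toLinearMap - LinearMap.id
  | some none => LinearMap.id + CliffordAlgebra.reverse
  | some (some j) => (nonVec K).comp
      (LinearMap.mulRight ℝ (cliffVec K j) - LinearMap.mulLeft ℝ (cliffVec K j))

variable (K) in
/-- The quadratic terms of the equations that define the Lorentz group. -/
def lieQuad : LieIndex K → Cliff K →ₗ[ℝ] Cliff K →ₗ[ℝ] Cliff K
  | none => 0
  | some none => -(LinearMap.mul ℝ (Cliff K)).compl₂ CliffordAlgebra.reverse
  | some (some j) => (((LinearMap.mul ℝ (Cliff K)).compl₁₂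
      (LinearMap.mulLeft ℝ (cliffVec K j) - LinearMap.mulRight ℝ (cliffVec K j))
        CliffordAlgebra.reverse)).compr₂ (nonVec K)

variable (K) in
/-- The Lie algebra of the Lorentz group. -/
def spinLie : Submodule ℝ (Cliff K) := LinearMap.ker (LinearMap.pi (lieEq K))

theorem lieEq_spinLie (j : LieIndex K) (x : spinLie K) : lieEq K j x = 0 :=
  congrFun (LinearMap.mem_ker.1 x.2) j

/-- The defining equations state this for basis vectors only, in the form that the non-vector part
of the commutator vanishes; linearity gives all vectors. -/
theorem commutator_spinLie (x : spinLie K) (v : Vec K) : ∃ w,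
    (x : Cliff K) * CliffordAlgebra.ι (minkowskiQ K) v -
      CliffordAlgebra.ι (minkowskiQ K) v * x = CliffordAlgebra.ι (minkowskiQ K) w := by
  have h : (nonVec K).comp ((LinearMap.mulLeft ℝ (x : Cliff K) - LinearMap.mulRight ℝ (x : Cliff K)).comp
      (CliffordAlgebra.ι (minkowskiQ K))) = 0 :=
    (Module.finBasis ℝ (Vec K)).ext fun j => lieEq_spinLie (some (some j)) x
  exact ⟨_, eq_ι_of_nonVec (LinearMap.congr_fun h v)⟩

theorem exists_spinLieProj : ∃ p : Cliff K →ₗ[ℝ] spinLie K, p.comp (spinLie K).subtype = LinearMap.id :=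
  LinearMap.exists_leftInverse_of_injective _ (spinLie K).ker_subtype

variable (K) in
/-- A projection of the Clifford algebra to the Lie algebra of the Lorentz group. -/
def spinLieProj : Cliff K →ₗ[ℝ] spinLie K := exists_spinLieProj.choose

theorem spinLieProj_coe (x : spinLie K) : spinLieProj K x = x :=
  LinearMap.congr_fun exists_spinLieProj.choose_spec x

variable (K) in
/-- The projection to the Lie algebra, as an endomorphism. -/
def lieProj : Cliff K →ₗ[ℝ] Cliff K := (spinLie K).subtype.comp (spinLieProj K)

/-- The joint kernel of the equations is the Lie algebra, on which the projection is the identity.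
So the complementary component factors through the values of the equations. -/
theorem exists_lieSection : ∃ k : (LieIndex K → Cliff K) →ₗ[ℝ] Cliff K,
    k.comp (LinearMap.pi (lieEq K)) = LinearMap.id - lieProj K := by
  refine exists_comp_eq_of_ker_le _ _ fun x hx => ?_
  have h := spinLieProj_coe ⟨x, hx⟩
  rw [LinearMap.mem_ker, LinearMap.sub_apply, sub_eq_zero]
  exact (congrArg Subtype.val h).symm

variable (K) in
/-- The components of a map that recovers an element of the complement of the Lie algebra from
the left hand sides of the equations. -/
def lieSection (j : LieIndex K) : Cliff K →ₗ[ℝ] Cliff K :=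
  exists_lieSection.choose.comp (LinearMap.single ℝ (fun _ : LieIndex K => Cliff K) j)

theorem sum_lieSection : ∑ j, (lieSection K j).comp (lieEq K j) = LinearMap.id - lieProj K := by
  classical
  rw [← exists_lieSection.choose_spec]
  refine LinearMap.ext fun x => ?_
  rw [LinearMap.sum_apply, LinearMap.comp_apply]
  conv_rhs => rw [← Finset.univ_sum_single (LinearMap.pi (lieEq K) x)]
  rw [map_sum]
  rfl

variable (K) in
/-- The quadratic map that has the element `s - 1` as a fixed point, for `s` in the Lorentz group with
`s - 1` in the complement of the Lie algebra. -/
def lieFix : Cliff K →ₗ[ℝ] Cliff K →ₗ[ℝ] Cliff K :=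
  ∑ j, (lieQuad K j).compr₂ (lieSection K j)

variable (q) in
/-- The extension of a linear map of the Clifford algebra to `A`-points. -/
def linA (L : Cliff K →ₗ[ℝ] Cliff K) : Ev q ⊗[ℝ] Cliff K →ₗ[ℝ] Ev q ⊗[ℝ] Cliff K :=
  TensorProduct.map LinearMap.id L

variable (q) in
/-- The extension of a bilinear map of the Clifford algebra to `A`-points. -/
def bilA (b : Cliff K →ₗ[ℝ] Cliff K →ₗ[ℝ] Cliff K) :
    Ev q ⊗[ℝ] Cliff K →ₗ[ℝ] Ev q ⊗[ℝ] Cliff K →ₗ[ℝ] Ev q ⊗[ℝ] Cliff K :=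
  TensorProduct.map₂ (LinearMap.mul ℝ (Ev q)) b

theorem linA_linA (L M : Cliff K →ₗ[ℝ] Cliff K) (x : Ev q ⊗[ℝ] Cliff K) :
    linA q L (linA q M x) = linA q (L.comp M) x := by
  rw [linA, linA, ← LinearMap.comp_apply, ← TensorProduct.map_comp]; rfl

theorem linA_id (x : Ev q ⊗[ℝ] Cliff K) : linA q LinearMap.id x = x := by
  rw [linA, TensorProduct.map_id]; rfl

theorem linA_add (L M : Cliff K →ₗ[ℝ] Cliff K) (x : Ev q ⊗[ℝ] Cliff K) :
    linA q (L + M) x = linA q L x + linA q M x := by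
  rw [linA, TensorProduct.map_add_right]; rfl

theorem linA_sub (L M : Cliff K →ₗ[ℝ] Cliff K) (x : Ev q ⊗[ℝ] Cliff K) :
    linA q (L - M) x = linA q L x - linA q M x := by
  rw [eq_sub_iff_add_eq, ← linA_add, sub_add_cancel]

theorem linA_zero (x : Ev q ⊗[ℝ] Cliff K) : linA q (0 : Cliff K →ₗ[ℝ] Cliff K) x = 0 := by
  rw [linA, TensorProduct.map_zero_right]; rfl

theorem linA_sum {J : Type} (s : Finset J) (L : J → Cliff K →ₗ[ℝ] Cliff K)
    (x : Ev q ⊗[ℝ] Cliff K) : linA q (∑ j ∈ s, L j) x = ∑ j ∈ s, linA q (L j) x := by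
  classical
  induction s using Finset.induction_on with
  | empty => rw [Finset.sum_empty, Finset.sum_empty, linA_zero]
  | insert j s hj ih => rw [Finset.sum_insert hj, Finset.sum_insert hj, linA_add, ih]

/-- Identities between bilinear maps on `A`-points follow from those on pure tensors. -/
theorem bilA_eq {b : Cliff K →ₗ[ℝ] Cliff K →ₗ[ℝ] Cliff K}
    {f : Ev q ⊗[ℝ] Cliff K →ₗ[ℝ] Ev q ⊗[ℝ] Cliff K →ₗ[ℝ] Ev q ⊗[ℝ] Cliff K}
    (h : ∀ a x c y, f (a ⊗ₜ x) (c ⊗ₜ y) = (a * c) ⊗ₜ b x y) (x y : Ev q ⊗[ℝ] Cliff K) :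
    bilA q b x y = f x y := by
  refine SVect.tensor_induction₂ (P := fun x y => bilA q b x y = f x y) ?_ ?_ ?_ ?_ ?_ x y
  · intro y; simp only [map_zero, LinearMap.zero_apply]
  · intro y; simp only [map_zero]
  · intro x x' y h1 h2; simp only [map_add, LinearMap.add_apply, h1, h2]
  · intro x y y' h1 h2; simp only [map_add, h1, h2]
  · intro a e b f
    exact (h _ _ _ _).symm

theorem bilA_compr₂ (b : Cliff K →ₗ[ℝ] Cliff K →ₗ[ℝ] Cliff K) (L : Cliff K →ₗ[ℝ] Cliff K)
    (x y : Ev q ⊗[ℝ] Cliff K) : bilA q (b.compr₂ L) x y = linA q L (bilA q b x y) :=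
  bilA_eq (f := (bilA q b).compr₂ (linA q L)) (fun _ _ _ _ => rfl) x y

theorem bilA_sum {J : Type} (s : Finset J) (b : J → Cliff K →ₗ[ℝ] Cliff K →ₗ[ℝ] Cliff K)
    (x y : Ev q ⊗[ℝ] Cliff K) : bilA q (∑ j ∈ s, b j) x y = ∑ j ∈ s, bilA q (b j) x y := by
  rw [bilA_eq (f := ∑ j ∈ s, bilA q (b j))]
  · simp only [LinearMap.sum_apply]
  · intro a x c y
    simp only [LinearMap.sum_apply, TensorProduct.tmul_sum]
    rfl

theorem iotaA_basis (j : Fin (Module.finrank ℝ (Vec K))) :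
    iotaA K q ((1 : Ev q) ⊗ₜ[ℝ] (Module.finBasis ℝ (Vec K) j : Vec K)) = 1 ⊗ₜ cliffVec K j := rfl

theorem linA_nonVec_iotaA (v : Ev q ⊗[ℝ] Vec K) : linA q (nonVec K) (iotaA K q v) = 0 := by
  rw [linA, iotaA, ← LinearMap.comp_apply, ← TensorProduct.map_comp,
    show (nonVec K).comp (CliffordAlgebra.ι (minkowskiQ K)) = 0 from LinearMap.ext nonVec_ι,
    TensorProduct.map_zero_right]
  rfl

/-- The two sides differ by e(m + r + mr). With r the reversal of m, the relation (1+m)(1+r) = 1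
trades the linear occurrence of r for a quadratic term, and the condition on conjugation becomes a
commutator with m plus a quadratic remainder. -/
theorem commutator_eq_conj_sub {R : Type} [Ring R] (m r e : R) (h : m + r + m * r = 0) :
    (m * e - e * m) - (e * m - m * e) * r = (1 + m) * e * (1 + r) - e := by
  have h1 := congrArg (e * ·) h
  simp only [mul_add, mul_zero] at h1
  rw [← sub_eq_zero, ← neg_eq_zero, ← h1]
  noncomm_ring

theorem bilA_lieQuad_rev (x y : Ev q ⊗[ℝ] Cliff K) :
    bilA q (lieQuad K (some none)) x y = -(x * revA K q y) := by
  refine SVect.tensor_induction₂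
    (P := fun x y => bilA q (lieQuad K (some none)) x y = -(x * revA K q y)) ?_ ?_ ?_ ?_ ?_ x y
  · intro y; rw [map_zero, LinearMap.zero_apply, zero_mul, neg_zero]
  · intro y; rw [map_zero, map_zero, mul_zero, neg_zero]
  · intro x x' y h1 h2; rw [map_add, LinearMap.add_apply, h1, h2, add_mul, neg_add]
  · intro x y y' h1 h2; rw [map_add, map_add, h1, h2, mul_add, neg_add]
  · intro a x c y
    change (a * c) ⊗ₜ[ℝ] (-(x * CliffordAlgebra.reverse y)) =
      -((a ⊗ₜ[ℝ] x) * (c ⊗ₜ[ℝ] CliffordAlgebra.reverse y))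
    rw [Algebra.TensorProduct.tmul_mul_tmul, TensorProduct.tmul_neg]

theorem bilA_lieQuad_vec (j : Fin (Module.finrank ℝ (Vec K))) (x y : Ev q ⊗[ℝ] Cliff K) :
    bilA q (lieQuad K (some (some j))) x y = linA q (nonVec K)
      ((((1 : Ev q) ⊗ₜ[ℝ] cliffVec K j) * x - x * ((1 : Ev q) ⊗ₜ[ℝ] cliffVec K j)) *
        revA K q y) := by
  set e : Ev q ⊗[ℝ] Cliff K := 1 ⊗ₜ cliffVec K j with he
  refine SVect.tensor_induction₂
    (P := fun x y => bilA q (lieQuad K (some (some j))) x y =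
      linA q (nonVec K) ((e * x - x * e) * revA K q y)) ?_ ?_ ?_ ?_ ?_ x y
  · intro y; rw [map_zero, LinearMap.zero_apply, zero_mul, mul_zero, sub_zero, zero_mul, map_zero]
  · intro y; rw [map_zero, map_zero, mul_zero, map_zero]
  · intro x x' y h1 h2
    rw [map_add, LinearMap.add_apply, h1, h2, ← map_add, ← add_mul, mul_add e, add_mul x,
      add_sub_add_comm]
  · intro x y y' h1 h2; rw [map_add, map_add, h1, h2, ← map_add, ← mul_add]
  · intro a x c y
    have h1 : (e * a ⊗ₜ[ℝ] x - a ⊗ₜ[ℝ] x * e) * revA K q (c ⊗ₜ[ℝ] y) =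
        (a * c) ⊗ₜ[ℝ] ((cliffVec K j * x - x * cliffVec K j) * CliffordAlgebra.reverse y) := by
      rw [he, Algebra.TensorProduct.tmul_mul_tmul, Algebra.TensorProduct.tmul_mul_tmul, mul_one,
        one_mul, ← TensorProduct.tmul_sub]
      exact Algebra.TensorProduct.tmul_mul_tmul _ _ _ _
    exact (congrArg (linA q (nonVec K)) h1).symm

theorem linA_lieEq_vec (j : Fin (Module.finrank ℝ (Vec K))) (x : Ev q ⊗[ℝ] Cliff K) :
    linA q (lieEq K (some (some j))) x = linA q (nonVec K)
      (x * ((1 : Ev q) ⊗ₜ[ℝ] cliffVec K j) - ((1 : Ev q) ⊗ₜ[ℝ] cliffVec K j) * x) := by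
  set e : Ev q ⊗[ℝ] Cliff K := 1 ⊗ₜ cliffVec K j with he
  induction x with
  | zero => rw [map_zero, mul_zero, zero_mul, sub_zero, map_zero]
  | add x y hx hy => rw [map_add, hx, hy, ← map_add, mul_add e, add_mul x, add_sub_add_comm]
  | tmul a x =>
    have h1 : a ⊗ₜ[ℝ] x * e - e * a ⊗ₜ[ℝ] x =
        a ⊗ₜ[ℝ] (x * cliffVec K j - cliffVec K j * x) := by
      rw [he, Algebra.TensorProduct.tmul_mul_tmul, Algebra.TensorProduct.tmul_mul_tmul, mul_one,
        one_mul, ← TensorProduct.tmul_sub]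
    exact (congrArg (linA q (nonVec K)) h1).symm

/-- The equations of the Lorentz group, separated into linear and quadratic terms. -/
theorem IsSpin.lieEq_eq {m : Ev q ⊗[ℝ] Cliff K} (h : IsSpin (1 + m)) (j : LieIndex K) :
    linA q (lieEq K j) m = bilA q (lieQuad K j) m m := by
  have h1 : m + revA K q m + m * revA K q m = 0 := by
    have := h.mul_rev
    rw [map_add, revA_one] at this
    rw [show m + revA K q m + m * revA K q m = (1 + m) * (1 + revA K q m) - 1 by noncomm_ring, this,
      sub_self]
  match j with
  | none =>
    have h2 := h.even
    rw [map_add, involA_one, add_right_inj] at h2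
    rw [show lieEq K none = (CliffordAlgebra.involute (Q := minkowskiQ K)).toLinearMap -
      LinearMap.id from rfl, linA_sub, linA_id, show linA q _ m = involA K q m from rfl, h2,
      sub_self]
    exact (map₂_zero' _ _ _).symm
  | some none =>
    rw [bilA_lieQuad_rev, ← eq_neg_of_add_eq_zero_left h1,
      show lieEq K (some none) = LinearMap.id + CliffordAlgebra.reverse from rfl, linA_add, linA_id]
    rfl
  | some (some j) =>
    rw [linA_lieEq_vec, bilA_lieQuad_vec]
    set e : Ev q ⊗[ℝ] Cliff K := 1 ⊗ₜ cliffVec K j with he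
    rw [← sub_eq_zero, ← map_sub]
    obtain ⟨w, hw⟩ := h.conj ((1 : Ev q) ⊗ₜ[ℝ] (Module.finBasis ℝ (Vec K) j : Vec K))
    rw [iotaA_basis, ← he, map_add, revA_one] at hw
    -- The difference of the linear and quadratic sides is the change of a basis vector under
    -- conjugation. Both terms of it are vectors, which `nonVec` kills.
    have h4 : (m * e - e * m) - (e * m - m * e) * revA K q m = iotaA K q w - e :=
      (commutator_eq_conj_sub m (revA K q m) e h1).trans (congrArg (· - e) hw)
    refine (congrArg (linA q (nonVec K)) h4).trans ?_
    rw [map_sub, linA_nonVec_iotaA, he, ← iotaA_basis, linA_nonVec_iotaA, sub_zero]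

/-- The section applied to the linear sides of the group equations returns the component of m
outside the Lie algebra, which is all of m. Replacing the linear sides by the quadratic ones gives
the fixed point equation. -/
theorem IsSpin.eq_lieFix {m : Ev q ⊗[ℝ] Cliff K} (h : IsSpin (1 + m))
    (hm : linA q (lieProj K) m = 0) : bilA q (lieFix K) m m = m := by
  rw [lieFix, bilA_sum]
  simp only [bilA_compr₂, ← h.lieEq_eq, linA_linA]
  rw [← linA_sum, sum_lieSection, linA_sub, linA_id, hm, sub_zero]

end SpinManifold

/-! ### The exponential map from the Lie algebra to the Lorentz group on A-points. -/

section SpinExp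

variable {K : Type} [NormedAddCommGroup K] [InnerProductSpace ℝ K] [FiniteDimensional ℝ K]
  [NormedDivAlg K] {q r : ℕ}

variable (K q) in
/-- The inclusion of the `A`-points of the Lie algebra of the Lorentz group. -/
def lieIncl : Ev q ⊗[ℝ] spinLie K →ₗ[ℝ] Ev q ⊗[ℝ] Cliff K :=
  TensorProduct.map LinearMap.id (spinLie K).subtype

theorem involA_lieIncl (X : Ev q ⊗[ℝ] spinLie K) : involA K q (lieIncl K q X) = lieIncl K q X := by
  induction X with
  | zero => rw [map_zero, map_zero]
  | add x y hx hy => rw [map_add, map_add, hx, hy]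
  | tmul a x =>
    have h : CliffordAlgebra.involute (x : Cliff K) - (x : Cliff K) = 0 := lieEq_spinLie none x
    exact congrArg (fun c : Cliff K => a ⊗ₜ[ℝ] c) (sub_eq_zero.1 h)

theorem revA_lieIncl (X : Ev q ⊗[ℝ] spinLie K) : revA K q (lieIncl K q X) = -lieIncl K q X := by
  induction X with
  | zero => rw [map_zero, map_zero, neg_zero]
  | add x y hx hy => rw [map_add, map_add, hx, hy, neg_add]
  | tmul a x =>
    have h : (x : Cliff K) + CliffordAlgebra.reverse (x : Cliff K) = 0 := lieEq_spinLie (some none) x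
    exact (congrArg (fun c : Cliff K => a ⊗ₜ[ℝ] c) (eq_neg_of_add_eq_zero_right h)).trans
      (TensorProduct.tmul_neg _ _)

theorem commutator_lieIncl (X : Ev q ⊗[ℝ] spinLie K) (v : Ev q ⊗[ℝ] Vec K) :
    lieIncl K q X * iotaA K q v - iotaA K q v * lieIncl K q X ∈ LinearMap.range (iotaA K q) := by
  refine SVect.tensor_induction₂ (P := fun X v => lieIncl K q X * iotaA K q v -
    iotaA K q v * lieIncl K q X ∈ LinearMap.range (iotaA K q)) ?_ ?_ ?_ ?_ ?_ X v
  · intro v; rw [map_zero, mul_zero, zero_mul, sub_zero]; exact zero_mem _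
  · intro X; rw [map_zero, mul_zero, zero_mul, sub_zero]; exact zero_mem _
  · intro X X' v h h'
    rw [map_add, mul_add, add_mul, add_sub_add_comm]
    exact add_mem h h'
  · intro X v v' h h'
    rw [map_add, mul_add, add_mul, add_sub_add_comm]
    exact add_mem h h'
  · intro a x b v
    obtain ⟨w, hw⟩ := commutator_spinLie x v
    refine ⟨(a * b) ⊗ₜ w, ?_⟩
    have h1 : (a ⊗ₜ[ℝ] (x : Cliff K)) * (b ⊗ₜ[ℝ] CliffordAlgebra.ι (minkowskiQ K) v) -
        (b ⊗ₜ[ℝ] CliffordAlgebra.ι (minkowskiQ K) v) * (a ⊗ₜ[ℝ] (x : Cliff K)) =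
        (a * b) ⊗ₜ[ℝ] CliffordAlgebra.ι (minkowskiQ K) w := by
      rw [Algebra.TensorProduct.tmul_mul_tmul, Algebra.TensorProduct.tmul_mul_tmul,
        ev_mul_comm b a, ← TensorProduct.tmul_sub, hw]
    exact h1.symm

/-- The exponential map of the Lorentz group. -/
theorem isSpin_aexp (X : Ev q ⊗[ℝ] spinLie K) : IsSpin (aexp (lieIncl K q X)) := by
  -- Reversal is -1 on the Lie algebra, and the reversed order of factors is harmless for powers of
  -- one element.
  have hr : revA K q (aexp (lieIncl K q X)) = aexp (-lieIncl K q X) := by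
    refine map_aexp (revA K q) fun n => ?_
    induction n with
    | zero => rw [pow_zero, pow_zero, revA_one]
    | succ n ih => rw [pow_succ, revA_mul, ih, revA_lieIncl, ← pow_succ']
  refine ⟨?_, ?_, ?_, fun v => ?_⟩
  · refine map_aexp (involA K q) fun n => ?_
    induction n with
    | zero => rw [pow_zero, involA_one]
    | succ n ih => rw [pow_succ, involA_mul, ih, involA_lieIncl]
  · rw [hr, aexp_mul_neg]
  · rw [hr, aexp_neg_mul]
  · rw [hr]
    obtain ⟨w, hw⟩ := aexp_conj_mem (LinearMap.range (iotaA K q)) (x := lieIncl K q X)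
      (by rintro _ ⟨v, rfl⟩; exact commutator_lieIncl X v) (LinearMap.mem_range_self _ v)
    exact ⟨w, hw.symm⟩

end SpinExp

/-! ### Exponential coordinates of a finite-dimensional algebra on A-points. -/

section AlgebraPoints

variable {C : Type} [Ring C] [Algebra ℝ C] [Module.Finite ℝ C] {q r : ℕ}

variable (C) in
/-- The purely even super vector space of an algebra. -/
abbrev algSV : SVect := ⟨C, PUnit⟩

theorem algSV_ext {x y : (algSV C).Pt q} (h : x.1 = y.1) : x = y :=
  Prod.ext h (Subsingleton.elim _ _)

theorem mapEv_pow (f : GrHom q r) (x : Ev q ⊗[ℝ] C) (n : ℕ) :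
    mapEv f C (x ^ n) = mapEv f C x ^ n := by
  induction n with
  | zero => rw [pow_zero, pow_zero, mapEv_one]
  | succ n ih => rw [pow_succ, pow_succ, mapEv_mul, ih]

theorem mapEv_aexp (f : GrHom q r) (x : Ev q ⊗[ℝ] C) :
    mapEv f C (aexp x) = aexp (mapEv f C x) :=
  map_aexp (mapEv f C) (mapEv_pow f x)

theorem aexp_one_tmul (u : C) : aexp ((1 : Ev q) ⊗ₜ[ℝ] u) = (1 : Ev q) ⊗ₜ[ℝ] aexp u :=
  (map_aexp (TensorProduct.mk ℝ (Ev q) C 1) fun n => by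
    rw [Algebra.TensorProduct.tmul_pow, one_pow]; rfl).symm

/-- The exponential map of an algebra, on `A`-points. -/
def expA (q : ℕ) (x : (algSV C).Pt q) : (algSV C).Pt q := (aexp x.1, 0)

/-- Even scalars act as multiplication by the central elements a ⊗ 1, and the derivative of the
exponential commutes with these, which is the required `A₀`-linearity. -/
theorem isSmoothOn_expA : IsSmoothOn (algSV C) (algSV C) Set.univ expA where
  natural q r f x _ := algSV_ext (mapEv_aexp f x.1).symm
  smooth q := by
    rw [a0SmoothOn_iff]
    refine ⟨fun k L l => ?_, fun x _ => ?_⟩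
    · exact smoothOn_aexp (C := Ev q ⊗[ℝ] C) k ((LinearMap.fst ℝ _ _).comp L)
        (l.comp (LinearMap.inl ℝ _ _))
    · obtain ⟨D, hD, hT⟩ := exists_hasLinDeriv_aexp (C := Ev q ⊗[ℝ] C) x.1
      refine ⟨(LinearMap.inl ℝ _ _).comp (D.comp (LinearMap.fst ℝ _ _)),
        fun v l => hD v.1 (l.comp (LinearMap.inl ℝ _ _)), fun a v => algSV_ext ?_⟩
      have h1 := hT (LinearMap.mulLeft ℝ (a ⊗ₜ[ℝ] (1 : C)))
        (fun x y => (mul_assoc _ _ _).symm)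
        (fun x y => by
          change (a ⊗ₜ[ℝ] (1 : C)) * (x * y) = x * ((a ⊗ₜ[ℝ] (1 : C)) * y)
          rw [← mul_assoc, ev_tmul_one_comm, mul_assoc]) v.1
      exact (congrArg D (ev_smul_eq_mul a v.1)).trans
        (h1.trans (ev_smul_eq_mul a (D v.1)).symm)

/-- Coordinates of an algebra near `1`, for a linear map `P`. If `P` is the projection to the Lie
algebra of a group, then the group is given by this Lie algebra in these coordinates. -/
def expCoord (P : C →ₗ[ℝ] C) (q : ℕ) (x : (algSV C).Pt q) : (algSV C).Pt q :=
  SVect.bil (V := algSV C) (W := algSV C) (X := algSV C) (LinearMap.mul ℝ C) 0 0 q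
    (expA q (SVect.lin (V := algSV C) (W := algSV C) P 0 q x))
    ((algSV C).realPt q 1 + SVect.lin (V := algSV C) (W := algSV C) (LinearMap.id - P) 0 q x)

theorem expCoord_fst (P : C →ₗ[ℝ] C) (x : (algSV C).Pt q) :
    (expCoord P q x).1 = aexp (TensorProduct.map LinearMap.id P x.1 : Ev q ⊗[ℝ] C) *
      (1 + TensorProduct.map LinearMap.id (LinearMap.id - P) x.1) := by
  rw [tensor_mul_eq_map₂]
  exact bil_zero_fst (V := algSV C) (W := algSV C) (X := algSV C) _ _ _ _

theorem isSmoothOn_expCoord (P : C →ₗ[ℝ] C) :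
    IsSmoothOn (algSV C) (algSV C) Set.univ (expCoord P) :=
  IsSmoothOn.bil openSet_univ
    (isSmoothOn_expA.comp_univ openSet_univ (isSmoothOn_lin (V := algSV C) (W := algSV C) _ P 0))
    ((isSmoothOn_realPt (V := algSV C) (W := algSV C) Set.univ (1 : C)).add
      (isSmoothOn_lin (V := algSV C) (W := algSV C) _ (LinearMap.id - P : C →ₗ[ℝ] C) 0)) _ _ _

theorem bodyMap_expCoord (P : C →ₗ[ℝ] C) (u : C) :
    bodyMap (V := algSV C) (W := algSV C) (expCoord P) u =
      aexp (P u) * (1 + (LinearMap.id - P : C →ₗ[ℝ] C) u) := by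
  have h : expCoord P 0 ((algSV C).realPt 0 u) =
      (algSV C).realPt 0 (aexp (P u) * (1 + (LinearMap.id - P : C →ₗ[ℝ] C) u)) := by
    refine algSV_ext ((expCoord_fst P _).trans ?_)
    change aexp ((1 : Ev 0) ⊗ₜ[ℝ] P u) *
      ((1 : Ev 0) ⊗ₜ[ℝ] (1 : C) + (1 : Ev 0) ⊗ₜ[ℝ] (LinearMap.id - P : C →ₗ[ℝ] C) u) = _
    rw [aexp_one_tmul, ← TensorProduct.tmul_add, Algebra.TensorProduct.tmul_mul_tmul, one_mul]
    rfl
  exact (congrArg _ h).trans (SVect.body_realPt _)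

/-- At the origin the exponential factor contributes P and the linear factor 1 - P, which sum to the
identity for any linear P. -/
theorem hasLinDeriv_bodyMap_expCoord (P : C →ₗ[ℝ] C) :
    HasLinDeriv (bodyMap (V := algSV C) (W := algSV C) (expCoord P)) (0 : C)
      (LinearMap.id : C →ₗ[ℝ] C) := by
  have h0 : HasLinDeriv (aexp : C → C) (P 0) LinearMap.id := by
    rw [map_zero]; exact hasLinDeriv_aexp_zero
  have h1 : HasLinDeriv (fun u : C => aexp (P u)) 0 (LinearMap.id.comp P) :=
    HasLinDeriv.comp openSet_univ openSet_univ (Set.mem_univ _) (Set.mem_univ _)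
      (smoothOn_linear _ P) smoothOn_aexp (hasLinDeriv_linear P 0) h0
  have h2 : HasLinDeriv (fun u : C => 1 + (LinearMap.id - P : C →ₗ[ℝ] C) u) 0 (0 + (LinearMap.id - P)) :=
    (hasLinDeriv_const 1 0).add (hasLinDeriv_linear (LinearMap.id - P : C →ₗ[ℝ] C) 0)
  have h3 := HasLinDeriv.bilin openSet_univ (Set.mem_univ _)
    (smoothOn_aexp.comp (smoothOn_linear Set.univ P) fun _ _ => Set.mem_univ _)
    ((smoothOn_const Set.univ 1).add (smoothOn_linear Set.univ (LinearMap.id - P))) h1 h2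
    (LinearMap.mul ℝ C)
  have h4 : ((LinearMap.mul ℝ C) (aexp (P 0))).comp (0 + (LinearMap.id - P)) +
      ((LinearMap.mul ℝ C).flip (1 + (LinearMap.id - P : C →ₗ[ℝ] C) 0)).comp (LinearMap.id.comp P) =
        LinearMap.id := by
    refine LinearMap.ext fun u => ?_
    simp [aexp_zero]
  rw [h4] at h3
  exact h3.congr openSet_univ (Set.mem_univ _) fun u _ => bodyMap_expCoord P u

theorem exists_inverse_expCoord (P : C →ₗ[ℝ] C) :
    ∃ (A B : Set C) (G : ∀ q, (algSV C).Pt q → (algSV C).Pt q), 0 ∈ A ∧ OpenSet A ∧ OpenSet B ∧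
      IsSmoothOn (algSV C) (algSV C) B G ∧
      (∀ q, ∀ x ∈ domain (algSV C) A q,
        expCoord P q x ∈ domain (algSV C) B q ∧ G q (expCoord P q x) = x) ∧
      (∀ q, ∀ y ∈ domain (algSV C) B q,
        G q y ∈ domain (algSV C) A q ∧ expCoord P q (G q y) = y) := by
  obtain ⟨A, B, G, h1, -, h2, h3, h4, h5, h6⟩ := (isSmoothOn_expCoord P).exists_inverse
    openSet_univ (Set.mem_univ (0 : C)) (LinearEquiv.refl ℝ C) (hasLinDeriv_bodyMap_expCoord P)
  exact ⟨A, B, G, h1, h2, h3, h4, h5, h6⟩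

end AlgebraPoints

/-! ### Small fixed points of quadratic maps on A-points. -/

section QuadraticFix

variable {V : SVect} {q : ℕ}

theorem SVect.bil_realPt (b : V.E →ₗ[ℝ] V.E →ₗ[ℝ] V.E) (u v : V.E) :
    SVect.bil (V := V) (W := V) (X := V) b 0 0 q (V.realPt q u) (V.realPt q v) =
      V.realPt q (b u v) := by
  rw [SVect.bil_apply, SVect.realPt_apply, SVect.realPt_apply, SVect.realPt_apply]
  simp [TensorProduct.map₂_apply_tmul]

/-- The body is itself a fixed point, so it vanishes by the choice of `N`. A small rescaling then
brings the nilpotent remainder near zero in V_A while keeping it fixed, and there the bilinear map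
on points has no other fixed point. No smallness of nilpotent parts is needed. -/
theorem SVect.eq_zero_of_quadratic (b : V.E →ₗ[ℝ] V.E →ₗ[ℝ] V.E) {N : Set V.E}
    (hN : ∀ u ∈ N, b u u = u → u = 0) {x : V.Pt q}
    (h : SVect.bil (V := V) (W := V) (X := V) b 0 0 q x x = x) (hx : V.body x ∈ N) : x = 0 := by
  have h0 : V.body x = 0 := by
    refine hN _ hx ?_
    have h1 := congrArg (V.map (GrHom.scale q 0)) h
    rw [← SVect.bil_map, SVect.map_scale_zero, SVect.bil_realPt] at h1
    have h2 := congrArg V.body h1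
    rwa [SVect.body_realPt, SVect.body_realPt] at h2
  obtain ⟨M, hM, h0M, hMf⟩ := exists_nhds_quadratic (SVect.bil (V := V) (W := V) (X := V) b 0 0 q)
  obtain ⟨δ, hδ, hs⟩ := SVect.exists_scale_mem x hM (by rw [h0, map_zero]; exact h0M)
  have h3 : V.map (GrHom.scale q (δ / 2)) x = 0 :=
    hMf _ (hs _ (by rw [abs_of_pos (by positivity)]; linarith)) (by rw [SVect.bil_map, h])
  exact map_scale_injective (by positivity) (h3.trans (map_zero _).symm)

end QuadraticFix

/-! ### The equations of the Lorentz group in exponential coordinates. -/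

section SpinManifold

variable {K : Type} [NormedAddCommGroup K] [InnerProductSpace ℝ K] [FiniteDimensional ℝ K]
  [NormedDivAlg K] {q r : ℕ}

theorem one_tmul_mul (u : Cliff K) (z : Ev q ⊗[ℝ] Cliff K) :
    linA q (LinearMap.mulLeft ℝ u) z = ((1 : Ev q) ⊗ₜ[ℝ] u) * z := by
  induction z with
  | zero => rw [map_zero, mul_zero]
  | add x y hx hy => rw [map_add, hx, hy, mul_add]
  | tmul a c =>
    exact (congrArg (· ⊗ₜ[ℝ] (u * c)) (one_mul a).symm).trans
      (Algebra.TensorProduct.tmul_mul_tmul (1 : Ev q) a u c).symm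

/-- The body of a point of the Lorentz group is a point of the Lorentz group. -/
theorem isSpin_body {x : (cliffSV K).Pt q} (hx : IsSpin x.1) (r : ℕ) :
    IsSpin ((1 : Ev r) ⊗ₜ[ℝ] ((cliffSV K).body x : Cliff K)) := by
  have h := spinGroup_functorial (GrHom.ofLinear (0 : (Fin q → ℝ) →ₗ[ℝ] (Fin r → ℝ)))
    (spinGroup_functorial (GrHom.scale q 0) (mem_spinGroup.2 hx))
  have h1 : (cliffSV K).map (GrHom.ofLinear (0 : (Fin q → ℝ) →ₗ[ℝ] (Fin r → ℝ)))
      ((cliffSV K).map (GrHom.scale q 0) x) = (cliffSV K).realPt r ((cliffSV K).body x) := by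
    rw [SVect.map_scale_zero, SVect.map_realPt]
  exact mem_spinGroup.1 (h1 ▸ h)

theorem one_tmul_injective {u v : Cliff K} (h : (1 : Ev q) ⊗ₜ[ℝ] u = (1 : Ev q) ⊗ₜ[ℝ] v) : u = v := by
  have h1 : (cliffSV K).realPt q u = (cliffSV K).realPt q v := cliffSV_ext h
  exact (SVect.body_realPt (V := cliffSV K) (q := q) u).symm.trans
    ((congrArg (cliffSV K).body h1).trans (SVect.body_realPt (V := cliffSV K) (q := q) v))

theorem reverse_body_mul {u : Cliff K} (h : IsSpin ((1 : Ev q) ⊗ₜ[ℝ] u)) :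
    CliffordAlgebra.reverse u * u = 1 := by
  refine one_tmul_injective (q := q) ?_
  have h1 := h.rev_mul
  change ((1 : Ev q) ⊗ₜ[ℝ] CliffordAlgebra.reverse u) * ((1 : Ev q) ⊗ₜ[ℝ] u) = 1 at h1
  rw [Algebra.TensorProduct.tmul_mul_tmul, one_mul] at h1
  exact h1

theorem lieProj_comp_subtype : (lieProj K).comp (spinLie K).subtype = (spinLie K).subtype :=
  LinearMap.ext fun x => congrArg Subtype.val (spinLieProj_coe x)

theorem linA_lieProj_lieIncl (X : Ev q ⊗[ℝ] spinLie K) :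
    linA q (lieProj K) (lieIncl K q X) = lieIncl K q X := by
  rw [linA, lieIncl, ← LinearMap.comp_apply, ← TensorProduct.map_comp, lieProj_comp_subtype]
  rfl

theorem spinLieProj_lieIncl (X : Ev q ⊗[ℝ] spinLie K) :
    TensorProduct.map LinearMap.id (spinLieProj K) (lieIncl K q X) = X := by
  rw [lieIncl, ← LinearMap.comp_apply, ← TensorProduct.map_comp,
    show (spinLieProj K).comp (spinLie K).subtype = LinearMap.id from
      LinearMap.ext spinLieProj_coe]
  exact LinearMap.congr_fun TensorProduct.map_id X

theorem linA_lieProj_eq (x : Ev q ⊗[ℝ] Cliff K) :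
    linA q (lieProj K) x =
      lieIncl K q (TensorProduct.map LinearMap.id (spinLieProj K) x) := by
  rw [lieIncl, ← LinearMap.comp_apply, ← TensorProduct.map_comp]
  rfl

theorem expCoord_lieIncl (X : Ev q ⊗[ℝ] spinLie K) (o : Od q ⊗[ℝ] PUnit) :
    (expCoord (lieProj K) q (lieIncl K q X, o)).1 = aexp (lieIncl K q X) := by
  rw [expCoord_fst]
  have h1 := linA_lieProj_lieIncl X
  have h2 : linA q (LinearMap.id - lieProj K) (lieIncl K q X) = 0 := by
    rw [linA_sub, linA_id, h1, sub_self]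
  change aexp (linA q (lieProj K) (lieIncl K q X)) *
    (1 + linA q (LinearMap.id - lieProj K) (lieIncl K q X)) = _
  rw [h1, h2, add_zero, mul_one]

/-- In exponential coordinates, points of the Lorentz group are given by points of its Lie
algebra. -/
theorem eq_lieIncl_of_isSpin {N : Set (Cliff K)} (hN : ∀ u ∈ N, lieFix K u u = u → u = 0)
    {X : (algSV (Cliff K)).Pt q} (h : IsSpin (expCoord (lieProj K) q X).1)
    (hX : (LinearMap.id - lieProj K : Cliff K →ₗ[ℝ] Cliff K) ((algSV (Cliff K)).body X) ∈ N) :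
    X.1 = lieIncl K q (TensorProduct.map LinearMap.id (spinLieProj K) X.1) := by
  rw [expCoord_fst] at h
  change IsSpin (aexp (linA q (lieProj K) X.1) *
    (1 + linA q (LinearMap.id - lieProj K) X.1)) at h
  rw [linA_lieProj_eq] at h
  have hs := isSpin_aexp (TensorProduct.map LinearMap.id (spinLieProj K) X.1)
  -- Dividing by the exponential factor, itself a group element, leaves the element 1 + m with m
  -- outside the Lie algebra.
  have h1 := hs.rev.mul h
  rw [← mul_assoc, hs.rev_mul, one_mul] at h1
  have h2 : linA q (lieProj K) (linA q (LinearMap.id - lieProj K) X.1) = 0 := by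
    rw [linA_linA, show (lieProj K).comp (LinearMap.id - lieProj K) = 0 from ?_, linA_zero]
    rw [LinearMap.comp_sub, LinearMap.comp_id, sub_eq_zero]
    conv_rhs => rw [lieProj, ← LinearMap.comp_assoc]
    rw [← lieProj, lieProj_comp_subtype]
    rfl
  have h3 := h1.eq_lieFix h2
  have h4 : SVect.lin (V := algSV (Cliff K)) (W := algSV (Cliff K)) (LinearMap.id - lieProj K) 0 q X
      = 0 := by
    refine SVect.eq_zero_of_quadratic (V := algSV (Cliff K)) (lieFix K) hN (algSV_ext ?_) ?_
    · exact (bil_zero_fst (V := algSV (Cliff K)) (W := algSV (Cliff K)) (X := algSV (Cliff K))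
        _ _ _ _).trans h3
    · rw [SVect.body_lin]
      exact hX
  have h5 : linA q (LinearMap.id - lieProj K) X.1 = 0 := congrArg Prod.fst h4
  rw [linA_sub, linA_id, sub_eq_zero] at h5
  exact h5.trans (linA_lieProj_eq _)

end SpinManifold

/-! ### Charts of the Lorentz group by left-translated exponentials. -/

section SpinManifold

variable {K : Type} [NormedAddCommGroup K] [InnerProductSpace ℝ K] [FiniteDimensional ℝ K]
  [NormedDivAlg K] {q r : ℕ}

variable (K) in
/-- The super vector space of the Lie algebra of the Lorentz group. -/
abbrev lieSV : SVect := ⟨spinLie K, PUnit⟩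

/-- The parametrization of the Lorentz group near a point by its Lie algebra. -/
def spinParam (u : Cliff K) (r : ℕ) (w : (lieSV K).Pt r) : (algSV (Cliff K)).Pt r :=
  SVect.lin (V := algSV (Cliff K)) (W := algSV (Cliff K)) (LinearMap.mulLeft ℝ u) 0 r
    (expA r (SVect.lin (V := lieSV K) (W := algSV (Cliff K)) (spinLie K).subtype 0 r w))

/-- Left translation of `A`-points of the Clifford algebra. -/
def leftTrans (u : Cliff K) (r : ℕ) : (algSV (Cliff K)).Pt r →ₗ[ℝ] (algSV (Cliff K)).Pt r :=
  SVect.lin (V := algSV (Cliff K)) (W := algSV (Cliff K)) (LinearMap.mulLeft ℝ u) 0 r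

theorem leftTrans_fst (u : Cliff K) (x : (algSV (Cliff K)).Pt r) :
    (leftTrans u r x).1 = ((1 : Ev r) ⊗ₜ[ℝ] u) * x.1 := one_tmul_mul u x.1

theorem spinParam_fst (u : Cliff K) (w : (lieSV K).Pt r) :
    (spinParam u r w).1 = ((1 : Ev r) ⊗ₜ[ℝ] u) * aexp (lieIncl K r w.1) := one_tmul_mul u _

theorem isSmoothOn_spinParam (u : Cliff K) (U : Set (spinLie K)) :
    IsSmoothOn (lieSV K) (algSV (Cliff K)) U (spinParam u) :=
  (((isSmoothOn_expA (C := Cliff K)).comp_univ openSet_univ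
    (isSmoothOn_lin (V := lieSV K) (W := algSV (Cliff K)) Set.univ (spinLie K).subtype 0)).lin
      openSet_univ (W := algSV (Cliff K)) (LinearMap.mulLeft ℝ u) 0).mono (Set.subset_univ _)

theorem body_expA {C : Type} [Ring C] [Algebra ℝ C] [Module.Finite ℝ C] (x : (algSV C).Pt r) :
    (algSV C).body (expA r x) = aexp ((algSV C).body x) := by
  rw [isSmoothOn_expA.body_eq (Set.mem_univ _), bodyMap]
  have h : expA 0 ((algSV C).realPt 0 ((algSV C).body x)) =
      (algSV C).realPt 0 (aexp ((algSV C).body x)) := algSV_ext (aexp_one_tmul _)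
  rw [h, SVect.body_realPt]

theorem bodyMap_expCoord_zero {C : Type} [Ring C] [Algebra ℝ C] [Module.Finite ℝ C]
    (P : C →ₗ[ℝ] C) : bodyMap (V := algSV C) (W := algSV C) (expCoord P) (0 : C) = (1 : C) := by
  rw [bodyMap_expCoord, map_zero, map_zero, aexp_zero, add_zero, one_mul]

theorem body_spinParam (u : Cliff K) (w : (lieSV K).Pt r) :
    (algSV (Cliff K)).body (spinParam u r w) = u * aexp ((lieSV K).body w : Cliff K) := by
  rw [spinParam, SVect.body_lin, body_expA, SVect.body_lin]
  rfl

theorem body_leftTrans (u : Cliff K) (x : (algSV (Cliff K)).Pt r) :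
    (algSV (Cliff K)).body (leftTrans u r x) = u * (algSV (Cliff K)).body x := by
  rw [leftTrans, SVect.body_lin]
  rfl

/-- The chart at a point is w ↦ u exp w with u the body of the point. Translating by the body
suffices, since charts are neighbourhoods of bodies, and u is again a group element. The inverse
translates back by the reversal of u, applies the inverse of `expCoord` and projects to the Lie
algebra; on group elements the projection loses nothing. -/
theorem exists_spin_chart (x : (algSV (Cliff K)).Pt q) (hx : IsSpin x.1) :
    ∃ (U : Set (Cliff K)) (U' : Set (spinLie K))
    (φ : ∀ r, (lieSV K).Pt r → (algSV (Cliff K)).Pt r)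
    (ρ : ∀ r, (algSV (Cliff K)).Pt r → (lieSV K).Pt r),
    (algSV (Cliff K)).body x ∈ U ∧ OpenSet U ∧ OpenSet U' ∧
    IsSmoothOn (lieSV K) (algSV (Cliff K)) U' φ ∧ IsSmoothOn (algSV (Cliff K)) (lieSV K) U ρ ∧
    (∀ r, ∀ w ∈ domain (lieSV K) U' r,
      IsSpin (φ r w).1 ∧ φ r w ∈ domain (algSV (Cliff K)) U r ∧ ρ r (φ r w) = w) ∧
    (∀ r, ∀ y : (algSV (Cliff K)).Pt r, IsSpin y.1 → y ∈ domain (algSV (Cliff K)) U r →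
      ρ r y ∈ domain (lieSV K) U' r ∧ φ r (ρ r y) = y) := by
  obtain ⟨N, hN, h0N, hNf⟩ := exists_nhds_quadratic (lieFix K)
  obtain ⟨A, B, G, h0A, hA, hB, hG, hFG, hGF⟩ := exists_inverse_expCoord (lieProj K)
  have hspin : ∀ r, IsSpin ((1 : Ev r) ⊗ₜ[ℝ] ((algSV (Cliff K)).body x : Cliff K)) :=
    isSpin_body hx
  set u : Cliff K := (algSV (Cliff K)).body x with hu
  set v : Cliff K := CliffordAlgebra.reverse u with hv
  have hvu : v * u = 1 := reverse_body_mul (hspin 0)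
  have hrev : ∀ r, revA K r ((1 : Ev r) ⊗ₜ[ℝ] u) = (1 : Ev r) ⊗ₜ[ℝ] v := fun _ => rfl
  let L : Cliff K →ₗ[ℝ] Cliff K := LinearMap.id - lieProj K
  -- The coordinates are restricted so that the body of the component outside the Lie algebra stays
  -- in `N`, where the quadratic map has no nonzero fixed point.
  let B' : Set (Cliff K) := B ∩ (fun b => L (bodyMap (V := algSV (Cliff K))
    (W := algSV (Cliff K)) G b)) ⁻¹' N
  have hB' : OpenSet B' := SmoothOn.isOpen_inter_preimage
    ((smoothOn_linear Set.univ L).comp hG.smoothOn_bodyMap fun _ _ => Set.mem_univ _) hB hN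
  have h1B : (1 : Cliff K) ∈ B' := by
    have h2 := hFG 0 ((algSV (Cliff K)).realPt 0 0) (realPt_mem_domain h0A)
    have h3 : expCoord (lieProj K) 0 ((algSV (Cliff K)).realPt 0 0) =
        (algSV (Cliff K)).realPt 0 1 := by
      rw [(isSmoothOn_expCoord (lieProj K)).realPt_eq (Set.mem_univ _), bodyMap_expCoord_zero]
    rw [h3] at h2
    refine ⟨?_, ?_⟩
    · have := h2.1
      rwa [domain, Set.mem_setOf_eq, SVect.body_realPt] at this
    · rw [Set.mem_preimage, bodyMap, h2.2, SVect.body_realPt, map_zero]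
      exact h0N
  let U : Set (Cliff K) := LinearMap.mulLeft ℝ v ⁻¹' B'
  let U₁ : Set (spinLie K) := (spinLie K).subtype ⁻¹' A
  -- Cut down twice: to the region where the coordinates are invertible, and to the parameters whose
  -- exponential lands in the shrunken target.
  let U' : Set (spinLie K) := U₁ ∩ (fun w => aexp (w : Cliff K)) ⁻¹' B'
  have hU' : OpenSet U' := SmoothOn.isOpen_inter_preimage
    ((smoothOn_aexp.comp (smoothOn_linear Set.univ (spinLie K).subtype)
      fun _ _ => Set.mem_univ _).mono (Set.subset_univ _)) (hA.preimage_linear _) hB'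
  refine ⟨U, U', spinParam u, fun r y => SVect.lin (V := algSV (Cliff K)) (W := lieSV K)
    (spinLieProj K) 0 r (G r (leftTrans v r y)), ?_, hB'.preimage_linear _, hU',
    isSmoothOn_spinParam u U', ?_, fun r w hw => ?_, fun r y hy hyU => ?_⟩
  · change v * u ∈ B'
    rw [hvu]
    exact h1B
  · refine (hG.comp (hB'.preimage_linear _) hB
      (isSmoothOn_lin (V := algSV (Cliff K)) (W := algSV (Cliff K)) _ (LinearMap.mulLeft ℝ v) 0)
      fun r y hy => ?_).lin (hB'.preimage_linear _) (W := lieSV K) (spinLieProj K) 0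
    exact (congrArg (· ∈ B) (body_leftTrans v y)).mpr hy.1
  · have hb : v * (algSV (Cliff K)).body (spinParam u r w) = aexp ((lieSV K).body w : Cliff K) := by
      rw [body_spinParam, ← mul_assoc, hvu, one_mul]
    refine ⟨?_, ?_, ?_⟩
    · rw [spinParam_fst]
      exact (hspin r).mul (isSpin_aexp _)
    · change v * (algSV (Cliff K)).body (spinParam u r w) ∈ B'
      rw [hb]
      exact hw.2
    · have h2 : leftTrans v r (spinParam u r w) =
          expCoord (lieProj K) r (lieIncl K r w.1, 0) := by
        refine algSV_ext ?_
        rw [leftTrans_fst, spinParam_fst, expCoord_lieIncl, ← mul_assoc, ← hrev,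
          (hspin r).rev_mul, one_mul]
      have h3 : ((lieIncl K r w.1, 0) : (algSV (Cliff K)).Pt r) ∈ domain (algSV (Cliff K)) A r :=
        (congrArg (· ∈ A) (SVect.body_lin (V := lieSV K) (W := algSV (Cliff K))
          (spinLie K).subtype 0 w)).mpr hw.1
      change SVect.lin (V := algSV (Cliff K)) (W := lieSV K) (spinLieProj K) 0 r
        (G r (leftTrans v r (spinParam u r w))) = w
      rw [h2, (hFG r _ h3).2]
      exact Prod.ext (spinLieProj_lieIncl w.1) (Subsingleton.elim _ _)
  · have hz : leftTrans v r y ∈ domain (algSV (Cliff K)) B r :=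
      (congrArg (· ∈ B) (body_leftTrans v y)).mpr hyU.1
    obtain ⟨hXA, hXz⟩ := hGF r _ hz
    set X := G r (leftTrans v r y) with hX
    have hbX : (algSV (Cliff K)).body X = bodyMap (V := algSV (Cliff K)) (W := algSV (Cliff K)) G
        (v * (algSV (Cliff K)).body y) := by
      rw [hX, hG.body_eq hz, body_leftTrans]
    -- The decisive point: the translated group element has its coordinates in the Lie algebra, so
    -- it is an exponential.
    have hXs : X.1 = lieIncl K r (TensorProduct.map LinearMap.id (spinLieProj K) X.1) := by
      refine eq_lieIncl_of_isSpin hNf ?_ ?_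
      · rw [hXz, leftTrans_fst, ← hrev]
        exact (hspin r).rev.mul hy
      · rw [hbX]
        exact hyU.2
    have hz2 : (leftTrans v r y).1 =
        aexp (lieIncl K r (TensorProduct.map LinearMap.id (spinLieProj K) X.1)) := by
      rw [← hXz, ← expCoord_lieIncl _ X.2, ← hXs]
    have hXX : X = SVect.lin (V := lieSV K) (W := algSV (Cliff K)) (spinLie K).subtype 0 r
        (SVect.lin (V := algSV (Cliff K)) (W := lieSV K) (spinLieProj K) 0 r X) :=
      algSV_ext hXs
    have hbX2 := congrArg (algSV (Cliff K)).body hXX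
    rw [SVect.body_lin] at hbX2
    refine ⟨⟨?_, ?_⟩, ?_⟩
    · exact (congrArg (· ∈ A) hbX2).mp hXA
    · have h2 : leftTrans v r y = expA r X := algSV_ext (hz2.trans (congrArg aexp hXs.symm))
      have h3 := congrArg (algSV (Cliff K)).body h2
      rw [body_expA, body_leftTrans, hbX2] at h3
      exact (congrArg (· ∈ B') h3).mp hyU
    · refine algSV_ext ?_
      rw [spinParam_fst]
      refine (congrArg (((1 : Ev r) ⊗ₜ[ℝ] u) * ·) hz2.symm).trans ?_
      rw [leftTrans_fst, ← mul_assoc, ← hrev, (hspin r).mul_rev, one_mul]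

theorem isSupermanifold_spinGroup : (spinGroup K).space.IsSupermanifold where
  functorial _ _ f _ hx := spinGroup_functorial f hx
  chart := by
    refine ⟨lieSV K, fun _ x hx => ?_⟩
    obtain ⟨U, U', φ, ρ, h1, h2, h3, h4, h5, h6, h7⟩ := exists_spin_chart x (mem_spinGroup.1 hx)
    exact ⟨U, U', φ, ρ, h1, h2, h3, h4, h5, fun r w hw => ⟨mem_spinGroup.2 (h6 r w hw).1,
      (h6 r w hw).2⟩, fun r y hy => h7 r y (mem_spinGroup.1 hy)⟩

theorem isSupergroup_spinGroup : IsSupergroup (spinGroup K) :=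
  isSupergroup_spinGroup_of_manifold isSupermanifold_spinGroup

end SpinManifold

/-! ### Extension of invariant cocycles to semidirect products. -/

section Extension

variable {G H : SGroup} {W : SVect} {q : ℕ}

theorem SVect.triple_pair {V : SVect} {X : Type} (x y z : V.Pt q)
    (F : V.Pt q → V.Pt q → V.Pt q → X) :
    F (SVect.pfst (SVect.pair x (SVect.pair y z)))
      (SVect.pfst (SVect.psnd (SVect.pair x (SVect.pair y z))))
      (SVect.psnd (SVect.psnd (SVect.pair x (SVect.pair y z)))) = F x y z := by
  simp only [SVect.pfst_pair, SVect.psnd_pair]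

/-- Agreement on points of the group is enough, because the faces in the coboundary are again tuples
of points. -/
theorem IsNormalizedCocycle.congr {p : ℕ} {a b : Cochain G W p} (hG : IsSupergroup G)
    (h : IsNormalizedCocycle G (trivAct G W) a)
    (hab : ∀ q g, (∀ i, g i ∈ G.space.pts q) → b q g = a q g) :
    IsNormalizedCocycle G (trivAct G W) b where
  smooth := h.smooth.congr
    (fun q r f x hx i => (congrArg (· ∈ G.space.pts r)
      (SVect.coord_map (V := G.space.V) f x i)).mpr (hG.manifold.functorial q r f _ (hx i)))
    fun q x hx => hab q _ hx
  closed q g hg := by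
    refine Eq.trans ?_ (h.closed q g hg)
    have h1 : ∀ j : Fin (p + 1), ∀ i, Fin.contractNth j (G.mul q) g i ∈ G.space.pts q := by
      intro j i
      rw [Fin.contractNth]
      split_ifs
      · exact hg _
      · exact hG.mul_mem (hg _) (hg _)
      · exact hg _
    simp only [coboundary, trivAct]
    rw [hab q _ fun i => hg _]
    simp only [hab q _ (h1 _)]
  normalized q g hg h1 := (hab q g hg).trans (h.normalized q g hg h1)

/-- Functions on triples that define a smooth normalized 3-cocycle with values in `W`. -/
structure IsTripleCocycle (H : SGroup) (W : SVect)
    (c : ∀ q, H.space.V.Pt q → H.space.V.Pt q → H.space.V.Pt q → W.Pt q) : Prop where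
  smooth : IsSMap (H.space.prod (H.space.prod H.space)) (affine W)
    fun q z => c q (SVect.pfst z) (SVect.pfst (SVect.psnd z)) (SVect.psnd (SVect.psnd z))
  closed : ∀ q, ∀ x ∈ H.space.pts q, ∀ y ∈ H.space.pts q, ∀ z ∈ H.space.pts q,
    ∀ w ∈ H.space.pts q, c q y z w - c q (H.mul q x y) z w + c q x (H.mul q y z) w -
      c q x y (H.mul q z w) + c q x y z = 0
  left : ∀ q y z, c q (H.one q) y z = 0
  mid : ∀ q y z, c q y (H.one q) z = 0
  right : ∀ q y z, c q y z (H.one q) = 0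

variable {c : ∀ q, H.space.V.Pt q → H.space.V.Pt q → H.space.V.Pt q → W.Pt q}

theorem IsTripleCocycle.isSMap (hc : IsTripleCocycle H W c) {M : SuperSpace}
    {f g h : Fam M H.space} (hf : IsSMap M H.space f) (hg : IsSMap M H.space g)
    (hh : IsSMap M H.space h) :
    IsSMap M (affine W) fun q z => c q (f q z) (g q z) (h q z) := by
  exact (congrArg (IsSMap M (affine W)) (funext fun q => funext fun z =>
    SVect.triple_pair (f q z) (g q z) (h q z) (c q))).mp (hc.smooth.comp (hf.pair (hg.pair hh)))

theorem IsTripleCocycle.isNormalizedCocycle (hc : IsTripleCocycle H W c) :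
    IsNormalizedCocycle (p := 3) H (trivAct H W) fun q n => c q (n 0) (n 1) (n 2) where
  smooth := hc.isSMap (M := H.space.pow 3) (isSMap_coord (p := 3) 0) (isSMap_coord (p := 3) 1)
    (isSMap_coord (p := 3) 2)
  closed q g hg := by
    rw [show g = ![g 0, g 1, g 2, g 3] from (List.ofFn_injective rfl), coboundary_three]
    exact hc.closed q _ (hg 0) _ (hg 1) _ (hg 2) _ (hg 3)
  normalized q g hg := by
    rintro ⟨i, hi⟩
    match i with
    | 0 => rw [hi, hc.left]
    | 1 => rw [hi, hc.mid]
    | 2 => rw [hi, hc.right]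

variable {act : ∀ q, G.space.V.Pt q → H.space.V.Pt q → H.space.V.Pt q}

/-- Invariance under x rewrites the first face, the only one with x removed. The identity then
becomes closedness on H for the edges s, x·t, xy·u, xyz·v. -/
theorem IsTripleCocycle.semidirect_closed (hG : IsSupergroup G)
    (ha : IsActionByAut G H act) (hc : IsTripleCocycle H W c)
    (hi : ∀ q, ∀ x ∈ G.space.pts q, ∀ s ∈ H.space.pts q, ∀ t ∈ H.space.pts q,
      ∀ u ∈ H.space.pts q, c q (act q x s) (act q x t) (act q x u) = c q s t u)
    {x y z xy yz : G.space.V.Pt q} {s t u v st tu uv : H.space.V.Pt q} (hx : x ∈ G.space.pts q)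
    (hy : y ∈ G.space.pts q) (hz : z ∈ G.space.pts q) (hs : s ∈ H.space.pts q)
    (ht : t ∈ H.space.pts q) (hu : u ∈ H.space.pts q) (hv : v ∈ H.space.pts q)
    (hxy : xy = G.mul q x y) (hyz : yz = G.mul q y z) (hst : st = H.mul q s (act q x t))
    (htu : tu = H.mul q t (act q y u)) (huv : uv = H.mul q u (act q z v)) :
    c q t (act q y u) (act q (G.mul q y z) v) -
      c q st (act q xy u) (act q (G.mul q xy z) v) +
      c q s (act q x tu) (act q (G.mul q x yz) v) -
      c q s (act q x t) (act q (G.mul q x y) uv) +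
      c q s (act q x t) (act q (G.mul q x y) u) = 0 := by
  subst hxy hyz hst htu huv
  have h := hc.closed q _ hs _ (ha.act_mem hx ht) _ (ha.act_mem (hG.mul_mem hx hy) hu) _
    (ha.act_mem (hG.mul_mem (hG.mul_mem hx hy) hz) hv)
  have h0 := hi q _ hx _ ht _ (ha.act_mem hy hu) _ (ha.act_mem (hG.mul_mem hy hz) hv)
  rw [← h0, ha.act_mul q _ hx _ ht _ (ha.act_mem hy hu), ← ha.mul_act q _ hx _ hy _ hu,
    ← ha.mul_act q _ hx _ (hG.mul_mem hy hz) _ hv, ← hG.mul_assoc q _ hx _ hy _ hz,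
    ha.act_mul q _ (hG.mul_mem hx hy) _ hu _ (ha.act_mem hz hv),
    ← ha.mul_act q _ (hG.mul_mem hx hy) _ hz _ hv]
  exact h

/-- An invariant cocycle extends to the semidirect product. -/
theorem IsTripleCocycle.semidirect (hG : IsSupergroup G) (hH : IsSupergroup H)
    (ha : IsActionByAut G H act) (hc : IsTripleCocycle H W c)
    (hi : ∀ q, ∀ x ∈ G.space.pts q, ∀ s ∈ H.space.pts q, ∀ t ∈ H.space.pts q,
      ∀ u ∈ H.space.pts q, c q (act q x s) (act q x t) (act q x u) = c q s t u) :
    IsNormalizedCocycle (semidirect G H act) (trivAct (semidirect G H act) W)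
      fun q (γ : Fin 3 → (G.space.V.prod H.space.V).Pt q) => c q (SVect.psnd (γ 0))
        (act q (SVect.pfst (γ 0)) (SVect.psnd (γ 1)))
        (act q (G.mul q (SVect.pfst (γ 0)) (SVect.pfst (γ 1))) (SVect.psnd (γ 2))) where
  smooth := by
    have h : ∀ i : Fin 3, IsSMap ((G.space.prod H.space).pow 3) (G.space.prod H.space)
      fun _ z => SVect.coord z i := isSMap_coord
    exact hc.isSMap (h 0).psnd (ha.smooth.comp₂ (h 0).pfst (h 1).psnd)
      (ha.smooth.comp₂ (hG.smooth_mul.comp₂ (h 0).pfst (h 1).pfst) (h 2).psnd)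
  closed q g hg := by
    refine (congrArg (coboundary _ _ _ q) (show g = ![g 0, g 1, g 2, g 3] from
      List.ofFn_injective rfl)).trans ((coboundary_three _ _ q _ _ _ _).trans ?_)
    exact hc.semidirect_closed hG ha hi (hg 0).1 (hg 1).1 (hg 2).1 (hg 0).2 (hg 1).2 (hg 2).2
      (hg 3).2 (SVect.pfst_pair _ _) (SVect.pfst_pair _ _) (SVect.psnd_pair _ _)
      (SVect.psnd_pair _ _) (SVect.psnd_pair _ _)
  normalized q g hg := by
    rintro ⟨i, hi⟩
    have hx := fun i => (hg i).1
    have h1 : SVect.psnd (V := G.space.V) (W := H.space.V) (g i) = H.one q := by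
      rw [hi]; exact SVect.psnd_pair _ _
    match i with
    | 0 => rw [h1, hc.left]
    | 1 => rw [h1, ha.act_one hH (hx 0), hc.mid]
    | 2 => rw [h1, ha.act_one hH (hG.mul_mem (hx 0) (hx 1)), hc.right]

theorem psnd_partialProd_semidirect {p : ℕ} (γ : Fin p → (G.space.V.prod H.space.V).Pt q)
    (k : Fin p) :
    SVect.psnd (V := G.space.V) (W := H.space.V)
        ((SuperString.semidirect G H act).partialProd q γ k.succ) =
      H.mul q (SVect.psnd (V := G.space.V) (W := H.space.V)
          ((SuperString.semidirect G H act).partialProd q γ k.castSucc))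
        (act q (SVect.pfst (V := G.space.V) (W := H.space.V)
          ((SuperString.semidirect G H act).partialProd q γ k.castSucc)) (SVect.psnd (γ k))) :=
  SVect.psnd_pair _ _

end Extension

/-! ### The cocycles on the supertranslation and Poincaré supergroups, and the superstring
2-supergroup. -/

section Superstring

variable {K : Type} [NormedAddCommGroup K] [InnerProductSpace ℝ K] [FiniteDimensional ℝ K]
  [NormedDivAlg K] {q : ℕ} {l : ℝ → ℝ}

variable (K) in
/-- A multiple of the cubic form that computes the integrals over simplices. -/
def cubicMul (C : ℝ) (q : ℕ) (x y z : (superTrans K).Pt q) : SVect.line.Pt q := C • cubic K q x y z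

theorem isTripleCocycle_cubicMul (C : ℝ) :
    IsTripleCocycle (transGroup K) SVect.line (cubicMul K C) where
  smooth := IsSMap.of_smooth (isSmoothOn_cubic.const_smul openSet_univ C) fun _ _ _ => Set.mem_univ _
  closed q x _ y _ z _ w _ := by
    have h := congrArg (C • ·) (cubic_cocycle (K := K) x y z w)
    simp only [smul_add, smul_sub, smul_zero] at h
    exact h
  left q y z := (congrArg (C • ·) (cubic_zero_left y z)).trans (smul_zero C)
  mid q y z := (congrArg (C • ·) (cubic_zero_mid y z)).trans (smul_zero C)
  right q y z := (congrArg (C • ·) (cubic_zero_right y z)).trans (smul_zero C)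

theorem neg_bch_bch (x y : (superTrans K).Pt q) :
    IsStringPair.bch (brT K q) (-x) (IsStringPair.bch (brT K q) x y) = y := by
  rw [← (isStringPair K q).bch_assoc, (isStringPair K q).neg_bch, IsStringPair.zero_bch]

variable (l) in
/-- The integral of the Jacobian of the standard simplex. -/
def simplexConst : ℝ := ∫ y in stdSimplexCoords 3, simplexJac l y

/-- The integral of `α` over a simplex, in terms of its successive edges. -/
theorem integralSimplex_alpha_of_edges (hl : IsSmoothingFactor l) {g : Fin 4 → (superTrans K).Pt q}
    {x y z : (superTrans K).Pt q} (h1 : g 1 = IsStringPair.bch (brT K q) (g 0) x)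
    (h2 : g 2 = IsStringPair.bch (brT K q) (g 1) y) (h3 : g 3 = IsStringPair.bch (brT K q) (g 2) z) :
    integralSimplex (transBracket K) l (alpha K) q g = cubicMul K (simplexConst l) q x y z := by
  rw [integralSimplex_alpha hl, h3, h2, neg_bch_bch, neg_bch_bch, h1, neg_bch_bch]
  rfl

theorem intAlpha_eq (hl : IsSmoothingFactor l) (n : Fin 3 → (superTrans K).Pt q) :
    intAlpha K l q n = cubicMul K (simplexConst l) q (n 0) (n 1) (n 2) :=
  integralSimplex_alpha_of_edges hl (transGroup_mul _ _) (transGroup_mul _ _) (transGroup_mul _ _)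

theorem isNormalizedCocycle_intAlpha (hl : IsSmoothingFactor l) :
    IsNormalizedCocycle (transGroup K) (trivAct (transGroup K) SVect.line) (intAlpha K l) :=
  (isTripleCocycle_cubicMul (simplexConst l)).isNormalizedCocycle.congr isSupergroup_transGroup
    fun _ g _ => intAlpha_eq hl g

theorem cubicMul_spinAct (C : ℝ) {x : (cliffSV K).Pt q} (hx : x ∈ (spinGroup K).space.pts q)
    (s t u : (superTrans K).Pt q) : cubicMul K C q (spinAct K q x s) (spinAct K q x t)
      (spinAct K q x u) = cubicMul K C q s t u := congrArg (C • ·) (cubic_spinAct hx s t u)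

theorem intAlpha_spinAct (hl : IsSmoothingFactor l) {x : (cliffSV K).Pt q}
    (hx : x ∈ (spinGroup K).space.pts q) (h : Fin 3 → (superTrans K).Pt q) :
    intAlpha K l q (fun i => spinAct K q x (h i)) = intAlpha K l q h := by
  rw [intAlpha_eq hl, intAlpha_eq hl]
  exact cubicMul_spinAct _ hx _ _ _

theorem pfst_partialProd_poincare (γ : Fin 3 → ((cliffSV K).prod (superTrans K)).Pt q)
    (h0 : SVect.pfst (γ 0) ∈ (spinGroup K).space.pts q) :
    SVect.pfst (V := cliffSV K) (W := superTrans K) ((poincare K).partialProd q γ 0) =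
      (spinGroup K).one q ∧
    SVect.pfst (V := cliffSV K) (W := superTrans K) ((poincare K).partialProd q γ 1) =
      SVect.pfst (γ 0) ∧
    SVect.pfst (V := cliffSV K) (W := superTrans K) ((poincare K).partialProd q γ 2) =
      (spinGroup K).mul q (SVect.pfst (γ 0)) (SVect.pfst (γ 1)) := by
  have h1 : SVect.pfst (V := cliffSV K) (W := superTrans K) ((poincare K).partialProd q γ 0) =
      (spinGroup K).one q := SVect.pfst_pair _ _
  have h2 : SVect.pfst (V := cliffSV K) (W := superTrans K) ((poincare K).partialProd q γ 1) =
      SVect.pfst (γ 0) :=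
    (SVect.pfst_pair (V := cliffSV K) (W := superTrans K) _ _).trans
      ((congrArg (fun x => (spinGroup K).mul q x (SVect.pfst (γ 0))) h1).trans
        (isSupergroup_spinGroup.one_mul q _ h0))
  exact ⟨h1, h2, (SVect.pfst_pair (V := cliffSV K) (W := superTrans K) _ _).trans
    (congrArg (fun x => (spinGroup K).mul q x (SVect.pfst (γ 1))) h2)⟩

/-- Projected to T, the partial products of (x₀,t₀), (x₁,t₁), (x₂,t₂) have the successive edges t₀,
x₀·t₁ and x₀x₁·t₂. These edges determine the integral by left invariance; the Lorentz components
enter only through the vertices at which an edge begins. -/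
theorem integralSimplex_alpha_of_act (hl : IsSmoothingFactor l) {f : Fin 4 → (cliffSV K).Pt q}
    {g : Fin 4 → (superTrans K).Pt q} {t : Fin 3 → (superTrans K).Pt q} {x y : (cliffSV K).Pt q}
    (h : ∀ k : Fin 3, g k.succ =
      IsStringPair.bch (brT K q) (g k.castSucc) (spinAct K q (f k.castSucc) (t k)))
    (h0 : f 0 = (spinGroup K).one q) (h1 : f 1 = x) (h2 : f 2 = y) :
    integralSimplex (transBracket K) l (alpha K) q g = cubicMul K (simplexConst l) q (t 0)
      (spinAct K q x (t 1)) (spinAct K q y (t 2)) := by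
  subst h1 h2
  have h3 : spinAct K q (f 0) (t 0) = t 0 := by
    rw [h0]; exact isActionByAut_spinAct.one_act q _ (Set.mem_univ _)
  refine (integralSimplex_alpha_of_edges hl (h 0) (h 1) (h 2)).trans ?_
  exact congrArg (fun s => cubicMul K (simplexConst l) q s _ _) h3

theorem intAlphaExt_eq (hl : IsSmoothingFactor l)
    (γ : Fin 3 → ((cliffSV K).prod (superTrans K)).Pt q)
    (h0 : SVect.pfst (γ 0) ∈ (spinGroup K).space.pts q) :
    intAlphaExt K l q γ = cubicMul K (simplexConst l) q (SVect.psnd (γ 0))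
      (spinAct K q (SVect.pfst (γ 0)) (SVect.psnd (γ 1)))
      (spinAct K q ((spinGroup K).mul q (SVect.pfst (γ 0)) (SVect.pfst (γ 1)))
        (SVect.psnd (γ 2))) := by
  obtain ⟨h1, h2, h3⟩ := pfst_partialProd_poincare γ h0
  exact integralSimplex_alpha_of_act hl (f := fun k => SVect.pfst (V := cliffSV K)
    (W := superTrans K) ((poincare K).partialProd q γ k)) (t := fun k => SVect.psnd (γ k))
    (fun k => (psnd_partialProd_semidirect (G := spinGroup K) (H := transGroup K)
      (act := spinAct K) γ k).trans (transGroup_mul _ _)) h1 h2 h3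

theorem isSupergroup_poincare : IsSupergroup (poincare K) :=
  isSupergroup_spinGroup.semidirect isSupergroup_transGroup isActionByAut_spinAct

theorem isNormalizedCocycle_intAlphaExt (hl : IsSmoothingFactor l) :
    IsNormalizedCocycle (poincare K) (trivAct (poincare K) SVect.line) (intAlphaExt K l) :=
  ((isTripleCocycle_cubicMul (simplexConst l)).semidirect isSupergroup_spinGroup
    isSupergroup_transGroup isActionByAut_spinAct
    fun _ _ hx s _ t _ u _ => cubicMul_spinAct _ hx s t u).congr isSupergroup_poincare
    fun _ g hg => intAlphaExt_eq hl g (hg 0).1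

theorem intAlphaExt_pair_one (hl : IsSmoothingFactor l) (h : Fin 3 → (superTrans K).Pt q) :
    intAlphaExt K l q (fun i => SVect.pair ((spinGroup K).one q) (h i)) = intAlpha K l q h := by
  have h1 : (spinGroup K).one q ∈ (spinGroup K).space.pts q := isSupergroup_spinGroup.one_mem q
  have h2 : ∀ i, SVect.pfst (V := cliffSV K) (W := superTrans K)
      (SVect.pair ((spinGroup K).one q) (h i)) = (spinGroup K).one q := fun i => SVect.pfst_pair _ _
  have h3 : ∀ i, SVect.psnd (V := cliffSV K) (W := superTrans K)
      (SVect.pair ((spinGroup K).one q) (h i)) = h i := fun i => SVect.psnd_pair _ _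
  have h4 : ∀ s, spinAct K q ((spinGroup K).one q) s = s := fun s =>
    isActionByAut_spinAct.one_act q s (Set.mem_univ _)
  refine (intAlphaExt_eq hl _ ((h2 0).symm ▸ h1)).trans (Eq.trans ?_ (intAlpha_eq hl h).symm)
  have h5 := isSupergroup_spinGroup.one_mul q _ h1
  exact congr (congr (congrArg (cubicMul K (simplexConst l) q) (h3 0))
    ((congrArg₂ (spinAct K q) (h2 0) (h3 1)).trans (h4 _)))
    ((congrArg₂ (spinAct K q) ((congrArg₂ ((spinGroup K).mul q) (h2 0) (h2 1)).trans h5)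
      (h3 2)).trans (h4 _))

theorem superstring_is2Supergroup (hl : IsSmoothingFactor l) : (superstring K l).Is2Supergroup :=
  isSupergroup_poincare.is2Supergroup (isNormalizedCocycle_intAlphaExt hl)

end Superstring

end SuperString

end

theorem mainTheorem1 (n : ℕ) (hn : n = 1 ∨ n = 2 ∨ n = 4 ∨ n = 8) :
    (∃ (K : Type) (_ : NormedAddCommGroup K) (_ : InnerProductSpace ℝ K)
      (_ : SuperString.NormedDivAlg K), FiniteDimensional ℝ K ∧ Module.finrank ℝ K = n) ∧
    (∃ l : ℝ → ℝ, SuperString.IsSmoothingFactor l) ∧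
    ∀ (K : Type) [NormedAddCommGroup K] [InnerProductSpace ℝ K] [FiniteDimensional ℝ K]
      [SuperString.NormedDivAlg K], Module.finrank ℝ K = n →
    ∀ l : ℝ → ℝ, SuperString.IsSmoothingFactor l →
      Module.finrank ℝ (SuperString.Vec K) = n + 2 ∧
      (SuperString.superTrans K).IsLieSuperalgebra (SuperString.transBracket K) ∧
      (SuperString.superTrans K).IsEven3Cocycle (SuperString.transBracket K)
        (SuperString.alpha K) ∧
      SuperString.IsSupergroup (SuperString.transGroup K) ∧
      SuperString.IsSupergroup (SuperString.spinGroup K) ∧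
      SuperString.IsActionByAut (SuperString.spinGroup K) (SuperString.transGroup K)
        (SuperString.spinAct K) ∧
      SuperString.IsSupergroup (SuperString.poincare K) ∧
      SuperString.IsNormalizedCocycle (SuperString.transGroup K)
        (SuperString.trivAct (SuperString.transGroup K) SuperString.SVect.line)
        (SuperString.intAlpha K l) ∧
      (∀ q, ∀ x ∈ (SuperString.spinGroup K).space.pts q,
        ∀ h : Fin 3 → (SuperString.superTrans K).Pt q,
        SuperString.intAlpha K l q (fun i => SuperString.spinAct K q x (h i)) =
          SuperString.intAlpha K l q h) ∧
      SuperString.IsNormalizedCocycle (SuperString.poincare K)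
        (SuperString.trivAct (SuperString.poincare K) SuperString.SVect.line)
        (SuperString.intAlphaExt K l) ∧
      (∀ q, ∀ h : Fin 3 → (SuperString.superTrans K).Pt q,
        SuperString.intAlphaExt K l q
            (fun i => SuperString.SVect.pair ((SuperString.spinGroup K).one q) (h i)) =
          SuperString.intAlpha K l q h) ∧
      (SuperString.superstring K l).Is2Supergroup := by
  refine ⟨SuperString.exists_normedDivAlg hn, SuperString.exists_isSmoothingFactor, ?_⟩
  intro K _ _ _ _ hK l hl
  exact ⟨hK ▸ SuperString.finrank_vec K, SuperString.transBracket_isLieSuperalgebra K,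
    SuperString.alpha_isEven3Cocycle K, SuperString.isSupergroup_transGroup,
    SuperString.isSupergroup_spinGroup, SuperString.isActionByAut_spinAct,
    SuperString.isSupergroup_poincare, SuperString.isNormalizedCocycle_intAlpha hl,
    fun _ _ hx h => SuperString.intAlpha_spinAct hl hx h,
    SuperString.isNormalizedCocycle_intAlphaExt hl,
    fun _ h => SuperString.intAlphaExt_pair_one hl h, SuperString.superstring_is2Supergroup hl⟩
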